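/- **Notation.** Let $a_+,a_->0$, $a=(a_++a_-)/2$, $\alpha=2\pi/(a_+a_-)$, $\chi=\frac{\pi}{24}\big(\frac{a_+}{a_-}+\frac{a_-}{a_+}\big)$. For $\delta=\pm$ put $s_\delta(z)=\sinh(\pi z/a_\delta)$, $c_\delta(z)=\cosh(\pi z/a_\delta)$, $e_\delta(z)=\exp(\pi z/a_\delta)$. Let $G(z)$ be the hyperbolic gamma function: the meromorphic function with $G(z+ia_\delta/2)=2c_{-\delta}(z)\,G(z-ia_\delta/2)$ that equals $\exp(ig(z))$ for $|\mathrm{Im}\,z|<a$, where $$g(z)=\int_0^\infty\frac{dt}{t}\Big(\frac{\sin 2tz}{2\sinh(a_+t)\sinh(a_-t)}-\frac{z}{a_+a_-t}\Big).$$ Put $G_R(z)=G(z)e^{i(\chi+\alpha z^2/4)}$, $G_L(z)=G(z)e^{-i(\chi+\alpha z^2/4)}$, and write $f(w\pm y)=f(w+y)f(w-y)$, $f(\pm z+w)=f(z+w)f(-z+w)$ (and all four sign choices in $f(\pm z\pm x+w)$); $(i\to-i)$ denotes the same term with $i$ replaced by $-i$. For $\gamma\in\mathbb R$, $b=a-i\gamma$,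 let $$H_\delta(b;z)=\Big(\frac{c_\delta(z+ia_{-\delta}/2\pm\gamma)}{s_\delta(z)s_\delta(z+ia_{-\delta})}\Big)^{1/2}e^{ia_{-\delta}\partial_z}+(i\to-i),$$ the square roots being continued from $\{z+ia_{-\delta}/2>0\}$, resp. $\{z-ia_{-\delta}/2>0\}$, where they are positive. Let $w(b;x)=G(\pm x+ia)/G(\pm x-\gamma)$ and, for $x,y>0$, $$F(b;x,y)=\frac{G(-\gamma)}{\sqrt{a_+a_-}}\,w(b;x)^{1/2}w(b;y)^{1/2}\int_{\mathbb R}\frac{G(z\pm(x-y)/2-ia/2-\gamma/2)}{G(z\pm(x+y)/2+ia/2+\gamma/2)}\,dz ,$$ with roots continuous in $\gamma$ and positive for $\gamma=0$. The same function has four further representations $$\frac{G(-\gamma)}{\sqrt{a_+a_-}}\,\overline{w}(x)^{1/2}w(y)^{1/2}I_{\gamma}(x,y),\quad \frac{G(\gamma)}{\sqrt{a_+a_-}}\,\overline{w}(x)^{1/2}w(y)^{1/2}I_{-\gamma}(y,x),$$ $$\frac{G(-\gamma)}{\sqrt{a_+a_-}}\,w(x)^{1/2}\overline{w}(y)^{1/2}I_{\gamma}(y,x),\quad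 \frac{G(\gamma)}{\sqrt{a_+a_-}}\,w(x)^{1/2}\overline{w}(y)^{1/2}I_{-\gamma}(x,y),$$ where $w(x)=w(a-i\gamma;x)$, $\overline w(x)=w(a+i\gamma;x)$, $I_\gamma(p,q)=\int_{\mathbb R}G(\pm z\pm p/2-ia/2+\gamma/2)\,e^{i\alpha zq}\,dz$. **Theorem.** Let $\eta\in\mathbb R$. 1. (Hamiltonians.) As $\Lambda\to\infty$, $H_\delta(a-i\eta-i\Lambda;x+\Lambda)$ and $e_\delta(-\Lambda)H_\delta(a-i\eta-i\Lambda;y)$ (with $\mathrm{Re}\,y>0$) converge pointwise, when applied to any function, to $$H^T_\delta(\eta;x)=[1+e_\delta(-2x-ia_{-\delta}+2\eta)]^{1/2}e^{ia_{-\delta}\partial_x}+(i\to-i),$$ $$\hat H^T_\delta(\eta;y)=\tfrac12e_\delta(\eta)\,s_\delta(y)^{-1/2}\big(e^{ia_{-\delta}\partial_y}+e^{-ia_{-\delta}\partial_y}\big)s_\delta(y)^{-1/2},$$ respectively. Here $[1+e_\delta(-2x\mp ia_{-\delta}+2\eta)]^{1/2}=v_\delta(x-\eta\pm ia_{-\delta}/2)$,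 where $v_\delta(u)=(1+e_\delta(-2u))^{1/2}$ is positive for real $u$ (so tends to $1$ for $\mathrm{Re}\,u\to\infty$) and continued to $\mathbb C\setminus\pm i[a_\delta/2,\infty)$ (on the two cuts, the limit from the right is taken), and $s_\delta(y)^{1/2}$ is holomorphic for $\mathrm{Re}\,y>0$ and positive for $y>0$. 2. (Eigenfunction.) For $x\in\mathbb R$, $y>0$ the limit $F^T(\eta;x,y)=\lim_{\Lambda\to\infty}F(a-i\eta-i\Lambda;x+\Lambda,y)$ exists, and each of the five representations of $F$ converges to it. 3. (Representations.) For $x\in\mathbb R$, $y>0$, $F^T(\eta;x,y)$ equals each of $$\Big(\tfrac{G(\pm y+ia)}{a_+a_-G_R(x-\eta)}\Big)^{1/2}e^{i\alpha y^2/4}\int_{\mathbb R}G_R(\pm z+(x-\eta)/2-ia/2)\,e^{i\alpha zy}\,dz,$$ $$\Big(\tfrac{G(\pm y+ia)}{a_+a_-G_L(\eta-x)}\Big)^{1/2}e^{-i\alpha y^2/4}\int_{\mathbb R}G_L(\pm z-(x-\eta)/2-ia/2)\,e^{i\alpha zy}\,dz,$$ $$\Big(\tfrac{G(\pm y+ia)}{a_+a_-G_R(x-\eta)}\Big)^{1/2}e^{i\alpha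 y^2/8}\int_{\mathbb R+i\epsilon}G(z\pm y/2-ia)\,e^{-i\alpha[z(x-\eta)+z^2/2]}\,dz,$$ $$\Big(\tfrac{G(\pm y+ia)}{a_+a_-G_L(\eta-x)}\Big)^{1/2}e^{-i\alpha y^2/8}\int_{\mathbb R+i\epsilon}G(z\pm y/2-ia)\,e^{-i\alpha[z(x-\eta)-z^2/2]}\,dz$$ for every $\epsilon\in(0,a/2)$, where the integrals converge absolutely and the roots are continuous in $x$ and positive in the limit $x\to\infty$. 4. (Joint eigenfunction.) Let $D=\{x\in\mathbb C: x-\eta\notin\pm i[a,\infty)\}$. $F^T(\eta;\cdot,\cdot)$ extends to a holomorphic function on $D\times\{\mathrm{Re}\,y>0\}$ that satisfies, for $\delta=\pm$, $$H^T_\delta(\eta;x)F^T=2c_\delta(y)F^T\quad\text{whenever }x,\,x\pm ia_{-\delta}\in D,\qquad \hat H^T_\delta(\eta;y)F^T=e_\delta(x)F^T .$$ 5. (Square-root-free forms.) Let $P=\{ia+ika_++ila_-:k,l=0,1,2,\dots\}$. (a) The function $\mathcal M(x,y)=\int_{\mathbb R}G_L(\pm z-x/2-ia/2)e^{i\alpha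 zy}dz$ ($x\in\mathbb R$, $y>0$) extends to a function that is holomorphic for $x\notin P$, $y\in\mathbb C$, and meromorphic in $x\in\mathbb C$, and for $x,x\pm ia_{-\delta}\notin P$ $$\mathcal M(x-ia_{-\delta},y)+[1+e_\delta(-2x-ia_{-\delta})]\,\mathcal M(x+ia_{-\delta},y)=2c_\delta(y)\mathcal M(x,y).$$ (b) The function $\hat{\mathcal M}(x,y)=\int_{\mathbb R+i\epsilon}G(z\pm y/2-ia)e^{i\alpha(y^2/8-z^2/2)}e^{-i\alpha zx}dz$ ($x\in\mathbb R$, $y>0$, $\epsilon\in(0,a/2)$) extends to a function, independent of $\epsilon$, that is holomorphic for $-x\notin P$, $y\in\mathbb C$, and meromorphic in $x\in\mathbb C$, and for $-x\notin P$, $s_\delta(y)\ne0$ $$\frac{i}{2s_\delta(y)}\big(\hat{\mathcal M}(x,y+ia_{-\delta})-\hat{\mathcal M}(x,y-ia_{-\delta})\big)=e_\delta(x)\hat{\mathcal M}(x,y).$$ -/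

import Mathlib

open Filter Topology MeasureTheory

noncomputable section

namespace RelToda

/-! Throughout `ap`, `am` are the two positive parameters `a₊`, `a₋`; a sign `δ = ±` is a `Bool`
(`true` is `+`), so `!δ` is `-δ`. -/

/-- `a_δ`. -/
def par (ap am : ℝ) (δ : Bool) : ℝ := if δ then ap else am

/-- `a = (a₊ + a₋) / 2`. -/
def mid (ap am : ℝ) : ℝ := (ap + am) / 2

/-- `α = 2π / (a₊ a₋)`. -/
def alpha (ap am : ℝ) : ℝ := 2 * Real.pi / (ap * am)

/-- `χ = (π / 24) (a₊ / a₋ + a₋ / a₊)`. -/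
def chi (ap am : ℝ) : ℝ := Real.pi / 24 * (ap / am + am / ap)

/-- `s_δ(z) = sinh (π z / a_δ)`. -/
def sd (ap am : ℝ) (δ : Bool) (z : ℂ) : ℂ := Complex.sinh (Real.pi * z / par ap am δ)

/-- `c_δ(z) = cosh (π z / a_δ)`. -/
def cd (ap am : ℝ) (δ : Bool) (z : ℂ) : ℂ := Complex.cosh (Real.pi * z / par ap am δ)

/-- `e_δ(z) = exp (π z / a_δ)`. -/
def ed (ap am : ℝ) (δ : Bool) (z : ℂ) : ℂ := Complex.exp (Real.pi * z / par ap am δ)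

/-- The imaginary step `i a_{-δ}`. -/
def step (ap am : ℝ) (δ : Bool) : ℂ := Complex.I * par ap am (!δ)

/-! ### The hyperbolic gamma function -/

/-- The function `g(z)` on the strip `|Im z| < a`, where the integral converges absolutely. -/
def g (ap am : ℝ) (z : ℂ) : ℂ :=
  ∫ y in Set.Ioi (0 : ℝ), (1 / (y : ℂ)) *
    (Complex.sin (2 * y * z) / (2 * Complex.sinh (ap * y) * Complex.sinh (am * y))
      - z / (ap * am * y))

/-- The hyperbolic gamma function `G(z)`: it is `exp (i g(z))` in the strip `|Im z| < a`, and it is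
continued meromorphically to `ℂ` by `G(z + i a₊ / 2) = 2 c₋(z) G(z - i a₊ / 2)`. The integer `n`
is the number of steps `i a₊` by which `z` is moved into `|Im z| ≤ a₊ / 2 < a`.
(The value at a pole is `0` by convention.) -/
def G (ap am : ℝ) (z : ℂ) : ℂ :=
  let n : ℤ := round (z.im / ap)
  Complex.exp (Complex.I * g ap am (z - n * (Complex.I * ap))) *
    (∏ k ∈ Finset.range n.toNat, 2 * cd ap am false (z - (k + 1 / 2) * (Complex.I * ap))) /
    (∏ k ∈ Finset.range (-n).toNat, 2 * cd ap am false (z + (k + 1 / 2) * (Complex.I * ap)))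

/-- `g_R(z) = g(z) + χ + α z² / 4`. -/
def gR (ap am : ℝ) (z : ℂ) : ℂ := g ap am z + chi ap am + alpha ap am * z ^ 2 / 4

/-- `g_L(z) = g(z) - χ - α z² / 4`. -/
def gL (ap am : ℝ) (z : ℂ) : ℂ := g ap am z - chi ap am - alpha ap am * z ^ 2 / 4

/-- `G_R`, which is `exp (i g_R)` in the strip `|Im z| < a`. -/
def GRight (ap am : ℝ) (z : ℂ) : ℂ :=
  G ap am z * Complex.exp (Complex.I * (chi ap am + alpha ap am * z ^ 2 / 4))

/-- `G_L`, which is `exp (i g_L)` in the strip `|Im z| < a`. -/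
def GLeft (ap am : ℝ) (z : ℂ) : ℂ :=
  G ap am z * Complex.exp (-(Complex.I * (chi ap am + alpha ap am * z ^ 2 / 4)))

/-! ### Branches of square roots -/

/-- `(cosh u)^{1/2}`: the branch that is positive on the real line, continued holomorphically to the
plane without the two cuts `± i [π/2, ∞)`. -/
def coshSqrt (u : ℂ) : ℂ :=
  if 0 ≤ u.re then Complex.exp (u / 2) * ((1 + Complex.exp (-(2 * u))) / 2) ^ (1 / 2 : ℂ)
  else Complex.exp (-(u / 2)) * ((1 + Complex.exp (2 * u)) / 2) ^ (1 / 2 : ℂ)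

/-- `(sinh u)^{1/2}` on the half plane `Re u > 0`: the holomorphic branch that is positive on
`(0, ∞)`. -/
def sinhSqrt (u : ℂ) : ℂ :=
  Complex.exp (u / 2) * ((1 - Complex.exp (-(2 * u))) / 2) ^ (1 / 2 : ℂ)

/-- `s_δ(z)^{1/2}` for `Re z > 0`, positive on `(0, ∞)`. -/
def sdSqrt (ap am : ℝ) (δ : Bool) (z : ℂ) : ℂ := sinhSqrt (Real.pi * z / par ap am δ)

/-- `c_δ(z)^{1/2}`, positive on the real line. -/
def cdSqrt (ap am : ℝ) (δ : Bool) (z : ℂ) : ℂ := coshSqrt (Real.pi * z / par ap am δ)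

/-- `(1 + e_δ(-2u))^{1/2}`: the branch that is positive on the real line (so it tends to `1` for
`Re u → ∞`), continued holomorphically to the plane without the cuts `± i [a_δ / 2, ∞)`. -/
def todaSqrt (ap am : ℝ) (δ : Bool) (u : ℂ) : ℂ :=
  if 0 ≤ u.re then (1 + ed ap am δ (-(2 * u))) ^ (1 / 2 : ℂ)
  else ed ap am δ (-u) * (1 + ed ap am δ (2 * u)) ^ (1 / 2 : ℂ)

lemma cpow_half_sq (z : ℂ) : (z ^ (1 / 2 : ℂ)) ^ 2 = z := by
  have h := Complex.cpow_nat_inv_pow z (n := 2) (by norm_num)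
  rw [one_div]
  exact_mod_cast h

lemma coshSqrt_sq (u : ℂ) : coshSqrt u ^ 2 = Complex.cosh u := by
  have h1 : Complex.exp (u / 2) ^ 2 = Complex.exp u := by
    rw [← Complex.exp_nat_mul]; congr 1; push_cast; ring
  have h2 : Complex.exp (-(u / 2)) ^ 2 = Complex.exp (-u) := by
    rw [← Complex.exp_nat_mul]; congr 1; push_cast; ring
  have h3 : Complex.exp u * Complex.exp (-(2 * u)) = Complex.exp (-u) := by
    rw [← Complex.exp_add]; congr 1; ring
  have h4 : Complex.exp (-u) * Complex.exp (2 * u) = Complex.exp u := by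
    rw [← Complex.exp_add]; congr 1; ring
  unfold coshSqrt
  split_ifs
  · rw [mul_pow, cpow_half_sq, h1, Complex.cosh]
    linear_combination h3 / 2
  · rw [mul_pow, cpow_half_sq, h2, Complex.cosh]
    linear_combination h4 / 2

lemma sinhSqrt_sq (u : ℂ) : sinhSqrt u ^ 2 = Complex.sinh u := by
  have h1 : Complex.exp (u / 2) ^ 2 = Complex.exp u := by
    rw [← Complex.exp_nat_mul]; congr 1; push_cast; ring
  have h3 : Complex.exp u * Complex.exp (-(2 * u)) = Complex.exp (-u) := by
    rw [← Complex.exp_add]; congr 1; ring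
  rw [sinhSqrt, mul_pow, cpow_half_sq, h1, Complex.sinh]
  linear_combination -h3 / 2

lemma todaSqrt_sq (ap am : ℝ) (δ : Bool) (u : ℂ) :
    todaSqrt ap am δ u ^ 2 = 1 + ed ap am δ (-(2 * u)) := by
  have h1 : ed ap am δ (-u) ^ 2 = ed ap am δ (-(2 * u)) := by
    unfold ed; rw [← Complex.exp_nat_mul]; congr 1; push_cast; ring
  have h2 : ed ap am δ (-(2 * u)) * ed ap am δ (2 * u) = 1 := by
    unfold ed; rw [← Complex.exp_add, ← Complex.exp_zero]; congr 1; ring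
  unfold todaSqrt
  split_ifs
  · rw [cpow_half_sq]
  · rw [mul_pow, cpow_half_sq, h1]
    linear_combination h2

/-! ### The difference operators

The operator `exp(± i a_{-δ} ∂_z)` maps `ψ` to `z ↦ ψ(z ± i a_{-δ})`. -/

/-- `H_δ(a - iγ; z) = (c_δ(z + i a_{-δ}/2 ± γ) / (s_δ(z) s_δ(z + i a_{-δ})))^{1/2}
exp(i a_{-δ} ∂_z) + (i → -i)` for `Re z > 0`. -/
def hypH (ap am : ℝ) (δ : Bool) (γ : ℝ) (ψ : ℂ → ℂ) (z : ℂ) : ℂ :=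
  cdSqrt ap am δ (z + step ap am δ / 2 + γ) * cdSqrt ap am δ (z + step ap am δ / 2 - γ) /
      (sdSqrt ap am δ z * sdSqrt ap am δ (z + step ap am δ)) * ψ (z + step ap am δ)
    + cdSqrt ap am δ (z - step ap am δ / 2 + γ) * cdSqrt ap am δ (z - step ap am δ / 2 - γ) /
      (sdSqrt ap am δ z * sdSqrt ap am δ (z - step ap am δ)) * ψ (z - step ap am δ)

/-- `H^T_δ(η; x) = [1 + e_δ(-2x - i a_{-δ} + 2η)]^{1/2} exp(i a_{-δ} ∂_x) + (i → -i)`. -/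
def todaH (ap am : ℝ) (δ : Bool) (η : ℝ) (ψ : ℂ → ℂ) (x : ℂ) : ℂ :=
  todaSqrt ap am δ (x - η + step ap am δ / 2) * ψ (x + step ap am δ)
    + todaSqrt ap am δ (x - η - step ap am δ / 2) * ψ (x - step ap am δ)

/-- `Ĥ^T_δ(η; y) = (e_δ(η)/2) s_δ(y)^{-1/2} (exp(i a_{-δ} ∂_y) + exp(-i a_{-δ} ∂_y)) s_δ(y)^{-1/2}`
for `Re y > 0`. -/
def dualTodaH (ap am : ℝ) (δ : Bool) (η : ℝ) (ψ : ℂ → ℂ) (y : ℂ) : ℂ :=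
  ed ap am δ η / 2 * (sdSqrt ap am δ y)⁻¹ *
    ((sdSqrt ap am δ (y + step ap am δ))⁻¹ * ψ (y + step ap am δ)
      + (sdSqrt ap am δ (y - step ap am δ))⁻¹ * ψ (y - step ap am δ))

/-- `𝒜^T_δ(η; x) = exp(-i a_{-δ} ∂_x) + [1 + e_δ(-2x - i a_{-δ} + 2η)] exp(i a_{-δ} ∂_x)`. -/
def todaA (ap am : ℝ) (δ : Bool) (η : ℝ) (ψ : ℂ → ℂ) (x : ℂ) : ℂ :=
  ψ (x - step ap am δ)
    + (1 + ed ap am δ (-(2 * x) - step ap am δ + 2 * η)) * ψ (x + step ap am δ)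

/-- `Â^T_δ(η; y) = (i e_δ(η) / (2 s_δ(y))) (exp(i a_{-δ} ∂_y) - exp(-i a_{-δ} ∂_y))`. -/
def dualTodaA (ap am : ℝ) (δ : Bool) (η : ℝ) (ψ : ℂ → ℂ) (y : ℂ) : ℂ :=
  Complex.I * ed ap am δ η / (2 * sd ap am δ y) * (ψ (y + step ap am δ) - ψ (y - step ap am δ))

/-! ### The hyperbolic joint eigenfunction `F(a - iγ; x, y)` -/

/-- `w(a - iγ; x)^{1/2} = (G(± x + ia) / G(± x - γ))^{1/2}` for `x > 0`, where
`G(x + ia) G(-x + ia) = 4 s₊(x) s₋(x) > 0`; the root is continuous in `γ` and positive for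
`γ = 0`. -/
def wSqrt (ap am : ℝ) (γ x : ℝ) : ℂ :=
  (G ap am (x + Complex.I * mid ap am) * G ap am (-x + Complex.I * mid ap am)) ^ (1 / 2 : ℂ) *
    Complex.exp (-(Complex.I / 2 * (g ap am (x - γ) + g ap am (-x - γ))))

/-- `∫ dz G(z ± (x-y)/2 - ia/2 - γ/2) / G(z ± (x+y)/2 + ia/2 + γ/2)`. -/
def ratioIntegral (ap am : ℝ) (γ x y : ℝ) : ℂ :=
  ∫ z : ℝ,
    G ap am (z + (x - y) / 2 - Complex.I * mid ap am / 2 - γ / 2) *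
      G ap am (z - (x - y) / 2 - Complex.I * mid ap am / 2 - γ / 2) /
    (G ap am (z + (x + y) / 2 + Complex.I * mid ap am / 2 + γ / 2) *
      G ap am (z - (x + y) / 2 + Complex.I * mid ap am / 2 + γ / 2))

/-- `∫ dz G(± z ± p/2 - ia/2 + γ/2) exp(iαzq)`, with all four choices of the signs. -/
def fourierIntegral (ap am : ℝ) (γ p q : ℝ) : ℂ :=
  ∫ z : ℝ,
    G ap am (z + p / 2 - Complex.I * mid ap am / 2 + γ / 2) *
      G ap am (z - p / 2 - Complex.I * mid ap am / 2 + γ / 2) *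
      G ap am (-z + p / 2 - Complex.I * mid ap am / 2 + γ / 2) *
      G ap am (-z - p / 2 - Complex.I * mid ap am / 2 + γ / 2) *
      Complex.exp (Complex.I * alpha ap am * z * q)

/-- `F(a - iγ; x, y) = w(a - iγ; x)^{1/2} w(a - iγ; y)^{1/2} ℛ_r(a - iγ; x, y)`, where `ℛ_r` is
given by its minimal integral representation. -/
def hypF (ap am : ℝ) (γ x y : ℝ) : ℂ :=
  G ap am (-γ) / Real.sqrt (ap * am) * (wSqrt ap am γ x * wSqrt ap am γ y) *
    ratioIntegral ap am γ x y

/-- The second representation of `F(a - iγ; x, y)`. -/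
def hypF2 (ap am : ℝ) (γ x y : ℝ) : ℂ :=
  G ap am (-γ) / Real.sqrt (ap * am) * (wSqrt ap am (-γ) x * wSqrt ap am γ y) *
    fourierIntegral ap am γ x y

/-- The third representation of `F(a - iγ; x, y)`. -/
def hypF3 (ap am : ℝ) (γ x y : ℝ) : ℂ :=
  G ap am γ / Real.sqrt (ap * am) * (wSqrt ap am (-γ) x * wSqrt ap am γ y) *
    fourierIntegral ap am (-γ) y x

/-- The fourth representation of `F(a - iγ; x, y)`. -/
def hypF4 (ap am : ℝ) (γ x y : ℝ) : ℂ :=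
  G ap am (-γ) / Real.sqrt (ap * am) * (wSqrt ap am γ x * wSqrt ap am (-γ) y) *
    fourierIntegral ap am γ y x

/-- The fifth representation of `F(a - iγ; x, y)`. -/
def hypF5 (ap am : ℝ) (γ x y : ℝ) : ℂ :=
  G ap am γ / Real.sqrt (ap * am) * (wSqrt ap am γ x * wSqrt ap am (-γ) y) *
    fourierIntegral ap am (-γ) x y

/-! ### The relativistic Toda eigenfunction -/

/-- `F^T(η; x, y) = lim_{Λ → ∞} F(a - iη - iΛ; x + Λ, y)`. -/
def todaF (ap am : ℝ) (η x y : ℝ) : ℂ :=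
  limUnder atTop fun Λ : ℝ => hypF ap am (η + Λ) (x + Λ) y

/-- `(G(± y + ia) / (a₊ a₋ G_R(x - η)))^{1/2}` for `y > 0`, where `G(y + ia) G(-y + ia) > 0`;
the root is continuous in `x` and positive in the limit `x → ∞`, where `g_R(x - η) → 0`. -/
def prefR (ap am : ℝ) (η x y : ℝ) : ℂ :=
  (G ap am (y + Complex.I * mid ap am) * G ap am (-y + Complex.I * mid ap am) / (ap * am))
      ^ (1 / 2 : ℂ) * Complex.exp (-(Complex.I / 2 * gR ap am (x - η)))

/-- `(G(± y + ia) / (a₊ a₋ G_L(η - x)))^{1/2}` for `y > 0`, with the same choice of the root. -/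
def prefL (ap am : ℝ) (η x y : ℝ) : ℂ :=
  (G ap am (y + Complex.I * mid ap am) * G ap am (-y + Complex.I * mid ap am) / (ap * am))
      ^ (1 / 2 : ℂ) * Complex.exp (-(Complex.I / 2 * gL ap am (η - x)))

/-- `G_R(± z + u/2 - ia/2) exp(iαzy)`. -/
def kerR (ap am : ℝ) (u y z : ℝ) : ℂ :=
  GRight ap am (z + u / 2 - Complex.I * mid ap am / 2) *
    GRight ap am (-z + u / 2 - Complex.I * mid ap am / 2) *
    Complex.exp (Complex.I * alpha ap am * z * y)

/-- `G_L(± z - u/2 - ia/2) exp(iαzy)`. -/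
def kerL (ap am : ℝ) (u y z : ℝ) : ℂ :=
  GLeft ap am (z - u / 2 - Complex.I * mid ap am / 2) *
    GLeft ap am (-z - u / 2 - Complex.I * mid ap am / 2) *
    Complex.exp (Complex.I * alpha ap am * z * y)

/-- `G(z ± y/2 - ia) exp(-iα[zu + z²/2])`. -/
def kerPlus (ap am : ℝ) (u y : ℝ) (z : ℂ) : ℂ :=
  G ap am (z + y / 2 - Complex.I * mid ap am) * G ap am (z - y / 2 - Complex.I * mid ap am) *
    Complex.exp (-(Complex.I * alpha ap am * (z * u + z ^ 2 / 2)))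

/-- `G(z ± y/2 - ia) exp(-iα[zu - z²/2])`. -/
def kerMinus (ap am : ℝ) (u y : ℝ) (z : ℂ) : ℂ :=
  G ap am (z + y / 2 - Complex.I * mid ap am) * G ap am (z - y / 2 - Complex.I * mid ap am) *
    Complex.exp (-(Complex.I * alpha ap am * (z * u - z ^ 2 / 2)))

/-- The plane without the cuts `η ± i[a, ∞)`. -/
def cutPlane (ap am η : ℝ) : Set ℂ := {x | x.re = η → |x.im| < mid ap am}

/-- The points `ia + z_{kl}`, where `z_{kl} = i k a₊ + i l a₋` with `k, l = 0, 1, 2, …`. -/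
def lattice (ap am : ℝ) : Set ℂ :=
  {x | ∃ k l : ℕ, x = Complex.I * (mid ap am + k * ap + l * am)}

end RelToda

end

open RelToda

/-! All analysis of `G` rests on one integral. Folding the definition of `g` onto the whole real
line, subtracting a principal part at 0 and raising the contour to ℝ + iρ gives g_R(z) = ∫ exp(2itz)
/ (4it sinh(a₊t) sinh(a₋t)) dt (`gR_eq_jInt`); the polynomial χ + αz²/4 is exactly the contribution
of the principal part. On the raised line exp(2itz) is O(exp(-2ρ Re z)), so G_R → 1 to the right.
Cancelling one hyperbolic sine gives the difference equation (`jInt_shift`, `exp_lInt`), and from it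
follow the poles, the reflection equation and the residue at -ia.

The central computation is the Fourier transform of G(±z + s) (`betaInt_eq`). A contour shift gives
a first order difference equation in the dual variable; a product of two gamma functions solves the
reciprocal equation; the product of the two is periodic and grows too slowly to be anything but
constant; the constant is read off at the edge of convergence. Letting s go to -∞ yields the
transform of a single G_R (`integral_rKer`). Convolution and Fourier inversion then identify the
integrals of `kerR` and `kerPlus`, while pairing `betaInt_eq` with an imaginary Gaussian identifies
those of `kerR` and `kerL` (`integral_kerL_eq`). Conjugation exchanges `kerR` with `kerL` and
`kerPlus` with `kerMinus`, so the common value `todaVal` is real.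

For the limit, two of the four gamma functions in each hyperbolic integrand keep fixed arguments,
and the other two, stripped of their Gaussians, tend to 1; the growth of the prefactors cancels, and
dominated convergence applies. The minimal and the fifth representation lead to `kerR`, the fourth
to `kerPlus`; the second and third are the conjugates of the fifth and fourth.

For the eigenvalue equations the integral of `kerPlus` is taken along a bent contour, which makes it
holomorphic for Im x > -a and all y (`nVal`). Pointwise identities for the integrand together with a
shift of the contour give square-root-free difference equations. The conjugate function lives on Im
x < a, and on the overlap the two differ by the factor G_R(x); so the function continues to all x
with no poles but those of G_R (`nExt`). Multiplication by a branch of G_R^(-1/2) on the cut plane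
and by (s₊(y) s₋(y))^(1/2) turns these equations into those of the Toda Hamiltonians. The
Hamiltonians themselves converge because the roots of cosh and sinh are exponentials to leading
order. -/

namespace RelToda

open Complex Set

/-! ### Cauchy's theorem for half-strips and horizontal lines. -/

section ContourShift

variable {f : ℂ → ℂ} {X b c : ℝ} {S : Set ℂ} {φ : ℝ → ℝ}

/-- Cauchy's theorem for a half-strip `Re z ≥ X`, `b ≤ Im z ≤ c`. -/
theorem integral_Ioi_sub_integral_Ioi (hS : S.Countable) (hbc : b ≤ c)
    (hcont : ContinuousOn f {z | X ≤ z.re ∧ z.im ∈ Icc b c})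
    (hdiff : ∀ z : ℂ, X < z.re → z.im ∈ Ioo b c → z ∉ S → DifferentiableAt ℂ f z)
    (hφ : Tendsto φ atTop (𝓝 0))
    (hle : ∀ r t : ℝ, X ≤ r → t ∈ Icc b c → ‖f (r + t * I)‖ ≤ φ r)
    (hb : IntegrableOn (fun r : ℝ => f (r + b * I)) (Ioi X))
    (hc : IntegrableOn (fun r : ℝ => f (r + c * I)) (Ioi X)) :
    (∫ r in Ioi X, f (r + b * I)) - ∫ r in Ioi X, f (r + c * I)
      = I * ∫ t in b..c, f (X + t * I) := by
  have key : ∀ R : ℝ, X ≤ R → (∫ r in X..R, f (r + b * I)) - (∫ r in X..R, f (r + c * I))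
      + I * (∫ t in b..c, f (R + t * I)) = I * ∫ t in b..c, f (X + t * I) := by
    intro R hR
    have := integral_boundary_rect_eq_zero_of_differentiable_on_off_countable f
      (⟨X, b⟩ : ℂ) (⟨R, c⟩ : ℂ) S hS ?_ ?_
    · simp only [smul_eq_mul] at this
      linear_combination this
    · refine hcont.mono ?_
      rintro z ⟨h1, h2⟩
      simp only [uIcc_of_le hR, uIcc_of_le hbc, mem_preimage] at h1 h2
      exact ⟨h1.1, h2⟩
    · rintro z ⟨⟨h1, h2⟩, h3⟩
      simp only [min_eq_left hR, max_eq_right hR, min_eq_left hbc, max_eq_right hbc,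
        mem_preimage] at h1 h2
      exact hdiff z h1.1 h2 h3
  have h1 := intervalIntegral_tendsto_integral_Ioi X hb tendsto_id
  have h2 := intervalIntegral_tendsto_integral_Ioi X hc tendsto_id
  -- The far edge of the rectangle has length c - b and carries values of size at most φ(R), so it
  -- drops out as R → ∞.
  have h3 : Tendsto (fun R : ℝ => I * ∫ t in b..c, f (R + t * I)) atTop (𝓝 0) := by
    rw [tendsto_zero_iff_norm_tendsto_zero]
    have h4 : Tendsto (fun R : ℝ => φ R * |c - b|) atTop (𝓝 0) := by
      simpa using hφ.mul_const |c - b|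
    refine squeeze_zero' (Eventually.of_forall fun _ => norm_nonneg _) ?_ h4
    filter_upwards [eventually_ge_atTop X] with R hR
    rw [norm_mul, norm_I, one_mul]
    refine intervalIntegral.norm_integral_le_of_norm_le_const fun t ht => ?_
    rw [uIoc_of_le hbc] at ht
    exact hle R t hR ⟨ht.1.le, ht.2⟩
  have h5 := (h1.sub h2).add h3
  rw [add_zero] at h5
  refine tendsto_nhds_unique h5 (tendsto_const_nhds.congr' ?_)
  filter_upwards [eventually_ge_atTop X] with R hR
  exact (key R hR).symm

/-- Cauchy's theorem for a half-strip `Re z ≤ X`, `b ≤ Im z ≤ c`. -/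
theorem integral_Iic_sub_integral_Iic (hS : S.Countable) (hbc : b ≤ c)
    (hcont : ContinuousOn f {z | z.re ≤ X ∧ z.im ∈ Icc b c})
    (hdiff : ∀ z : ℂ, z.re < X → z.im ∈ Ioo b c → z ∉ S → DifferentiableAt ℂ f z)
    (hφ : Tendsto φ atTop (𝓝 0))
    (hle : ∀ r t : ℝ, r ≤ X → t ∈ Icc b c → ‖f (r + t * I)‖ ≤ φ (-r))
    (hb : IntegrableOn (fun r : ℝ => f (r + b * I)) (Iic X))
    (hc : IntegrableOn (fun r : ℝ => f (r + c * I)) (Iic X)) :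
    (∫ r in Iic X, f (r + b * I)) - ∫ r in Iic X, f (r + c * I)
      = -(I * ∫ t in b..c, f (X + t * I)) := by
  -- The reflection z ↦ -z carries the left half-strip to a right one; the heights b and c change
  -- sign and order.
  have conv : ∀ u : ℝ, (fun r : ℝ => f (-((r : ℂ) + ((-u : ℝ) : ℂ) * I)))
      = fun r : ℝ => (fun r : ℝ => f (r + u * I)) (-r) := by
    intro u; funext r; push_cast; congr 1; ring
  have hint : ∀ u : ℝ, IntegrableOn (fun r : ℝ => f (r + u * I)) (Iic X) →
      IntegrableOn (fun r : ℝ => f (-((r : ℂ) + ((-u : ℝ) : ℂ) * I))) (Ioi (-X)) := by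
    intro u hu
    rw [conv]
    have h := hu.comp_neg
    rw [neg_Iic] at h
    exact h.mono_set Ioi_subset_Ici_self
  have hval : ∀ u : ℝ, (∫ r in Ioi (-X), f (-((r : ℂ) + ((-u : ℝ) : ℂ) * I)))
      = ∫ r in Iic X, f (r + u * I) := by
    intro u
    rw [conv]
    have := integral_comp_neg_Ioi (-X) (fun r : ℝ => f (r + u * I))
    rw [neg_neg] at this
    exact this
  have hSn : (Neg.neg ⁻¹' S : Set ℂ).Countable := hS.preimage neg_injective
  have := integral_Ioi_sub_integral_Ioi (f := fun z => f (-z)) (X := -X) (b := -c) (c := -b)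
    (φ := φ) hSn (neg_le_neg hbc) ?_ ?_ hφ ?_ (hint c hc) (hint b hb)
  · rw [hval, hval] at this
    have e : (∫ t in (-c)..(-b), f (-(((-X : ℝ) : ℂ) + t * I))) = ∫ t in b..c, f (X + t * I) := by
      rw [← intervalIntegral.integral_comp_neg]
      refine intervalIntegral.integral_congr fun t _ => ?_
      push_cast; congr 1; ring
    rw [e] at this
    linear_combination -this
  · refine hcont.comp continuous_neg.continuousOn ?_
    rintro z ⟨h1, h2⟩
    refine ⟨?_, ?_⟩
    · simp only [neg_re]; linarith
    · simp only [neg_im]; exact ⟨by linarith [h2.2], by linarith [h2.1]⟩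
  · intro z h1 h2 h3
    have := hdiff (-z) (by simp only [neg_re]; linarith)
      (by simp only [neg_im]; exact ⟨by linarith [h2.2], by linarith [h2.1]⟩) h3
    exact DifferentiableAt.comp z this differentiableAt_id.neg
  · intro r t h1 h2
    have := hle (-r) (-t) (by linarith) ⟨by linarith [h2.2], by linarith [h2.1]⟩
    rw [neg_neg] at this
    refine le_trans (le_of_eq ?_) this
    push_cast; congr 2; ring

/-- Shift of a horizontal line of integration. -/
theorem integral_line_eq (hS : S.Countable) (hbc : b ≤ c)
    (hcont : ContinuousOn f {z | z.im ∈ Icc b c})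
    (hdiff : ∀ z : ℂ, z.im ∈ Ioo b c → z ∉ S → DifferentiableAt ℂ f z)
    (hφ : Tendsto φ atTop (𝓝 0))
    (hle : ∀ r t : ℝ, t ∈ Icc b c → ‖f (r + t * I)‖ ≤ φ |r|)
    (hb : Integrable (fun r : ℝ => f (r + b * I)))
    (hc : Integrable (fun r : ℝ => f (r + c * I))) :
    (∫ r : ℝ, f (r + b * I)) = ∫ r : ℝ, f (r + c * I) := by
  -- The strip is cut along Re z = 0; the integrals over the cut from the two sides cancel.
  have h1 := integral_Ioi_sub_integral_Ioi (X := 0) hS hbc (hcont.mono fun z hz => hz.2)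
    (fun z _ => hdiff z) hφ (fun r t hr ht => by simpa [abs_of_nonneg hr] using hle r t ht)
    hb.integrableOn hc.integrableOn
  have h2 := integral_Iic_sub_integral_Iic (X := 0) hS hbc (hcont.mono fun z hz => hz.2)
    (fun z _ => hdiff z) hφ (fun r t hr ht => by simpa [abs_of_nonpos hr] using hle r t ht)
    hb.integrableOn hc.integrableOn
  rw [← intervalIntegral.integral_Iic_add_Ioi hb.integrableOn hb.integrableOn (b := 0),
    ← intervalIntegral.integral_Iic_add_Ioi hc.integrableOn hc.integrableOn (b := 0)]
  linear_combination h1 + h2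

theorem integrableOn_exp_neg_mul_Ioi {μ : ℝ} (hμ : 0 < μ) (X : ℝ) :
    IntegrableOn (fun r : ℝ => Real.exp (-(μ * r))) (Ioi X) := by
  simpa only [neg_mul] using integrableOn_exp_mul_Ioi (neg_lt_zero.2 hμ) X

theorem integrableOn_exp_mul_Iic' {μ : ℝ} (hμ : 0 < μ) (X : ℝ) :
    IntegrableOn (fun r : ℝ => Real.exp (μ * r)) (Iic X) :=
  integrableOn_exp_mul_Iic hμ X

theorem integrable_exp_neg_mul_abs {μ : ℝ} (hμ : 0 < μ) :
    Integrable (fun r : ℝ => Real.exp (-(μ * |r|))) := by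
  rw [← integrableOn_univ, ← Iic_union_Ioi (a := (0 : ℝ))]
  refine IntegrableOn.union ?_ ?_
  · refine (integrableOn_exp_mul_Iic' hμ 0).congr_fun (fun r hr => ?_) measurableSet_Iic
    simp only [abs_of_nonpos (mem_Iic.1 hr)]; ring_nf
  · refine (integrableOn_exp_neg_mul_Ioi hμ 0).congr_fun (fun r hr => ?_) measurableSet_Ioi
    simp only [abs_of_pos (mem_Ioi.1 hr)]

theorem tendsto_const_mul_exp_neg {μ : ℝ} (hμ : 0 < μ) (C : ℝ) :
    Tendsto (fun r : ℝ => C * Real.exp (-(μ * r))) atTop (𝓝 0) := by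
  have : Tendsto (fun r : ℝ => μ * r) atTop atTop := tendsto_id.const_mul_atTop hμ
  simpa using (Real.tendsto_exp_neg_atTop_nhds_zero.comp this).const_mul C

theorem continuous_line (b : ℝ) : Continuous fun r : ℝ => (r : ℂ) + b * I := by fun_prop

theorem integrable_of_exp_bound {F : ℝ → ℂ} {C μ : ℝ} (hμ : 0 < μ)
    (hF : AEStronglyMeasurable F) (h : ∀ r, ‖F r‖ ≤ C * Real.exp (-(μ * |r|))) :
    Integrable F :=
  ((integrable_exp_neg_mul_abs hμ).const_mul C).mono' hF (Eventually.of_forall h)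

/-- Shift of a horizontal line of integration for an exponentially decaying integrand. -/
theorem integral_line_eq_of_exp_bound {C μ : ℝ} (hμ : 0 < μ) (hS : S.Countable) (hbc : b ≤ c)
    (hcont : ContinuousOn f {z | z.im ∈ Icc b c})
    (hdiff : ∀ z : ℂ, z.im ∈ Ioo b c → z ∉ S → DifferentiableAt ℂ f z)
    (hle : ∀ r t : ℝ, t ∈ Icc b c → ‖f (r + t * I)‖ ≤ C * Real.exp (-(μ * |r|))) :
    (∫ r : ℝ, f (r + b * I)) = ∫ r : ℝ, f (r + c * I) := by
  have hint : ∀ u ∈ Icc b c, Integrable (fun r : ℝ => f (r + u * I)) := by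
    intro u hu
    refine integrable_of_exp_bound hμ ?_ (fun r => hle r u hu)
    refine Continuous.aestronglyMeasurable ?_
    exact hcont.comp_continuous (continuous_line u) (fun r => by simpa using hu)
  exact integral_line_eq hS hbc hcont hdiff (tendsto_const_mul_exp_neg hμ C)
    (fun r t ht => hle r t ht) (hint b ⟨le_rfl, hbc⟩) (hint c ⟨hbc, le_rfl⟩)

end ContourShift

/-! ### Removable singularities. -/

section Removable

/-- A singularity at which `(z - c) f(z) → 0` is removable. -/
theorem differentiableOn_update_limUnder_of_tendsto {f : ℂ → ℂ} {s : Set ℂ} {c : ℂ}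
    (hs : s ∈ 𝓝 c) (hd : DifferentiableOn ℂ f (s \ {c}))
    (ho : Tendsto (fun z => (z - c) * f z) (𝓝[≠] c) (𝓝 0)) :
    DifferentiableOn ℂ (Function.update f c (limUnder (𝓝[≠] c) f)) s := by
  refine differentiableOn_update_limUnder_of_isLittleO hs hd ?_
  rw [Asymptotics.isLittleO_iff_tendsto']
  · have h2 : Tendsto (fun z : ℂ => (z - c) * f c) (𝓝[≠] c) (𝓝 0) := by
      have : Tendsto (fun z : ℂ => (z - c) * f c) (𝓝 c) (𝓝 ((c - c) * f c)) := by
        exact ((continuous_id.sub continuous_const).mul continuous_const).tendsto c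
      rw [sub_self, zero_mul] at this
      exact this.mono_left nhdsWithin_le_nhds
    have h3 := ho.sub h2
    rw [sub_zero] at h3
    refine h3.congr fun z => ?_
    rw [div_inv_eq_mul]; ring
  · filter_upwards [self_mem_nhdsWithin] with z hz h
    exact absurd (sub_eq_zero.1 (inv_eq_zero.1 h)) hz

end Removable

/-! ### Holomorphic dependence of integrals on parameters. -/

section Parametric

variable {T : Type*} [MeasurableSpace T] {ν : Measure T}

/-- Cauchy's estimate on the complex line through p in direction v. It makes a bound on an integrand
alone sufficient for differentiation under the integral sign. -/
theorem norm_fderiv_apply_le {E : Type*} [NormedAddCommGroup E] [NormedSpace ℂ E] {h : E → ℂ}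
    {p v : E} {r C : ℝ} (hr : 0 < r) (hv : ‖v‖ ≤ 1)
    (hd : ∀ q ∈ Metric.closedBall p r, DifferentiableAt ℂ h q)
    (hC : ∀ q ∈ Metric.closedBall p r, ‖h q‖ ≤ C) : ‖fderiv ℂ h p v‖ ≤ C / r := by
  have hmem : ∀ ζ : ℂ, ζ ∈ Metric.closedBall (0 : ℂ) r → p + ζ • v ∈ Metric.closedBall p r := by
    intro ζ hζ
    rw [Metric.mem_closedBall, dist_eq_norm, add_sub_cancel_left, norm_smul]
    rw [mem_closedBall_zero_iff] at hζ
    nlinarith [norm_nonneg ζ, norm_nonneg v]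
  have hl : ∀ ζ : ℂ, HasDerivAt (fun ζ : ℂ => p + ζ • v) v ζ := by
    intro ζ
    simpa using ((hasDerivAt_id ζ).smul_const v).const_add p
  have hda : ∀ ζ ∈ Metric.closedBall (0 : ℂ) r,
      DifferentiableAt ℂ (fun ζ : ℂ => h (p + ζ • v)) ζ := fun ζ hζ =>
    (hd _ (hmem ζ hζ)).comp ζ (hl ζ).differentiableAt
  have h1 : deriv (fun ζ : ℂ => h (p + ζ • v)) 0 = fderiv ℂ h p v := by
    have hd0 := (hd p (Metric.mem_closedBall_self hr.le)).hasFDerivAt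
    have := HasFDerivAt.comp_hasDerivAt (f := fun ζ : ℂ => p + ζ • v) (0 : ℂ)
      (by simpa using hd0) (hl 0)
    exact this.deriv
  rw [← h1]
  refine norm_deriv_le_of_forall_mem_sphere_norm_le hr ?_ ?_
  · refine DifferentiableOn.diffContOnCl ?_
    rw [closure_ball _ hr.ne']
    exact fun ζ hζ => (hda ζ hζ).differentiableWithinAt
  · intro ζ hζ
    exact hC _ (hmem ζ (Metric.sphere_subset_closedBall hζ))

/-- Holomorphic dependence on parameters of an integral. -/
theorem differentiableAt_integral_prod {F : ℂ × ℂ → T → ℂ} {p : ℂ × ℂ} {U : Set (ℂ × ℂ)}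
    (hU : U ∈ 𝓝 p) {B : T → ℝ} (hB : Integrable B ν)
    (hmeas : ∀ q ∈ U, AEStronglyMeasurable (F q) ν)
    (hd : ∀ᵐ t ∂ν, ∀ q ∈ U, DifferentiableAt ℂ (fun q => F q t) q)
    (hle : ∀ᵐ t ∂ν, ∀ q ∈ U, ‖F q t‖ ≤ B t) :
    DifferentiableAt ℂ (fun q => ∫ t, F q t ∂ν) p := by
  obtain ⟨r, hr, hrU⟩ := Metric.nhds_basis_closedBall.mem_iff.1 hU
  -- Half the radius leaves around each point of the smaller ball a ball inside U, on which Cauchy's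
  -- estimate is applied.
  set r2 := r / 2 with hr2
  have hr2p : 0 < r2 := by positivity
  have hsub : ∀ q ∈ Metric.ball p r2, Metric.closedBall q r2 ⊆ U := by
    intro q hq
    refine subset_trans (Metric.closedBall_subset_closedBall' ?_) hrU
    rw [Metric.mem_ball] at hq; linarith
  have hp : p ∈ Metric.ball p r2 := Metric.mem_ball_self hr2p
  have hpU : p ∈ U := mem_of_mem_nhds hU
  have hbd : ∀ᵐ t ∂ν, ∀ q ∈ Metric.ball p r2,
      ‖fderiv ℂ (fun q => F q t) q‖ ≤ B t / r2 := by
    filter_upwards [hd, hle] with t h1 h2 q hq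
    have hBt : 0 ≤ B t := (norm_nonneg _).trans (h2 p hpU)
    refine ContinuousLinearMap.opNorm_le_of_unit_norm (𝕜 := ℂ) ?_ ?_
    · positivity
    · intro v hv
      exact norm_fderiv_apply_le hr2p hv.le (fun x hx => h1 x (hsub q hq hx))
        (fun x hx => h2 x (hsub q hq hx))
  -- Measurability of the derivative in t: it is a limit of difference quotients with steps 1 / (n +
  -- n0 + 1), where n0 is so large that all shifted points lie in U.
  have hdir : ∀ v : ℂ × ℂ, AEStronglyMeasurable (fun t => fderiv ℂ (fun q => F q t) p v) ν := by
    intro v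
    have hev : ∀ᶠ n : ℕ in atTop, p + ((1 : ℂ) / ((n : ℂ) + 1)) • v ∈ U := by
      have : Tendsto (fun n : ℕ => p + ((1 : ℂ) / ((n : ℂ) + 1)) • v) atTop (𝓝 (p + (0 : ℂ) • v)) :=
        (tendsto_one_div_add_atTop_nhds_zero_nat.smul_const v).const_add p
      rw [zero_smul, add_zero] at this
      exact this.eventually hU
    obtain ⟨n0, hn0⟩ := eventually_atTop.1 hev
    refine aestronglyMeasurable_of_tendsto_ae (u := atTop)
      (f := fun (n : ℕ) t => (((n + n0 : ℕ) : ℂ) + 1) *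
        (F (p + ((1 : ℂ) / (((n + n0 : ℕ) : ℂ) + 1)) • v) t - F p t)) ?_ ?_
    · intro n
      exact ((hmeas _ (hn0 (n + n0) (by omega))).sub (hmeas p hpU)).const_mul _
    · filter_upwards [hd] with t h1
      have h2 := (h1 p hpU).hasFDerivAt
      have h3 : HasDerivAt (fun ζ : ℂ => F (p + ζ • v) t) (fderiv ℂ (fun q => F q t) p v) 0 := by
        have hl : HasDerivAt (fun ζ : ℂ => p + ζ • v) v 0 := by
          simpa using ((hasDerivAt_id (0 : ℂ)).smul_const v).const_add p
        exact HasFDerivAt.comp_hasDerivAt (f := fun ζ : ℂ => p + ζ • v) (0 : ℂ)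
          (by simpa using h2) hl
      have h4 : Tendsto (fun n : ℕ => (1 : ℂ) / (((n + n0 : ℕ) : ℂ) + 1)) atTop (𝓝[≠] 0) := by
        refine tendsto_nhdsWithin_iff.2 ⟨?_, Eventually.of_forall fun n => ?_⟩
        · exact (tendsto_one_div_add_atTop_nhds_zero_nat (𝕜 := ℂ)).comp (tendsto_add_atTop_nat n0)
        · simp only [mem_compl_iff, mem_singleton_iff, one_div, inv_eq_zero]
          exact Nat.cast_add_one_ne_zero _
      have h5 := (hasDerivAt_iff_tendsto_slope.1 h3).comp h4
      refine h5.congr fun n => ?_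
      simp only [Function.comp, slope_def_field, zero_smul, add_zero, sub_zero]
      field_simp
  have hmeas' : AEStronglyMeasurable (fun t => fderiv ℂ (fun q => F q t) p) ν := by
    have e : (fun t => fderiv ℂ (fun q => F q t) p) = fun t =>
        (fderiv ℂ (fun q => F q t) p (1, 0)) • ContinuousLinearMap.fst ℂ ℂ ℂ
        + (fderiv ℂ (fun q => F q t) p (0, 1)) • ContinuousLinearMap.snd ℂ ℂ ℂ := by
      funext t
      ext <;> simp
    rw [e]
    exact ((hdir _).smul_const _).add ((hdir _).smul_const _)
  have := hasFDerivAt_integral_of_dominated_of_fderiv_le (𝕜 := ℂ) (μ := ν) (F := F) (x₀ := p)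
    (F' := fun q t => fderiv ℂ (fun q => F q t) q) (bound := fun t => B t / r2)
    (Metric.ball_mem_nhds p hr2p) ?_ ?_ hmeas' hbd (hB.div_const _) ?_
  · exact this.differentiableAt
  · filter_upwards [hU] with q hq using hmeas q hq
  · exact hB.mono' (hmeas p hpU) (hle.mono fun t h => h p hpU)
  · filter_upwards [hd] with t h1 q hq
    exact (h1 q (hsub q hq (Metric.mem_closedBall_self hr2p.le))).hasFDerivAt

theorem differentiableAt_integral {F : ℂ → T → ℂ} {p : ℂ} {U : Set ℂ}
    (hU : U ∈ 𝓝 p) {B : T → ℝ} (hB : Integrable B ν)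
    (hmeas : ∀ q ∈ U, AEStronglyMeasurable (F q) ν)
    (hd : ∀ᵐ t ∂ν, ∀ q ∈ U, DifferentiableAt ℂ (fun q => F q t) q)
    (hle : ∀ᵐ t ∂ν, ∀ q ∈ U, ‖F q t‖ ≤ B t) :
    DifferentiableAt ℂ (fun q => ∫ t, F q t ∂ν) p := by
  have h := differentiableAt_integral_prod (F := fun q t => F q.1 t) (p := (p, 0))
    (U := Prod.fst ⁻¹' U) (continuous_fst.continuousAt.preimage_mem_nhds hU) hB
    (fun q hq => hmeas q.1 hq)
    (hd.mono fun t h q hq => (h q.1 hq).comp q differentiableAt_fst) (hle.mono fun t h q hq => h q.1 hq)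
  have h2 : DifferentiableAt ℂ (fun q : ℂ => (q, (0 : ℂ))) p :=
    differentiableAt_id.prodMk (differentiableAt_const _)
  exact DifferentiableAt.comp (f := fun q : ℂ => (q, (0 : ℂ))) p h h2

end Parametric

end RelToda

namespace RelToda

open Complex Set

/-! ### Periodic holomorphic functions of slow growth are constant. -/

section Periodic

theorem isPreconnected_strip (c : ℝ) : IsPreconnected {w : ℂ | |w.im| < c} := by
  have : {w : ℂ | |w.im| < c} = (Complex.imLm : ℂ →ₗ[ℝ] ℝ) ⁻¹' Ioo (-c) c := by
    ext w; simp [abs_lt]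
  rw [this]
  exact ((convex_Ioo (-c) c).linear_preimage _).isPreconnected

theorem isOpen_strip (c : ℝ) : IsOpen {w : ℂ | |w.im| < c} :=
  isOpen_lt (by fun_prop) continuous_const

/-- Since θ < 1, the bound forces z F(z) → 0 at the origin, which makes the singularity removable,
and (F(z) - F(0)) / z → 0 at infinity, so that Liouville's theorem kills this quotient. -/
theorem differentiable_eq_of_sublinear {F : ℂ → ℂ} {C θ : ℝ} (hθ : θ < 1)
    (hd : ∀ z, z ≠ 0 → DifferentiableAt ℂ F z)
    (hle : ∀ z, z ≠ 0 → ‖F z‖ ≤ C * Real.exp (θ * |Real.log ‖z‖|)) :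
    ∃ k, ∀ z, z ≠ 0 → F z = k := by
  have hθ' : 0 < 1 - θ := by linarith
  have h0 : Tendsto (fun z => (z - 0) * F z) (𝓝[≠] 0) (𝓝 0) := by
    have hlog : Tendsto (fun z : ℂ => Real.log ‖z‖) (𝓝[≠] 0) atBot :=
      Real.tendsto_log_nhdsNE_zero.comp (tendsto_norm_nhdsNE_zero.mono_right
        (nhdsWithin_mono _ fun x hx => ne_of_gt hx))
    have h2 := (tendsto_const_mul_exp_neg hθ' C).comp (tendsto_neg_atBot_atTop.comp hlog)
    refine squeeze_zero_norm' ?_ h2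
    filter_upwards [self_mem_nhdsWithin, hlog.eventually_le_atBot 0] with z hz hz1
    have hz0 : z ≠ 0 := hz
    have e : ‖z‖ = Real.exp (Real.log ‖z‖) := (Real.exp_log (norm_pos_iff.2 hz0)).symm
    rw [sub_zero, norm_mul]
    calc ‖z‖ * ‖F z‖ ≤ Real.exp (Real.log ‖z‖) * (C * Real.exp (θ * |Real.log ‖z‖|)) := by
          rw [← e]; exact mul_le_mul_of_nonneg_left (hle z hz0) (norm_nonneg _)
      _ = C * (Real.exp (Real.log ‖z‖) * Real.exp (θ * |Real.log ‖z‖|)) := by ring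
      _ = _ := by
          rw [← Real.exp_add, abs_of_nonpos hz1]; simp only [Function.comp]; ring_nf
  set Ft := Function.update F 0 (limUnder (𝓝[≠] 0) F) with hFt
  have hent : DifferentiableOn ℂ Ft univ :=
    differentiableOn_update_limUnder_of_tendsto univ_mem
      (fun z hz => (hd z hz.2).differentiableWithinAt) h0
  have hne : ∀ z, z ≠ 0 → Ft z = F z := fun z hz => Function.update_of_ne hz _ _
  have hD : Differentiable ℂ (dslope Ft 0) :=
    differentiableOn_univ.1 ((differentiableOn_dslope univ_mem).2 hent)
  have hlim : Tendsto (dslope Ft 0) (cocompact ℂ) (𝓝 0) := by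
    have hnorm := tendsto_norm_cocompact_atTop (E := ℂ)
    have hlog : Tendsto (fun z : ℂ => Real.log ‖z‖) (cocompact ℂ) atTop :=
      Real.tendsto_log_atTop.comp hnorm
    have h2 := (tendsto_const_mul_exp_neg hθ' C).comp hlog
    have h3 := (tendsto_const_mul_exp_neg one_pos ‖Ft 0‖).comp hlog
    have h4 := h2.add h3
    rw [add_zero] at h4
    refine squeeze_zero_norm' ?_ h4
    filter_upwards [hnorm.eventually_ge_atTop 1, hlog.eventually_ge_atTop 0] with z hz1 hz2
    have hz0 : z ≠ 0 := norm_pos_iff.1 (by linarith)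
    have e : ‖z‖ = Real.exp (Real.log ‖z‖) := (Real.exp_log (norm_pos_iff.2 hz0)).symm
    rw [dslope_of_ne _ hz0, slope_def_field, sub_zero, norm_div, div_eq_mul_inv]
    have e2 : ‖z‖⁻¹ = Real.exp (-Real.log ‖z‖) := by rw [Real.exp_neg, ← e]
    rw [e2]
    have h5 := norm_sub_le (Ft z) (Ft 0)
    have h6 := hle z hz0
    rw [hne z hz0] at h5 ⊢
    rw [abs_of_nonneg hz2] at h6
    have e3 : Real.exp (-((1 - θ) * Real.log ‖z‖))
        = Real.exp (θ * Real.log ‖z‖) * Real.exp (-Real.log ‖z‖) := by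
      rw [← Real.exp_add]; ring_nf
    simp only [Function.comp, e3, one_mul]
    rw [← mul_assoc, ← add_mul]
    exact mul_le_mul_of_nonneg_right (by linarith) (Real.exp_pos _).le
  refine ⟨Ft 0, fun z hz => ?_⟩
  have h1 := hD.apply_eq_of_tendsto_cocompact z hlim
  rw [dslope_of_ne _ hz, slope_def_field, sub_zero, div_eq_zero_iff] at h1
  rw [← hne z hz]
  exact sub_eq_zero.1 (h1.resolve_right hz)

/-- A holomorphic function on a strip that is periodic in the imaginary direction and of slow
exponential growth is constant. -/
theorem eq_of_periodic_strip {f : ℂ → ℂ} {T c C κ : ℝ} (hT : 0 < T) (hc : T / 2 < c)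
    (hd : ∀ w : ℂ, |w.im| < c → DifferentiableAt ℂ f w)
    (hper : ∀ w : ℂ, |w.im| < c - T / 2 → f (w + T / 2 * I) = f (w - T / 2 * I))
    (hκ : κ < 2 * Real.pi / T)
    (hle : ∀ w : ℂ, |w.im| ≤ T / 2 → ‖f w‖ ≤ C * Real.exp (κ * |w.re|)) :
    ∃ k, ∀ w : ℂ, |w.im| < c → f w = k := by
  have hpi := Real.pi_pos
  -- With this scale z ↦ h log z maps the punctured plane onto a strip of height T, one period.
  -- Periodicity removes the jump along the negative axis, and exp(κ|Re w|) becomes a power with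
  -- exponent κh < 1.
  set h : ℝ := T / (2 * Real.pi) with hh
  have hhp : 0 < h := by positivity
  have hhpi : h * Real.pi = T / 2 := by rw [hh]; field_simp
  have hhc : (h : ℂ) * (Real.pi * I) = T / 2 * I := by
    rw [← mul_assoc, ← ofReal_mul, hhpi]; push_cast; ring
  have him : ∀ z : ℂ, ((h : ℂ) * log z).im = h * z.arg := fun z => by
    rw [im_ofReal_mul, log_im]
  have hre : ∀ z : ℂ, ((h : ℂ) * log z).re = h * Real.log ‖z‖ := fun z => by
    rw [re_ofReal_mul, log_re]
  have himle : ∀ z : ℂ, |((h : ℂ) * log z).im| ≤ T / 2 := by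
    intro z
    rw [him, abs_mul, abs_of_pos hhp, ← hhpi]
    exact mul_le_mul_of_nonneg_left (abs_arg_le_pi z) hhp.le
  have hdF : ∀ z, z ≠ 0 → DifferentiableAt ℂ (fun z => f (h * log z)) z := by
    intro z hz
    by_cases hs : z ∈ slitPlane
    · refine DifferentiableAt.comp z (hd _ (lt_of_le_of_lt (himle z) hc)) ?_
      exact (differentiableAt_log hs).const_mul _
    · rw [mem_slitPlane_iff, not_or, not_lt, not_ne_iff] at hs
      have hre0 : z.re < 0 := lt_of_le_of_ne hs.1 fun hr => hz (Complex.ext hr hs.2)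
      have hmem : -z ∈ slitPlane := by
        rw [mem_slitPlane_iff]; left; simpa using hre0
      have hargc : ContinuousAt (fun z : ℂ => arg (-z)) z :=
        ContinuousAt.comp (f := fun z : ℂ => -z) (continuousAt_arg hmem) continuous_neg.continuousAt
      have harg0 : arg (-z) = 0 := by
        rw [arg_eq_zero_iff]; simp [hs.2, hre0.le]
      have hev : ∀ᶠ ζ in 𝓝 z, |arg (-ζ)| < min Real.pi ((c - T / 2) / h) := by
        have : Tendsto (fun z : ℂ => |arg (-z)|) (𝓝 z) (𝓝 0) := by
          have := hargc.abs
          rw [ContinuousAt, harg0, abs_zero] at this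
          exact this
        exact this.eventually_lt_const (lt_min hpi (div_pos (by linarith) hhp))
      -- Near the negative axis log ζ is log(-ζ) + πi or log(-ζ) - πi, depending on the side. The
      -- two values of h log ζ differ by the period T, so one holomorphic formula serves both sides.
      have heq : (fun z => f (h * log z)) =ᶠ[𝓝 z]
          fun ζ => f (h * log (-ζ) + T / 2 * I) := by
        filter_upwards [hev, isOpen_ne.mem_nhds hz] with ζ hζ hζ0
        rw [lt_min_iff] at hζ
        have hb := abs_lt.1 hζ.1
        have hne : -ζ ≠ 0 := neg_ne_zero.2 hζ0
        by_cases hneg : arg (-ζ) ≤ 0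
        · have : log ζ = log (-ζ) + Real.pi * I := by
            rw [← log_exp (x := log (-ζ) + Real.pi * I), exp_add, exp_log hne, exp_pi_mul_I]
            · congr 1; ring
            · simp [log_im]; linarith
            · simp [log_im]; linarith
          simp only [this, mul_add, hhc]
        · have : log ζ = log (-ζ) - Real.pi * I := by
            rw [← log_exp (x := log (-ζ) - Real.pi * I), exp_sub, exp_log hne, exp_pi_mul_I]
            · congr 1; ring
            · simp [log_im]; linarith
            · simp [log_im]; linarith
          simp only [this, mul_sub, hhc]
          refine (hper _ ?_).symm
          rw [him, abs_mul, abs_of_pos hhp]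
          have := hζ.2
          rw [lt_div_iff₀ hhp] at this; linarith
      refine DifferentiableAt.congr_of_eventuallyEq ?_ heq
      refine DifferentiableAt.comp z (hd _ ?_) ?_
      · rw [add_im, him, harg0]
        have : ((T : ℂ) / 2 * I).im = T / 2 := by
          rw [show (T : ℂ) / 2 = ((T / 2 : ℝ) : ℂ) by push_cast; ring, im_ofReal_mul, I_im, mul_one]
        rw [this, mul_zero, zero_add, abs_of_pos (by positivity)]; exact hc
      · refine DifferentiableAt.add_const _ (DifferentiableAt.const_mul ?_ _)
        exact (differentiableAt_log hmem).comp z differentiableAt_id.neg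
  have hleF : ∀ z, z ≠ 0 → ‖f (h * log z)‖ ≤ C * Real.exp (κ * h * |Real.log ‖z‖|) := by
    intro z _
    refine (hle _ (himle z)).trans (le_of_eq ?_)
    rw [hre, abs_mul, abs_of_pos hhp, mul_assoc]
  obtain ⟨k, hk⟩ := differentiable_eq_of_sublinear (F := fun z => f (h * log z)) (C := C)
    (θ := κ * h) (by rw [hh]; rw [lt_div_iff₀ hT] at hκ; rw [← mul_div_assoc, div_lt_one (by positivity)]; linarith)
    hdF hleF
  refine ⟨k, ?_⟩
  have h1 : ∀ w : ℂ, |w.im| < T / 2 → f w = k := by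
    intro w hw
    have := hk (exp (w / h)) (exp_ne_zero _)
    rw [abs_lt] at hw
    have e : (w / (h : ℂ)).im = w.im / h := div_ofReal_im w h
    rw [log_exp] at this
    · rwa [mul_div_cancel₀ _ (ofReal_ne_zero.2 hhp.ne')] at this
    · rw [e, lt_div_iff₀ hhp]; linarith
    · rw [e, div_le_iff₀ hhp]; linarith
  have hcpos : 0 < c := by linarith
  have han : AnalyticOnNhd ℂ f {w : ℂ | |w.im| < c} := by
    refine DifferentiableOn.analyticOnNhd (fun w hw => (hd w hw).differentiableWithinAt)
      (isOpen_strip c)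
  have hk' : AnalyticOnNhd ℂ (fun _ : ℂ => k) {w : ℂ | |w.im| < c} := analyticOnNhd_const
  have := han.eqOn_of_preconnected_of_eventuallyEq hk' (isPreconnected_strip c) (z₀ := 0)
    (by simpa using hcpos) ?_
  · exact fun w hw => this hw
  · filter_upwards [(isOpen_strip (T / 2)).mem_nhds (x := 0) (by simpa using hT)] with w hw
    exact h1 w hw

end Periodic

end RelToda

namespace RelToda

open Complex Set

/-! ### Lower bounds for sinh, and integrals of its reciprocal. -/

section Estimates

theorem sinh_mul_line (p r u : ℝ) : sinh ((p : ℂ) * (r + u * I)) =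
    ((Real.sinh (p * r) * Real.cos (p * u) : ℝ) : ℂ)
      + ((Real.cosh (p * r) * Real.sin (p * u) : ℝ) : ℂ) * I := by
  rw [mul_add, ← mul_assoc, sinh_add, sinh_mul_I, cosh_mul_I]
  push_cast; ring

theorem re_sinh_mul_line (p r u : ℝ) :
    (sinh ((p : ℂ) * (r + u * I))).re = Real.sinh (p * r) * Real.cos (p * u) := by
  simp only [sinh_mul_line, add_re, ofReal_re, re_ofReal_mul, I_re, mul_zero, add_zero]

theorem im_sinh_mul_line (p r u : ℝ) :
    (sinh ((p : ℂ) * (r + u * I))).im = Real.cosh (p * r) * Real.sin (p * u) := by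
  simp only [sinh_mul_line, add_im, ofReal_im, im_ofReal_mul, I_im, mul_one, zero_add]

theorem cosh_le_norm_sinh_mul (p r u : ℝ) :
    |Real.sin (p * u)| * Real.cosh (p * r) ≤ ‖sinh (p * (r + u * I))‖ := by
  have := abs_im_le_norm (sinh ((p : ℂ) * (r + u * I)))
  rw [im_sinh_mul_line, abs_mul, abs_of_pos (Real.cosh_pos _)] at this
  linarith

/-- From |sinh(x + iy)|² = sinh² x + sin² y. Unlike the bound through cosh this needs no sine
factor, so it is uniform in the height, at the price of being empty at r = 0. -/
theorem sinh_abs_le_norm_sinh (p r u : ℝ) :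
    Real.sinh |p * r| ≤ ‖sinh (p * (r + u * I))‖ := by
  have h1 := im_sinh_mul_line p r u
  have h2 := re_sinh_mul_line p r u
  refine le_of_sq_le_sq ?_ (norm_nonneg _)
  rw [← normSq_eq_norm_sq, normSq_apply, h1, h2]
  have h3 : Real.sinh |p * r| ^ 2 = Real.sinh (p * r) ^ 2 := by
    rcases abs_cases (p * r) with h | h <;> rw [h.1]
    rw [Real.sinh_neg, neg_sq]
  rw [h3]
  have h4 := Real.cosh_sq (p * r)
  have h5 := Real.sin_sq_add_cos_sq (p * u)
  have e : Real.sinh (p * r) * Real.cos (p * u) * (Real.sinh (p * r) * Real.cos (p * u)) +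
      Real.cosh (p * r) * Real.sin (p * u) * (Real.cosh (p * r) * Real.sin (p * u))
      = Real.sinh (p * r) ^ 2 + Real.sin (p * u) ^ 2 := by
    have : Real.cosh (p * r) * Real.sin (p * u) * (Real.cosh (p * r) * Real.sin (p * u))
      = Real.cosh (p * r) ^ 2 * Real.sin (p * u) ^ 2 := by ring
    rw [this, h4]
    linear_combination Real.sinh (p * r) ^ 2 * h5
  rw [e]; nlinarith [sq_nonneg (Real.sin (p * u))]

theorem exp_abs_half_le_cosh (x : ℝ) : Real.exp |x| / 2 ≤ Real.cosh x := by
  rw [← Real.cosh_abs, Real.cosh_eq]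
  have := Real.exp_pos (-|x|); linarith

theorem exp_le_sinh_abs {p : ℝ} (hp : 0 < p) {r : ℝ} (hr : 1 ≤ |r|) :
    (1 - Real.exp (-(2 * p))) / 2 * Real.exp (p * |r|) ≤ Real.sinh |p * r| := by
  rw [abs_mul, abs_of_pos hp, Real.sinh_eq]
  have h1 : Real.exp (-(p * |r|)) ≤ Real.exp (-(2 * p)) * Real.exp (p * |r|) := by
    rw [← Real.exp_add]; refine Real.exp_le_exp.2 ?_; nlinarith
  linarith

theorem norm_exp_two_mul (t z : ℂ) :
    ‖exp (2 * I * t * z)‖ = Real.exp (-(2 * (t.re * z.im + t.im * z.re))) := by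
  rw [norm_exp]; congr 1; simp; ring

/-- Bounded by `C / r²` far out in a horizontal strip: lines of integration can be shifted. -/
theorem integral_line_eq_of_inv_sq {f : ℂ → ℂ} {b c C : ℝ} {S : Set ℂ} (hS : S.Countable)
    (hbc : b ≤ c) (hcont : ContinuousOn f {z | z.im ∈ Icc b c})
    (hdiff : ∀ z : ℂ, z.im ∈ Ioo b c → z ∉ S → DifferentiableAt ℂ f z)
    (hle : ∀ r t : ℝ, 1 ≤ |r| → t ∈ Icc b c → ‖f (r + t * I)‖ ≤ C / r ^ 2) :
    Integrable (fun r : ℝ => f (r + b * I)) ∧ Integrable (fun r : ℝ => f (r + c * I)) ∧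
      (∫ r : ℝ, f (r + b * I)) = ∫ r : ℝ, f (r + c * I) := by
  obtain ⟨M, hM⟩ := ((isCompact_Icc (a := (-1 : ℝ)) (b := 1)).reProdIm
    (isCompact_Icc (a := b) (b := c))).exists_bound_of_continuousOn
    (hcont.mono fun z hz => hz.2)
  have hC : 0 ≤ C := by
    have := (norm_nonneg _).trans (hle 1 b (by simp) ⟨le_rfl, hbc⟩)
    simpa using this
  have hbound : ∀ r t : ℝ, t ∈ Icc b c → ‖f (r + t * I)‖ ≤ 2 * (|M| + C) * (1 + |r| ^ 2)⁻¹ := by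
    intro r t ht
    rw [← div_eq_mul_inv, le_div_iff₀ (by positivity), sq_abs]
    rcases le_total 1 |r| with h | h
    · have h1 := hle r t h ht
      have hr2 : 1 ≤ r ^ 2 := by rw [← sq_abs]; nlinarith
      rw [le_div_iff₀ (by positivity)] at h1
      nlinarith [abs_nonneg M, norm_nonneg (f (r + t * I))]
    · have h1 := hM (r + t * I) ⟨by simpa using abs_le.1 h, by simpa using ht⟩
      have hr2 : r ^ 2 ≤ 1 := by rw [← sq_abs]; nlinarith [abs_nonneg r]
      nlinarith [le_abs_self M, norm_nonneg (f (r + t * I)), abs_nonneg M]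
  have hint : ∀ u ∈ Icc b c, Integrable (fun r : ℝ => f (r + u * I)) := by
    intro u hu
    refine (integrable_inv_one_add_sq.const_mul (2 * (|M| + C))).mono' ?_
      (Eventually.of_forall fun r => by simpa using hbound r u hu)
    exact (hcont.comp_continuous (continuous_line u)
      (fun r => by simpa using hu)).aestronglyMeasurable
  refine ⟨hint b ⟨le_rfl, hbc⟩, hint c ⟨hbc, le_rfl⟩, ?_⟩
  refine integral_line_eq hS hbc hcont hdiff (φ := fun r => 2 * (|M| + C) * (1 + r ^ 2)⁻¹) ?_ hbound
    (hint b ⟨le_rfl, hbc⟩) (hint c ⟨hbc, le_rfl⟩)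
  have : Tendsto (fun r : ℝ => (1 + r ^ 2)⁻¹) atTop (𝓝 0) :=
    (tendsto_atTop_add_const_left _ _ (tendsto_pow_atTop two_ne_zero)).inv_tendsto_atTop
  simpa using this.const_mul (2 * (|M| + C))

theorem exp_neg_mul_abs_le_inv_sq {μ : ℝ} (hμ : 0 < μ) {r : ℝ} (hr : 1 ≤ |r|) :
    Real.exp (-(μ * |r|)) ≤ 2 / μ ^ 2 / r ^ 2 := by
  have h1 := Real.quadratic_le_exp_of_nonneg (x := μ * |r|) (by positivity)
  rw [Real.exp_neg, div_div, ← sq_abs r, ← mul_pow]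
  have h0 : 0 < μ * |r| := mul_pos hμ (by linarith)
  rw [inv_le_comm₀ (Real.exp_pos _) (by positivity), inv_div]
  linarith

theorem hasDerivAt_arctan_sinh (r : ℝ) :
    HasDerivAt (fun r => Real.arctan (Real.sinh r)) (1 / Real.cosh r) r := by
  have h := (Real.hasDerivAt_arctan (Real.sinh r)).comp r (Real.hasDerivAt_sinh r)
  convert! h using 1
  have := Real.cosh_sq r
  rw [show 1 + Real.sinh r ^ 2 = Real.cosh r ^ 2 by linarith]
  have h2 := (Real.cosh_pos r).ne'
  field_simp

theorem integrable_one_div_cosh {q : ℝ} (hq : 0 < q) :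
    Integrable fun r : ℝ => 1 / Real.cosh (q * r) := by
  refine ((integrable_exp_neg_mul_abs hq).const_mul 2).mono' ?_ (Eventually.of_forall fun r => ?_)
  · refine Continuous.aestronglyMeasurable ?_
    exact continuous_const.div (Real.continuous_cosh.comp (by fun_prop))
      fun r => (Real.cosh_pos _).ne'
  · rw [Real.norm_eq_abs, abs_of_pos (by have := Real.cosh_pos (q * r); positivity),
      div_le_iff₀ (Real.cosh_pos _), Real.exp_neg]
    have := exp_abs_half_le_cosh (q * r)
    rw [abs_mul, abs_of_pos hq] at this
    have h2 := Real.exp_pos (q * |r|)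
    rw [mul_assoc, inv_mul_eq_div, ← mul_div_assoc, le_div_iff₀ h2]; linarith

theorem integral_one_div_cosh {q : ℝ} (hq : 0 < q) :
    ∫ r : ℝ, 1 / Real.cosh (q * r) = Real.pi / q := by
  have h1 := integrable_one_div_cosh one_pos
  simp only [one_mul] at h1
  have hs : Tendsto Real.sinh atTop atTop := by
    refine tendsto_atTop_mono' _ ?_ tendsto_id
    filter_upwards [eventually_ge_atTop 0] with x hx using Real.self_le_sinh_iff.2 hx
  have hs' : Tendsto Real.sinh atBot atBot := by
    refine tendsto_atBot_mono' _ ?_ tendsto_id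
    filter_upwards [eventually_le_atBot 0] with x hx using Real.sinh_le_self_iff.2 hx
  have h2 := integral_of_hasDerivAt_of_tendsto hasDerivAt_arctan_sinh h1
    (((Real.tendsto_arctan_atBot.mono_right nhdsWithin_le_nhds)).comp hs')
    (((Real.tendsto_arctan_atTop.mono_right nhdsWithin_le_nhds)).comp hs)
  have h3 := Measure.integral_comp_mul_left (fun r => 1 / Real.cosh r) q
  rw [h3, h2, abs_of_pos (inv_pos.2 hq), smul_eq_mul]
  field_simp; ring

/-- At the height where qu = π/2 the hyperbolic sine turns into i cosh: even in r and free of zeros.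
The explicit integrals are all evaluated on such a line. -/
theorem sinh_line {q u : ℝ} (h : q * u = Real.pi / 2) (r : ℝ) :
    sinh ((q : ℂ) * (r + u * I)) = I * Real.cosh (q * r) := by
  rw [sinh_mul_line, h, Real.cos_pi_div_two, Real.sin_pi_div_two]
  push_cast; ring

theorem integral_one_div_sinh_line {q u : ℝ} (hq : 0 < q) (h : q * u = Real.pi / 2) :
    (Integrable fun r : ℝ => 1 / sinh ((q : ℂ) * (r + u * I))) ∧
    ∫ r : ℝ, 1 / sinh ((q : ℂ) * (r + u * I)) = -(Real.pi / q * I) := by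
  have e : (fun r : ℝ => 1 / sinh ((q : ℂ) * (r + u * I)))
      = fun r : ℝ => -I * ((1 / Real.cosh (q * r) : ℝ) : ℂ) := by
    funext r
    rw [sinh_line h]
    push_cast
    rw [one_div, mul_inv, inv_I]; ring
  rw [e]
  refine ⟨(integrable_one_div_cosh hq).ofReal.const_mul _, ?_⟩
  rw [integral_const_mul]
  rw [integral_complex_ofReal, integral_one_div_cosh hq]
  push_cast; ring

end Estimates

end RelToda

namespace RelToda

open Complex Set

/-! ### The contour integral for g_R: convergence, decay, holomorphy. -/

section LineIntegrals

/-- The height of the line of integration in the integral representation of `g_R`. -/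
noncomputable def rho (p q : ℝ) : ℝ := Real.pi / (2 * (p + q))

/-- The integrand of `g_R`. -/
noncomputable def jKer (p q : ℝ) (z t : ℂ) : ℂ :=
  exp (2 * I * t * z) / (4 * I * t * (sinh (p * t) * sinh (q * t)))

/-- The integral `∫ exp(2itz) / (4it sinh(pt) sinh(qt)) dt` over `ℝ + iρ`. -/
noncomputable def jInt (p q : ℝ) (z : ℂ) : ℂ := ∫ r : ℝ, jKer p q z (r + rho p q * I)

/-- The integral `∫ exp(2itz) / (2t sinh(qt)) dt` over `ℝ + iu`. -/
noncomputable def lInt (u q : ℝ) (z : ℂ) : ℂ :=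
  ∫ r : ℝ, exp (2 * I * (r + u * I) * z) / (2 * (r + u * I) * sinh (q * (r + u * I)))

/-- The integral `∫ exp(2itz) / sinh(qt) dt` over `ℝ + iu`. -/
noncomputable def mInt (u q : ℝ) (z : ℂ) : ℂ :=
  ∫ r : ℝ, exp (2 * I * (r + u * I) * z) / sinh (q * (r + u * I))

variable {p q : ℝ}

theorem rho_pos (hp : 0 < p) (hq : 0 < q) : 0 < rho p q := by
  have := Real.pi_pos; unfold rho; positivity

theorem rho_comm (p q : ℝ) : rho p q = rho q p := by rw [rho, rho, add_comm]

/-- The height ρ is fixed by (p + q)ρ = π/2. Hence pρ and qρ stay below π/2, the line passes under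
all nonzero poles of the integrand, and sinh((p + q)t) becomes i cosh on it. -/
theorem mul_rho_lt (hp : 0 < p) (hq : 0 < q) : q * rho p q < Real.pi / 2 := by
  have := Real.pi_pos
  rw [rho, ← mul_div_assoc, div_lt_div_iff₀ (by positivity) (by positivity)]
  nlinarith [mul_pos this hp]

theorem mul_rho_lt' (hp : 0 < p) (hq : 0 < q) : p * rho p q < Real.pi / 2 := by
  rw [rho_comm]; exact mul_rho_lt hq hp

theorem sin_pos_of_lt_pi_div_two {x : ℝ} (h0 : 0 < x) (h1 : x ≤ Real.pi / 2) : 0 < Real.sin x :=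
  Real.sin_pos_of_pos_of_lt_pi h0 (by linarith [Real.pi_pos])

theorem line_ne_zero {u : ℝ} (hu : 0 < u) (r : ℝ) : (r : ℂ) + u * I ≠ 0 := by
  intro h
  have := congrArg Complex.im h
  simp at this; exact hu.ne' this

theorem le_norm_line (r u : ℝ) : u ≤ ‖(r : ℂ) + u * I‖ := by
  have := abs_im_le_norm ((r : ℂ) + u * I)
  simp at this; exact (le_abs_self u).trans this

theorem norm_exp_line_le (r u : ℝ) (z : ℂ) :
    ‖exp (2 * I * (r + u * I) * z)‖ ≤ Real.exp (-(2 * u * z.re)) * Real.exp (2 * |z.im| * |r|) := by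
  rw [norm_exp_two_mul, ← Real.exp_add]
  refine Real.exp_le_exp.2 ?_
  simp only [add_re, ofReal_re, re_ofReal_mul, I_re, add_im, ofReal_im, im_ofReal_mul, I_im]
  have := neg_abs_le (r * z.im)
  rw [abs_mul] at this
  nlinarith

/-- The basic bound for integrands with a `sinh` in the denominator. -/
theorem norm_exp_div_sinh_le {u : ℝ} (hq : 0 < q) (hu : 0 < q * u) (hu' : q * u ≤ Real.pi / 2)
    (r : ℝ) (z : ℂ) : ‖exp (2 * I * (r + u * I) * z) / sinh (q * (r + u * I))‖ ≤
      2 / Real.sin (q * u) * Real.exp (-(2 * u * z.re)) *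
        Real.exp (-((q - 2 * |z.im|) * |r|)) := by
  have hs := sin_pos_of_lt_pi_div_two hu hu'
  have h1 := cosh_le_norm_sinh_mul q r u
  rw [abs_of_pos hs] at h1
  have h2 := exp_abs_half_le_cosh (q * r)
  rw [abs_mul, abs_of_pos hq] at h2
  have h3 : Real.sin (q * u) * (Real.exp (q * |r|) / 2) ≤ ‖sinh ((q : ℂ) * (r + u * I))‖ :=
    (mul_le_mul_of_nonneg_left h2 hs.le).trans h1
  have h4 := norm_exp_line_le r u z
  have h5 := Real.exp_pos (q * |r|)
  rw [norm_div, div_le_iff₀ (lt_of_lt_of_le (by positivity) h3)]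
  refine h4.trans ?_
  have h6 : Real.exp (2 * |z.im| * |r|) =
      Real.exp (-((q - 2 * |z.im|) * |r|)) * Real.exp (q * |r|) := by
    rw [← Real.exp_add]; ring_nf
  rw [h6]
  calc _ = 2 / Real.sin (q * u) * Real.exp (-(2 * u * z.re)) *
        Real.exp (-((q - 2 * |z.im|) * |r|)) * (Real.sin (q * u) * (Real.exp (q * |r|) / 2)) := by
        generalize Real.sin (q * u) = s at hs
        field_simp
    _ ≤ _ := mul_le_mul_of_nonneg_left h3 (by positivity)

theorem sinh_line_ne_zero {u : ℝ} (hu : 0 < q * u) (hu' : q * u ≤ Real.pi / 2) (r : ℝ) :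
    sinh ((q : ℂ) * (r + u * I)) ≠ 0 := by
  intro h
  have hs := sin_pos_of_lt_pi_div_two hu hu'
  have h1 := cosh_le_norm_sinh_mul q r u
  rw [h, norm_zero, abs_of_pos hs] at h1
  have := mul_pos hs (Real.cosh_pos (q * r))
  linarith

theorem norm_exp_div_mul_sinh_le {u : ℝ} (hq : 0 < q) (hu0 : 0 < u)
    (hu' : q * u ≤ Real.pi / 2) (r : ℝ) (z : ℂ) :
    ‖exp (2 * I * (r + u * I) * z) / (2 * (r + u * I) * sinh (q * (r + u * I)))‖ ≤
      1 / u / Real.sin (q * u) * Real.exp (-(2 * u * z.re)) *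
        Real.exp (-((q - 2 * |z.im|) * |r|)) := by
  have h1 := norm_exp_div_sinh_le hq (mul_pos hq hu0) hu' r z
  have h2 := le_norm_line r u
  have e : exp (2 * I * (r + u * I) * z) / (2 * (r + u * I) * sinh (q * (r + u * I)))
    = (exp (2 * I * (r + u * I) * z) / sinh (q * (r + u * I))) / (2 * (r + u * I)) := by
    rw [div_div, mul_comm (sinh _)]
  have h3 : ‖(2 : ℂ) * (r + u * I)‖ = 2 * ‖(r : ℂ) + u * I‖ := by rw [norm_mul]; simp
  rw [e, norm_div, h3, div_le_iff₀ (by linarith)]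
  refine h1.trans ?_
  have hs := sin_pos_of_lt_pi_div_two (mul_pos hq hu0) hu'
  calc _ = (1 / u / Real.sin (q * u) * Real.exp (-(2 * u * z.re)) *
        Real.exp (-((q - 2 * |z.im|) * |r|))) * (2 * u) := by field_simp
    _ ≤ _ := mul_le_mul_of_nonneg_left (by linarith) (by positivity)

/-- The constant in the bound for the integrand of `g_R`. -/
noncomputable def jConst (p q : ℝ) : ℝ :=
  1 / rho p q / Real.sin (q * rho p q) / Real.sin (p * rho p q)

theorem jConst_pos (hp : 0 < p) (hq : 0 < q) : 0 < jConst p q := by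
  have h := rho_pos hp hq
  have h1 := sin_pos_of_lt_pi_div_two (mul_pos hq h) (mul_rho_lt hp hq).le
  have h2 := sin_pos_of_lt_pi_div_two (mul_pos hp h) (mul_rho_lt' hp hq).le
  unfold jConst; positivity

theorem norm_jKer_le (hp : 0 < p) (hq : 0 < q) (r : ℝ) (z : ℂ) :
    ‖jKer p q z (r + rho p q * I)‖ ≤ jConst p q * Real.exp (-(2 * rho p q * z.re)) *
      Real.exp (-((p + q - 2 * |z.im|) * |r|)) := by
  set u := rho p q
  have hu : 0 < u := rho_pos hp hq
  have h1 := norm_exp_div_mul_sinh_le hq hu (mul_rho_lt hp hq).le r z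
  have hs := sin_pos_of_lt_pi_div_two (mul_pos hp hu) (mul_rho_lt' hp hq).le
  have hs' := sin_pos_of_lt_pi_div_two (mul_pos hq hu) (mul_rho_lt hp hq).le
  have h2 := cosh_le_norm_sinh_mul p r u
  rw [abs_of_pos hs] at h2
  have h3 := exp_abs_half_le_cosh (p * r)
  rw [abs_mul, abs_of_pos hp] at h3
  have h4 : Real.sin (p * u) * (Real.exp (p * |r|) / 2) ≤ ‖sinh ((p : ℂ) * (r + u * I))‖ :=
    (mul_le_mul_of_nonneg_left h3 hs.le).trans h2
  have e : jKer p q z (r + u * I) = exp (2 * I * (r + u * I) * z) /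
      (2 * (r + u * I) * sinh (q * (r + u * I))) / (2 * I * sinh (p * (r + u * I))) := by
    rw [jKer, div_div]; ring_nf
  have h5 : ‖(2 : ℂ) * I * sinh (p * (r + u * I))‖ = 2 * ‖sinh ((p : ℂ) * (r + u * I))‖ := by
    rw [norm_mul]; simp
  have hpos : 0 < Real.sin (p * u) * (Real.exp (p * |r|) / 2) := by positivity
  rw [e, norm_div, h5, div_le_iff₀ (by linarith)]
  refine h1.trans ?_
  have h6 : Real.exp (-((q - 2 * |z.im|) * |r|)) =
      Real.exp (-((p + q - 2 * |z.im|) * |r|)) * Real.exp (p * |r|) := by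
    rw [← Real.exp_add]; ring_nf
  rw [h6, jConst]
  calc _ = (1 / u / Real.sin (q * u) / Real.sin (p * u) * Real.exp (-(2 * u * z.re)) *
        Real.exp (-((p + q - 2 * |z.im|) * |r|))) *
        (2 * (Real.sin (p * u) * (Real.exp (p * |r|) / 2))) := by
        generalize Real.sin (p * u) = s at hs
        generalize Real.sin (q * u) = s' at hs'
        field_simp
    _ ≤ _ := mul_le_mul_of_nonneg_left (by linarith) (by positivity)

theorem continuous_jKer_line (hp : 0 < p) (hq : 0 < q) (z : ℂ) :
    Continuous fun r : ℝ => jKer p q z (r + rho p q * I) := by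
  have hu := rho_pos hp hq
  unfold jKer
  refine Continuous.div (by fun_prop) ?_ fun r => ?_
  · exact (continuous_const.mul (continuous_line _)).mul
      ((continuous_sinh.comp (continuous_const.mul (continuous_line _))).mul
        (continuous_sinh.comp (continuous_const.mul (continuous_line _))))
  · exact mul_ne_zero (mul_ne_zero (by simp) (line_ne_zero hu r))
      (mul_ne_zero (sinh_line_ne_zero (mul_pos hp hu) (mul_rho_lt' hp hq).le r)
        (sinh_line_ne_zero (mul_pos hq hu) (mul_rho_lt hp hq).le r))

theorem integrable_jKer (hp : 0 < p) (hq : 0 < q) {z : ℂ} (hz : |z.im| < (p + q) / 2) :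
    Integrable fun r : ℝ => jKer p q z (r + rho p q * I) :=
  integrable_of_exp_bound (μ := p + q - 2 * |z.im|) (by linarith)
    (continuous_jKer_line hp hq z).aestronglyMeasurable (fun r => norm_jKer_le hp hq r z)

/-- The factor exp(-2ρ Re z), which is |exp(2itz)| at the height ρ of the line up to a part absorbed
by the sines, comes out of the integral. This exponential decay is the source of all asymptotics of
G_R. -/
theorem jInt_bound (hp : 0 < p) (hq : 0 < q) {v : ℝ} (hv : v < (p + q) / 2) :
    ∃ C, 0 ≤ C ∧ ∀ z : ℂ, |z.im| ≤ v → ‖jInt p q z‖ ≤ C * Real.exp (-(2 * rho p q * z.re)) := by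
  have hμ : 0 < p + q - 2 * v := by linarith
  have hJ := jConst_pos hp hq
  refine ⟨jConst p q * ∫ r : ℝ, Real.exp (-((p + q - 2 * v) * |r|)), ?_, fun z hz => ?_⟩
  · exact mul_nonneg hJ.le (integral_nonneg fun r => (Real.exp_pos _).le)
  · have := norm_integral_le_of_norm_le (μ := volume)
      (f := fun r : ℝ => jKer p q z (r + rho p q * I))
      (((integrable_exp_neg_mul_abs hμ).const_mul (jConst p q *
      Real.exp (-(2 * rho p q * z.re))))) (Eventually.of_forall fun r => ?_)
    · rw [integral_const_mul] at this
      refine this.trans (le_of_eq ?_); ring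
    · refine (norm_jKer_le hp hq r z).trans ?_
      refine mul_le_mul_of_nonneg_left (Real.exp_le_exp.2 ?_) (by positivity)
      nlinarith [abs_nonneg r]

theorem differentiableAt_jInt (hp : 0 < p) (hq : 0 < q) {z : ℂ} (hz : |z.im| < (p + q) / 2) :
    DifferentiableAt ℂ (jInt p q) z := by
  obtain ⟨v, hv1, hv2⟩ := exists_between hz
  have hμ : 0 < p + q - 2 * v := by linarith
  have hJ := jConst_pos hp hq
  have hu := rho_pos hp hq
  have hopen : {w : ℂ | |w.im| < v ∧ z.re - 1 < w.re} ∈ 𝓝 z := by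
    refine IsOpen.mem_nhds ((isOpen_strip v).inter (isOpen_lt continuous_const continuous_re)) ?_
    exact ⟨hv1, by simp⟩
  refine differentiableAt_integral hopen ((integrable_exp_neg_mul_abs hμ).const_mul (jConst p q *
      Real.exp (-(2 * rho p q * (z.re - 1))))) ?_ ?_ ?_
  · exact fun w _ => (continuous_jKer_line hp hq w).aestronglyMeasurable
  · refine Eventually.of_forall fun r w _ => ?_
    unfold jKer; fun_prop
  · refine Eventually.of_forall fun r w hw => (norm_jKer_le hp hq r w).trans ?_
    refine mul_le_mul (mul_le_mul_of_nonneg_left (Real.exp_le_exp.2 ?_) hJ.le)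
      (Real.exp_le_exp.2 ?_) (Real.exp_pos _).le (by positivity)
    · have := hw.2; nlinarith
    · have := hw.1; nlinarith [abs_nonneg r]

end LineIntegrals

/-! ### The elementary integral behind the difference equation of G. -/

section ShiftEquation

variable {u q : ℝ}

theorem continuous_mKer (hu : 0 < q * u) (hu' : q * u ≤ Real.pi / 2) (z : ℂ) :
    Continuous fun r : ℝ => exp (2 * I * (r + u * I) * z) / sinh (q * (r + u * I)) :=
  Continuous.div (by fun_prop)
    (continuous_sinh.comp (continuous_const.mul (continuous_line _))) (sinh_line_ne_zero hu hu')

theorem continuous_lKer (hq : 0 < q) (hu : 0 < u) (hu' : q * u ≤ Real.pi / 2) (z : ℂ) :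
    Continuous fun r : ℝ =>
      exp (2 * I * (r + u * I) * z) / (2 * (r + u * I) * sinh (q * (r + u * I))) :=
  Continuous.div (by fun_prop) ((continuous_const.mul (continuous_line _)).mul
    (continuous_sinh.comp (continuous_const.mul (continuous_line _))))
    fun r => mul_ne_zero (mul_ne_zero two_ne_zero (line_ne_zero hu r))
      (sinh_line_ne_zero (mul_pos hq hu) hu' r)

theorem integrable_mKer (hq : 0 < q) (hu : 0 < u) (hu' : q * u ≤ Real.pi / 2) {z : ℂ}
    (hz : |z.im| < q / 2) :
    Integrable fun r : ℝ => exp (2 * I * (r + u * I) * z) / sinh (q * (r + u * I)) :=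
  integrable_of_exp_bound (μ := q - 2 * |z.im|) (by linarith)
    (continuous_mKer (mul_pos hq hu) hu' z).aestronglyMeasurable
    (fun r => norm_exp_div_sinh_le hq (mul_pos hq hu) hu' r z)

/-- Differentiation in z removes the factor 1/(2t) and leaves an integral that can be computed in
closed form. -/
theorem hasDerivAt_lInt (hq : 0 < q) (hu : 0 < u) (hu' : q * u ≤ Real.pi / 2) {z : ℂ}
    (hz : |z.im| < q / 2) : HasDerivAt (lInt u q) (I * mInt u q z) z := by
  obtain ⟨v, hv1, hv2⟩ := exists_between hz
  have hμ : 0 < q - 2 * v := by linarith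
  have hs := sin_pos_of_lt_pi_div_two (mul_pos hq hu) hu'
  have hopen : {w : ℂ | |w.im| < v ∧ z.re - 1 < w.re} ∈ 𝓝 z := by
    refine IsOpen.mem_nhds ((isOpen_strip v).inter (isOpen_lt continuous_const continuous_re)) ?_
    exact ⟨hv1, by simp⟩
  have h := hasDerivAt_integral_of_dominated_loc_of_deriv_le (𝕜 := ℂ) (μ := volume)
    (F := fun w (r : ℝ) => exp (2 * I * (r + u * I) * w) / (2 * (r + u * I) * sinh (q * (r + u * I))))
    (F' := fun w (r : ℝ) => I * (exp (2 * I * (r + u * I) * w) / sinh (q * (r + u * I))))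
    (x₀ := z) (bound := fun r => (2 / Real.sin (q * u) * Real.exp (-(2 * u * (z.re - 1)))) *
        Real.exp (-((q - 2 * v) * |r|))) hopen ?_ ?_ ?_ ?_ ?_ ?_
  · have h2 := h.2
    rw [integral_const_mul] at h2
    exact h2
  · exact Eventually.of_forall fun w => (continuous_lKer hq hu hu' w).aestronglyMeasurable
  · exact integrable_of_exp_bound (μ := q - 2 * |z.im|) (by linarith)
      (continuous_lKer hq hu hu' z).aestronglyMeasurable
      (fun r => norm_exp_div_mul_sinh_le hq hu hu' r z)
  · exact ((continuous_mKer (mul_pos hq hu) hu' z).const_smul I).aestronglyMeasurable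
  · refine Eventually.of_forall fun r w hw => ?_
    rw [norm_mul, norm_I, one_mul]
    refine (norm_exp_div_sinh_le hq (mul_pos hq hu) hu' r w).trans ?_
    refine mul_le_mul (mul_le_mul_of_nonneg_left (Real.exp_le_exp.2 ?_) (by positivity))
      (Real.exp_le_exp.2 ?_) (Real.exp_pos _).le (by positivity)
    · have := hw.2; nlinarith
    · have := hw.1; nlinarith [abs_nonneg r]
  · exact (integrable_exp_neg_mul_abs hμ).const_mul _
  · refine Eventually.of_forall fun r w _ => ?_
    have h1 : HasDerivAt (fun w => exp (2 * I * (r + u * I) * w))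
        (exp (2 * I * (r + u * I) * w) * (2 * I * (r + u * I))) w := by
      simpa using ((hasDerivAt_id w).const_mul (2 * I * (r + u * I))).cexp
    convert! h1.div_const (2 * (r + u * I) * sinh (q * (r + u * I))) using 1
    have h3 := line_ne_zero hu r
    have h4 := sinh_line_ne_zero (mul_pos hq hu) hu' r
    generalize (r : ℂ) + u * I = t at h3 h4 ⊢
    generalize sinh ((q : ℂ) * t) = s at h4 ⊢
    field_simp

theorem lInt_bound (hq : 0 < q) (hu : 0 < u) (hu' : q * u ≤ Real.pi / 2) {v : ℝ}
    (hv : v < q / 2) : ∃ C, 0 ≤ C ∧ ∀ z : ℂ, |z.im| ≤ v →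
      ‖lInt u q z‖ ≤ C * Real.exp (-(2 * u * z.re)) := by
  have hμ : 0 < q - 2 * v := by linarith
  have hs := sin_pos_of_lt_pi_div_two (mul_pos hq hu) hu'
  refine ⟨1 / u / Real.sin (q * u) * ∫ r : ℝ, Real.exp (-((q - 2 * v) * |r|)), ?_, fun z hz => ?_⟩
  · exact mul_nonneg (by positivity) (integral_nonneg fun r => (Real.exp_pos _).le)
  · have := norm_integral_le_of_norm_le (μ := volume) (f := fun r : ℝ =>
      exp (2 * I * (r + u * I) * z) / (2 * (r + u * I) * sinh (q * (r + u * I))))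
      (((integrable_exp_neg_mul_abs hμ).const_mul (1 / u / Real.sin (q * u) *
      Real.exp (-(2 * u * z.re))))) (Eventually.of_forall fun r => ?_)
    · rw [integral_const_mul] at this
      refine this.trans (le_of_eq ?_); ring
    · refine (norm_exp_div_mul_sinh_le hq hu hu' r z).trans ?_
      refine mul_le_mul_of_nonneg_left (Real.exp_le_exp.2 ?_) (by positivity)
      nlinarith [abs_nonneg r]

theorem sinh_mul_ne_zero {t : ℂ} (hq : 0 < q) (h0 : 0 < t.im) (h1 : q * t.im ≤ Real.pi / 2) :
    sinh (q * t) ≠ 0 := by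
  have := sinh_line_ne_zero (q := q) (u := t.im) (mul_pos hq h0) h1 t.re
  rwa [re_add_im] at this

/-- Since 1/sinh(qt) has no pole with 0 < Im t ≤ π/(2q), the line may be raised to the height where
`sinh_line` applies. -/
theorem mInt_eq_mInt {h : ℝ} (hq : 0 < q) (hu : 0 < u) (huh : u ≤ h) (hh : q * h ≤ Real.pi / 2)
    {z : ℂ} (hz : |z.im| < q / 2) : mInt u q z = mInt h q z := by
  have hu' : ∀ t ∈ Icc u h, 0 < q * t ∧ q * t ≤ Real.pi / 2 := fun t ht =>
    ⟨mul_pos hq (hu.trans_le ht.1), (mul_le_mul_of_nonneg_left ht.2 hq.le).trans hh⟩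
  have hsm : ∀ t ∈ Icc u h, Real.sin (q * u) ≤ Real.sin (q * t) := fun t ht =>
    Real.sin_le_sin_of_le_of_le_pi_div_two (by linarith [Real.pi_pos, (hu' u ⟨le_rfl, huh⟩).1])
      (hu' t ht).2 (mul_le_mul_of_nonneg_left ht.1 hq.le)
  have hs0 := sin_pos_of_lt_pi_div_two (hu' u ⟨le_rfl, huh⟩).1 (hu' u ⟨le_rfl, huh⟩).2
  refine integral_line_eq_of_exp_bound (f := fun t => exp (2 * I * t * z) / sinh (q * t))
    (S := ∅) (μ := q - 2 * |z.im|)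
    (C := 2 / Real.sin (q * u) * Real.exp (2 * h * |z.re|)) (by linarith) countable_empty huh
    ?_ ?_ ?_
  · intro t ht
    refine ContinuousAt.continuousWithinAt ?_
    refine ContinuousAt.div (by fun_prop) (by fun_prop) ?_
    exact sinh_mul_ne_zero hq (hu.trans_le ht.1) (hu' _ ht).2
  · intro t ht _
    refine DifferentiableAt.div (by fun_prop) (by fun_prop) ?_
    exact sinh_mul_ne_zero hq (hu.trans ht.1) (hu' _ ⟨ht.1.le, ht.2.le⟩).2
  · intro r t ht
    refine (norm_exp_div_sinh_le hq (hu' t ht).1 (hu' t ht).2 r z).trans ?_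
    refine mul_le_mul_of_nonneg_right ?_ (Real.exp_pos _).le
    refine mul_le_mul ?_ (Real.exp_le_exp.2 ?_) (Real.exp_pos _).le (by positivity)
    · exact div_le_div_of_nonneg_left (by norm_num) hs0 (hsm t ht)
    · have h1 := neg_abs_le z.re
      have h2 := ht.2
      have h3 : 0 < t := hu.trans_le ht.1
      nlinarith [abs_nonneg z.re]

/-- On this line the denominator is even in r, so the substitution r ↦ -r reverses z up to the
factor coming from the height h. -/
theorem mInt_neg_eq {h : ℝ} (hh : q * h = Real.pi / 2) (z : ℂ) :
    mInt h q (-z) = exp (4 * h * z) * mInt h q z := by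
  simp only [mInt, sinh_line hh]
  rw [← integral_const_mul, ← integral_neg_eq_self]
  congr 1; funext r
  rw [← mul_div_assoc, ← Complex.exp_add, mul_neg q r, Real.cosh_neg]
  push_cast
  congr 2
  linear_combination (-4 * (h : ℂ) * z) * I_sq

theorem norm_cos_le (r t : ℝ) (z : ℂ) :
    ‖cos (2 * (r + t * I) * z)‖ ≤ Real.exp (2 * |t| * |z.re|) * Real.exp (2 * |z.im| * |r|) := by
  have h : ∀ w : ℂ, ‖cos w‖ ≤ Real.exp |w.im| := by
    intro w
    rw [Complex.cos, norm_div, norm_ofNat, div_le_iff₀ two_pos]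
    refine (norm_add_le _ _).trans ?_
    rw [norm_exp, norm_exp]
    have h1 : Real.exp (w * I).re ≤ Real.exp |w.im| := by
      refine Real.exp_le_exp.2 ?_; simpa using neg_le_abs w.im
    have h2 : Real.exp (-w * I).re ≤ Real.exp |w.im| := by
      refine Real.exp_le_exp.2 ?_; simpa using le_abs_self w.im
    linarith
  refine (h _).trans ?_
  rw [← Real.exp_add]
  refine Real.exp_le_exp.2 ?_
  have e : (2 * ((r : ℂ) + t * I) * z).im = 2 * (r * z.im + t * z.re) := by simp; ring
  rw [e, abs_mul, abs_two]
  have := abs_add_le (r * z.im) (t * z.re)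
  rw [abs_mul, abs_mul] at this
  linarith

/-- The sum is the integral of 2 cos(2tz)/sinh(qt). Subtracting 2/sinh(qt) makes the integrand odd
and regular at 0, so its part vanishes after a shift to the real axis; what remains is twice the
integral of 1/sinh. -/
theorem mInt_add_mInt_neg {h : ℝ} (hq : 0 < q) (hh : q * h = Real.pi / 2) {z : ℂ}
    (hz : |z.im| < q / 2) : mInt h q z + mInt h q (-z) = -(2 * Real.pi / q * I) := by
  have hh0 : 0 < h := by
    have := Real.pi_pos
    by_contra hcon
    nlinarith
  set f : ℂ → ℂ := fun t => (cos (2 * t * z) - 1) / sinh (q * t) with hf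
  have hsne : ∀ t : ℂ, t.im ∈ Icc 0 h → t ≠ 0 → sinh (q * t) ≠ 0 := by
    intro t ht ht0 hs
    have h1 := im_sinh_mul_line q t.re t.im
    have h2 := re_sinh_mul_line q t.re t.im
    rw [re_add_im, hs] at h1 h2
    simp only [zero_im, zero_re] at h1 h2
    rcases eq_or_lt_of_le ht.1 with h3 | h3
    · rw [← h3, mul_zero, Real.cos_zero, mul_one] at h2
      have := Real.sinh_eq_zero.1 h2.symm
      have hr := (mul_eq_zero.1 this).resolve_left hq.ne'
      exact ht0 (Complex.ext hr h3.symm)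
    · exact sinh_mul_ne_zero hq h3 ((mul_le_mul_of_nonneg_left ht.2 hq.le).trans hh.le) hs
  have hf0 : ContinuousAt f 0 := by
    have h1 : HasDerivAt (fun t : ℂ => cos (2 * t * z)) 0 0 := by
      have := (((hasDerivAt_id (0 : ℂ)).const_mul 2).mul_const z).ccos
      simpa using this
    have h2 : HasDerivAt (fun t : ℂ => sinh (q * t)) q 0 := by
      have := ((hasDerivAt_id (0 : ℂ)).const_mul (q : ℂ)).csinh
      simpa using this
    rw [← continuousWithinAt_compl_self]
    have h3 := hasDerivAt_iff_tendsto_slope.1 h1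
    have h4 := hasDerivAt_iff_tendsto_slope.1 h2
    have h5 := h3.div h4 (ofReal_ne_zero.2 hq.ne')
    rw [ContinuousWithinAt]
    simp only [hf, mul_zero, zero_mul, cos_zero, sub_self, zero_div] at h5 ⊢
    refine h5.congr' ?_
    filter_upwards [self_mem_nhdsWithin] with t ht
    have ht0 : t ≠ 0 := ht
    simp only [slope_def_field, mul_zero, zero_mul, cos_zero, sinh_zero, sub_zero, Pi.div_apply]
    rw [div_div_div_cancel_right₀ ht0]
  have hdiff : ∀ t : ℂ, t.im ∈ Icc 0 h → t ≠ 0 → DifferentiableAt ℂ f t := fun t ht ht0 =>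
    DifferentiableAt.div (by fun_prop) (by fun_prop) (hsne t ht ht0)
  have hμ : 0 < q - 2 * |z.im| := by linarith
  have hbound : ∀ r t : ℝ, 1 ≤ |r| → t ∈ Icc 0 h → ‖f (r + t * I)‖ ≤
      ((Real.exp (2 * h * |z.re|) + 1) / ((1 - Real.exp (-(2 * q))) / 2) *
        (2 / (q - 2 * |z.im|) ^ 2)) / r ^ 2 := by
    intro r t hr ht
    have h1 := (exp_le_sinh_abs hq hr).trans (sinh_abs_le_norm_sinh q r t)
    have h2 := norm_cos_le r t z
    have hk : 0 < (1 - Real.exp (-(2 * q))) / 2 := by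
      have : Real.exp (-(2 * q)) < 1 := (by rw [Real.exp_lt_one_iff]; linarith)
      linarith
    have h3 : ‖cos (2 * (r + t * I) * z) - 1‖ ≤
        (Real.exp (2 * h * |z.re|) + 1) * Real.exp (2 * |z.im| * |r|) := by
      refine (norm_sub_le _ _).trans ?_
      rw [norm_one, add_mul, one_mul]
      refine add_le_add (h2.trans ?_) (Real.one_le_exp (by positivity))
      refine mul_le_mul_of_nonneg_right (Real.exp_le_exp.2 ?_) (Real.exp_pos _).le
      rw [abs_of_nonneg ht.1]
      exact mul_le_mul_of_nonneg_right (by linarith [ht.2]) (abs_nonneg _)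
    have h4 := exp_neg_mul_abs_le_inv_sq hμ hr
    rw [hf, norm_div]
    calc _ ≤ (Real.exp (2 * h * |z.re|) + 1) * Real.exp (2 * |z.im| * |r|) /
          ((1 - Real.exp (-(2 * q))) / 2 * Real.exp (q * |r|)) :=
          div_le_div₀ (by positivity) h3 (by positivity) h1
      _ = (Real.exp (2 * h * |z.re|) + 1) / ((1 - Real.exp (-(2 * q))) / 2) *
          Real.exp (-((q - 2 * |z.im|) * |r|)) := by
          rw [mul_div_mul_comm, ← Real.exp_sub]; ring_nf
      _ ≤ _ := by
          rw [mul_div_assoc]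
          exact mul_le_mul_of_nonneg_left h4 (by positivity)
  obtain ⟨hi0, hih, heq⟩ := integral_line_eq_of_inv_sq (f := f) (b := 0) (c := h) (S := {0})
    (countable_singleton 0) hh0.le (fun t ht => by
      rcases eq_or_ne t 0 with rfl | h0
      · exact hf0.continuousWithinAt
      · exact (hdiff t ht h0).continuousAt.continuousWithinAt)
    (fun t ht h0 => hdiff t ⟨ht.1.le, ht.2.le⟩ h0) hbound
  -- On the real axis the integrand is odd; the shift carries this zero up to height h.
  have hodd : (∫ r : ℝ, f (r + (0 : ℝ) * I)) = 0 := by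
    have h1 : (∫ r : ℝ, f (r + (0 : ℝ) * I)) = -∫ r : ℝ, f (r + (0 : ℝ) * I) := by
      conv_lhs => rw [← integral_neg_eq_self]
      rw [← integral_neg]
      congr 1; funext r
      simp only [hf]
      push_cast
      rw [zero_mul, add_zero, add_zero, mul_neg, mul_neg, neg_mul, Complex.cos_neg, sinh_neg,
        div_neg]
    have h2 : (2 : ℂ) * (∫ r : ℝ, f (r + (0 : ℝ) * I)) = 0 := by linear_combination h1
    exact (mul_eq_zero.1 h2).resolve_left two_ne_zero
  obtain ⟨hci, hcv⟩ := integral_one_div_sinh_line hq hh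
  rw [heq] at hodd
  have e1 : mInt h q z + mInt h q (-z) = ∫ r : ℝ, (2 * f (r + h * I)
      + 2 * (1 / sinh ((q : ℂ) * (r + h * I)))) := by
    rw [mInt, mInt, ← integral_add (integrable_mKer hq hh0 hh.le hz)
      (integrable_mKer hq hh0 hh.le (by simpa using hz))]
    congr 1; funext r
    simp only [hf, Complex.cos]
    rw [show 2 * ((r : ℂ) + h * I) * z * I = 2 * I * (r + h * I) * z by ring,
      show -(2 * ((r : ℂ) + h * I) * z) * I = 2 * I * (r + h * I) * -z by ring]
    ring
  rw [e1, integral_add (hih.const_mul 2) (hci.const_mul 2), integral_const_mul,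
    integral_const_mul, hodd, hcv]
  ring

theorem mInt_eq (hq : 0 < q) (hu : 0 < u) (hu' : q * u ≤ Real.pi / 2) {z : ℂ}
    (hz : |z.im| < q / 2) :
    mInt u q z * (1 + exp (2 * Real.pi * z / q)) = -(2 * Real.pi / q * I) := by
  have hq0 : (q : ℂ) ≠ 0 := ofReal_ne_zero.2 hq.ne'
  set h : ℝ := Real.pi / (2 * q)
  have hh : q * h = Real.pi / 2 := by simp only [h]; field_simp
  have huh : u ≤ h := by
    by_contra hcon; push Not at hcon; nlinarith
  rw [mInt_eq_mInt hq hu huh hh.le hz, ← mInt_add_mInt_neg hq hh hz, mInt_neg_eq hh]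
  have : (4 : ℂ) * h * z = 2 * Real.pi * z / q := by
    simp only [h]; push_cast; field_simp; ring
  rw [this]; ring

/-- By `mInt_eq` the derivative of the left side vanishes on the strip, and the left side tends to 1
as Re z → ∞. In other words `lInt` is -log(1 + exp(-2πz/q)). -/
theorem exp_lInt (hq : 0 < q) (hu : 0 < u) (hu' : q * u ≤ Real.pi / 2) {z : ℂ}
    (hz : |z.im| < q / 2) : exp (lInt u q z) * (1 + exp (-(2 * Real.pi * z / q))) = 1 := by
  have hq0 : (q : ℂ) ≠ 0 := ofReal_ne_zero.2 hq.ne'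
  have hpi := Real.pi_pos
  set K : ℂ → ℂ := fun z => exp (lInt u q z) * (1 + exp (-(2 * Real.pi * z / q))) with hK
  have hder : ∀ w : ℂ, |w.im| < q / 2 → HasDerivAt K 0 w := by
    intro w hw
    have h1 := (hasDerivAt_lInt hq hu hu' hw).cexp
    have h2 : HasDerivAt (fun w : ℂ => 1 + exp (-(2 * Real.pi * w / q)))
        (exp (-(2 * Real.pi * w / q)) * (-(2 * Real.pi / q))) w := by
      have : HasDerivAt (fun w : ℂ => -(2 * Real.pi * w / q)) (-(2 * Real.pi / q)) w := by
        simpa using (((hasDerivAt_id w).const_mul (2 * (Real.pi : ℂ))).div_const (q : ℂ)).fun_neg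
      simpa using this.cexp.const_add 1
    convert! h1.mul h2 using 1
    have h3 := mInt_eq hq hu hu' hw
    have h4 : exp (2 * Real.pi * w / q) * exp (-(2 * Real.pi * w / q)) = 1 := by
      rw [← Complex.exp_add, add_neg_cancel, exp_zero]
    have h5 : I * mInt u q w * (1 + exp (-(2 * Real.pi * w / q)))
        = 2 * Real.pi / q * exp (-(2 * Real.pi * w / q)) := by
      linear_combination I * exp (-(2 * Real.pi * w / q)) * h3 - I * mInt u q w * h4
        - (2 * Real.pi / q) * exp (-(2 * Real.pi * w / q)) * I_sq
    linear_combination -exp (lInt u q w) * h5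
  have hconst : ∀ x : ℝ, K x = K z := by
    intro x
    have hx : (x : ℂ) ∈ {w : ℂ | |w.im| < q / 2} := by simpa using hq
    exact (isOpen_strip (q / 2)).is_const_of_deriv_eq_zero (isPreconnected_strip _)
      (fun w hw => (hder w hw).differentiableAt.differentiableWithinAt)
      (fun w hw => (hder w hw).deriv) hx hz
  have hlim : Tendsto (fun x : ℝ => K x) atTop (𝓝 1) := by
    obtain ⟨C, _, hC⟩ := lInt_bound hq hu hu' (v := 0) (by linarith)
    have h1 : Tendsto (fun x : ℝ => lInt u q x) atTop (𝓝 0) := by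
      refine squeeze_zero_norm (fun x => hC x (by simp)) ?_
      exact tendsto_const_mul_exp_neg (by positivity) C
    have h2 : Tendsto (fun x : ℝ => exp (-(2 * Real.pi * (x : ℂ) / q))) atTop (𝓝 0) := by
      rw [tendsto_zero_iff_norm_tendsto_zero]
      have := tendsto_const_mul_exp_neg (μ := 2 * Real.pi / q) (by positivity) 1
      refine this.congr fun x => ?_
      rw [norm_exp, one_mul]
      congr 1
      rw [show -(2 * (Real.pi : ℂ) * x / q) = ((-(2 * Real.pi * x / q) : ℝ) : ℂ) by push_cast; rfl,
        ofReal_re]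
      ring
    have h3 := ((continuous_exp.tendsto 0).comp h1).mul (h2.const_add 1)
    simpa [hK] using h3
  exact tendsto_nhds_unique (tendsto_const_nhds.congr fun x => (hconst x).symm) hlim

end ShiftEquation

end RelToda

namespace RelToda

open Complex Set

/-! ### Second order expansions at 0. -/

section SecondOrder

/-- `F(t) = 1 + a t + b t² + o(t²)` as `t → 0`. -/
def SecondOrder (F : ℂ → ℂ) (a b : ℂ) : Prop :=
  Tendsto (fun t => (F t - 1 - a * t) / t ^ 2) (𝓝[≠] 0) (𝓝 b)

variable {F H : ℂ → ℂ} {a b a' b' : ℂ}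

theorem tendsto_id_nhdsNE : Tendsto (fun t : ℂ => t) (𝓝[≠] 0) (𝓝 0) :=
  tendsto_id.mono_right nhdsWithin_le_nhds

theorem SecondOrder.tendsto (h : SecondOrder F a b) : Tendsto F (𝓝[≠] 0) (𝓝 1) := by
  have h1 : Tendsto (fun t : ℂ => (F t - 1 - a * t) / t ^ 2 * t ^ 2 + (1 + a * t)) (𝓝[≠] 0)
      (𝓝 (b * 0 ^ 2 + (1 + a * 0))) :=
    (Tendsto.mul h (tendsto_id_nhdsNE.pow 2)).add ((tendsto_id_nhdsNE.const_mul a).const_add 1)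
  have h2 : b * 0 ^ 2 + (1 + a * 0) = 1 := by ring
  rw [h2] at h1
  refine h1.congr' ?_
  filter_upwards [self_mem_nhdsWithin] with t ht
  have ht0 : t ≠ 0 := ht
  rw [div_mul_cancel₀ _ (pow_ne_zero 2 ht0)]; ring

theorem SecondOrder.mul (h : SecondOrder F a b) (h' : SecondOrder H a' b') :
    SecondOrder (fun t => F t * H t) (a + a') (b + b' + a * a') := by
  have h1 : Tendsto (fun t : ℂ => (F t - 1 - a * t) / t ^ 2 * H t
      + (H t - 1 - a' * t) / t ^ 2 * (1 + a * t) + a * a') (𝓝[≠] 0)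
      (𝓝 (b * 1 + b' * (1 + a * 0) + a * a')) :=
    ((Tendsto.mul h h'.tendsto).add
      (Tendsto.mul h' ((tendsto_id_nhdsNE.const_mul a).const_add 1))).add_const _
  have h2 : b * 1 + b' * (1 + a * 0) + a * a' = b + b' + a * a' := by ring
  rw [h2] at h1
  refine h1.congr' ?_
  filter_upwards [self_mem_nhdsWithin] with t ht
  have ht0 : t ≠ 0 := ht
  field_simp; ring

theorem SecondOrder.inv (h : SecondOrder F 0 b) : SecondOrder (fun t => (F t)⁻¹) 0 (-b) := by
  have h1 : Tendsto (fun t : ℂ => -((F t - 1 - 0 * t) / t ^ 2) * (F t)⁻¹) (𝓝[≠] 0)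
      (𝓝 (-b * (1 : ℂ)⁻¹)) :=
    (Tendsto.neg h).mul (h.tendsto.inv₀ one_ne_zero)
  rw [inv_one, mul_one] at h1
  refine h1.congr' ?_
  filter_upwards [self_mem_nhdsWithin, h.tendsto.eventually_ne one_ne_zero] with t ht hF
  have ht0 : t ≠ 0 := ht
  field_simp; ring

theorem tendsto_of_norm_le_mul {f : ℂ → ℂ} {b : ℂ} {C : ℝ}
    (h : ∀ᶠ t in 𝓝[≠] (0 : ℂ), ‖f t - b‖ ≤ C * ‖t‖) : Tendsto f (𝓝[≠] 0) (𝓝 b) := by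
  rw [tendsto_iff_norm_sub_tendsto_zero]
  refine squeeze_zero' (Eventually.of_forall fun _ => norm_nonneg _) h ?_
  simpa using (tendsto_id_nhdsNE.norm).const_mul C

theorem eventually_norm_mul_le_one (c : ℂ) : ∀ᶠ t in 𝓝[≠] (0 : ℂ), ‖c * t‖ ≤ 1 := by
  have : Tendsto (fun t : ℂ => ‖c * t‖) (𝓝[≠] 0) (𝓝 0) := by
    simpa using (tendsto_id_nhdsNE.const_mul c).norm
  exact this.eventually_le_const one_pos

theorem secondOrder_exp (c : ℂ) : SecondOrder (fun t => exp (c * t)) c (c ^ 2 / 2) := by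
  refine tendsto_of_norm_le_mul (C := ‖c‖ ^ 3) ?_
  filter_upwards [self_mem_nhdsWithin, eventually_norm_mul_le_one c] with t ht h1
  have ht0 : t ≠ 0 := ht
  have h2 := Complex.exp_bound h1 (n := 3) (by norm_num)
  simp only [Finset.sum_range_succ, Finset.sum_range_zero, Nat.factorial] at h2
  have e : (exp (c * t) - 1 - c * t) / t ^ 2 - c ^ 2 / 2
      = (exp (c * t) - (0 + (c * t) ^ 0 / ((1 : ℕ) : ℂ) + (c * t) ^ 1 / (((0 + 1) * 1 : ℕ) : ℂ)
        + (c * t) ^ 2 / (((1 + 1) * ((0 + 1) * 1) : ℕ) : ℂ))) / t ^ 2 := by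
    push_cast; field_simp; ring
  rw [e, norm_div, norm_pow, div_le_iff₀ (by positivity)]
  refine h2.trans ?_
  rw [norm_mul, mul_pow]
  have : ((Nat.succ 3 : ℕ) : ℝ) * ((((2 + 1) * ((1 + 1) * ((0 + 1) * 1)) : ℕ) : ℝ) * (3 : ℕ))⁻¹ ≤ 1 := by
    norm_num
  calc _ ≤ ‖c‖ ^ 3 * ‖t‖ ^ 3 * 1 := mul_le_mul_of_nonneg_left this (by positivity)
    _ = _ := by ring

theorem secondOrder_cosh (c : ℂ) : SecondOrder (fun t => cosh (c * t)) 0 (c ^ 2 / 2) := by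
  have h1 := secondOrder_exp c
  have h2 := secondOrder_exp (-c)
  have h3 := (Tendsto.add h1 h2).div_const 2
  have e : (c ^ 2 / 2 + (-c) ^ 2 / 2) / 2 = c ^ 2 / 2 := by ring
  rw [e] at h3
  refine h3.congr fun t => ?_
  simp only [Complex.cosh, neg_mul]; ring

theorem secondOrder_sinh_div {c : ℂ} (hc : c ≠ 0) :
    SecondOrder (fun t => sinh (c * t) / (c * t)) 0 (c ^ 2 / 6) := by
  refine tendsto_of_norm_le_mul (C := ‖c‖ ^ 3) ?_
  filter_upwards [self_mem_nhdsWithin, eventually_norm_mul_le_one c] with t ht h1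
  have ht0 : t ≠ 0 := ht
  -- The cubic term of exp is needed here: sinh is divided by ct and then by t² once more, so the
  -- remainder must be O(t⁴).
  have hb : ∀ x : ℂ, ‖x‖ ≤ 1 → ‖exp x - (1 + x + x ^ 2 / 2 + x ^ 3 / 6)‖ ≤ ‖x‖ ^ 4 := by
    intro x hx
    have h2 := Complex.exp_bound hx (n := 4) (by norm_num)
    simp only [Finset.sum_range_succ, Finset.sum_range_zero, Nat.factorial] at h2
    have e : 1 + x + x ^ 2 / 2 + x ^ 3 / 6 = (0 + x ^ 0 / ((1 : ℕ) : ℂ)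
      + x ^ 1 / (((0 + 1) * 1 : ℕ) : ℂ) + x ^ 2 / (((1 + 1) * ((0 + 1) * 1) : ℕ) : ℂ)
      + x ^ 3 / (((2 + 1) * ((1 + 1) * ((0 + 1) * 1)) : ℕ) : ℂ)) := by
      push_cast; ring
    rw [e]
    refine h2.trans (mul_le_of_le_one_right (by positivity) ?_)
    norm_num
  have h2 := hb _ h1
  have h3 := hb (-(c * t)) (by rwa [norm_neg])
  rw [norm_neg] at h3
  have e : (sinh (c * t) / (c * t) - 1 - 0 * t) / t ^ 2 - c ^ 2 / 6
      = ((exp (c * t) - (1 + c * t + (c * t) ^ 2 / 2 + (c * t) ^ 3 / 6))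
        - (exp (-(c * t)) - (1 + -(c * t) + (-(c * t)) ^ 2 / 2 + (-(c * t)) ^ 3 / 6)))
        / (2 * c * t ^ 3) := by
    rw [Complex.sinh]; field_simp; ring
  rw [e, norm_div]
  have h4 : ‖(2 : ℂ) * c * t ^ 3‖ = 2 * (‖c‖ * ‖t‖ ^ 3) := by rw [norm_mul, norm_mul, norm_pow]; simp [mul_assoc]
  have hc0 : 0 < ‖c‖ := norm_pos_iff.2 hc
  have ht1 : 0 < ‖t‖ := norm_pos_iff.2 ht0
  rw [h4, div_le_iff₀ (by positivity)]
  refine (norm_sub_le _ _).trans ((add_le_add h2 h3).trans (le_of_eq ?_))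
  rw [norm_mul]; ring

end SecondOrder

/-! ### The integral representation of g_R and its difference equation. -/

section GFunction

variable {p q : ℝ}

/-- The shifts by ± ip/2 multiply exp(2itz) by exp(∓ pt); the difference of these is -2 sinh(pt) and
cancels one of the two sines. -/
theorem jInt_shift (hp : 0 < p) (hq : 0 < q) {z : ℂ} (hz : |z.im| < q / 2) :
    jInt p q (z + p / 2 * I) - jInt p q (z - p / 2 * I) = I * lInt (rho p q) q z := by
  have hρ := rho_pos hp hq
  have him : ((p : ℂ) / 2 * I).im = p / 2 := by
    rw [show (p : ℂ) / 2 * I = ((p / 2 : ℝ) : ℂ) * I by push_cast; ring, im_ofReal_mul, I_im, mul_one]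
  have hz' := abs_lt.1 hz
  have h1 : |(z + p / 2 * I).im| < (p + q) / 2 := by
    rw [add_im, him, abs_lt]; constructor <;> linarith
  have h2 : |(z - p / 2 * I).im| < (p + q) / 2 := by
    rw [sub_im, him, abs_lt]; constructor <;> linarith
  rw [jInt, jInt, ← integral_sub (integrable_jKer hp hq h1) (integrable_jKer hp hq h2), lInt,
    ← integral_const_mul]
  congr 1; funext r
  have ht := line_ne_zero hρ r
  have hs1 := sinh_line_ne_zero (mul_pos hp hρ) (mul_rho_lt' hp hq).le r
  have hs2 := sinh_line_ne_zero (mul_pos hq hρ) (mul_rho_lt hp hq).le r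
  simp only [jKer]
  set t : ℂ := (r : ℂ) + rho p q * I
  have e1 : exp (2 * I * t * (z + p / 2 * I)) = exp (2 * I * t * z) * exp (-(p * t)) := by
    rw [← Complex.exp_add]; congr 1; linear_combination (t * p) * I_sq
  have e2 : exp (2 * I * t * (z - p / 2 * I)) = exp (2 * I * t * z) * exp (p * t) := by
    rw [← Complex.exp_add]; congr 1; linear_combination (-t * p) * I_sq
  rw [e1, e2]
  have e3 : exp (p * t) - exp (-(p * t)) = 2 * sinh (p * t) := by rw [Complex.sinh]; ring
  generalize sinh ((q : ℂ) * t) = s2 at hs2 ⊢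
  generalize sinh ((p : ℂ) * t) = s1 at hs1 e3 ⊢
  have e4 : exp (2 * I * t * z) * exp (-(p * t)) - exp (2 * I * t * z) * exp (p * t)
      = -(2 * s1) * exp (2 * I * t * z) := by linear_combination -exp (2 * I * t * z) * e3
  rw [← sub_div, e4]
  generalize exp (2 * I * t * z) = E
  field_simp
  linear_combination (-4 * E) * I_sq

/-- The principal part at `0` of the integrand of `g_R`. -/
noncomputable def jPrin (p q : ℝ) (z t : ℂ) : ℂ :=
  z / (2 * p * q * t ^ 2)
    + ((p + q) ^ 3 / (4 * I * p * q)) * (cosh ((p + q : ℝ) * t) / sinh ((p + q : ℝ) * t) ^ 3)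
    + ((p + q) * (-2 * z ^ 2 - (p ^ 2 + q ^ 2) / 6) / (4 * I * p * q))
      * (1 / sinh ((p + q : ℝ) * t))

/-- After multiplication by 4i pq t³ the kernel is a product of expansions 1 + O(t), and the terms
of `jPrin` match it through order t². The combination cosh/sinh³ stands in for 1/t³: the t² terms of
t³ cosh/sinh³ cancel, so it adds nothing at order 1/t. -/
theorem tendsto_mul_jKer_sub (hp : 0 < p) (hq : 0 < q) (z : ℂ) :
    Tendsto (fun t => (t - 0) * (jKer p q z t - jPrin p q z t)) (𝓝[≠] 0) (𝓝 0) := by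
  have hp0 : (p : ℂ) ≠ 0 := ofReal_ne_zero.2 hp.ne'
  have hq0 : (q : ℂ) ≠ 0 := ofReal_ne_zero.2 hq.ne'
  have hβ : ((p + q : ℝ) : ℂ) ≠ 0 := ofReal_ne_zero.2 (by positivity)
  have hA := secondOrder_exp (2 * I * z)
  have hB := (secondOrder_sinh_div hp0).inv
  have hC := (secondOrder_sinh_div hq0).inv
  have hD := (secondOrder_sinh_div hβ).inv
  have hE := secondOrder_cosh ((p + q : ℝ) : ℂ)
  have h1 := (hA.mul hB).mul hC
  have h2 := ((hE.mul hD).mul hD).mul hD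
  have h3 : Tendsto (fun t : ℂ => (-2 * z ^ 2 - ((p : ℂ) ^ 2 + q ^ 2) / 6) *
      (sinh ((p + q : ℝ) * t) / ((p + q : ℝ) * t))⁻¹) (𝓝[≠] 0) (𝓝 _) := hD.tendsto.const_mul _
  have h4 := ((Tendsto.sub h1 h2).sub h3).div_const (4 * I * p * q)
  rw [show ((2 * I * z) ^ 2 / 2 + -((p : ℂ) ^ 2 / 6) + 2 * I * z * 0 + -((q : ℂ) ^ 2 / 6)
      + (2 * I * z + 0) * 0 - ((((p + q : ℝ) : ℂ)) ^ 2 / 2 + -((((p + q : ℝ) : ℂ)) ^ 2 / 6) + 0 * 0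
      + -((((p + q : ℝ) : ℂ)) ^ 2 / 6) + (0 + 0) * 0 + -((((p + q : ℝ) : ℂ)) ^ 2 / 6)
      + (0 + 0 + 0) * 0) - (-2 * z ^ 2 - ((p : ℂ) ^ 2 + q ^ 2) / 6) * 1) / (4 * I * p * q)
      = 0 by rw [div_eq_zero_iff]; left; linear_combination 2 * z ^ 2 * I_sq] at h4
  refine h4.congr' ?_
  have hne : ∀ c : ℝ, 0 < c → ∀ᶠ t in 𝓝[≠] (0 : ℂ), sinh (c * t) ≠ 0 := by
    intro c hc
    have := (secondOrder_sinh_div (ofReal_ne_zero.2 hc.ne')).tendsto.eventually_ne one_ne_zero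
    filter_upwards [this] with t ht h
    rw [h, zero_div] at ht; exact ht rfl
  filter_upwards [self_mem_nhdsWithin, hne p hp, hne q hq, hne (p + q) (by positivity)] with
    t ht s1 s2 s3
  have ht0 : t ≠ 0 := ht
  simp only [jKer, jPrin]
  rw [show 2 * I * z * t = 2 * I * t * z by ring]
  push_cast at s3 hβ ⊢
  generalize sinh ((p : ℂ) * t) = x at s1 ⊢
  generalize sinh ((q : ℂ) * t) = y at s2 ⊢
  generalize sinh (((p : ℂ) + q) * t) = w at s3 ⊢
  generalize cosh (((p : ℂ) + q) * t) = w'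
  generalize exp (2 * I * t * z) = E
  field_simp
  ring

theorem sinh_real_mul_ne_zero {c h : ℝ} (hc : 0 < c) (hh : c * h ≤ Real.pi / 2) {t : ℂ}
    (ht : t.im ∈ Icc 0 h) (ht0 : t ≠ 0) : sinh (c * t) ≠ 0 := by
  intro hs
  have h2 := re_sinh_mul_line c t.re t.im
  rw [re_add_im, hs] at h2
  rcases eq_or_lt_of_le ht.1 with h3 | h3
  · rw [← h3, mul_zero, Real.cos_zero, mul_one, zero_re] at h2
    have := Real.sinh_eq_zero.1 h2.symm
    exact ht0 (Complex.ext ((mul_eq_zero.1 this).resolve_left hc.ne') h3.symm)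
  · exact sinh_mul_ne_zero hc h3 ((mul_le_mul_of_nonneg_left ht.2 hc.le).trans hh) hs

theorem add_mul_rho (hp : 0 < p) (hq : 0 < q) : (p + q) * rho p q = Real.pi / 2 := by
  rw [rho]; field_simp

theorem norm_one_div_sinh_le {c : ℝ} (hc : 0 < c) {r : ℝ} (hr : 1 ≤ |r|) (u : ℝ) :
    ‖1 / sinh (c * (r + u * I))‖ ≤
      ((1 - Real.exp (-(2 * c))) / 2)⁻¹ * Real.exp (-(c * |r|)) := by
  have h1 := (exp_le_sinh_abs hc hr).trans (sinh_abs_le_norm_sinh c r u)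
  have hk : 0 < (1 - Real.exp (-(2 * c))) / 2 := by
    have : Real.exp (-(2 * c)) < 1 := by rw [Real.exp_lt_one_iff]; linarith
    linarith
  rw [norm_div, norm_one, Real.exp_neg (c * |r|), ← mul_inv, one_div]
  exact inv_anti₀ (by positivity) h1

theorem norm_cosh_le (c r u : ℝ) (hc : 0 < c) :
    ‖cosh ((c : ℂ) * (r + u * I))‖ ≤ Real.exp (c * |r|) := by
  have h1 : ∀ w : ℂ, w.re ≤ c * |r| → ‖exp w‖ ≤ Real.exp (c * |r|) := by
    intro w hw
    rw [norm_exp]; exact Real.exp_le_exp.2 hw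
  have e : ((c : ℂ) * (r + u * I)).re = c * r := by simp
  rw [Complex.cosh, norm_div, norm_ofNat, div_le_iff₀ two_pos]
  refine (norm_add_le _ _).trans ?_
  have h2 := h1 (c * (r + u * I)) (by rw [e]; exact mul_le_mul_of_nonneg_left (le_abs_self r) hc.le)
  have h3 := h1 (-(c * (r + u * I))) (by
    rw [neg_re, e, ← mul_neg]; exact mul_le_mul_of_nonneg_left (neg_le_abs r) hc.le)
  linarith

/-- Every part decays exponentially except z/(2pq t²); this one term is why contour shifts are done
with the bound C/r². -/
theorem exists_norm_jKer_sub_le (hp : 0 < p) (hq : 0 < q) {z : ℂ} (hz : |z.im| < (p + q) / 2) :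
    ∃ C, ∀ r u : ℝ, 1 ≤ |r| → u ∈ Icc 0 (rho p q) →
      ‖jKer p q z (r + u * I) - jPrin p q z (r + u * I)‖ ≤ C / r ^ 2 := by
  have hμ : 0 < p + q - 2 * |z.im| := by linarith
  have hβ : 0 < p + q := by positivity
  set kp := ((1 - Real.exp (-(2 * p))) / 2)⁻¹
  set kq := ((1 - Real.exp (-(2 * q))) / 2)⁻¹
  set kb := ((1 - Real.exp (-(2 * (p + q)))) / 2)⁻¹
  refine ⟨Real.exp (2 * rho p q * |z.re|) * |kp| * |kq| * (2 / (p + q - 2 * |z.im|) ^ 2)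
    + (‖z / (2 * p * q)‖ + ‖((p + q : ℂ) ^ 3 / (4 * I * p * q))‖ * (|kb| ^ 3 * (2 / (2 * (p + q)) ^ 2))
    + ‖((p + q : ℂ) * (-2 * z ^ 2 - ((p : ℂ) ^ 2 + q ^ 2) / 6) / (4 * I * p * q))‖ *
      (|kb| * (2 / (p + q) ^ 2))), fun r u hr hu => ?_⟩
  have hr2 : 0 < r ^ 2 := by
    rw [← sq_abs]; positivity
  have hn : |r| ≤ ‖(r : ℂ) + u * I‖ := by
    have := abs_re_le_norm ((r : ℂ) + u * I); simpa using this
  have hsp := norm_one_div_sinh_le hp hr u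
  have hsq := norm_one_div_sinh_le hq hr u
  have hsb := norm_one_div_sinh_le hβ hr u
  have hsp' := hsp.trans (mul_le_mul_of_nonneg_right (le_abs_self kp) (Real.exp_pos _).le)
  have hsq' := hsq.trans (mul_le_mul_of_nonneg_right (le_abs_self kq) (Real.exp_pos _).le)
  have hsb' := hsb.trans (mul_le_mul_of_nonneg_right (le_abs_self kb) (Real.exp_pos _).le)
  have hcb := norm_cosh_le (p + q) r u hβ
  rw [add_div _ _ (r ^ 2)]
  refine (norm_sub_le _ _).trans (add_le_add ?_ ?_)
  · have e : jKer p q z (r + u * I) = exp (2 * I * (r + u * I) * z) * (1 / sinh (p * (r + u * I))) *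
        (1 / sinh (q * (r + u * I))) * (1 / (4 * I * (r + u * I))) := by
      rw [jKer]; simp only [div_eq_mul_inv, mul_inv]; ring
    have h1 : ‖1 / (4 * I * ((r : ℂ) + u * I))‖ ≤ 1 := by
      have h3 : ‖4 * I * ((r : ℂ) + u * I)‖ = 4 * ‖(r : ℂ) + u * I‖ := by
        rw [norm_mul, norm_mul, norm_I]; simp
      rw [norm_div, norm_one, h3, div_le_one (by linarith)]
      linarith
    have h2 : ‖exp (2 * I * (r + u * I) * z)‖ ≤
        Real.exp (2 * rho p q * |z.re|) * Real.exp (2 * |z.im| * |r|) := by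
      refine (norm_exp_line_le r u z).trans ?_
      refine mul_le_mul_of_nonneg_right (Real.exp_le_exp.2 ?_) (Real.exp_pos _).le
      have := neg_abs_le z.re
      have h3 := hu.1
      have h4 := hu.2
      nlinarith [abs_nonneg z.re]
    rw [e, norm_mul, norm_mul, norm_mul]
    calc _ ≤ (Real.exp (2 * rho p q * |z.re|) * Real.exp (2 * |z.im| * |r|)) *
          (|kp| * Real.exp (-(p * |r|))) * (|kq| * Real.exp (-(q * |r|))) * 1 := by gcongr
      _ = Real.exp (2 * rho p q * |z.re|) * |kp| * |kq| * (Real.exp (2 * |z.im| * |r|) *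
          Real.exp (-(p * |r|)) * Real.exp (-(q * |r|))) := by ring
      _ = Real.exp (2 * rho p q * |z.re|) * |kp| * |kq| *
          Real.exp (-((p + q - 2 * |z.im|) * |r|)) := by
          rw [← Real.exp_add, ← Real.exp_add]; ring_nf
      _ ≤ _ := by
          rw [mul_div_assoc]
          exact mul_le_mul_of_nonneg_left (exp_neg_mul_abs_le_inv_sq hμ hr) (by positivity)
  · rw [jPrin, add_div _ _ (r ^ 2), add_div _ _ (r ^ 2)]
    refine (norm_add₃_le).trans (add_le_add (add_le_add ?_ ?_) ?_)
    · have e : z / (2 * p * q * ((r : ℂ) + u * I) ^ 2) = z / (2 * p * q) / ((r : ℂ) + u * I) ^ 2 := by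
        rw [div_div]
      rw [e, norm_div, norm_pow]
      refine div_le_div_of_nonneg_left (norm_nonneg _) hr2 ?_
      rw [← sq_abs]; exact pow_le_pow_left₀ (abs_nonneg _) hn 2
    · have e : cosh ((p + q : ℝ) * ((r : ℂ) + u * I)) / sinh ((p + q : ℝ) * ((r : ℂ) + u * I)) ^ 3
          = cosh ((p + q : ℝ) * ((r : ℂ) + u * I)) *
            (1 / sinh ((p + q : ℝ) * ((r : ℂ) + u * I))) ^ 3 := by
        rw [one_div, inv_pow, div_eq_mul_inv]
      rw [e, norm_mul, norm_mul, norm_pow, mul_div_assoc]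
      refine mul_le_mul_of_nonneg_left ?_ (norm_nonneg _)
      calc _ ≤ Real.exp ((p + q) * |r|) * (|kb| * Real.exp (-((p + q) * |r|))) ^ 3 := by gcongr
        _ = |kb| ^ 3 * Real.exp (-(2 * (p + q) * |r|)) := by
          rw [mul_pow, ← Real.exp_nat_mul]
          rw [mul_left_comm, ← Real.exp_add]
          congr 2; push_cast; ring
        _ ≤ _ := by
          rw [mul_div_assoc]
          exact mul_le_mul_of_nonneg_left (exp_neg_mul_abs_le_inv_sq (by positivity) hr)
            (by positivity)
    · rw [norm_mul, mul_div_assoc ‖_‖ _ (r ^ 2)]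
      refine mul_le_mul_of_nonneg_left (hsb'.trans ?_) (norm_nonneg _)
      rw [mul_div_assoc]
      exact mul_le_mul_of_nonneg_left (exp_neg_mul_abs_le_inv_sq hβ hr) (abs_nonneg _)

theorem integral_inv_sq_line {u : ℝ} (hu : 0 < u) :
    (Integrable fun r : ℝ => 1 / ((r : ℂ) + u * I) ^ 2) ∧
      ∫ r : ℝ, 1 / ((r : ℂ) + u * I) ^ 2 = 0 := by
  have hint : Integrable fun r : ℝ => 1 / ((r : ℂ) + u * I) ^ 2 := by
    refine (integrable_inv_one_add_sq.const_mul (max 1 (1 / u ^ 2))).mono' ?_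
      (Eventually.of_forall fun r => ?_)
    · exact (continuous_const.div ((continuous_line u).pow 2)
        fun r => pow_ne_zero 2 (line_ne_zero hu r)).aestronglyMeasurable
    · have h2 : ‖(r : ℂ) + u * I‖ ^ 2 = r ^ 2 + u ^ 2 := by
        rw [← normSq_eq_norm_sq, normSq_apply]; simp; ring
      rw [norm_div, norm_one, norm_pow, h2, ← div_eq_mul_inv,
        div_le_div_iff₀ (by positivity) (by positivity)]
      have h3 := le_max_left 1 (1 / u ^ 2)
      have h4 := le_max_right 1 (1 / u ^ 2)
      rw [div_le_iff₀ (by positivity)] at h4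
      nlinarith [sq_nonneg r]
  refine ⟨hint, ?_⟩
  have hder : ∀ r : ℝ, HasDerivAt (fun r : ℝ => -((r : ℂ) + u * I)⁻¹)
      (1 / ((r : ℂ) + u * I) ^ 2) r := by
    intro r
    have h1 : HasDerivAt (fun r : ℝ => (r : ℂ) + u * I) 1 r :=
      (hasDerivAt_id r).ofReal_comp.add_const _
    convert! (h1.inv (line_ne_zero hu r)).neg using 1
    ring
  have hn : ∀ r : ℝ, |r| ≤ ‖(r : ℂ) + u * I‖ := fun r => by
    have := abs_re_le_norm ((r : ℂ) + u * I); simpa using this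
  have h1 : Tendsto (fun r : ℝ => -((r : ℂ) + u * I)⁻¹) atBot (𝓝 0) := by
    rw [← neg_zero]
    refine Tendsto.neg (tendsto_inv₀_cobounded.comp ?_)
    rw [← tendsto_norm_atTop_iff_cobounded]
    exact tendsto_atTop_mono hn tendsto_abs_atBot_atTop
  have h2 : Tendsto (fun r : ℝ => -((r : ℂ) + u * I)⁻¹) atTop (𝓝 0) := by
    rw [← neg_zero]
    refine Tendsto.neg (tendsto_inv₀_cobounded.comp ?_)
    rw [← tendsto_norm_atTop_iff_cobounded]
    exact tendsto_atTop_mono hn tendsto_abs_atTop_atTop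
  rw [integral_of_hasDerivAt_of_tendsto hder hint h1 h2, sub_zero]

/-- On the line the quotient is -sinh/cosh³ of a real argument, an odd function. -/
theorem integral_cosh_div_sinh_line {c u : ℝ} (hc : 0 < c) (h : c * u = Real.pi / 2) :
    (Integrable fun r : ℝ => cosh (c * ((r : ℂ) + u * I)) / sinh (c * ((r : ℂ) + u * I)) ^ 3) ∧
      ∫ r : ℝ, cosh (c * ((r : ℂ) + u * I)) / sinh (c * ((r : ℂ) + u * I)) ^ 3 = 0 := by
  have hcosh : ∀ r : ℝ, cosh (c * ((r : ℂ) + u * I)) = I * Real.sinh (c * r) := by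
    intro r
    have hcu : (c : ℂ) * u = Real.pi / 2 := by
      rw [← ofReal_mul, h]; push_cast; ring
    rw [mul_add, ← mul_assoc, hcu, Complex.cosh_add, cosh_mul_I, sinh_mul_I,
      Complex.cos_pi_div_two, Complex.sin_pi_div_two]
    push_cast; ring
  have e : (fun r : ℝ => cosh (c * ((r : ℂ) + u * I)) / sinh (c * ((r : ℂ) + u * I)) ^ 3)
      = fun r : ℝ => -((Real.sinh (c * r) / Real.cosh (c * r) ^ 3 : ℝ) : ℂ) := by
    funext r
    rw [hcosh, sinh_line h]
    have h1 : ((Real.cosh (c * r) : ℝ) : ℂ) ≠ 0 := ofReal_ne_zero.2 (Real.cosh_pos _).ne'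
    push_cast at h1 ⊢
    generalize cosh ((c : ℂ) * r) = x at h1 ⊢
    have : I ^ 3 = -I := by rw [pow_succ, I_sq]; ring
    rw [mul_pow, this]
    field_simp
  rw [e]
  constructor
  · refine Integrable.neg (Integrable.ofReal ?_)
    refine (integrable_one_div_cosh hc).mono' ?_ (Eventually.of_forall fun r => ?_)
    · refine Continuous.aestronglyMeasurable ?_
      exact (Real.continuous_sinh.comp (by fun_prop)).div
        ((Real.continuous_cosh.comp (by fun_prop)).pow 3)
        fun r => pow_ne_zero 3 (Real.cosh_pos _).ne'
    · have h1 := Real.one_le_cosh (c * r)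
      have h2 : |Real.sinh (c * r)| ≤ Real.cosh (c * r) ^ 2 := by
        have h3 := Real.cosh_sq (c * r)
        rw [h3, ← sq_abs (Real.sinh (c * r))]
        nlinarith [sq_nonneg (|Real.sinh (c * r)| - 1 / 2)]
      change |Real.sinh (c * r) / Real.cosh (c * r) ^ 3| ≤ _
      rw [abs_div, abs_of_pos (by positivity : 0 < Real.cosh (c * r) ^ 3),
        div_le_div_iff₀ (by positivity) (by positivity)]
      nlinarith
  · have h1 : (∫ r : ℝ, -((Real.sinh (c * r) / Real.cosh (c * r) ^ 3 : ℝ) : ℂ))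
        = -∫ r : ℝ, -((Real.sinh (c * r) / Real.cosh (c * r) ^ 3 : ℝ) : ℂ) := by
      conv_lhs => rw [← integral_neg_eq_self]
      rw [← integral_neg]
      congr 1; funext r
      rw [mul_neg, Real.sinh_neg, Real.cosh_neg]; push_cast; ring
    have h2 : (2 : ℂ) * (∫ r : ℝ, -((Real.sinh (c * r) / Real.cosh (c * r) ^ 3 : ℝ) : ℂ)) = 0 := by
      linear_combination h1
    exact (mul_eq_zero.1 h2).resolve_left two_ne_zero

theorem jKer_sub_add_neg (z : ℂ) (t : ℂ) :
    (jKer p q z t - jPrin p q z t) + (jKer p q z (-t) - jPrin p q z (-t)) =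
      1 / t * (sin (2 * t * z) / (2 * sinh (p * t) * sinh (q * t)) - z / (p * q * t)) := by
  have e1 : jKer p q z (-t) = -(exp (-(2 * I * t * z)) / (4 * I * t * (sinh (p * t) * sinh (q * t)))) := by
    rw [jKer, mul_neg (p : ℂ), mul_neg (q : ℂ), sinh_neg, sinh_neg, neg_mul_neg, mul_neg (4 * I) t,
      neg_mul, div_neg]
    congr 3; ring
  have e2 : jPrin p q z t + jPrin p q z (-t) = 1 / t * (z / (p * q * t)) := by
    rw [jPrin, jPrin]
    simp only [mul_neg, sinh_neg, cosh_neg, neg_sq, div_neg]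
    have : (-sinh (((p + q : ℝ) : ℂ) * t)) ^ 3 = -(sinh (((p + q : ℝ) : ℂ) * t)) ^ 3 := by ring
    rw [this, div_neg]
    simp only [div_eq_mul_inv, mul_inv]
    ring
  have e3 : sin (2 * t * z) = (exp (2 * I * t * z) - exp (-(2 * I * t * z))) * (-I / 2) := by
    rw [Complex.sin, show -(2 * t * z) * I = -(2 * I * t * z) by ring,
      show 2 * t * z * I = 2 * I * t * z by ring]
    ring
  rw [e1, mul_sub, ← e2, e3, jKer]
  simp only [div_eq_mul_inv, mul_inv, inv_I]
  ring

/-- The integral representation of `g_R`. -/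
theorem gR_eq_jInt (hp : 0 < p) (hq : 0 < q) {z : ℂ} (hz : |z.im| < (p + q) / 2) :
    gR p q z = jInt p q z := by
  have hρ := rho_pos hp hq
  have hβ : 0 < p + q := by positivity
  set f : ℂ → ℂ := fun t => jKer p q z t - jPrin p q z t with hf
  have hdf : ∀ t : ℂ, t.im ∈ Icc 0 (rho p q) → t ≠ 0 → DifferentiableAt ℂ f t := by
    intro t ht ht0
    have h1 := sinh_real_mul_ne_zero hp (mul_rho_lt' hp hq).le ht ht0
    have h2 := sinh_real_mul_ne_zero hq (mul_rho_lt hp hq).le ht ht0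
    have h3 := sinh_real_mul_ne_zero hβ (add_mul_rho hp hq).le ht ht0
    have hp0 : (p : ℂ) ≠ 0 := ofReal_ne_zero.2 hp.ne'
    have hq0 : (q : ℂ) ≠ 0 := ofReal_ne_zero.2 hq.ne'
    simp only [hf, jKer, jPrin]
    refine DifferentiableAt.sub (DifferentiableAt.div (by fun_prop) (by fun_prop) ?_)
      (DifferentiableAt.add (DifferentiableAt.add (DifferentiableAt.div (by fun_prop) (by fun_prop) ?_)
        (DifferentiableAt.const_mul (DifferentiableAt.div (by fun_prop) (by fun_prop) ?_) _))
        (DifferentiableAt.const_mul (DifferentiableAt.div (by fun_prop) (by fun_prop) ?_) _))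
    · exact mul_ne_zero (mul_ne_zero (by simp) ht0) (mul_ne_zero h1 h2)
    · exact mul_ne_zero (mul_ne_zero (mul_ne_zero two_ne_zero hp0) hq0) (pow_ne_zero 2 ht0)
    · exact pow_ne_zero 3 h3
    · exact h3
  have hlim := tendsto_mul_jKer_sub hp hq z
  set ft := Function.update f 0 (limUnder (𝓝[≠] 0) f) with hft
  have hne : ∀ t, t ≠ 0 → ft t = f t := fun t ht => Function.update_of_ne ht _ _
  -- near `0` all three `sinh` factors vanish only at `0`
  have hball : DifferentiableAt ℂ ft 0 := by
    have hev : ∀ c : ℝ, 0 < c → ∀ᶠ t in 𝓝[≠] (0 : ℂ), sinh (c * t) ≠ 0 := by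
      intro c hc
      have := (secondOrder_sinh_div (ofReal_ne_zero.2 hc.ne')).tendsto.eventually_ne one_ne_zero
      filter_upwards [this] with t ht h
      rw [h, zero_div] at ht; exact ht rfl
    have hall := ((hev p hp).and (hev q hq)).and (hev (p + q) hβ)
    rw [eventually_nhdsWithin_iff] at hall
    obtain ⟨s, hs, hso, hs0⟩ := eventually_nhds_iff.1 hall
    refine (differentiableOn_update_limUnder_of_tendsto (hso.mem_nhds hs0) ?_ hlim).differentiableAt
      (hso.mem_nhds hs0)
    rintro t ⟨hts, ht0⟩
    obtain ⟨⟨h1, h2⟩, h3⟩ := hs t hts ht0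
    have ht0' : t ≠ 0 := ht0
    have hp0 : (p : ℂ) ≠ 0 := ofReal_ne_zero.2 hp.ne'
    have hq0 : (q : ℂ) ≠ 0 := ofReal_ne_zero.2 hq.ne'
    refine DifferentiableAt.differentiableWithinAt ?_
    simp only [jKer, jPrin]
    refine DifferentiableAt.sub (DifferentiableAt.div (by fun_prop) (by fun_prop) ?_)
      (DifferentiableAt.add (DifferentiableAt.add (DifferentiableAt.div (by fun_prop) (by fun_prop) ?_)
        (DifferentiableAt.const_mul (DifferentiableAt.div (by fun_prop) (by fun_prop) ?_) _))
        (DifferentiableAt.const_mul (DifferentiableAt.div (by fun_prop) (by fun_prop) ?_) _))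
    · exact mul_ne_zero (mul_ne_zero (by simp) ht0') (mul_ne_zero h1 h2)
    · exact mul_ne_zero (mul_ne_zero (mul_ne_zero two_ne_zero hp0) hq0) (pow_ne_zero 2 ht0')
    · exact pow_ne_zero 3 h3
    · exact h3
  have hdft : ∀ t : ℂ, t.im ∈ Icc 0 (rho p q) → DifferentiableAt ℂ ft t := by
    intro t ht
    rcases eq_or_ne t 0 with rfl | h0
    · exact hball
    · refine (hdf t ht h0).congr_of_eventuallyEq ?_
      filter_upwards [isOpen_ne.mem_nhds h0] with s hs using hne s hs
  obtain ⟨C, hC⟩ := exists_norm_jKer_sub_le hp hq hz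
  obtain ⟨hi0, hi1, heq⟩ := integral_line_eq_of_inv_sq (f := ft) (b := 0) (c := rho p q) (S := ∅)
    (C := C) countable_empty hρ.le (fun t ht => (hdft t ht).continuousAt.continuousWithinAt)
    (fun t ht _ => hdft t ⟨ht.1.le, ht.2.le⟩) (fun r t hr ht => by
      rw [hne]
      · exact hC r t hr ht
      · intro h
        have := congrArg Complex.re h
        simp at this; rw [this] at hr; simp at hr; linarith)
  have hline : ∀ r : ℝ, ft (r + rho p q * I) = f (r + rho p q * I) := fun r =>
    hne _ (line_ne_zero hρ r)
  simp only [hline] at hi1 heq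
  -- the integral over the real axis
  have hreal : (∫ r : ℝ, ft (r + (0 : ℝ) * I)) = g p q z := by
    have h1 : (∫ r : ℝ, ft (r + (0 : ℝ) * I)) = ∫ r : ℝ, ft (-r + (0 : ℝ) * I) := by
      rw [← integral_neg_eq_self]; simp
    have hi2 : Integrable fun r : ℝ => ft (-r + (0 : ℝ) * I) := by
      have := hi0.comp_neg; simpa using this
    -- Symmetrising in r ↦ -r removes the odd part of the kernel; the even sum, over the half line,
    -- is the integrand of `g` by `jKer_sub_add_neg`.
    have h2 : (2 : ℂ) * (∫ r : ℝ, ft (r + (0 : ℝ) * I))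
        = ∫ r : ℝ, (ft (r + (0 : ℝ) * I) + ft (-r + (0 : ℝ) * I)) := by
      rw [integral_add hi0 hi2, ← h1, two_mul]
    have h3 : (∫ r in Iic (0 : ℝ), (ft (r + (0 : ℝ) * I) + ft (-r + (0 : ℝ) * I)))
        = ∫ r in Ioi (0 : ℝ), (ft (r + (0 : ℝ) * I) + ft (-r + (0 : ℝ) * I)) := by
      have := integral_comp_neg_Iic (0 : ℝ) (fun r : ℝ => ft (r + (0 : ℝ) * I) + ft (-r + (0 : ℝ) * I))
      rw [neg_zero] at this
      rw [← this]
      congr 1; funext r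
      push_cast; rw [neg_neg, add_comm]
    have h4 : (∫ r in Ioi (0 : ℝ), (ft (r + (0 : ℝ) * I) + ft (-r + (0 : ℝ) * I))) = g p q z := by
      refine setIntegral_congr_fun measurableSet_Ioi fun r hr => ?_
      have hr0 : (r : ℂ) ≠ 0 := ofReal_ne_zero.2 (ne_of_gt hr)
      simp only [ofReal_zero, zero_mul, add_zero]
      rw [hne _ hr0, hne _ (neg_ne_zero.2 hr0)]
      exact jKer_sub_add_neg z r
    have hi3 : Integrable fun r : ℝ => ft (r + (0 : ℝ) * I) + ft (-r + (0 : ℝ) * I) := hi0.add hi2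
    rw [← intervalIntegral.integral_Iic_add_Ioi hi3.integrableOn hi3.integrableOn (b := 0), h3, h4,
      ← two_mul] at h2
    exact mul_left_cancel₀ two_ne_zero h2
  obtain ⟨ia, va⟩ := integral_inv_sq_line hρ
  obtain ⟨ib, vb⟩ := integral_cosh_div_sinh_line hβ (add_mul_rho hp hq)
  obtain ⟨ic, vc⟩ := integral_one_div_sinh_line hβ (add_mul_rho hp hq)
  -- The principal part is put back on the raised line. Of its three terms only 1/sinh has a nonzero
  -- integral there, and that integral is χ + αz²/4.
  have hsplit : jInt p q z = (∫ r : ℝ, f (r + rho p q * I)) + ∫ r : ℝ, (z / (2 * p * q) *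
      (1 / ((r : ℂ) + rho p q * I) ^ 2) + ((p + q : ℂ) ^ 3 / (4 * I * p * q)) *
      (cosh ((p + q : ℝ) * ((r : ℂ) + rho p q * I)) /
        sinh ((p + q : ℝ) * ((r : ℂ) + rho p q * I)) ^ 3)
      + ((p + q : ℂ) * (-2 * z ^ 2 - ((p : ℂ) ^ 2 + q ^ 2) / 6) / (4 * I * p * q)) *
        (1 / sinh ((p + q : ℝ) * ((r : ℂ) + rho p q * I)))) := by
    rw [← integral_add hi1 (((ia.const_mul _).fun_add (ib.const_mul _)).fun_add (ic.const_mul _)), jInt]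
    congr 1; funext r
    simp only [hf, jPrin]
    rw [show z / (2 * p * q * ((r : ℂ) + rho p q * I) ^ 2) = z / (2 * p * q) *
      (1 / ((r : ℂ) + rho p q * I) ^ 2) by rw [mul_one_div, div_div]]
    ring
  rw [hsplit, ← heq, hreal, integral_add ((ia.const_mul _).fun_add (ib.const_mul _)) (ic.const_mul _),
    integral_add (ia.const_mul _) (ib.const_mul _), integral_const_mul, integral_const_mul,
    integral_const_mul, va, vb, vc, gR, chi, alpha]
  have hp0 : (p : ℂ) ≠ 0 := ofReal_ne_zero.2 hp.ne'
  have hq0 : (q : ℂ) ≠ 0 := ofReal_ne_zero.2 hq.ne'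
  have hb0 : (p : ℂ) + q ≠ 0 := by
    rw [← ofReal_add]; exact ofReal_ne_zero.2 hβ.ne'
  push_cast
  field_simp
  ring

end GFunction

end RelToda

/-! ### The hyperbolic gamma function: continuation, poles, difference and reflection equations. -/

namespace RelToda

open Complex Set

variable {ap am : ℝ}

theorem g_neg (ap am : ℝ) (z : ℂ) : g ap am (-z) = -g ap am z := by
  rw [g, g, ← integral_neg]
  refine integral_congr_ae (Eventually.of_forall fun y => ?_)
  simp only [mul_neg, Complex.sin_neg]
  ring

theorem conj_g (ap am : ℝ) (z : ℂ) :
    (starRingEnd ℂ) (g ap am z) = g ap am ((starRingEnd ℂ) z) := by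
  rw [g, g, ← integral_conj]
  refine integral_congr_ae (Eventually.of_forall fun y => ?_)
  simp only [map_mul, map_sub, map_div₀, map_one, conj_ofReal, ← Complex.sin_conj,
    ← Complex.sinh_conj, map_ofNat]

theorem g_comm (ap am : ℝ) (z : ℂ) : g ap am z = g am ap z := by
  rw [g, g]
  refine integral_congr_ae (Eventually.of_forall fun y => ?_)
  simp only [mul_comm (ap : ℂ) (am : ℂ), mul_assoc,
    mul_comm (Complex.sinh (ap * y)) (Complex.sinh (am * y))]

theorem g_eq_jInt (hap : 0 < ap) (ham : 0 < am) {z : ℂ} (hz : |z.im| < mid ap am) :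
    g ap am z = jInt ap am z - chi ap am - alpha ap am * z ^ 2 / 4 := by
  rw [← gR_eq_jInt hap ham hz, gR]; ring

theorem mid_pos (hap : 0 < ap) (ham : 0 < am) : 0 < mid ap am := by
  rw [mid]; positivity

theorem alpha_pos (hap : 0 < ap) (ham : 0 < am) : 0 < alpha ap am := by
  have := Real.pi_pos
  rw [alpha]; positivity

/-- `jInt_shift` and `exp_lInt` produce the factor 1 + exp(-2πz/a₋); the quadratic term separating g
from g_R contributes exp(πz/a₋), and the product is 2 cosh(πz/a₋). -/
theorem expG_shift (hap : 0 < ap) (ham : 0 < am) {z : ℂ} (hz : |z.im| < am / 2) :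
    exp (I * g ap am (z + I * ap / 2)) =
      2 * cosh (Real.pi * z / am) * exp (I * g ap am (z - I * ap / 2)) := by
  have hm : mid ap am = ap / 2 + am / 2 := by rw [mid]; ring
  have ha := abs_lt.1 hz
  have e : I * (ap : ℂ) / 2 = ap / 2 * I := by ring
  have i1 : (z + ap / 2 * I).im = z.im + ap / 2 := by simp
  have i2 : (z - ap / 2 * I).im = z.im - ap / 2 := by simp
  have h1 : |(z + ap / 2 * I).im| < mid ap am := by
    rw [i1, abs_lt]; constructor <;> linarith
  have h2 : |(z - ap / 2 * I).im| < mid ap am := by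
    rw [i2, abs_lt]; constructor <;> linarith
  have hs := jInt_shift hap ham hz
  have hl := exp_lInt ham (rho_pos hap ham) (mul_rho_lt hap ham).le hz
  rw [e, g_eq_jInt hap ham h1, g_eq_jInt hap ham h2]
  have hap' : (ap : ℂ) ≠ 0 := ofReal_ne_zero.2 hap.ne'
  have ham' : (am : ℂ) ≠ 0 := ofReal_ne_zero.2 ham.ne'
  have hal : (alpha ap am : ℂ) * ap / 2 = Real.pi / am := by
    rw [alpha]; push_cast; field_simp
  set J := jInt ap am (z - ap / 2 * I)
  have hJ : jInt ap am (z + ap / 2 * I) = J + I * lInt (rho ap am) am z := by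
    rw [← hs]; ring
  rw [hJ]
  set L := lInt (rho ap am) am z
  have e1 : I * (J + I * L - chi ap am - alpha ap am * (z + ap / 2 * I) ^ 2 / 4) =
      I * (J - chi ap am - alpha ap am * (z - ap / 2 * I) ^ 2 / 4) + (-L + Real.pi * z / am) := by
    have : (Real.pi : ℂ) * z / am = alpha ap am * ap / 2 * z := by rw [hal]; ring
    rw [this]
    linear_combination (L - alpha ap am * ap / 2 * z) * I_sq
  rw [e1, exp_add, mul_comm]
  congr 1
  have hL : exp (-L) = 1 + exp (-(2 * Real.pi * z / am)) := by
    rw [exp_neg]; exact inv_eq_of_mul_eq_one_right hl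
  rw [exp_add, hL, add_mul, one_mul, ← exp_add, Complex.cosh]
  have : -(2 * Real.pi * z / am) + Real.pi * z / am = -(Real.pi * z / am) := by ring
  rw [this]; ring

theorem differentiableAt_g (hap : 0 < ap) (ham : 0 < am) {z : ℂ} (hz : |z.im| < mid ap am) :
    DifferentiableAt ℂ (g ap am) z := by
  have h : DifferentiableAt ℂ (fun z => jInt ap am z - chi ap am - alpha ap am * z ^ 2 / 4) z :=
    ((differentiableAt_jInt hap ham hz).sub_const _).sub (by fun_prop)
  refine h.congr_of_eventuallyEq ?_
  filter_upwards [(isOpen_strip (mid ap am)).mem_nhds hz] with w hw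
  exact g_eq_jInt hap ham hw

theorem analyticAt_g (hap : 0 < ap) (ham : 0 < am) {z : ℂ} (hz : |z.im| < mid ap am) :
    AnalyticAt ℂ (g ap am) z := by
  have hd : DifferentiableOn ℂ (g ap am) {w | |w.im| < mid ap am} := fun w hw =>
    (differentiableAt_g hap ham hw).differentiableWithinAt
  exact hd.analyticAt ((isOpen_strip (mid ap am)).mem_nhds hz)

/-- The branch of `G` obtained from the strip around `Im z = m a₊`. -/
noncomputable def gPiece (ap am : ℝ) (m : ℤ) (z : ℂ) : ℂ :=
  exp (I * g ap am (z - m * (I * ap))) *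
    (∏ k ∈ Finset.range m.toNat, 2 * cd ap am false (z - (k + 1 / 2) * (I * ap))) /
    (∏ k ∈ Finset.range (-m).toNat, 2 * cd ap am false (z + (k + 1 / 2) * (I * ap)))

theorem G_eq_gPiece_round (ap am : ℝ) (z : ℂ) : G ap am z = gPiece ap am (round (z.im / ap)) z := rfl

theorem cd_ne_zero_of_im {δ : Bool} (h : 0 < par ap am δ) {z : ℂ} (hz : |z.im| < par ap am δ / 2) :
    cd ap am δ z ≠ 0 := by
  intro h0
  rw [cd, ← Complex.cos_mul_I, Complex.cos_eq_zero_iff] at h0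
  obtain ⟨k, hk⟩ := h0
  have h1 := congrArg Complex.re hk
  have e : (Real.pi : ℂ) * z / par ap am δ * I = ((Real.pi / par ap am δ : ℝ) : ℂ) * z * I := by
    push_cast; ring
  have e2 : ((2 * k + 1) * Real.pi / 2 : ℂ) = (((2 * k + 1) * Real.pi / 2 : ℝ) : ℂ) := by
    push_cast; ring
  rw [e, e2, ofReal_re] at h1
  have h2 : (((Real.pi / par ap am δ : ℝ) : ℂ) * z * I).re = -(Real.pi / par ap am δ * z.im) := by
    simp [mul_assoc]
  rw [h2] at h1
  have hp := Real.pi_pos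
  have h3 : -z.im = (2 * k + 1) * (par ap am δ / 2) := by
    field_simp at h1 ⊢
    linarith
  have h4 : (1 : ℝ) ≤ |2 * (k : ℝ) + 1| := by
    have h5 : (2 * k + 1 : ℤ) ≠ 0 := by omega
    exact_mod_cast Int.one_le_abs h5
  rw [← abs_neg, h3, abs_mul, abs_of_pos (by positivity : 0 < par ap am δ / 2)] at hz
  nlinarith

/-- On the overlap of neighbouring strips the branches differ by one use of `expG_shift`, centred
halfway between them. For m ≥ 0 the factor joins the numerator, for m < 0 it cancels the last one of
the denominator. -/
theorem gPiece_succ (hap : 0 < ap) (ham : 0 < am) {m : ℤ} {z : ℂ}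
    (h1 : |z.im - m * ap| < mid ap am) (h2 : |z.im - (m + 1) * ap| < mid ap am) :
    gPiece ap am m z = gPiece ap am (m + 1) z := by
  have hm : mid ap am = ap / 2 + am / 2 := by rw [mid]; ring
  have ha := abs_lt.1 h1
  have hb := abs_lt.1 h2
  have hu : |(z - (m + 1 / 2) * (I * ap)).im| < am / 2 := by
    have : (z - (m + 1 / 2) * (I * ap)).im = z.im - (m + 1 / 2) * ap := by
      simp
    rw [this, abs_lt]; constructor <;> linarith
  have hs := expG_shift hap ham hu
  have e1 : z - (m + 1 / 2) * (I * ap) + I * ap / 2 = z - m * (I * ap) := by ring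
  have e2 : z - (m + 1 / 2) * (I * ap) - I * ap / 2 = z - ((m + 1 : ℤ) : ℂ) * (I * ap) := by
    push_cast; ring
  rw [e1, e2] at hs
  have hc : cosh (Real.pi * (z - (m + 1 / 2) * (I * ap)) / am) ≠ 0 :=
    cd_ne_zero_of_im (ap := ap) (am := am) (δ := false) ham hu
  rw [gPiece, gPiece, hs]
  rcases le_or_gt 0 m with h0 | h0
  · obtain ⟨n, rfl⟩ := Int.eq_ofNat_of_zero_le h0
    have t1 : ((n : ℤ)).toNat = n := rfl
    have t2 : ((n : ℤ) + 1).toNat = n + 1 := rfl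
    have t3 : (-(n : ℤ)).toNat = 0 := by omega
    have t4 : (-((n : ℤ) + 1)).toNat = 0 := by omega
    rw [t1, t2, t3, t4, Finset.prod_range_succ, cd]
    simp only [Finset.range_zero, Finset.prod_empty, div_one, par, Int.cast_natCast,
      Bool.false_eq_true, if_false]
    ring
  · obtain ⟨n, rfl⟩ : ∃ n : ℕ, m = -(n + 1 : ℤ) := ⟨(-m - 1).toNat, by omega⟩
    have t1 : (-(n + 1 : ℤ)).toNat = 0 := by omega
    have t2 : (-(n + 1 : ℤ) + 1).toNat = 0 := by omega
    have t3 : (-(-(n + 1 : ℤ))).toNat = n + 1 := by omega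
    have t4 : (-(-(n + 1 : ℤ) + 1)).toNat = n := by omega
    rw [t1, t2, t3, t4, Finset.prod_range_succ]
    have e3 : 2 * cd ap am false (z + (n + 1 / 2) * (I * ap)) =
        2 * cosh (Real.pi * (z - ((-(n + 1 : ℤ) : ℤ) + 1 / 2) * (I * ap)) / am) := by
      rw [cd]; congr 3
      push_cast; ring
    rw [e3, Finset.range_zero, Finset.prod_empty, mul_one, mul_one,
      mul_comm (∏ k ∈ Finset.range n, _), mul_div_mul_left _ _ (mul_ne_zero two_ne_zero hc)]

theorem abs_im_sub_round (hap : 0 < ap) (z : ℂ) : |z.im - round (z.im / ap) * ap| ≤ ap / 2 := by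
  have h := abs_sub_round (z.im / ap)
  have e : z.im - round (z.im / ap) * ap = (z.im / ap - round (z.im / ap)) * ap := by
    field_simp
  rw [e, abs_mul, abs_of_pos hap]
  nlinarith

theorem gPiece_eq_of_le (hap : 0 < ap) (ham : 0 < am) {m n : ℤ} (hmn : m ≤ n) {z : ℂ}
    (h1 : |z.im - m * ap| < mid ap am) (h2 : |z.im - n * ap| < mid ap am) :
    gPiece ap am m z = gPiece ap am n z := by
  induction n, hmn using Int.leInduction with
  | base => rfl
  | succ k hk ih =>
    have h3 : |z.im - k * ap| < mid ap am := by
      have hk' : (m : ℝ) ≤ k := by exact_mod_cast hk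
      push_cast at h2
      rw [abs_lt] at *
      constructor <;> nlinarith
    rw [ih h3, gPiece_succ hap ham h3 (by exact_mod_cast h2)]

theorem G_eq_gPiece (hap : 0 < ap) (ham : 0 < am) {m : ℤ} {z : ℂ}
    (h1 : |z.im - m * ap| < mid ap am) : G ap am z = gPiece ap am m z := by
  have h2 : |z.im - round (z.im / ap) * ap| < mid ap am :=
    (abs_im_sub_round hap z).trans_lt (by rw [mid]; linarith)
  rw [G_eq_gPiece_round]
  rcases le_total m (round (z.im / ap)) with h | h
  · exact (gPiece_eq_of_le hap ham h h1 h2).symm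
  · exact gPiece_eq_of_le hap ham h h2 h1

theorem G_eq_exp (hap : 0 < ap) (ham : 0 < am) {z : ℂ} (hz : |z.im| < mid ap am) :
    G ap am z = exp (I * g ap am z) := by
  rw [G_eq_gPiece hap ham (m := 0) (by simpa using hz), gPiece]
  simp

theorem G_eventuallyEq (hap : 0 < ap) (ham : 0 < am) (z : ℂ) :
    G ap am =ᶠ[𝓝 z] gPiece ap am (round (z.im / ap)) := by
  have h2 : |z.im - round (z.im / ap) * ap| < mid ap am :=
    (abs_im_sub_round hap z).trans_lt (by rw [mid]; linarith)
  have ho : IsOpen {w : ℂ | |w.im - round (z.im / ap) * ap| < mid ap am} :=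
    isOpen_lt (by fun_prop) continuous_const
  filter_upwards [ho.mem_nhds h2] with w hw
  exact G_eq_gPiece hap ham hw

theorem analyticAt_cd (ap am : ℝ) (δ : Bool) (z : ℂ) : AnalyticAt ℂ (cd ap am δ) z := by
  have : Differentiable ℂ (cd ap am δ) := by
    unfold cd; fun_prop
  exact this.analyticAt z

theorem cd_eq_zero {δ : Bool} (h : par ap am δ ≠ 0) {z : ℂ} (hz : cd ap am δ z = 0) :
    ∃ k : ℤ, z = -((k + 1 / 2) * (I * par ap am δ)) := by
  rw [cd, ← Complex.cos_mul_I, Complex.cos_eq_zero_iff] at hz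
  obtain ⟨k, hk⟩ := hz
  refine ⟨k, ?_⟩
  have h' : (par ap am δ : ℂ) ≠ 0 := ofReal_ne_zero.2 h
  have hp : (Real.pi : ℂ) ≠ 0 := ofReal_ne_zero.2 Real.pi_ne_zero
  field_simp at hk
  linear_combination (-I / 2) * hk + z * I_sq

/-- A zero of the factor means z + i(k + 1/2)a₊ = -i(l + 1/2)a₋ for an integer l. The range of k
bounds Im z from above and forces l ≥ 0, which puts -z in the lattice. -/
theorem gPiece_denom_ne_zero (hap : 0 < ap) (ham : 0 < am) {z : ℂ} (hz : -z ∉ lattice ap am)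
    {k : ℕ} (hk : k < (-round (z.im / ap)).toNat) :
    2 * cd ap am false (z + (k + 1 / 2) * (I * ap)) ≠ 0 := by
  intro h0
  have h0' : cd ap am false (z + (k + 1 / 2) * (I * ap)) = 0 := by simpa using h0
  obtain ⟨l, hl⟩ := cd_eq_zero (by exact ham.ne') h0'
  simp only [par, Bool.false_eq_true, if_false] at hl
  have hr := abs_le.1 (abs_im_sub_round hap z)
  have him := congrArg Complex.im hl
  have e1 : (z + (k + 1 / 2) * (I * ap)).im = z.im + (k + 1 / 2) * ap := by simp
  have e2 : (-(((l : ℂ) + 1 / 2) * (I * am))).im = -((l + 1 / 2) * am) := by simp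
  rw [e1, e2] at him
  have hk' : ((k : ℤ) : ℝ) + 1 ≤ ((-round (z.im / ap) : ℤ) : ℝ) := by
    have : (k : ℤ) + 1 ≤ -round (z.im / ap) := by omega
    exact_mod_cast this
  push_cast at hk'
  have h1 : 0 ≤ (l + 1 / 2) * am := by nlinarith
  have h2 : (-1 : ℝ) < l := by
    by_contra hcon
    push Not at hcon
    nlinarith
  have h3 : 0 ≤ l := by
    have : (-1 : ℤ) < l := by exact_mod_cast h2
    omega
  obtain ⟨n, rfl⟩ := Int.eq_ofNat_of_zero_le h3
  refine hz ⟨k, n, ?_⟩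
  rw [mid]
  push_cast at hl ⊢
  linear_combination -hl

theorem analyticAt_expG (hap : 0 < ap) (ham : 0 < am) {c z : ℂ}
    (hz : |(z - c).im| < mid ap am) : AnalyticAt ℂ (fun z => exp (I * g ap am (z - c))) z := by
  refine AnalyticAt.cexp (analyticAt_const.mul ?_)
  exact (analyticAt_g hap ham hz).fun_comp_of_eq (by fun_prop) rfl

theorem abs_im_sub_round_mul (hap : 0 < ap) (ham : 0 < am) (z : ℂ) :
    |(z - (round (z.im / ap) : ℂ) * (I * ap)).im| < mid ap am := by
  have : (z - (round (z.im / ap) : ℂ) * (I * ap)).im = z.im - round (z.im / ap) * ap := by simp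
  rw [this]
  exact (abs_im_sub_round hap z).trans_lt (by rw [mid]; linarith)

theorem analyticAt_G (hap : 0 < ap) (ham : 0 < am) {z : ℂ} (hz : -z ∉ lattice ap am) :
    AnalyticAt ℂ (G ap am) z := by
  refine AnalyticAt.congr ?_ (G_eventuallyEq hap ham z).symm
  unfold gPiece
  refine AnalyticAt.div (AnalyticAt.mul (analyticAt_expG hap ham
    (abs_im_sub_round_mul hap ham z)) ?_) ?_ ?_
  · refine Finset.analyticAt_fun_prod _ fun k _ => analyticAt_const.mul ?_
    exact (analyticAt_cd ap am false _).fun_comp_of_eq (by fun_prop) rfl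
  · refine Finset.analyticAt_fun_prod _ fun k _ => analyticAt_const.mul ?_
    exact (analyticAt_cd ap am false _).fun_comp_of_eq (by fun_prop) rfl
  · exact Finset.prod_ne_zero_iff.2 fun k hk =>
      gPiece_denom_ne_zero hap ham hz (Finset.mem_range.1 hk)

theorem meromorphicAt_G (hap : 0 < ap) (ham : 0 < am) (z : ℂ) : MeromorphicAt (G ap am) z := by
  have h : MeromorphicAt (gPiece ap am (round (z.im / ap))) z := by
    unfold gPiece
    refine MeromorphicAt.div (MeromorphicAt.mul (analyticAt_expG hap ham
      (abs_im_sub_round_mul hap ham z)).meromorphicAt ?_) ?_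
    · refine AnalyticAt.meromorphicAt (Finset.analyticAt_fun_prod _ fun k _ =>
        analyticAt_const.mul ?_)
      exact (analyticAt_cd ap am false _).fun_comp_of_eq (by fun_prop) rfl
    · refine AnalyticAt.meromorphicAt (Finset.analyticAt_fun_prod _ fun k _ =>
        analyticAt_const.mul ?_)
      exact (analyticAt_cd ap am false _).fun_comp_of_eq (by fun_prop) rfl
  exact h.congr ((G_eventuallyEq hap ham z).symm.filter_mono nhdsWithin_le_nhds)

theorem conj_cd (ap am : ℝ) (δ : Bool) (z : ℂ) :
    (starRingEnd ℂ) (cd ap am δ z) = cd ap am δ ((starRingEnd ℂ) z) := by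
  rw [cd, cd, ← Complex.cosh_conj]; simp

theorem cd_neg (ap am : ℝ) (δ : Bool) (z : ℂ) : cd ap am δ (-z) = cd ap am δ z := by
  rw [cd, cd, ← Complex.cosh_neg]; congr 1; ring

theorem conj_G (ap am : ℝ) (z : ℂ) :
    (starRingEnd ℂ) (G ap am z) = G ap am (-(starRingEnd ℂ) z) := by
  have him : (-(starRingEnd ℂ) z).im = z.im := by simp
  rw [G, G, him]
  simp only [map_div₀, map_mul, map_prod, conj_cd, ← exp_conj, conj_I, conj_g, map_ofNat]
  congr 2
  · congr 1
    rw [neg_mul, ← mul_neg, ← g_neg]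
    congr 3
    simp
    ring
  · refine Finset.prod_congr rfl fun k _ => ?_
    rw [← cd_neg]
    congr 2
    simp [Complex.conj_ofNat]
    ring
  · refine funext fun k => ?_
    rw [← cd_neg]
    congr 2
    simp [Complex.conj_ofNat]
    ring

theorem lattice_countable (ap am : ℝ) : (lattice ap am).Countable := by
  have : lattice ap am = range fun n : ℕ × ℕ => I * (mid ap am + n.1 * ap + n.2 * am : ℂ) := by
    ext x; constructor
    · rintro ⟨k, l, rfl⟩; exact ⟨(k, l), rfl⟩
    · rintro ⟨⟨k, l⟩, rfl⟩; exact ⟨k, l, rfl⟩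
  rw [this]
  exact countable_range _

theorem mid_le_im_of_mem_lattice (hap : 0 < ap) (ham : 0 < am) {z : ℂ} (hz : z ∈ lattice ap am) :
    mid ap am ≤ z.im := by
  obtain ⟨k, l, rfl⟩ := hz
  have : (I * (mid ap am + k * ap + l * am : ℂ)).im = mid ap am + k * ap + l * am := by simp
  rw [this]
  have : 0 ≤ k * ap + l * am := by positivity
  linarith

theorem re_of_mem_lattice {z : ℂ} (hz : z ∈ lattice ap am) : z.re = 0 := by
  obtain ⟨k, l, rfl⟩ := hz
  simp

theorem notMem_lattice_of_im_lt (hap : 0 < ap) (ham : 0 < am) {z : ℂ} (hz : z.im < mid ap am) :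
    z ∉ lattice ap am := fun h => absurd (mid_le_im_of_mem_lattice hap ham h) (not_le.2 hz)

theorem neg_notMem_lattice_of_lt_im (hap : 0 < ap) (ham : 0 < am) {z : ℂ}
    (hz : -mid ap am < z.im) : -z ∉ lattice ap am :=
  notMem_lattice_of_im_lt hap ham (by simp; linarith)

theorem add_step_mem_lattice {z : ℂ} (hz : z ∈ lattice ap am) (δ : Bool) :
    z + step ap am δ ∈ lattice ap am := by
  obtain ⟨k, l, rfl⟩ := hz
  cases δ
  · refine ⟨k + 1, l, ?_⟩
    simp only [step, par, Bool.not_false, if_true]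
    push_cast; ring
  · refine ⟨k, l + 1, ?_⟩
    simp only [step, par, Bool.not_true, Bool.false_eq_true, if_false]
    push_cast; ring

theorem isPreconnected_compl_of_countable {S : Set ℂ} (hS : S.Countable) :
    IsPreconnected Sᶜ :=
  (hS.isConnected_compl_of_one_lt_rank (by
    rw [Complex.rank_real_complex]; exact Nat.one_lt_ofNat)).isPreconnected

/-- Adding ia₊ raises the rounded integer by exactly one and leaves the base point in the strip
unchanged, so only the factor with k = 0 is gained or lost. A lost factor has to be nonzero, hence
the lattice condition. -/
theorem G_add_step_false (hap : 0 < ap) {w : ℂ} (hw : -w ∉ lattice ap am) (ham : 0 < am) :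
    G ap am (w + I * ap) = 2 * cd ap am false (w + I * ap / 2) * G ap am w := by
  have hr : round ((w + I * ap).im / ap) = round (w.im / ap) + 1 := by
    have : (w + I * ap).im / ap = w.im / ap + 1 := by simp; field_simp
    rw [this, round_add_one]
  rw [G_eq_gPiece_round, G_eq_gPiece_round, hr]
  have hden := fun k hk => gPiece_denom_ne_zero (k := k) hap ham hw hk
  generalize round (w.im / ap) = m at hden ⊢
  have e0 : w + I * ap - ((m + 1 : ℤ) : ℂ) * (I * ap) = w - m * (I * ap) := by push_cast; ring
  rw [gPiece, gPiece, e0]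
  rcases le_or_gt 0 m with h0 | h0
  · obtain ⟨n, rfl⟩ := Int.eq_ofNat_of_zero_le h0
    have t1 : ((n : ℤ)).toNat = n := rfl
    have t2 : ((n : ℤ) + 1).toNat = n + 1 := rfl
    have t3 : (-(n : ℤ)).toNat = 0 := by omega
    have t4 : (-((n : ℤ) + 1)).toNat = 0 := by omega
    rw [t1, t2, t3, t4, Finset.prod_range_succ']
    have e1 : w + I * ap - (((0 : ℕ) : ℂ) + 1 / 2) * (I * ap) = w + I * ap / 2 := by
      push_cast; ring
    have e2 : ∀ k : ℕ, w + I * ap - (((k + 1 : ℕ) : ℂ) + 1 / 2) * (I * ap) =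
        w - (k + 1 / 2) * (I * ap) := fun k => by push_cast; ring
    simp only [e1, e2]
    simp only [Finset.range_zero, Finset.prod_empty, div_one]
    ring
  · obtain ⟨n, rfl⟩ : ∃ n : ℕ, m = -(n + 1 : ℤ) := ⟨(-m - 1).toNat, by omega⟩
    have t1 : (-(n + 1 : ℤ)).toNat = 0 := by omega
    have t2 : (-(n + 1 : ℤ) + 1).toNat = 0 := by omega
    have t3 : (-(-(n + 1 : ℤ))).toNat = n + 1 := by omega
    have t4 : (-(-(n + 1 : ℤ) + 1)).toNat = n := by omega
    have h1 := hden 0 (by omega)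
    rw [t1, t2, t3, t4, Finset.prod_range_succ']
    have e1 : w + (((0 : ℕ) : ℂ) + 1 / 2) * (I * ap) = w + I * ap / 2 := by
      push_cast; ring
    have e2 : ∀ k : ℕ, w + I * ap + ((k : ℂ) + 1 / 2) * (I * ap) =
        w + (((k + 1 : ℕ) : ℂ) + 1 / 2) * (I * ap) := fun k => by push_cast; ring
    simp only [e1, e2] at h1 ⊢
    simp only [Finset.range_zero, Finset.prod_empty, mul_one]
    rw [mul_comm (∏ k ∈ Finset.range n, _), ← mul_div_mul_left _ _ h1, mul_div_assoc]

/-- The definition of `G` favours a₊, but `g` is symmetric in a₊ and a₋. The equation therefore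
holds near -ia₋/2 by `expG_shift` with the parameters exchanged, and spreads by the identity theorem
over the complement of a countable set. -/
theorem G_add_step_true (hap : 0 < ap) (ham : 0 < am) {w : ℂ} (hw : -w ∉ lattice ap am) :
    G ap am (w + I * am) = 2 * cd ap am true (w + I * am / 2) * G ap am w := by
  have hU : IsPreconnected {w : ℂ | -w ∉ lattice ap am} := by
    have : {w : ℂ | -w ∉ lattice ap am} = ((fun w => -w) ⁻¹' lattice ap am)ᶜ := rfl
    rw [this]
    exact isPreconnected_compl_of_countable
      ((lattice_countable ap am).preimage neg_injective)
  have h1 : AnalyticOnNhd ℂ (fun w => G ap am (w + I * am)) {w : ℂ | -w ∉ lattice ap am} := by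
    intro z hz
    refine (analyticAt_G hap ham (z := z + I * am) fun h => hz ?_).fun_comp_of_eq (by fun_prop) rfl
    have := add_step_mem_lattice h true
    simpa [step, par] using this
  have h2 : AnalyticOnNhd ℂ (fun w => 2 * cd ap am true (w + I * am / 2) * G ap am w)
      {w : ℂ | -w ∉ lattice ap am} := by
    intro z hz
    refine (analyticAt_const.mul ?_).mul (analyticAt_G hap ham hz)
    exact (analyticAt_cd ap am true _).fun_comp_of_eq (by fun_prop) rfl
  have h3 : (fun w => G ap am (w + I * am)) =ᶠ[𝓝 (-(I * am / 2))]
      fun w => 2 * cd ap am true (w + I * am / 2) * G ap am w := by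
    have ho : IsOpen {w : ℂ | |(w + I * am / 2).im| < ap / 2} :=
      isOpen_lt (by fun_prop) continuous_const
    filter_upwards [ho.mem_nhds (by simp [hap])] with w hw
    have hs := expG_shift ham hap hw
    have i1 : (w + I * am / 2).im = w.im + am / 2 := by simp
    have i2 : (w + I * am).im = w.im + am := by simp
    have hw' := abs_lt.1 (show |w.im + am / 2| < ap / 2 by rw [← i1]; exact hw)
    have hm : mid ap am = ap / 2 + am / 2 := by rw [mid]; ring
    rw [G_eq_exp hap ham (z := w + I * am) (by rw [i2, abs_lt]; constructor <;> linarith),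
      G_eq_exp hap ham (z := w) (by rw [abs_lt]; constructor <;> linarith), g_comm, g_comm ap am w]
    have e1 : w + I * am / 2 + I * am / 2 = w + I * am := by ring
    have e2 : w + I * am / 2 - I * am / 2 = w := by ring
    rw [e1, e2] at hs
    exact hs
  have h0 : -(I * am / 2) ∈ {w : ℂ | -w ∉ lattice ap am} := by
    refine neg_notMem_lattice_of_lt_im hap ham ?_
    have : (-(I * am / 2) : ℂ).im = -(am / 2) := by simp
    rw [this, mid]; linarith
  exact h1.eqOn_of_preconnected_of_eventuallyEq h2 hU h0 h3 hw

theorem G_add_step (hap : 0 < ap) (ham : 0 < am) (δ : Bool) {w : ℂ} (hw : -w ∉ lattice ap am) :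
    G ap am (w + step ap am δ) = 2 * cd ap am δ (w + step ap am δ / 2) * G ap am w := by
  cases δ
  · exact G_add_step_false hap hw ham
  · exact G_add_step_true hap ham hw

/-- Near 0 this is the oddness of `g`; the identity theorem extends it past all zeros and poles. -/
theorem G_mul_neg (hap : 0 < ap) (ham : 0 < am) {z : ℂ} (hz : z ∉ lattice ap am)
    (hz' : -z ∉ lattice ap am) : G ap am z * G ap am (-z) = 1 := by
  have hU : IsPreconnected {w : ℂ | w ∉ lattice ap am ∧ -w ∉ lattice ap am} := by
    have : {w : ℂ | w ∉ lattice ap am ∧ -w ∉ lattice ap am} =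
        (lattice ap am ∪ (fun w => -w) ⁻¹' lattice ap am)ᶜ := by
      rw [compl_union]; rfl
    rw [this]
    exact isPreconnected_compl_of_countable ((lattice_countable ap am).union
      ((lattice_countable ap am).preimage neg_injective))
  have h1 : AnalyticOnNhd ℂ (fun w => G ap am w * G ap am (-w))
      {w : ℂ | w ∉ lattice ap am ∧ -w ∉ lattice ap am} := by
    intro w hw
    refine (analyticAt_G hap ham hw.2).mul ?_
    exact (analyticAt_G hap ham (z := -w) (by simpa using hw.1)).fun_comp_of_eq (by fun_prop) rfl
  have h3 : (fun w => G ap am w * G ap am (-w)) =ᶠ[𝓝 0] fun _ => 1 := by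
    filter_upwards [(isOpen_strip (mid ap am)).mem_nhds
      (show |(0 : ℂ).im| < mid ap am by simpa using mid_pos hap ham)] with w hw
    rw [G_eq_exp hap ham hw, G_eq_exp hap ham (by simpa using hw), g_neg, ← exp_add]
    simp
  have h0 : (0 : ℂ) ∈ {w : ℂ | w ∉ lattice ap am ∧ -w ∉ lattice ap am} := by
    have := notMem_lattice_of_im_lt hap ham (z := 0) (by simpa using mid_pos hap ham)
    exact ⟨this, by simpa using this⟩
  exact h1.eqOn_of_preconnected_of_eventuallyEq (fun w _ => analyticAt_const) hU h0 h3 ⟨hz, hz'⟩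

end RelToda

/-! ### G_R and G_L: difference equation, bounds, limits; special values of G. -/

namespace RelToda

open Complex Set

variable {ap am : ℝ}

theorem par_pos (hap : 0 < ap) (ham : 0 < am) (δ : Bool) : 0 < par ap am δ := by
  cases δ <;> simpa [par]

theorem alpha_mul_step (hap : 0 < ap) (ham : 0 < am) (δ : Bool) :
    I * alpha ap am * step ap am δ = -(2 * Real.pi / par ap am δ) := by
  have hap' : (ap : ℂ) ≠ 0 := ofReal_ne_zero.2 hap.ne'
  have ham' : (am : ℂ) ≠ 0 := ofReal_ne_zero.2 ham.ne'
  have hI := I_sq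
  cases δ <;> simp only [alpha, step, par, Bool.not_true, Bool.not_false, Bool.false_eq_true,
    if_false, if_true] <;> push_cast <;> field_simp <;> rw [hI]

theorem step_re (ap am : ℝ) (δ : Bool) : (step ap am δ).re = 0 := by simp [step]

theorem step_im (ap am : ℝ) (δ : Bool) : (step ap am δ).im = par ap am (!δ) := by simp [step]

/-- The quadratic exponent changes under the step by a term linear in w, which turns 2 cosh u into
exp(-u) · 2 cosh u = 1 + exp(-2u). -/
theorem GRight_add_step (hap : 0 < ap) (ham : 0 < am) (δ : Bool) {w : ℂ}
    (hw : -w ∉ lattice ap am) : GRight ap am (w + step ap am δ) =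
      (1 + ed ap am δ (-(2 * w) - step ap am δ)) * GRight ap am w := by
  rw [GRight, GRight, G_add_step hap ham δ hw]
  have h := alpha_mul_step hap ham δ
  set s := step ap am δ
  set u : ℂ := Real.pi * (w + s / 2) / par ap am δ with hu
  have e1 : I * (chi ap am + alpha ap am * (w + s) ^ 2 / 4) =
      -u + I * (chi ap am + alpha ap am * w ^ 2 / 4) := by
    rw [hu]
    linear_combination ((2 * w + s) / 4) * h
  have e2 : ed ap am δ (-(2 * w) - s) = exp (-u) * exp (-u) := by
    rw [ed, ← exp_add]; congr 1; rw [hu]; ring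
  have e3 : cd ap am δ (w + s / 2) = cosh u := rfl
  have e4 : exp u * exp (-u) = 1 := by rw [← exp_add]; simp
  rw [e1, e2, e3, exp_add, Complex.cosh]
  linear_combination (G ap am w * exp (I * (chi ap am + alpha ap am * w ^ 2 / 4))) * e4

theorem GRight_mul_GLeft_neg (hap : 0 < ap) (ham : 0 < am) {z : ℂ} (hz : z ∉ lattice ap am)
    (hz' : -z ∉ lattice ap am) : GRight ap am z * GLeft ap am (-z) = 1 := by
  have h := G_mul_neg hap ham hz hz'
  rw [GRight, GLeft, neg_sq, mul_mul_mul_comm, h, ← exp_add]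
  simp

theorem conj_GRight (ap am : ℝ) (z : ℂ) :
    (starRingEnd ℂ) (GRight ap am z) = GLeft ap am (-(starRingEnd ℂ) z) := by
  rw [GRight, GLeft, map_mul, conj_G, ← exp_conj]
  congr 2
  simp [Complex.conj_ofNat]

theorem conj_GLeft (ap am : ℝ) (z : ℂ) :
    (starRingEnd ℂ) (GLeft ap am z) = GRight ap am (-(starRingEnd ℂ) z) := by
  have := congrArg (starRingEnd ℂ) (conj_GRight ap am (-(starRingEnd ℂ) z))
  simpa using this.symm

theorem norm_GLeft (ap am : ℝ) (z : ℂ) :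
    ‖GLeft ap am z‖ = ‖GRight ap am (-(starRingEnd ℂ) z)‖ := by
  rw [← conj_GLeft, RCLike.norm_conj]

theorem G_eq_GRight (ap am : ℝ) (z : ℂ) : G ap am z =
    GRight ap am z * exp (-(I * (chi ap am + alpha ap am * z ^ 2 / 4))) := by
  rw [GRight, mul_assoc, ← exp_add]; simp

theorem G_eq_GLeft (ap am : ℝ) (z : ℂ) : G ap am z =
    GLeft ap am z * exp (I * (chi ap am + alpha ap am * z ^ 2 / 4)) := by
  rw [GLeft, mul_assoc, ← exp_add]; simp

theorem norm_G_eq_GRight (ap am : ℝ) (z : ℂ) : ‖G ap am z‖ =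
    ‖GRight ap am z‖ * Real.exp (alpha ap am / 2 * (z.im * z.re)) := by
  rw [G_eq_GRight, norm_mul, Complex.norm_exp]
  congr 2
  have : -(I * (chi ap am + alpha ap am * z ^ 2 / 4)) =
      -(I * ((chi ap am : ℂ) + (alpha ap am / 4 : ℝ) * (z * z))) := by push_cast; ring
  rw [this]
  simp [-ofReal_div]
  ring

theorem norm_G_eq_GLeft (ap am : ℝ) (z : ℂ) : ‖G ap am z‖ =
    ‖GLeft ap am z‖ * Real.exp (-(alpha ap am / 2 * (z.im * z.re))) := by
  rw [G_eq_GLeft, norm_mul, Complex.norm_exp]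
  congr 2
  have : I * (chi ap am + alpha ap am * z ^ 2 / 4) =
      I * ((chi ap am : ℂ) + (alpha ap am / 4 : ℝ) * (z * z)) := by push_cast; ring
  rw [this]
  simp [-ofReal_div]
  ring

theorem GRight_eq_exp (hap : 0 < ap) (ham : 0 < am) {z : ℂ} (hz : |z.im| < mid ap am) :
    GRight ap am z = exp (I * jInt ap am z) := by
  rw [GRight, G_eq_exp hap ham hz, g_eq_jInt hap ham hz, ← exp_add]
  congr 1; ring

theorem analyticAt_GRight (hap : 0 < ap) (ham : 0 < am) {z : ℂ} (hz : -z ∉ lattice ap am) :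
    AnalyticAt ℂ (GRight ap am) z := by
  unfold GRight
  exact (analyticAt_G hap ham hz).mul (by fun_prop)

theorem norm_ed_step (ap am : ℝ) (δ : Bool) (w : ℂ) :
    ‖ed ap am δ (-(2 * w) - step ap am δ)‖ =
      Real.exp (-(2 * Real.pi * w.re / par ap am δ)) := by
  rw [ed, Complex.norm_exp]
  congr 1
  have : (Real.pi : ℂ) * (-(2 * w) - step ap am δ) / par ap am δ =
      ((Real.pi / par ap am δ : ℝ) : ℂ) * (-(2 * w) - step ap am δ) := by push_cast; ring
  rw [this, re_ofReal_mul]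
  simp [step_re]
  ring

theorem exists_norm_GRight_le_strip (hap : 0 < ap) (ham : 0 < am) {v : ℝ} (hv : v < mid ap am)
    (R : ℝ) : ∃ K, 0 < K ∧ ∀ z : ℂ, |z.im| ≤ v → -R ≤ z.re → ‖GRight ap am z‖ ≤ K := by
  obtain ⟨C, hC, h⟩ := jInt_bound hap ham hv
  refine ⟨Real.exp (C * Real.exp (2 * rho ap am * R)), Real.exp_pos _, fun z hz hR => ?_⟩
  rw [GRight_eq_exp hap ham (hz.trans_lt hv)]
  refine (Complex.norm_exp_le_exp_norm _).trans (Real.exp_le_exp.2 ?_)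
  rw [norm_mul, norm_I, one_mul]
  refine (h z hz).trans (mul_le_mul_of_nonneg_left (Real.exp_le_exp.2 ?_) hC)
  have := rho_pos hap ham
  nlinarith

/-- Induction on the number of steps ia₊ upwards: each multiplies by 1 + e₋(…), which is bounded
because Re z is bounded below. -/
theorem exists_norm_GRight_le_upper (hap : 0 < ap) (ham : 0 < am) {v : ℝ} (hv : v < mid ap am)
    (R Y : ℝ) : ∃ K, 0 < K ∧ ∀ z : ℂ, -v ≤ z.im → z.im ≤ Y → -R ≤ z.re →
      ‖GRight ap am z‖ ≤ K := by
  have key : ∀ n : ℕ, ∃ K, 0 < K ∧ ∀ z : ℂ, -max v (ap / 2) ≤ z.im → z.im ≤ ap / 2 + n * ap →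
      -R ≤ z.re → ‖GRight ap am z‖ ≤ K := by
    have hv' : max v (ap / 2) < mid ap am := max_lt hv (by rw [mid]; linarith)
    intro n
    induction n with
    | zero =>
      obtain ⟨K, hK, h⟩ := exists_norm_GRight_le_strip hap ham hv' R
      refine ⟨K, hK, fun z h1 h2 h3 => h z (abs_le.2 ⟨h1, h2.trans ?_⟩) h3⟩
      simp
    | succ n ih =>
      obtain ⟨K, hK, h⟩ := ih
      refine ⟨(1 + Real.exp (2 * Real.pi * R / am)) * K, by positivity, fun z h1 h2 h3 => ?_⟩
      have hK1 : K ≤ (1 + Real.exp (2 * Real.pi * R / am)) * K :=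
        le_mul_of_one_le_left hK.le (by linarith [Real.exp_pos (2 * Real.pi * R / am)])
      rcases le_or_gt z.im (ap / 2 + n * ap) with h4 | h4
      · exact (h z h1 h4 h3).trans hK1
      · set w := z - step ap am false with hw
        have hz : z = w + step ap am false := by rw [hw]; ring
        have i1 : w.im = z.im - ap := by rw [hw, sub_im, step_im]; rfl
        have i2 : w.re = z.re := by rw [hw, sub_re, step_re, sub_zero]
        have hn : 0 ≤ (n : ℝ) * ap := by positivity
        have h5 : -max v (ap / 2) ≤ w.im := by
          have := le_max_right v (ap / 2)
          linarith
        rw [hz, GRight_add_step hap ham false (neg_notMem_lattice_of_lt_im hap ham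
          (lt_of_lt_of_le (by linarith) h5)), norm_mul]
        push_cast at h2
        refine mul_le_mul ((norm_add_le _ _).trans ?_) (h w h5 (by linarith) (by linarith))
          (norm_nonneg _) (by positivity)
        rw [norm_one, norm_ed_step]
        gcongr
        have e : par ap am false = am := rfl
        rw [e, ← neg_div]
        gcongr
        have := Real.pi_pos
        nlinarith
  obtain ⟨n, hn⟩ := exists_nat_ge (Y / ap)
  obtain ⟨K, hK, h⟩ := key n
  refine ⟨K, hK, fun z h1 h2 h3 => h z ?_ ?_ h3⟩
  · linarith [le_max_left v (ap / 2)]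
  · rw [div_le_iff₀ hap] at hn; linarith

theorem notMem_lattice_of_re_ne {z : ℂ} (hz : z.re ≠ 0) : z ∉ lattice ap am :=
  fun h => hz (re_of_mem_lattice h)

/-- Downward steps divide by 1 + e₋(…). For Re z ≥ R > 0 this factor stays at distance 1 -
exp(-2πR/a₋) from 0, so no pole is met. -/
theorem exists_norm_GRight_le_right (hap : 0 < ap) (ham : 0 < am) {R : ℝ} (hR : 0 < R) (Y : ℝ) :
    ∃ K, 0 < K ∧ ∀ z : ℂ, |z.im| ≤ Y → R ≤ z.re → ‖GRight ap am z‖ ≤ K := by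
  obtain ⟨K₀, hK₀, h0⟩ := exists_norm_GRight_le_upper hap ham (v := 0) (mid_pos hap ham) 0
    (max Y 0)
  have hq : 0 < 1 - Real.exp (-(2 * Real.pi * R / am)) := by
    have := Real.pi_pos
    rw [sub_pos, Real.exp_lt_one_iff, neg_lt_zero]; positivity
  set q := 1 - Real.exp (-(2 * Real.pi * R / am)) with hqdef
  have hq1 : q ≤ 1 := by rw [hqdef]; linarith [Real.exp_pos (-(2 * Real.pi * R / am))]
  have key : ∀ n : ℕ, ∃ K, 0 < K ∧ ∀ z : ℂ, -(n * ap) ≤ z.im → z.im ≤ max Y 0 → R ≤ z.re →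
      ‖GRight ap am z‖ ≤ K := by
    intro n
    induction n with
    | zero => exact ⟨K₀, hK₀, fun z h1 h2 h3 => h0 z (by simpa using h1) h2 (by linarith)⟩
    | succ n ih =>
      obtain ⟨K, hK, h⟩ := ih
      obtain ⟨K₁, hK₁, h1⟩ := exists_norm_GRight_le_upper hap ham (v := 0) (mid_pos hap ham) 0 ap
      refine ⟨max K K₁ / q, by positivity, fun z hz1 hz2 hz3 => ?_⟩
      have hz0 : z.re ≠ 0 := by linarith
      have hs := GRight_add_step hap ham false (w := z)
        (notMem_lattice_of_re_ne (by simpa using hz0))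
      have i1 : (z + step ap am false).im = z.im + ap := by rw [add_im, step_im]; rfl
      have i2 : (z + step ap am false).re = z.re := by rw [add_re, step_re, add_zero]
      push_cast at hz1
      rcases le_or_gt (-(n * ap)) z.im with h4 | h4
      · exact (h z h4 hz2 hz3).trans ((le_max_left K K₁).trans
          (le_div_self (by positivity) hq hq1))
      · have hb : ‖GRight ap am (z + step ap am false)‖ ≤ max K K₁ := by
          rcases le_or_gt (z.im + ap) (max Y 0) with h5 | h5
          · exact (h _ (by rw [i1]; linarith) (by rw [i1]; exact h5) (by rw [i2]; exact hz3)).trans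
              (le_max_left _ _)
          · rcases le_or_gt 0 (z.im + ap) with h6 | h6
            · refine (h1 _ (by rw [i1]; linarith) ?_ (by rw [i2]; linarith)).trans
                (le_max_right _ _)
              rw [i1]
              have : 0 ≤ (n : ℝ) * ap := by positivity
              linarith
            · exfalso
              linarith [le_max_right Y 0]
        rw [hs, norm_mul] at hb
        have hl : q ≤ ‖1 + ed ap am false (-(2 * z) - step ap am false)‖ := by
          have h7 := norm_sub_norm_le (1 : ℂ) (-ed ap am false (-(2 * z) - step ap am false))
          rw [norm_neg, norm_one, norm_ed_step, sub_neg_eq_add] at h7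
          refine le_trans ?_ h7
          rw [hqdef]
          have e : par ap am false = am := rfl
          rw [e]
          have := Real.pi_pos
          gcongr
        rw [le_div_iff₀ hq]
        calc _ ≤ ‖GRight ap am z‖ * ‖1 + ed ap am false (-(2 * z) - step ap am false)‖ := by gcongr
          _ ≤ _ := by rw [mul_comm]; exact hb
  obtain ⟨n, hn⟩ := exists_nat_ge (Y / ap)
  obtain ⟨K, hK, h⟩ := key n
  refine ⟨K, hK, fun z h1 h3 => h z ?_
    ((abs_le.1 h1).2.trans (le_max_left _ _)) h3⟩
  rw [div_le_iff₀ hap] at hn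
  linarith [(abs_le.1 h1).1]

theorem neg_conj_re (z : ℂ) : (-(starRingEnd ℂ) z).re = -z.re := by simp

theorem neg_conj_im (z : ℂ) : (-(starRingEnd ℂ) z).im = z.im := by simp

/-- For Re z ≥ 0 the bounded function is G_R, for Re z ≤ 0 it is G_L, the conjugate of G_R at the
reflected point. In both cases the removed Gaussian has modulus exp(α/2 · Im z |Re z|). -/
theorem exists_norm_G_le_upper (hap : 0 < ap) (ham : 0 < am) {v : ℝ} (hv : v < mid ap am) (Y : ℝ) :
    ∃ K, 0 < K ∧ ∀ z : ℂ, -v ≤ z.im → z.im ≤ Y →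
      ‖G ap am z‖ ≤ K * Real.exp (alpha ap am / 2 * (z.im * |z.re|)) := by
  obtain ⟨K, hK, h⟩ := exists_norm_GRight_le_upper hap ham hv 0 Y
  refine ⟨K, hK, fun z h1 h2 => ?_⟩
  rcases le_total 0 z.re with h0 | h0
  · rw [norm_G_eq_GRight, abs_of_nonneg h0]
    gcongr
    exact h z h1 h2 (by simpa using h0)
  · rw [norm_G_eq_GLeft, abs_of_nonpos h0, norm_GLeft, mul_neg, mul_neg]
    gcongr
    refine h _ ?_ ?_ ?_
    · rw [neg_conj_im]; exact h1
    · rw [neg_conj_im]; exact h2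
    · rw [neg_conj_re]; linarith

theorem exists_norm_G_le_right (hap : 0 < ap) (ham : 0 < am) {R : ℝ} (hR : 0 < R) (Y : ℝ) :
    ∃ K, 0 < K ∧ ∀ z : ℂ, |z.im| ≤ Y → R ≤ |z.re| →
      ‖G ap am z‖ ≤ K * Real.exp (alpha ap am / 2 * (z.im * |z.re|)) := by
  obtain ⟨K, hK, h⟩ := exists_norm_GRight_le_right hap ham hR Y
  refine ⟨K, hK, fun z h1 h2 => ?_⟩
  rcases le_total 0 z.re with h0 | h0
  · rw [abs_of_nonneg h0] at h2
    rw [norm_G_eq_GRight, abs_of_nonneg h0]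
    gcongr
    exact h z h1 h2
  · rw [abs_of_nonpos h0] at h2
    rw [norm_G_eq_GLeft, abs_of_nonpos h0, norm_GLeft, mul_neg, mul_neg]
    gcongr
    refine h _ ?_ ?_
    · rw [neg_conj_im]; exact h1
    · rw [neg_conj_re]; exact h2

theorem tendsto_jInt_add (hap : 0 < ap) (ham : 0 < am) {z : ℂ} (hz : |z.im| < mid ap am) :
    Tendsto (fun t : ℝ => jInt ap am (z + t)) atTop (𝓝 0) := by
  obtain ⟨C, hC, h⟩ := jInt_bound hap ham hz
  have hρ := rho_pos hap ham
  refine squeeze_zero_norm (fun t => (h _ (by simp)).trans (le_of_eq ?_))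
    (tendsto_const_mul_exp_neg (mul_pos two_pos hρ) (C * Real.exp (-(2 * rho ap am * z.re))))
  rw [mul_assoc C, ← Real.exp_add]
  congr 2
  simp; ring

theorem tendsto_GRight_add (hap : 0 < ap) (ham : 0 < am) {z : ℂ} (hz : |z.im| < mid ap am) :
    Tendsto (fun t : ℝ => GRight ap am (z + t)) atTop (𝓝 1) := by
  have h := ((tendsto_jInt_add hap ham hz).const_mul I).cexp
  rw [mul_zero, exp_zero] at h
  refine h.congr fun t => (GRight_eq_exp hap ham (by simpa using hz)).symm

theorem G_sub_mid (hap : 0 < ap) (ham : 0 < am) {y : ℂ}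
    (hy : -(y - I * mid ap am) ∉ lattice ap am) :
    G ap am (y + I * ((ap - am) / 2 : ℝ)) =
      -(2 * I * sd ap am false y) * G ap am (y - I * mid ap am) := by
  have h := G_add_step hap ham false hy
  have e1 : y - I * mid ap am + step ap am false = y + I * ((ap - am) / 2 : ℝ) := by
    simp only [step, par, mid, Bool.not_false, if_true]; push_cast; ring
  have e2 : y - I * mid ap am + step ap am false / 2 = y - I * am / 2 := by
    simp only [step, par, mid, Bool.not_false, if_true]; push_cast; ring
  rw [e1, e2] at h
  rw [h]
  have ham' : (am : ℂ) ≠ 0 := ofReal_ne_zero.2 ham.ne'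
  have e3 : (Real.pi : ℂ) * (y - I * am / 2) / par ap am false =
      Real.pi * y / par ap am false - Real.pi / 2 * I := by
    simp only [par, Bool.false_eq_true, if_false]
    field_simp
  rw [cd, e3, Complex.cosh_sub, cosh_mul_I, sinh_mul_I, Complex.cos_pi_div_two,
    Complex.sin_pi_div_two, sd]
  ring

theorem G_sub_mid' (hap : 0 < ap) (ham : 0 < am) {y : ℂ}
    (hy : -(y - I * mid ap am) ∉ lattice ap am) :
    G ap am (y - I * ((ap - am) / 2 : ℝ)) =
      -(2 * I * sd ap am true y) * G ap am (y - I * mid ap am) := by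
  have h := G_add_step hap ham true hy
  have e1 : y - I * mid ap am + step ap am true = y - I * ((ap - am) / 2 : ℝ) := by
    simp only [step, par, mid, Bool.not_true, Bool.false_eq_true, if_false]; push_cast; ring
  have e2 : y - I * mid ap am + step ap am true / 2 = y - I * ap / 2 := by
    simp only [step, par, mid, Bool.not_true, Bool.false_eq_true, if_false]; push_cast; ring
  rw [e1, e2] at h
  rw [h]
  have hap' : (ap : ℂ) ≠ 0 := ofReal_ne_zero.2 hap.ne'
  have e3 : (Real.pi : ℂ) * (y - I * ap / 2) / par ap am true =
      Real.pi * y / par ap am true - Real.pi / 2 * I := by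
    simp only [par, if_true]
    field_simp
  rw [cd, e3, Complex.cosh_sub, cosh_mul_I, sinh_mul_I, Complex.cos_pi_div_two,
    Complex.sin_pi_div_two, sd]
  ring

theorem abs_half_sub_lt_mid (hap : 0 < ap) (ham : 0 < am) : |(ap - am) / 2| < mid ap am := by
  rw [mid, abs_lt]; constructor <;> linarith

theorem G_real_mul_I (hap : 0 < ap) (ham : 0 < am) {t : ℝ} (ht : |t| < mid ap am) :
    ∃ r : ℝ, G ap am (I * t) = Real.exp r := by
  have hg : (starRingEnd ℂ) (g ap am (I * t)) = -g ap am (I * t) := by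
    rw [conj_g, ← g_neg]; simp
  have hre : (g ap am (I * t)).re = 0 := by
    have := congrArg Complex.re hg
    simp at this
    linarith
  refine ⟨-(g ap am (I * t)).im, ?_⟩
  rw [G_eq_exp hap ham (by simpa using ht), ofReal_exp]
  congr 1
  apply Complex.ext <;> simp [hre]

theorem tendsto_sd_div (δ : Bool) :
    Tendsto (fun y : ℂ => sd ap am δ y / y) (𝓝[≠] 0) (𝓝 (Real.pi / par ap am δ)) := by
  have h : HasDerivAt (sd ap am δ) (Real.pi / par ap am δ) 0 := by
    have h1 : HasDerivAt (fun z : ℂ => (Real.pi : ℂ) * z / par ap am δ)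
        (Real.pi / par ap am δ) 0 := by
      convert! ((hasDerivAt_id (0 : ℂ)).const_mul (Real.pi : ℂ)).div_const (par ap am δ : ℂ) using 1
      simp
    convert! h1.csinh using 1
    simp
  have h2 := hasDerivAt_iff_tendsto_slope.1 h
  refine h2.congr fun y => ?_
  simp [slope, sd]
  ring

theorem sd_eq_zero_iff (hap : 0 < ap) (ham : 0 < am) {δ : Bool} {y : ℂ} :
    sd ap am δ y = 0 ↔ ∃ k : ℤ, y = k * (I * par ap am δ) := by
  have hp : (par ap am δ : ℂ) ≠ 0 := ofReal_ne_zero.2 (par_pos hap ham δ).ne'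
  have hpi : (Real.pi : ℂ) ≠ 0 := ofReal_ne_zero.2 Real.pi_ne_zero
  have e : Complex.sinh (Real.pi * y / par ap am δ) = 0 ↔
      Complex.sin (Real.pi * y / par ap am δ * I) = 0 := by
    rw [sin_mul_I]; simp
  rw [sd, e, Complex.sin_eq_zero_iff]
  constructor
  · rintro ⟨k, hk⟩
    refine ⟨-k, ?_⟩
    field_simp at hk
    push_cast
    linear_combination (-I) * hk + y * I_sq
  · rintro ⟨k, rfl⟩
    refine ⟨-k, ?_⟩
    field_simp
    push_cast
    linear_combination k * I_sq

theorem sd_ne_zero_of_re (hap : 0 < ap) (ham : 0 < am) {δ : Bool} {y : ℂ} (hy : y.re ≠ 0) :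
    sd ap am δ y ≠ 0 := by
  intro h
  obtain ⟨k, rfl⟩ := (sd_eq_zero_iff hap ham).1 h
  simp at hy

/-- The two steps from y - ia, by ia₊ and by ia₋, end at y ± i(a₊ - a₋)/2 (`G_sub_mid`,
`G_sub_mid'`). Comparing them as y → 0 gives the ratio a₊/a₋ of two values that are inverse to each
other; the root is positive since G is positive on the imaginary axis inside the strip. -/
theorem G_half_sub (hap : 0 < ap) (ham : 0 < am) :
    G ap am (I * ((ap - am) / 2 : ℝ)) = Real.sqrt (ap / am) := by
  obtain ⟨r, hr⟩ := G_real_mul_I hap ham (abs_half_sub_lt_mid hap ham)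
  have hcont : ∀ t : ℝ, |t| < mid ap am →
      Tendsto (fun y : ℝ => G ap am (y + I * t)) (𝓝[>] 0) (𝓝 (G ap am (I * t))) := by
    intro t ht
    have h1 : ContinuousAt (G ap am) (I * t) := (analyticAt_G hap ham
      (neg_notMem_lattice_of_lt_im hap ham (by simp; exact (abs_lt.1 ht).1))).continuousAt
    have h2 : Tendsto (fun y : ℝ => (y : ℂ) + I * t) (𝓝[>] 0) (𝓝 (I * t)) := by
      have : ContinuousAt (fun y : ℝ => (y : ℂ) + I * t) 0 := by fun_prop
      have h3 := this.tendsto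
      simp only [ofReal_zero, zero_add] at h3
      exact h3.mono_left nhdsWithin_le_nhds
    exact h1.tendsto.comp h2
  have hofReal : Tendsto (fun y : ℝ => (y : ℂ)) (𝓝[>] 0) (𝓝[≠] 0) := by
    refine tendsto_nhdsWithin_iff.2 ⟨?_, ?_⟩
    · exact (continuous_ofReal.tendsto' 0 0 ofReal_zero).mono_left nhdsWithin_le_nhds
    · filter_upwards [self_mem_nhdsWithin] with y hy
      exact ofReal_ne_zero.2 (ne_of_gt hy)
  have h1 := hcont _ (abs_half_sub_lt_mid hap ham)
  have h2 := hcont (-((ap - am) / 2)) (by rw [abs_neg]; exact abs_half_sub_lt_mid hap ham)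
  have hinv : G ap am (I * ((ap - am) / 2 : ℝ)) * G ap am (I * (-((ap - am) / 2) : ℝ)) = 1 := by
    have := abs_lt.1 (abs_half_sub_lt_mid hap ham)
    have h := G_mul_neg hap ham (z := I * ((ap - am) / 2 : ℝ))
      (notMem_lattice_of_im_lt hap ham (by
        have e : (I * ((ap - am) / 2 : ℝ)).im = (ap - am) / 2 := by simp [-ofReal_div, -ofReal_sub]
        rw [e]; linarith))
      (neg_notMem_lattice_of_lt_im hap ham (by
        have e : (I * ((ap - am) / 2 : ℝ)).im = (ap - am) / 2 := by simp [-ofReal_div, -ofReal_sub]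
        rw [e]; linarith))
    rw [← h]; congr 2; push_cast; ring
  have ha := (tendsto_sd_div (ap := ap) (am := am) true).comp hofReal
  have hb := (tendsto_sd_div (ap := ap) (am := am) false).comp hofReal
  have h3 := (h1.mul ha).sub (h2.mul hb)
  have hz : ∀ᶠ y : ℝ in 𝓝[>] 0, G ap am (y + I * ((ap - am) / 2 : ℝ)) *
      ((fun y : ℂ => sd ap am true y / y) ∘ fun y : ℝ => (y : ℂ)) y
      - G ap am (y + I * (-((ap - am) / 2) : ℝ)) *
        ((fun y : ℂ => sd ap am false y / y) ∘ fun y : ℝ => (y : ℂ)) y = 0 := by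
    filter_upwards [self_mem_nhdsWithin] with y hy
    have hy' : -((y : ℂ) - I * mid ap am) ∉ lattice ap am :=
      notMem_lattice_of_re_ne (by simpa using ne_of_gt hy)
    have e : (y : ℂ) + I * (-((ap - am) / 2) : ℝ) = y - I * ((ap - am) / 2 : ℝ) := by
      push_cast; ring
    rw [G_sub_mid hap ham hy', e, G_sub_mid' hap ham hy']
    simp only [Function.comp]
    ring
  have h4 := tendsto_nhds_unique (h3.congr' (hz.mono fun y hy => hy)) tendsto_const_nhds
  have hap' : (ap : ℂ) ≠ 0 := ofReal_ne_zero.2 hap.ne'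
  have ham' : (am : ℂ) ≠ 0 := ofReal_ne_zero.2 ham.ne'
  have hpi : (Real.pi : ℂ) ≠ 0 := ofReal_ne_zero.2 Real.pi_ne_zero
  have h5 : G ap am (I * ((ap - am) / 2 : ℝ)) ^ 2 = (ap : ℂ) / am := by
    simp only [par, Bool.false_eq_true, if_false, if_true] at h4
    generalize G ap am (I * ((ap - am) / 2 : ℝ)) = x at h4 hinv ⊢
    generalize G ap am (I * (-((ap - am) / 2) : ℝ)) = x' at h4 hinv
    field_simp at h4 ⊢
    have h4' : x * am - ap * x' = 0 := by
      refine mul_left_cancel₀ hpi (h4.trans ?_)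
      simp
    linear_combination x * h4' + (ap : ℂ) * hinv
  rw [hr] at h5 ⊢
  have h6 : Real.exp r ^ 2 = ap / am := by exact_mod_cast h5
  rw [← h6, Real.sqrt_sq (Real.exp_pos r).le]

/-- The residue of `G` at its first pole `-ia`. -/
theorem tendsto_mul_G_sub_mid (hap : 0 < ap) (ham : 0 < am) :
    Tendsto (fun y : ℂ => y * G ap am (y - I * mid ap am)) (𝓝[≠] 0)
      (𝓝 (I * Real.sqrt (ap * am) / (2 * Real.pi))) := by
  have hc : Tendsto (fun y : ℂ => G ap am (y + I * ((ap - am) / 2 : ℝ))) (𝓝[≠] 0)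
      (𝓝 (Real.sqrt (ap / am))) := by
    rw [← G_half_sub hap ham]
    have h1 : ContinuousAt (G ap am) (I * ((ap - am) / 2 : ℝ)) := (analyticAt_G hap ham
      (neg_notMem_lattice_of_lt_im hap ham (by
        have e : (I * ((ap - am) / 2 : ℝ)).im = (ap - am) / 2 := by simp [-ofReal_div, -ofReal_sub]
        rw [e]; exact (abs_lt.1 (abs_half_sub_lt_mid hap ham)).1))).continuousAt
    have h2 : Tendsto (fun y : ℂ => y + I * ((ap - am) / 2 : ℝ)) (𝓝[≠] 0)
        (𝓝 (I * ((ap - am) / 2 : ℝ))) := by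
      have : ContinuousAt (fun y : ℂ => y + I * ((ap - am) / 2 : ℝ)) 0 := by fun_prop
      have h3 := this.tendsto
      simp only [zero_add] at h3
      exact h3.mono_left nhdsWithin_le_nhds
    exact h1.tendsto.comp h2
  have hap' : (ap : ℂ) ≠ 0 := ofReal_ne_zero.2 hap.ne'
  have ham' : (am : ℂ) ≠ 0 := ofReal_ne_zero.2 ham.ne'
  have hpi : (Real.pi : ℂ) ≠ 0 := ofReal_ne_zero.2 Real.pi_ne_zero
  have hs := (tendsto_sd_div (ap := ap) (am := am) false)
  have hs0 : -(2 * I * ((Real.pi : ℂ) / par ap am false)) ≠ 0 := by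
    simp only [par, Bool.false_eq_true, if_false]
    simp [hpi, ham']
  have h := hc.div ((hs.const_mul (2 * I)).neg) hs0
  have e : (Real.sqrt (ap / am) : ℂ) / -(2 * I * ((Real.pi : ℂ) / par ap am false)) =
      I * Real.sqrt (ap * am) / (2 * Real.pi) := by
    have : Real.sqrt (ap * am) = Real.sqrt (ap / am) * am := by
      have : ap * am = ap / am * am ^ 2 := by field_simp
      rw [this, Real.sqrt_mul (by positivity), Real.sqrt_sq ham.le]
    rw [this]
    simp only [par, Bool.false_eq_true, if_false]
    push_cast
    generalize (Real.sqrt (ap / am) : ℂ) = q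
    field_simp
    rw [I_sq]; ring
  rw [e] at h
  refine h.congr' ?_
  have hm := mid_pos hap ham
  -- Inside this radius s₋ vanishes only at 0, and -(y - ia) is a lattice point only for y = 0.
  have hmin : 0 < min ap am := lt_min hap ham
  filter_upwards [self_mem_nhdsWithin, nhdsWithin_le_nhds (Metric.ball_mem_nhds (0 : ℂ) hmin)]
    with y hy hy2
  have hy0 : y ≠ 0 := hy
  have hyn : ‖y‖ < min ap am := by simpa using hy2
  have hs1 : sd ap am false y ≠ 0 := by
    intro h0
    obtain ⟨k, hk⟩ := (sd_eq_zero_iff hap ham).1 h0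
    rcases eq_or_ne k 0 with h1 | h1
    · rw [h1] at hk; exact hy0 (by simpa using hk)
    · have h2 : ‖y‖ = |(k : ℝ)| * am := by
        rw [hk]; simp [par, abs_of_pos ham]
      have h3 : (1 : ℝ) ≤ |(k : ℝ)| := by exact_mod_cast Int.one_le_abs h1
      have h4 := min_le_right ap am
      nlinarith
  have hl : -(y - I * mid ap am) ∉ lattice ap am := by
    rintro ⟨k, l, hkl⟩
    have h1 : y = -(I * (k * ap + l * am)) := by linear_combination -hkl
    have h2 : ‖y‖ = k * ap + l * am := by
      rw [h1, norm_neg, norm_mul, norm_I, one_mul]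
      have : (k * ap + l * am : ℂ) = ((k * ap + l * am : ℝ) : ℂ) := by push_cast; ring
      rw [this, norm_real, Real.norm_of_nonneg (by positivity)]
    rw [h2] at hyn
    have h5 := min_le_left ap am
    have h6 := min_le_right ap am
    rcases Nat.eq_zero_or_pos k with hk | hk
    · rcases Nat.eq_zero_or_pos l with hl | hl
      · exact hy0 (by rw [h1, hk, hl]; simp)
      · have : (1 : ℝ) ≤ l := by exact_mod_cast hl
        have : 0 ≤ (k : ℝ) * ap := by positivity
        nlinarith
    · have : (1 : ℝ) ≤ k := by exact_mod_cast hk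
      have : 0 ≤ (l : ℝ) * am := by positivity
      nlinarith
  simp only [Pi.div_apply]
  rw [G_sub_mid hap ham hl]
  generalize G ap am (y - I * mid ap am) = c
  field_simp

/-- Both factors are reduced by one step and then by reflection. For y > 0 the right side is
positive, so the root (G(±y + ia))^(1/2) is a real number. -/
theorem G_mid_mul_G_mid (hap : 0 < ap) (ham : 0 < am) {y : ℝ} (hy : y ≠ 0) :
    G ap am (y + I * mid ap am) * G ap am (-y + I * mid ap am) =
      4 * sd ap am true y * sd ap am false y := by
  have hy1 : -((y : ℂ) - I * mid ap am) ∉ lattice ap am := notMem_lattice_of_re_ne (by simpa)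
  have hy2 : -(-(y : ℂ) - I * mid ap am) ∉ lattice ap am := notMem_lattice_of_re_ne (by simpa)
  have h1 := G_sub_mid hap ham hy1
  have h2 := G_sub_mid' hap ham hy2
  have e1 : -(y : ℂ) - I * ((ap - am) / 2 : ℝ) = -(y + I * ((ap - am) / 2 : ℝ)) := by ring
  rw [e1] at h2
  have h3 := G_mul_neg hap ham (z := y + I * ((ap - am) / 2 : ℝ))
    (notMem_lattice_of_re_ne (by simpa)) (notMem_lattice_of_re_ne (by simpa))
  rw [h1, h2] at h3
  have h4 := G_mul_neg hap ham (z := y - I * mid ap am)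
    (notMem_lattice_of_re_ne (by simpa)) (notMem_lattice_of_re_ne (by simpa))
  have h5 := G_mul_neg hap ham (z := -y - I * mid ap am)
    (notMem_lattice_of_re_ne (by simpa)) (notMem_lattice_of_re_ne (by simpa))
  have e2 : -((y : ℂ) - I * mid ap am) = -y + I * mid ap am := by ring
  have e3 : -(-(y : ℂ) - I * mid ap am) = y + I * mid ap am := by ring
  have e4 : sd ap am true (-(y : ℂ)) = -sd ap am true y := by
    rw [sd, sd, ← Complex.sinh_neg]; congr 1; ring
  rw [e2] at h4
  rw [e3] at h5
  rw [e4] at h3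
  set A := G ap am (y + I * mid ap am)
  set B := G ap am (-y + I * mid ap am)
  set A' := G ap am (-(y : ℂ) - I * mid ap am)
  set B' := G ap am ((y : ℂ) - I * mid ap am)
  set s := sd ap am true (y : ℂ)
  set t := sd ap am false (y : ℂ)
  have h6 : 4 * s * t * (A' * B') = 1 := by
    linear_combination h3 + 4 * s * t * A' * B' * I_sq
  linear_combination (-(A * B)) * h6 + (4 * s * t * B' * B) * h5 + (4 * s * t) * h4

end RelToda

/-! ### The Fourier transform of G(±z + s): bounds, holomorphy, difference equation. -/

namespace RelToda

open Complex Set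

variable {ap am : ℝ}

/-- The Fourier transform of `G(± z + s)`. -/
noncomputable def betaInt (ap am : ℝ) (s w : ℂ) : ℂ :=
  ∫ z : ℝ, G ap am (z + s) * G ap am (-z + s) * exp (I * alpha ap am * z * w)

theorem norm_exp_alpha (ap am : ℝ) (z w : ℂ) : ‖exp (I * alpha ap am * z * w)‖ =
    Real.exp (-(alpha ap am * (z.re * w.im + z.im * w.re))) := by
  rw [Complex.norm_exp]
  congr 1
  have : I * (alpha ap am : ℂ) * z * w = I * ((alpha ap am : ℂ) * (z * w)) := by ring
  rw [this]
  simp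

/-- The exponents of the two factors add up to 2 Im s, so Im z disappears from the decay rate. The
bound is uniform on strips, as the contour shift requires. -/
theorem exists_norm_beta_le (hap : 0 < ap) (ham : 0 < am) {v : ℝ} (hv : v < mid ap am) (R : ℝ) :
    ∃ K, 0 < K ∧ ∀ s z : ℂ, |s.re| ≤ R → s.im ≤ 0 → |z.im| - s.im ≤ v →
      ‖G ap am (z + s) * G ap am (-z + s)‖ ≤ K * Real.exp (alpha ap am * (s.im * |z.re|)) := by
  obtain ⟨K, hK, h⟩ := exists_norm_G_le_upper hap ham hv v
  have hα := alpha_pos hap ham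
  refine ⟨K * K * Real.exp (alpha ap am * (2 * v) * R), by positivity,
    fun s z hs hs0 hz => ?_⟩
  have ht := abs_le.1 (le_refl |z.im|)
  have habs := abs_nonneg z.im
  have h1 := h (z + s) (by rw [add_im]; linarith [ht.1]) (by rw [add_im]; linarith [ht.2])
  have h2 := h (-z + s) (by rw [add_im, neg_im]; linarith [ht.2])
    (by rw [add_im, neg_im]; linarith [ht.1])
  have key : ∀ x r S : ℝ, |x| ≤ v → |S| ≤ R → x * |r + S| ≤ x * |r| + v * R := by
    intro x r S hx hS
    have h3 : |(|r + S| - |r|)| ≤ |S| := by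
      have := abs_abs_sub_abs_le (r + S) r
      simpa using this
    have h4 : x * (|r + S| - |r|) ≤ v * R := by
      refine (le_abs_self _).trans ?_
      rw [abs_mul]
      exact mul_le_mul hx (h3.trans hS) (abs_nonneg _) ((abs_nonneg _).trans hx)
    linarith
  have h3 := key (z + s).im z.re s.re
    (by rw [add_im, abs_le]; constructor <;> linarith [ht.1, ht.2]) hs
  have h4 := key (-z + s).im (-z.re) s.re
    (by rw [add_im, neg_im, abs_le]; constructor <;> linarith [ht.1, ht.2]) hs
  rw [abs_neg] at h4
  have e1 : (z + s).re = z.re + s.re := rfl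
  have e2 : (-z + s).re = -z.re + s.re := rfl
  have e3 : (z + s).im = z.im + s.im := rfl
  have e4 : (-z + s).im = -z.im + s.im := rfl
  rw [norm_mul]
  calc _ ≤ (K * Real.exp (alpha ap am / 2 * ((z + s).im * |(z + s).re|))) *
        (K * Real.exp (alpha ap am / 2 * ((-z + s).im * |(-z + s).re|))) :=
        mul_le_mul h1 h2 (norm_nonneg _) (by positivity)
    _ = K * K * Real.exp (alpha ap am / 2 * ((z + s).im * |(z + s).re| +
          (-z + s).im * |(-z + s).re|)) := by
        rw [mul_mul_mul_comm, ← Real.exp_add]; ring_nf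
    _ ≤ K * K * Real.exp (alpha ap am / 2 * (2 * (s.im * |z.re|) + 4 * (v * R))) := by
        refine mul_le_mul_of_nonneg_left (Real.exp_le_exp.2
          (mul_le_mul_of_nonneg_left ?_ (by positivity))) (by positivity)
        rw [e1, e2]
        have h5 := mul_nonneg (habs.trans (by linarith : |z.im| ≤ v)) ((abs_nonneg _).trans hs)
        have h6 : (z + s).im * |z.re| + (-z + s).im * |z.re| = 2 * (s.im * |z.re|) := by
          rw [e3, e4]; ring
        linarith
    _ = _ := by
        rw [mul_assoc (K * K), ← Real.exp_add]; ring_nf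

theorem analyticAt_beta (hap : 0 < ap) (ham : 0 < am) {s z : ℂ}
    (h : |z.im| - s.im < mid ap am) :
    AnalyticAt ℂ (fun z => G ap am (z + s) * G ap am (-z + s)) z := by
  have ht := abs_le.1 (le_refl |z.im|)
  have h1 := analyticAt_G hap ham (z := z + s) (neg_notMem_lattice_of_lt_im hap ham
    (by rw [add_im]; linarith [ht.1]))
  have h2 := analyticAt_G hap ham (z := -z + s) (neg_notMem_lattice_of_lt_im hap ham
    (by rw [add_im, neg_im]; linarith [ht.2]))
  exact (h1.fun_comp_of_eq (f := fun z => z + s) (by fun_prop) rfl).mul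
    (h2.fun_comp_of_eq (f := fun z => -z + s) (by fun_prop) rfl)

theorem continuous_G_line (hap : 0 < ap) (ham : 0 < am) {s c : ℂ} (hc : c.im = 0)
    (hs : -mid ap am < s.im) : Continuous fun z : ℝ => G ap am (c * z + s) := by
  rw [continuous_iff_continuousAt]
  intro z
  have h1 := (analyticAt_G hap ham (z := c * z + s) (neg_notMem_lattice_of_lt_im hap ham
    (by simpa [hc] using hs))).continuousAt
  exact ContinuousAt.comp (f := fun z : ℝ => c * z + s) h1 (by fun_prop)

theorem continuous_beta (hap : 0 < ap) (ham : 0 < am) {s : ℂ} (hs : -mid ap am < s.im) (w : ℂ) :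
    Continuous fun z : ℝ => G ap am (z + s) * G ap am (-z + s) * exp (I * alpha ap am * z * w) := by
  have h1 := continuous_G_line hap ham (c := 1) (by simp) hs
  have h2 := continuous_G_line hap ham (c := -1) (by simp) hs
  simp only [one_mul, neg_mul] at h1 h2
  exact (h1.mul h2).mul (by fun_prop)

theorem norm_betaKer_le {K : ℝ} {s w : ℂ} {z : ℝ}
    (h : ‖G ap am (z + s) * G ap am (-z + s)‖ ≤ K * Real.exp (alpha ap am * (s.im * |z|))) :
    ‖G ap am (z + s) * G ap am (-z + s) * exp (I * alpha ap am * z * w)‖ ≤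
      K * Real.exp (alpha ap am * (s.im * |z|)) * Real.exp (-(alpha ap am * (z * w.im))) := by
  rw [norm_mul, norm_exp_alpha]
  simp only [ofReal_re, ofReal_im, zero_mul, add_zero]
  gcongr

theorem exp_neg_alpha_le (hα : 0 < alpha ap am) {c z t : ℝ} (hc : |t| ≤ c) :
    Real.exp (-(alpha ap am * (z * t))) ≤ Real.exp (alpha ap am * (c * |z|)) := by
  refine Real.exp_le_exp.2 ?_
  rw [← mul_neg]
  refine mul_le_mul_of_nonneg_left ?_ hα.le
  refine (neg_le_abs _).trans ?_
  rw [abs_mul, mul_comm]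
  exact mul_le_mul_of_nonneg_right hc (abs_nonneg _)

/-- Numbers c1 < c2 are inserted between |Im w| and -Im s. Hence `c1 - c2` is negative if c1 is the
smaller; the code takes |Im w| < c2 < c1 < -Im s, which makes α(c1 - c2) a positive decay rate
common to a whole neighbourhood. -/
theorem differentiableAt_betaInt (hap : 0 < ap) (ham : 0 < am) {p : ℂ × ℂ}
    (h1 : -mid ap am < p.1.im) (h2 : |p.2.im| < -p.1.im) :
    DifferentiableAt ℂ (fun q : ℂ × ℂ => betaInt ap am q.1 q.2) p := by
  have hα := alpha_pos hap ham
  obtain ⟨v, hv1, hv2⟩ := exists_between (neg_lt.1 h1)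
  obtain ⟨c2, hc1, hc2⟩ := exists_between h2
  obtain ⟨c1, hc3, hc4⟩ := exists_between hc2
  obtain ⟨K, hK, hb⟩ := exists_norm_beta_le hap ham hv2 (|p.1.re| + 1)
  have hc20 : 0 ≤ c2 := (abs_nonneg _).trans hc1.le
  set U : Set (ℂ × ℂ) := {q | |q.1.re| < |p.1.re| + 1 ∧ -q.1.im < v ∧ c1 < -q.1.im ∧
    |q.2.im| < c2} with hU
  have o1 : IsOpen {q : ℂ × ℂ | |q.1.re| < |p.1.re| + 1} :=
    isOpen_lt (by fun_prop) continuous_const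
  have o2 : IsOpen {q : ℂ × ℂ | -q.1.im < v} := isOpen_lt (by fun_prop) continuous_const
  have o3 : IsOpen {q : ℂ × ℂ | c1 < -q.1.im} := isOpen_lt continuous_const (by fun_prop)
  have o4 : IsOpen {q : ℂ × ℂ | |q.2.im| < c2} := isOpen_lt (by fun_prop) continuous_const
  have hUo : IsOpen U := o1.inter (o2.inter (o3.inter o4))
  have hpU : p ∈ U := ⟨by simp, hv1, hc4, hc1⟩
  unfold betaInt
  refine differentiableAt_integral_prod (hUo.mem_nhds hpU)
    (B := fun z => K * Real.exp (-(alpha ap am * (c1 - c2) * |z|)))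
    ((integrable_exp_neg_mul_abs (by nlinarith : 0 < alpha ap am * (c1 - c2))).const_mul K)
    ?_ ?_ ?_
  · intro q hq
    exact (continuous_beta hap ham (by linarith [hq.2.1]) _).aestronglyMeasurable
  · refine Eventually.of_forall fun z q hq => ?_
    have h3 : ∀ c : ℂ, c.im = 0 →
        DifferentiableAt ℂ (fun q : ℂ × ℂ => G ap am (c * z + q.1)) q := by
      intro c hc
      have := (analyticAt_G hap ham (z := c * z + q.1) (neg_notMem_lattice_of_lt_im hap ham
        (by simp [hc]; linarith [hq.2.1]))).differentiableAt
      exact DifferentiableAt.comp (f := fun q : ℂ × ℂ => c * z + q.1) q this (by fun_prop)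
    have h4 := h3 1 (by simp)
    have h5 := h3 (-1) (by simp)
    simp only [one_mul, neg_mul] at h4 h5
    exact (h4.mul h5).mul (by fun_prop)
  · refine Eventually.of_forall fun z q hq => ?_
    have h3 := hb q.1 z hq.1.le (by linarith [hq.2.2.1]) (by simpa using hq.2.1.le)
    simp only [ofReal_re] at h3
    refine (norm_betaKer_le h3).trans ?_
    have h4 := exp_neg_alpha_le hα (z := z) hq.2.2.2.le
    calc _ ≤ K * Real.exp (alpha ap am * (-c1 * |z|)) * Real.exp (alpha ap am * (c2 * |z|)) := by
          gcongr
          linarith [hq.2.2.1]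
      _ = _ := by rw [mul_assoc, ← Real.exp_add]; ring_nf

theorem integrable_betaKer (hap : 0 < ap) (ham : 0 < am) {s w : ℂ}
    (h1 : -mid ap am < s.im) (h2 : |w.im| < -s.im) :
    Integrable fun z : ℝ => G ap am (z + s) * G ap am (-z + s) *
      exp (I * alpha ap am * z * w) := by
  have hα := alpha_pos hap ham
  obtain ⟨K, hK, hb⟩ := exists_norm_beta_le hap ham (neg_lt.1 h1) (|s.re|)
  refine integrable_of_exp_bound (C := K) (μ := alpha ap am * (-s.im - |w.im|))
    (mul_pos hα (by linarith)) (continuous_beta hap ham h1 _).aestronglyMeasurable fun z => ?_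
  have h3 := hb s z le_rfl (by linarith [abs_nonneg w.im]) (by simp)
  simp only [ofReal_re] at h3
  refine (norm_betaKer_le h3).trans ?_
  have h4 := exp_neg_alpha_le hα (z := z) (le_refl |w.im|)
  calc _ ≤ K * Real.exp (alpha ap am * (s.im * |z|)) *
        Real.exp (alpha ap am * (|w.im| * |z|)) := by gcongr
    _ = _ := by rw [mul_assoc, ← Real.exp_add]; ring_nf

theorem exists_norm_betaInt_le (hap : 0 < ap) (ham : 0 < am) {s : ℂ} {v : ℝ}
    (h1 : -mid ap am < s.im) (h2 : v < -s.im) :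
    ∃ C, ∀ w : ℂ, |w.im| ≤ v → ‖betaInt ap am s w‖ ≤ C := by
  have hα := alpha_pos hap ham
  obtain ⟨K, hK, hb⟩ := exists_norm_beta_le hap ham (neg_lt.1 h1) (|s.re|)
  refine ⟨∫ z : ℝ, K * Real.exp (-(alpha ap am * (-s.im - v) * |z|)), fun w hw => ?_⟩
  refine norm_integral_le_of_norm_le ((integrable_exp_neg_mul_abs
    (mul_pos hα (by linarith))).const_mul K) (Eventually.of_forall fun z => ?_)
  have h3 := hb s z le_rfl (by linarith [abs_nonneg w.im]) (by simp)
  simp only [ofReal_re] at h3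
  refine (norm_betaKer_le h3).trans ?_
  have h4 := exp_neg_alpha_le hα (z := z) hw
  calc _ ≤ K * Real.exp (alpha ap am * (s.im * |z|)) *
        Real.exp (alpha ap am * (v * |z|)) := by gcongr
    _ = _ := by rw [mul_assoc, ← Real.exp_add]; ring_nf

/-- The line is moved from Im z = -a₋δ/2 to Im z = a₋δ/2 for the integrand with s raised by half a
step (a₋δ being the parameter `par ap am (!δ)`). On each edge one gamma function is a full step too
high; the difference equation replaces it by 2 cosh, whose two exponentials move w by half a step up
or down. -/
theorem betaInt_shift (hap : 0 < ap) (ham : 0 < am) (δ : Bool) {s w : ℂ}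
    (h1 : -mid ap am < s.im) (h2 : |w.im| < -s.im - par ap am (!δ) / 2) :
    betaInt ap am s (w + step ap am δ / 2) * sd ap am δ (w + s + step ap am δ / 2) =
      -(betaInt ap am s (w - step ap am δ / 2) * sd ap am δ (w - s - step ap am δ / 2)) := by
  have hα := alpha_pos hap ham
  have hp := par_pos hap ham (!δ)
  have hαs := alpha_mul_step hap ham δ
  have hsim := step_im ap am δ
  have hsre := step_re ap am δ
  set q := par ap am δ with hq
  set p := par ap am (!δ) with hpdef
  set S := step ap am δ with hS
  have hSI : S = I * p := rfl
  set f : ℂ → ℂ := fun z => G ap am (z + (s + S / 2)) * G ap am (-z + (s + S / 2)) *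
    exp (I * alpha ap am * z * w) with hf
  have him : (s + S / 2).im = s.im + p / 2 := by simp [hSI]
  have habs : ∀ t : ℝ, t ∈ Icc (-(p / 2)) (p / 2) → |t| ≤ p / 2 := fun t ht => abs_le.2 ht
  have hw0 := abs_nonneg w.im
  obtain ⟨K, hK, hb⟩ := exists_norm_beta_le hap ham (neg_lt.1 h1) (|(s + S / 2).re|)
  have hline : (∫ r : ℝ, f (r + (-(p / 2) : ℝ) * I)) = ∫ r : ℝ, f (r + (p / 2 : ℝ) * I) := by
    refine integral_line_eq_of_exp_bound (C := K * Real.exp (alpha ap am * (p / 2 * |w.re|)))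
      (μ := alpha ap am * (-s.im - p / 2 - |w.im|)) (mul_pos hα (by linarith)) countable_empty
      (by linarith) ?_ ?_ ?_
    · intro z hz
      have hz' := habs _ hz
      exact ((analyticAt_beta hap ham (s := s + S / 2) (z := z)
        (by rw [him]; linarith)).continuousAt.mul (by fun_prop)).continuousWithinAt
    · intro z hz _
      have hz' := habs _ ⟨hz.1.le, hz.2.le⟩
      exact (analyticAt_beta hap ham (s := s + S / 2) (z := z)
        (by rw [him]; linarith)).differentiableAt.mul (by fun_prop)
    · intro r t ht
      have ht' := habs _ ht
      have i1 : ((r : ℂ) + t * I).re = r := by simp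
      have i2 : ((r : ℂ) + t * I).im = t := by simp
      have h3 := hb (s + S / 2) (r + t * I) le_rfl (by rw [him]; linarith)
        (by rw [him, i2]; linarith)
      rw [him, i1] at h3
      rw [hf]
      simp only
      rw [norm_mul, norm_exp_alpha, i1, i2]
      have h4 : Real.exp (-(alpha ap am * (r * w.im + t * w.re))) ≤
          Real.exp (alpha ap am * (|w.im| * |r|)) * Real.exp (alpha ap am * (p / 2 * |w.re|)) := by
        rw [mul_add, neg_add, Real.exp_add]
        refine mul_le_mul (exp_neg_alpha_le hα le_rfl) ?_ (Real.exp_pos _).le (Real.exp_pos _).le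
        rw [mul_comm t]
        exact exp_neg_alpha_le hα ht'
      calc _ ≤ (K * Real.exp (alpha ap am * ((s.im + p / 2) * |r|))) *
            (Real.exp (alpha ap am * (|w.im| * |r|)) *
              Real.exp (alpha ap am * (p / 2 * |w.re|))) := by gcongr
        _ = K * Real.exp (alpha ap am * (p / 2 * |w.re|)) *
            (Real.exp (alpha ap am * ((s.im + p / 2) * |r|)) *
              Real.exp (alpha ap am * (|w.im| * |r|))) := by ring
        _ = _ := by rw [← Real.exp_add]; ring_nf
  have hi1 := integrable_betaKer hap ham (s := s) (w := w + S / 2) h1 (by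
    have : (w + S / 2).im = w.im + p / 2 := by simp [hSI]
    rw [this]
    calc |w.im + p / 2| ≤ |w.im| + |p / 2| := abs_add_le _ _
      _ < _ := by rw [abs_of_pos (by positivity : 0 < p / 2)]; linarith)
  have hi2 := integrable_betaKer hap ham (s := s) (w := w - S / 2) h1 (by
    have : (w - S / 2).im = w.im - p / 2 := by simp [hSI]
    rw [this]
    calc |w.im - p / 2| ≤ |w.im| + |p / 2| := abs_sub _ _
      _ < _ := by rw [abs_of_pos (by positivity : 0 < p / 2)]; linarith)
  have hq0 : (q : ℂ) ≠ 0 := ofReal_ne_zero.2 (par_pos hap ham δ).ne'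
  have eu : (Real.pi : ℂ) / q = -(I * alpha ap am * S / 2) := by rw [hαs]; ring
  set κ : ℂ := (Real.pi : ℂ) / q with hκ
  have hcosh : ∀ u : ℂ, 2 * cd ap am δ u = exp (κ * u) + exp (-(κ * u)) := by
    intro u
    rw [cd, Complex.cosh, ← hq]
    have : (Real.pi : ℂ) * u / q = κ * u := by rw [hκ]; ring
    rw [this]; ring
  have hexp : ∀ a b c d e : ℂ, a + b = d + e → exp a * (c * exp b) = exp d * (c * exp e) := by
    intro a b c d e h
    calc _ = c * (exp a * exp b) := by ring
      _ = _ := by rw [← exp_add, h, exp_add]; ring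
  have hL : ∀ r : ℝ, f (r + (-(p / 2) : ℝ) * I) =
      exp (κ * (w - (s + S / 2))) * (G ap am (r + s) * G ap am (-r + s) *
        exp (I * alpha ap am * r * (w - S / 2))) +
      exp (κ * (w + (s + S / 2))) * (G ap am (r + s) * G ap am (-r + s) *
        exp (I * alpha ap am * r * (w + S / 2))) := by
    intro r
    have e1 : (r : ℂ) + (-(p / 2) : ℝ) * I + (s + S / 2) = r + s := by
      rw [hSI]; push_cast; ring
    have e2 : -((r : ℂ) + (-(p / 2) : ℝ) * I) + (s + S / 2) = (-r + s) + S := by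
      rw [hSI]; push_cast; ring
    have e3 : (r : ℂ) + (-(p / 2) : ℝ) * I = r - S / 2 := by rw [hSI]; push_cast; ring
    simp only [hf]
    rw [e1, e2, G_add_step hap ham δ (w := -r + s) (neg_notMem_lattice_of_lt_im hap ham
      (by simpa using h1)), hcosh, e3, ← hS]
    set g1 := G ap am (r + s)
    set g2 := G ap am (-r + s)
    have a1 := hexp (κ * (-↑r + s + S / 2)) (I * alpha ap am * (r - S / 2) * w) (g1 * g2)
      (κ * (w + (s + S / 2))) (I * alpha ap am * r * (w + S / 2)) (by rw [eu]; ring)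
    have a2 := hexp (-(κ * (-↑r + s + S / 2))) (I * alpha ap am * (r - S / 2) * w) (g1 * g2)
      (κ * (w - (s + S / 2))) (I * alpha ap am * r * (w - S / 2)) (by rw [eu]; ring)
    linear_combination a1 + a2
  have hR : ∀ r : ℝ, f (r + (p / 2 : ℝ) * I) =
      exp (-(κ * (w - (s + S / 2)))) * (G ap am (r + s) * G ap am (-r + s) *
        exp (I * alpha ap am * r * (w - S / 2))) +
      exp (-(κ * (w + (s + S / 2)))) * (G ap am (r + s) * G ap am (-r + s) *
        exp (I * alpha ap am * r * (w + S / 2))) := by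
    intro r
    have e1 : (r : ℂ) + (p / 2 : ℝ) * I + (s + S / 2) = (r + s) + S := by
      rw [hSI]; push_cast; ring
    have e2 : -((r : ℂ) + (p / 2 : ℝ) * I) + (s + S / 2) = -r + s := by
      rw [hSI]; push_cast; ring
    have e3 : (r : ℂ) + (p / 2 : ℝ) * I = r + S / 2 := by rw [hSI]; push_cast; ring
    simp only [hf]
    rw [e1, e2, G_add_step hap ham δ (w := r + s) (neg_notMem_lattice_of_lt_im hap ham
      (by simpa using h1)), hcosh, e3, ← hS]
    set g1 := G ap am (r + s)
    set g2 := G ap am (-r + s)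
    have a1 := hexp (κ * (↑r + s + S / 2)) (I * alpha ap am * (r + S / 2) * w) (g1 * g2)
      (-(κ * (w - (s + S / 2)))) (I * alpha ap am * r * (w - S / 2)) (by rw [eu]; ring)
    have a2 := hexp (-(κ * (↑r + s + S / 2))) (I * alpha ap am * (r + S / 2) * w) (g1 * g2)
      (-(κ * (w + (s + S / 2)))) (I * alpha ap am * r * (w + S / 2)) (by rw [eu]; ring)
    linear_combination a1 + a2
  rw [integral_congr_ae (Eventually.of_forall hL), integral_congr_ae (Eventually.of_forall hR),
    integral_add (hi2.const_mul _) (hi1.const_mul _),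
    integral_add (hi2.const_mul _) (hi1.const_mul _), integral_const_mul, integral_const_mul,
    integral_const_mul, integral_const_mul] at hline
  have hsinh : ∀ u : ℂ, 2 * sd ap am δ u = exp (κ * u) - exp (-(κ * u)) := by
    intro u
    rw [sd, Complex.sinh, ← hq]
    have : (Real.pi : ℂ) * u / q = κ * u := by rw [hκ]; ring
    rw [this]; ring
  have f1 := hsinh (w + s + S / 2)
  have f2 := hsinh (w - s - S / 2)
  have g1 : w + s + S / 2 = w + (s + S / 2) := by ring
  have g2 : w - s - S / 2 = w - (s + S / 2) := by ring
  rw [g1] at f1 ⊢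
  rw [g2] at f2 ⊢
  rw [betaInt, betaInt]
  linear_combination (1 / 2 : ℂ) * hline + (1 / 2 : ℂ) * (∫ z : ℝ, G ap am (z + s) *
    G ap am (-z + s) * exp (I * alpha ap am * z * (w + S / 2))) * f1 + (1 / 2 : ℂ) *
    (∫ z : ℝ, G ap am (z + s) * G ap am (-z + s) *
      exp (I * alpha ap am * z * (w - S / 2))) * f2

end RelToda

/-! ### Closed form of the Fourier transform of G(±z + s). -/

namespace RelToda

open Complex Set

variable {ap am : ℝ}

/-- The reciprocal of the Fourier transform of `G(± z + s)`, up to a constant. -/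
noncomputable def betaRec (ap am : ℝ) (s w : ℂ) : ℂ :=
  G ap am (w + s + I * mid ap am) * G ap am (-w + s + I * mid ap am)

theorem par_mul_par (ap am : ℝ) (δ : Bool) : par ap am δ * par ap am (!δ) = ap * am := by
  cases δ <;> simp [par, mul_comm]

theorem par_add_par (ap am : ℝ) (δ : Bool) : par ap am δ + par ap am (!δ) = 2 * mid ap am := by
  cases δ <;> simp [par, mid] <;> ring

theorem mul_abs_add_le {x r S v : ℝ} (hx : |x| ≤ v) : x * |r + S| ≤ x * |r| + v * |S| := by
  have h3 : |(|r + S| - |r|)| ≤ |S| := by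
    have := abs_abs_sub_abs_le (r + S) r
    simpa using this
  have h4 : x * (|r + S| - |r|) ≤ v * |S| := by
    refine (le_abs_self _).trans ?_
    rw [abs_mul]
    exact mul_le_mul hx h3 (abs_nonneg _) ((abs_nonneg _).trans hx)
  linarith

theorem analyticAt_betaRec (hap : 0 < ap) (ham : 0 < am) {s w : ℂ}
    (h1 : -mid ap am < s.im) (h2 : |w.im| < -s.im) :
    AnalyticAt ℂ (betaRec ap am s) w := by
  have hw := abs_lt.1 h2
  have a1 := analyticAt_G hap ham (z := w + s + I * mid ap am)
    (neg_notMem_lattice_of_lt_im hap ham (by simp; linarith))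
  have a2 := analyticAt_G hap ham (z := -w + s + I * mid ap am)
    (neg_notMem_lattice_of_lt_im hap ham (by simp; linarith))
  exact (a1.fun_comp_of_eq (f := fun w => w + s + I * mid ap am) (by fun_prop) rfl).mul
    (a2.fun_comp_of_eq (f := fun w => -w + s + I * mid ap am) (by fun_prop) rfl)

/-- The difference equation of each factor gives one sine. Compared with `betaInt_shift` the sines
have changed places, so the product of the two functions is periodic. -/
theorem betaRec_shift (hap : 0 < ap) (ham : 0 < am) (δ : Bool) {s w : ℂ}
    (h1 : -mid ap am < s.im) (h2 : |w.im| < -s.im - par ap am (!δ) / 2) :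
    betaRec ap am s (w + step ap am δ / 2) * sd ap am δ (w - s - step ap am δ / 2) =
      -(betaRec ap am s (w - step ap am δ / 2) * sd ap am δ (w + s + step ap am δ / 2)) := by
  have hw := abs_lt.1 h2
  have hp := par_pos hap ham (!δ)
  have hsum := par_add_par ap am δ
  have hsim := step_im ap am δ
  have e0 : I * (mid ap am : ℂ) = step ap am δ / 2 + I * par ap am δ / 2 := by
    have : (mid ap am : ℂ) = (par ap am δ + par ap am (!δ)) / 2 := by
      rw [← ofReal_add, hsum]; push_cast; ring
    rw [this, step]; ring
  set S := step ap am δ with hS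
  have him2 : (S / 2).im = par ap am (!δ) / 2 := by
    have : S / 2 = I * ((par ap am (!δ) / 2 : ℝ) : ℂ) := by rw [hS, step]; push_cast; ring
    rw [this]; simp [-ofReal_div]
  have b1 := G_add_step hap ham δ (w := w + s + I * mid ap am - S / 2)
    (neg_notMem_lattice_of_lt_im hap ham (by simp [him2, -ofReal_div]; linarith))
  have b2 := G_add_step hap ham δ (w := -w + s + I * mid ap am - S / 2)
    (neg_notMem_lattice_of_lt_im hap ham (by simp [him2, -ofReal_div]; linarith))
  have e1 : w + s + I * mid ap am - S / 2 + S = w + S / 2 + s + I * mid ap am := by ring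
  have e2 : -w + s + I * mid ap am - S / 2 + S = -(w - S / 2) + s + I * mid ap am := by ring
  have e3 : w + s + I * mid ap am - S / 2 = w - S / 2 + s + I * mid ap am := by ring
  have e4 : -w + s + I * mid ap am - S / 2 = -(w + S / 2) + s + I * mid ap am := by ring
  rw [← hS, e1, e3] at b1
  rw [← hS, e2, e4] at b2
  have hq0 : (par ap am δ : ℂ) ≠ 0 := ofReal_ne_zero.2 (par_pos hap ham δ).ne'
  have hc : ∀ u : ℂ, cd ap am δ (u + I * par ap am δ / 2) = I * sd ap am δ u := by
    intro u
    have : (Real.pi : ℂ) * (u + I * par ap am δ / 2) / par ap am δ =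
        Real.pi * u / par ap am δ + Real.pi / 2 * I := by
      field_simp
    rw [cd, this, Complex.cosh_add, cosh_mul_I, sinh_mul_I, Complex.cos_pi_div_two,
      Complex.sin_pi_div_two, sd]
    ring
  have c1 : cd ap am δ (w - S / 2 + s + I * mid ap am + S / 2) =
      I * sd ap am δ (w + s + S / 2) := by
    rw [← hc]; congr 1; rw [e0]; ring
  have c2 : cd ap am δ (-(w + S / 2) + s + I * mid ap am + S / 2) =
      -(I * sd ap am δ (w - s - S / 2)) := by
    have : -(w + S / 2) + s + I * mid ap am + S / 2 =
        -(w - s - S / 2) + I * par ap am δ / 2 := by rw [e0]; ring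
    rw [this, hc]
    have : sd ap am δ (-(w - s - S / 2)) = -sd ap am δ (w - s - S / 2) := by
      rw [sd, sd, ← Complex.sinh_neg]; congr 1; ring
    rw [this]; ring
  rw [c1] at b1
  rw [c2] at b2
  rw [betaRec, betaRec, b1, b2]
  ring

theorem exists_norm_betaRec_le (hap : 0 < ap) (ham : 0 < am) {s : ℂ} {v : ℝ}
    (h1 : -mid ap am < s.im) (h2 : v < -s.im) :
    ∃ C, ∀ w : ℂ, |w.im| ≤ v →
      ‖betaRec ap am s w‖ ≤ C * Real.exp (alpha ap am * (mid ap am + s.im) * |w.re|) := by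
  have hα := alpha_pos hap ham
  set x := mid ap am + s.im with hx
  have hx0 : 0 < x := by linarith
  obtain ⟨K, hK, h⟩ := exists_norm_G_le_upper hap ham (v := v - x) (by linarith) (x + v)
  refine ⟨K * K * Real.exp (alpha ap am * ((x + v) * |s.re|)), fun w hw => ?_⟩
  have hw' := abs_le.1 hw
  have i1 : (w + s + I * mid ap am).im = x + w.im := by simp [hx]; ring
  have i2 : (-w + s + I * mid ap am).im = x - w.im := by simp [hx]; ring
  have r1 : (w + s + I * mid ap am).re = w.re + s.re := by simp
  have r2 : (-w + s + I * mid ap am).re = -w.re + s.re := by simp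
  have b1 := h (w + s + I * mid ap am) (by rw [i1]; linarith) (by rw [i1]; linarith)
  have b2 := h (-w + s + I * mid ap am) (by rw [i2]; linarith) (by rw [i2]; linarith)
  rw [i1, r1] at b1
  rw [i2, r2] at b2
  have k1 := mul_abs_add_le (x := x + w.im) (r := w.re) (S := s.re) (v := x + v)
    (abs_le.2 ⟨by linarith, by linarith⟩)
  have k2 := mul_abs_add_le (x := x - w.im) (r := -w.re) (S := s.re) (v := x + v)
    (abs_le.2 ⟨by linarith, by linarith⟩)
  rw [abs_neg] at k2
  rw [betaRec, norm_mul]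
  calc _ ≤ (K * Real.exp (alpha ap am / 2 * ((x + w.im) * |w.re + s.re|))) *
        (K * Real.exp (alpha ap am / 2 * ((x - w.im) * |-w.re + s.re|))) :=
        mul_le_mul b1 b2 (norm_nonneg _) (by positivity)
    _ = K * K * Real.exp (alpha ap am / 2 * ((x + w.im) * |w.re + s.re| +
          (x - w.im) * |-w.re + s.re|)) := by
        rw [mul_mul_mul_comm, ← Real.exp_add]; ring_nf
    _ ≤ K * K * Real.exp (alpha ap am / 2 * (2 * (x * |w.re|) + 2 * ((x + v) * |s.re|))) := by
        refine mul_le_mul_of_nonneg_left (Real.exp_le_exp.2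
          (mul_le_mul_of_nonneg_left ?_ (by positivity))) (by positivity)
        linarith
    _ = _ := by
        rw [mul_assoc (K * K), ← Real.exp_add]; ring_nf

/-- The product is periodic with period `step ap am δ`. The transform is bounded and `betaRec` grows
at the rate α(a + Im s), below the critical 2π/period = α · `par ap am δ`; so the product is
constant. The second hypothesis makes the strip higher than one period. -/
theorem exists_betaInt_mul_betaRec (hap : 0 < ap) (ham : 0 < am) (δ : Bool) {s : ℂ}
    (h1 : -mid ap am < s.im) (h2 : par ap am (!δ) / 2 < -s.im) :
    ∃ k, ∀ w : ℂ, |w.im| < -s.im → betaInt ap am s w * betaRec ap am s w = k := by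
  have hα := alpha_pos hap ham
  have hp := par_pos hap ham (!δ)
  have hq := par_pos hap ham δ
  have hsum := par_add_par ap am δ
  obtain ⟨C₁, hC₁⟩ := exists_norm_betaInt_le hap ham h1 h2
  obtain ⟨C₂, hC₂⟩ := exists_norm_betaRec_le hap ham h1 h2
  have hC₁0 : 0 ≤ C₁ := (norm_nonneg _).trans (hC₁ 0 (by simpa using (by positivity)))
  refine eq_of_periodic_strip (T := par ap am (!δ)) (c := -s.im) (C := C₁ * C₂)
    (κ := alpha ap am * (mid ap am + s.im)) hp h2 ?_ ?_ ?_ ?_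
  · intro w hw
    refine DifferentiableAt.mul ?_ (analyticAt_betaRec hap ham h1 hw).differentiableAt
    have := differentiableAt_betaInt hap ham (p := (s, w)) h1 hw
    exact DifferentiableAt.comp (f := fun w : ℂ => (s, w)) w this (by fun_prop)
  · intro w hw
    have hw' := abs_lt.1 hw
    have e : (par ap am (!δ) : ℂ) / 2 * I = step ap am δ / 2 := by rw [step]; ring
    have b1 := betaInt_shift hap ham δ h1 hw
    have b2 := betaRec_shift hap ham δ h1 hw
    have hS : (step ap am δ / 2).im = par ap am (!δ) / 2 := by
      rw [← e]; simp
    rw [e]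
    have key : ∀ B₁ B₂ P₁ P₂ x y : ℂ, B₁ * x = -(B₂ * y) → P₁ * y = -(P₂ * x) → x ≠ 0 →
        y ≠ 0 → B₁ * P₁ = B₂ * P₂ := by
      intro B₁ B₂ P₁ P₂ x y ha hb hx hy
      refine mul_right_cancel₀ (mul_ne_zero hx hy) ?_
      linear_combination (P₁ * y) * ha - (B₂ * y) * hb
    have hnz : ∀ u : ℂ, u.im ≠ 0 → |u.im| < par ap am δ → sd ap am δ u ≠ 0 := by
      intro u hu hu' h0
      obtain ⟨k, rfl⟩ := (sd_eq_zero_iff hap ham).1 h0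
      have : (k * (I * par ap am δ) : ℂ).im = k * par ap am δ := by simp
      rw [this] at hu hu'
      have hk : k ≠ 0 := by rintro rfl; simp at hu
      have h3 : (1 : ℝ) ≤ |(k : ℝ)| := by exact_mod_cast Int.one_le_abs hk
      rw [abs_mul, abs_of_pos hq] at hu'
      nlinarith
    refine key _ _ _ _ _ _ b1 b2 (hnz _ ?_ ?_) (hnz _ ?_ ?_)
    · rw [add_im, add_im, hS]; linarith
    · rw [add_im, add_im, hS, abs_lt]; constructor <;> linarith
    · rw [sub_im, sub_im, hS]; linarith
    · rw [sub_im, sub_im, hS, abs_lt]; constructor <;> linarith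
  · have e : 2 * Real.pi / par ap am (!δ) = alpha ap am * par ap am δ := by
      rw [alpha, ← par_mul_par ap am δ]; field_simp
    rw [e]
    exact mul_lt_mul_of_pos_left (by linarith) hα
  · intro w hw
    rw [norm_mul, mul_assoc]
    exact mul_le_mul (hC₁ w hw) (hC₂ w hw) (norm_nonneg _) hC₁0

theorem integral_exp_mul_Iio {c : ℝ} (hc : 0 < c) :
    ∫ t in Iio (0 : ℝ), Real.exp (c * t) = 1 / c := by
  rw [← integral_Iic_eq_integral_Iio, integral_exp_mul_Iic hc]; simp

/-- At w = -s - iν the integrand behaves like exp(ανz) for z → -∞ and decays at +∞. So the transform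
diverges like 1/(αν) as ν → 0, which is enough to fix the constant. -/
theorem tendsto_mul_betaInt (hap : 0 < ap) (ham : 0 < am) {s : ℂ}
    (h1 : -mid ap am < s.im) (h2 : s.im < 0) :
    Tendsto (fun ν : ℝ => (ν : ℂ) * betaInt ap am s (-s - I * ν)) (𝓝[>] 0)
      (𝓝 (1 / alpha ap am)) := by
  have hα := alpha_pos hap ham
  obtain ⟨K, hK, hb⟩ := exists_norm_beta_le hap ham (neg_lt.1 h1) (|s.re|)
  set F : ℝ → ℂ := fun z => G ap am (z + s) * G ap am (-z + s) *
    exp (I * alpha ap am * z * (-s)) with hF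
  have hFc : Continuous F := continuous_beta hap ham h1 _
  have hFle : ∀ r : ℝ, ‖F r‖ ≤ K * Real.exp (alpha ap am * (s.im * |r| + r * s.im)) := by
    intro r
    have h3 := hb s r le_rfl (by linarith) (by simp)
    simp only [ofReal_re] at h3
    refine (norm_betaKer_le h3).trans (le_of_eq ?_)
    rw [mul_assoc, ← Real.exp_add, neg_im]; ring_nf
  -- Substituting z = t/ν absorbs the factor ν and leaves the fixed weight exp(αt), with F rescaled
  -- to its limits at ±∞.
  have hint : ∀ ν : ℝ, 0 < ν → (ν : ℂ) * betaInt ap am s (-s - I * ν) =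
      ∫ t : ℝ, F (t / ν) * Real.exp (alpha ap am * t) := by
    intro ν hν
    have h3 := Measure.integral_comp_div
      (fun z : ℝ => F z * Real.exp (alpha ap am * (z * ν))) ν
    rw [abs_of_pos hν] at h3
    have h4 : betaInt ap am s (-s - I * ν) =
        ∫ z : ℝ, F z * Real.exp (alpha ap am * (z * ν)) := by
      rw [betaInt]
      refine integral_congr_ae (Eventually.of_forall fun z => ?_)
      simp only [hF]
      rw [mul_assoc (G ap am (z + s) * G ap am (-z + s)), ofReal_exp, ← exp_add]
      congr 2
      push_cast
      linear_combination (-(alpha ap am * z * ν : ℂ)) * I_sq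
    rw [h4]
    rw [real_smul] at h3
    rw [← h3]
    refine integral_congr_ae (Eventually.of_forall fun t => ?_)
    simp only
    rw [div_mul_cancel₀ _ hν.ne']
  have hlimneg : ∀ t : ℝ, t < 0 → Tendsto (fun ν : ℝ => F (t / ν)) (𝓝[>] 0) (𝓝 1) := by
    intro t ht
    -- For z → -∞ the factor G(z + s) is compared with G_L and G(-z + s) with G_R; the two Gaussians
    -- cancel exp(-iαzs), so F tends to 1.
    have hF1 : ∀ r : ℝ, F r = (starRingEnd ℂ) (GRight ap am (-(starRingEnd ℂ) s + (-r : ℝ))) *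
        GRight ap am (s + (-r : ℝ)) := by
      intro r
      rw [conj_GRight]
      have e : -(starRingEnd ℂ) (-(starRingEnd ℂ) s + ((-r : ℝ) : ℂ)) = r + s := by
        simp
      rw [e, GLeft, GRight]
      simp only [hF]
      have e2 : -(r : ℂ) + s = s + (-r : ℝ) := by push_cast; ring
      rw [e2, mul_mul_mul_comm, ← exp_add]
      congr 2
      push_cast; ring
    have hs : |s.im| < mid ap am := by rw [abs_of_neg h2]; linarith
    have h3 := tendsto_GRight_add hap ham (z := -(starRingEnd ℂ) s) (by simpa using hs)
    have h4 := tendsto_GRight_add hap ham (z := s) hs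
    have h5 : Tendsto (fun ν : ℝ => -(t / ν)) (𝓝[>] 0) atTop := by
      have : (fun ν : ℝ => -(t / ν)) = fun ν => -t * ν⁻¹ := by funext ν; ring
      rw [this]
      exact tendsto_inv_nhdsGT_zero.const_mul_atTop (by linarith)
    have h6 := (((continuous_conj.tendsto 1).comp h3).mul h4).comp h5
    simp only [map_one, mul_one] at h6
    refine h6.congr fun ν => ?_
    rw [hF1]; rfl
  have hlimpos : ∀ t : ℝ, 0 < t → Tendsto (fun ν : ℝ => F (t / ν)) (𝓝[>] 0) (𝓝 0) := by
    intro t ht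
    have h5 : Tendsto (fun ν : ℝ => t / ν) (𝓝[>] 0) atTop := by
      have : (fun ν : ℝ => t / ν) = fun ν => t * ν⁻¹ := by funext ν; ring
      rw [this]
      exact tendsto_inv_nhdsGT_zero.const_mul_atTop ht
    have h6 : Tendsto F atTop (𝓝 0) := by
      refine squeeze_zero_norm' ?_ (tendsto_const_mul_exp_neg
        (mul_pos (mul_pos two_pos hα) (neg_pos.2 h2)) K)
      filter_upwards [eventually_ge_atTop 0] with r hr
      refine (hFle r).trans (le_of_eq ?_)
      rw [abs_of_nonneg hr]; ring_nf
    exact h6.comp h5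
  have hlim : Tendsto (fun ν : ℝ => ∫ t : ℝ, F (t / ν) * Real.exp (alpha ap am * t)) (𝓝[>] 0)
      (𝓝 (∫ t : ℝ, (Iio (0 : ℝ)).indicator (fun t => (Real.exp (alpha ap am * t) : ℂ)) t)) := by
    refine tendsto_integral_filter_of_dominated_convergence
      (fun t => K * Real.exp (-(alpha ap am * |t|))) ?_ ?_
      ((integrable_exp_neg_mul_abs hα).const_mul K) ?_
    · refine Eventually.of_forall fun ν => Continuous.aestronglyMeasurable ?_
      exact (hFc.comp (by fun_prop)).mul (by fun_prop)
    · filter_upwards [Ioc_mem_nhdsGT (neg_pos.2 h2)] with ν hν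
      refine Eventually.of_forall fun t => ?_
      rw [norm_mul, norm_real, Real.norm_of_nonneg (Real.exp_pos _).le]
      refine (mul_le_mul_of_nonneg_right (hFle _) (Real.exp_pos _).le).trans ?_
      rw [mul_assoc, ← Real.exp_add]
      refine mul_le_mul_of_nonneg_left (Real.exp_le_exp.2 ?_) hK.le
      rw [← mul_add, ← mul_neg]
      refine mul_le_mul_of_nonneg_left ?_ hα.le
      rw [abs_div, abs_of_pos hν.1]
      rcases le_total t 0 with ht | ht
      · rw [abs_of_nonpos ht]
        have : s.im * (-t / ν) + t / ν * s.im = 0 := by ring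
        linarith
      · rw [abs_of_nonneg ht]
        have : t ≤ t / ν * (-s.im) := by
          rw [div_mul_eq_mul_div, le_div_iff₀ hν.1]
          exact mul_le_mul_of_nonneg_left hν.2 ht
        linarith
    · have h0 : ∀ᵐ t : ℝ, t ≠ 0 := by simp [ae_iff]
      filter_upwards [h0] with t ht
      rcases lt_or_gt_of_ne ht with h | h
      · rw [indicator_of_mem (show t ∈ Iio (0 : ℝ) from h)]
        simpa using (hlimneg t h).mul_const (Real.exp (alpha ap am * t) : ℂ)
      · rw [indicator_of_notMem (show t ∉ Iio (0 : ℝ) from not_lt.2 h.le)]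
        simpa using (hlimpos t h).mul_const (Real.exp (alpha ap am * t) : ℂ)
  have hval : ∫ t : ℝ, (Iio (0 : ℝ)).indicator (fun t => (Real.exp (alpha ap am * t) : ℂ)) t =
      1 / alpha ap am := by
    rw [integral_indicator measurableSet_Iio, integral_complex_ofReal, integral_exp_mul_Iio hα]
    push_cast; ring
  rw [hval] at hlim
  refine hlim.congr' ?_
  filter_upwards [self_mem_nhdsWithin] with ν hν
  exact (hint ν hν).symm

/-- The simple zero of G at ia is the reflection of the simple pole at -ia, and its slope comes from
the residue there. -/
theorem tendsto_G_mid_div (hap : 0 < ap) (ham : 0 < am) :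
    Tendsto (fun ν : ℝ => G ap am (I * mid ap am - I * ν) / ν) (𝓝[>] 0)
      (𝓝 (2 * Real.pi / Real.sqrt (ap * am))) := by
  have hm := mid_pos hap ham
  have h1 : Tendsto (fun ν : ℝ => I * (ν : ℂ)) (𝓝[>] 0) (𝓝[≠] 0) := by
    refine tendsto_nhdsWithin_iff.2 ⟨?_, ?_⟩
    · have : Continuous fun ν : ℝ => I * (ν : ℂ) := by fun_prop
      exact (this.tendsto' 0 0 (by simp)).mono_left nhdsWithin_le_nhds
    · filter_upwards [self_mem_nhdsWithin] with y hy
      exact mul_ne_zero I_ne_zero (ofReal_ne_zero.2 (ne_of_gt hy))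
  have hsq : (Real.sqrt (ap * am) : ℂ) ≠ 0 :=
    ofReal_ne_zero.2 (Real.sqrt_pos.2 (by positivity)).ne'
  have hpi : (Real.pi : ℂ) ≠ 0 := ofReal_ne_zero.2 Real.pi_ne_zero
  have h2 := (((tendsto_mul_G_sub_mid hap ham).comp h1).inv₀ (by
    simp [hsq, hpi])).const_mul I
  have e : I * (I * (Real.sqrt (ap * am) : ℂ) / (2 * Real.pi))⁻¹ =
      2 * Real.pi / Real.sqrt (ap * am) := by
    field_simp
  rw [e] at h2
  refine h2.congr' ?_
  filter_upwards [Ioo_mem_nhdsGT hm] with ν hν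
  have hν0 : (ν : ℂ) ≠ 0 := ofReal_ne_zero.2 hν.1.ne'
  have h3 := G_mul_neg hap ham (z := I * mid ap am - I * ν)
    (notMem_lattice_of_im_lt hap ham (by simp; exact hν.1))
    (neg_notMem_lattice_of_lt_im hap ham (by simp; linarith [hν.2]))
  have e2 : -(I * mid ap am - I * ν) = I * (ν : ℂ) - I * mid ap am := by ring
  rw [e2] at h3
  have h4 : G ap am (I * (ν : ℂ) - I * mid ap am) ≠ 0 := right_ne_zero_of_mul_eq_one h3
  simp only [Function.comp]
  rw [eq_div_iff hν0, eq_comm, ← mul_right_inj' h4, mul_comm, h3]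
  generalize G ap am (I * (ν : ℂ) - I * mid ap am) = x at h4
  field_simp

/-- At w = -s - iν the zero of G(ia - iν) cancels the divergence 1/(αν) of the transform, and ν → 0
evaluates the constant. -/
theorem betaInt_mul_betaRec_of_lt (hap : 0 < ap) (ham : 0 < am) (δ : Bool) {s w : ℂ}
    (h1 : -mid ap am < s.im) (h2 : par ap am (!δ) / 2 < -s.im) (hw : |w.im| < -s.im) :
    betaInt ap am s w * betaRec ap am s w =
      Real.sqrt (ap * am) * G ap am (2 * s + I * mid ap am) := by
  have hp := par_pos hap ham (!δ)
  have hm := mid_pos hap ham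
  have hα := alpha_pos hap ham
  obtain ⟨k, hk⟩ := exists_betaInt_mul_betaRec hap ham δ h1 h2
  rw [hk w hw]
  have h3 := tendsto_mul_betaInt hap ham h1 (by linarith)
  have h4 := tendsto_G_mid_div hap ham
  have h5 : Tendsto (fun ν : ℝ => G ap am (2 * s + I * mid ap am + I * ν)) (𝓝[>] 0)
      (𝓝 (G ap am (2 * s + I * mid ap am))) := by
    have h6 : ContinuousAt (G ap am) (2 * s + I * mid ap am) := (analyticAt_G hap ham
      (neg_notMem_lattice_of_lt_im hap ham (by simp; linarith))).continuousAt
    have h7 : Tendsto (fun ν : ℝ => 2 * s + I * mid ap am + I * (ν : ℂ)) (𝓝[>] 0)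
        (𝓝 (2 * s + I * mid ap am)) := by
      have : Continuous fun ν : ℝ => 2 * s + I * mid ap am + I * (ν : ℂ) := by fun_prop
      exact (this.tendsto' 0 _ (by simp)).mono_left nhdsWithin_le_nhds
    exact h6.tendsto.comp h7
  have h8 := (h3.mul h4).mul h5
  have e : 1 / (alpha ap am : ℂ) * (2 * Real.pi / Real.sqrt (ap * am)) =
      Real.sqrt (ap * am) := by
    have hsq : Real.sqrt (ap * am) ≠ 0 := (Real.sqrt_pos.2 (by positivity)).ne'
    have : 1 / alpha ap am * (2 * Real.pi / Real.sqrt (ap * am)) = Real.sqrt (ap * am) := by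
      rw [alpha]
      have hpi := Real.pi_ne_zero
      have := Real.mul_self_sqrt (by positivity : 0 ≤ ap * am)
      field_simp
      rw [sq, this]
    exact_mod_cast this
  rw [e] at h8
  refine tendsto_nhds_unique (tendsto_const_nhds.congr' ?_) h8
  filter_upwards [Ioo_mem_nhdsGT (by linarith : 0 < -s.im)] with ν hν
  have hν0 : (ν : ℂ) ≠ 0 := ofReal_ne_zero.2 hν.1.ne'
  rw [← hk (-s - I * ν) (by
    have : (-s - I * (ν : ℂ)).im = -s.im - ν := by simp
    rw [this, abs_lt]; constructor <;> linarith [hν.1, hν.2]), betaRec]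
  have e1 : -s - I * (ν : ℂ) + s + I * mid ap am = I * mid ap am - I * ν := by ring
  have e2 : -(-s - I * (ν : ℂ)) + s + I * mid ap am = 2 * s + I * mid ap am + I * ν := by ring
  rw [e1, e2]
  field_simp

theorem betaInt_mul_betaRec (hap : 0 < ap) (ham : 0 < am) {s w : ℂ}
    (h1 : -mid ap am < s.im) (h2 : s.im ≤ -(mid ap am / 2)) (hw : |w.im| < -s.im) :
    betaInt ap am s w * betaRec ap am s w =
      Real.sqrt (ap * am) * G ap am (2 * s + I * mid ap am) := by
  -- The smaller of the two parameters is at most a, so half of it is at most -Im s. The strict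
  -- inequality needed above may still fail at Im s = -a/2; it holds for s - it, and t → 0 recovers
  -- s.
  obtain ⟨δ, hδ⟩ : ∃ δ : Bool, par ap am (!δ) ≤ mid ap am := by
    rcases le_total ap am with h | h
    · exact ⟨false, by simp [par, mid]; linarith⟩
    · exact ⟨true, by simp [par, mid]; linarith⟩
  have hm := mid_pos hap ham
  have hw' := abs_lt.1 hw
  have hc : Tendsto (fun t : ℝ => s - I * (t : ℂ)) (𝓝[>] 0) (𝓝 s) := by
    have : Continuous fun t : ℝ => s - I * (t : ℂ) := by fun_prop
    exact (this.tendsto' 0 _ (by simp)).mono_left nhdsWithin_le_nhds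
  have a1 : ContinuousAt (fun s => betaInt ap am s w) s :=
    (DifferentiableAt.comp (f := fun s : ℂ => (s, w)) s
      (differentiableAt_betaInt hap ham (p := (s, w)) h1 hw) (by fun_prop)).continuousAt
  have a2 : ContinuousAt (fun s => betaRec ap am s w) s := by
    have b1 := analyticAt_G hap ham (z := w + s + I * mid ap am)
      (neg_notMem_lattice_of_lt_im hap ham (by simp; linarith))
    have b2 := analyticAt_G hap ham (z := -w + s + I * mid ap am)
      (neg_notMem_lattice_of_lt_im hap ham (by simp; linarith))
    exact (ContinuousAt.comp (f := fun s => w + s + I * mid ap am) b1.continuousAt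
      (by fun_prop)).mul (ContinuousAt.comp (f := fun s => -w + s + I * mid ap am)
        b2.continuousAt (by fun_prop))
  have a3 : ContinuousAt (fun s => G ap am (2 * s + I * mid ap am)) s :=
    ContinuousAt.comp (f := fun s => 2 * s + I * mid ap am) (analyticAt_G hap ham
      (neg_notMem_lattice_of_lt_im hap ham (by simp; linarith))).continuousAt (by fun_prop)
  have l1 := (a1.mul a2).tendsto.comp hc
  have l2 := (a3.tendsto.comp hc).const_mul (Real.sqrt (ap * am) : ℂ)
  refine tendsto_nhds_unique (l1.congr' ?_) l2
  filter_upwards [Ioo_mem_nhdsGT (by linarith : 0 < s.im + mid ap am)] with t ht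
  have i1 : (s - I * (t : ℂ)).im = s.im - t := by simp
  exact betaInt_mul_betaRec_of_lt hap ham δ (by rw [i1]; linarith [ht.2])
    (by rw [i1]; linarith [ht.1]) (by rw [i1]; linarith [ht.1])

/-- The Fourier transform of `G(± z + s)`. -/
theorem betaInt_eq (hap : 0 < ap) (ham : 0 < am) {s w : ℂ}
    (h1 : -mid ap am < s.im) (h2 : s.im ≤ -(mid ap am / 2)) (hw : |w.im| < -s.im) :
    betaInt ap am s w = Real.sqrt (ap * am) * G ap am (2 * s + I * mid ap am) *
      (G ap am (w - s - I * mid ap am) * G ap am (-w - s - I * mid ap am)) := by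
  have hw' := abs_lt.1 hw
  have hm := mid_pos hap ham
  rw [← betaInt_mul_betaRec hap ham h1 h2 hw, betaRec]
  have b1 := G_mul_neg hap ham (z := w + s + I * mid ap am)
    (notMem_lattice_of_im_lt hap ham (by simp; linarith))
    (neg_notMem_lattice_of_lt_im hap ham (by simp; linarith))
  have b2 := G_mul_neg hap ham (z := -w + s + I * mid ap am)
    (notMem_lattice_of_im_lt hap ham (by simp; linarith))
    (neg_notMem_lattice_of_lt_im hap ham (by simp; linarith))
  have e1 : -(w + s + I * mid ap am) = -w - s - I * mid ap am := by ring
  have e2 : -(-w + s + I * mid ap am) = w - s - I * mid ap am := by ring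
  rw [e1] at b1
  rw [e2] at b2
  linear_combination (-(betaInt ap am s w)) * b1 - betaInt ap am s w *
    (G ap am (w + s + I * mid ap am) * G ap am (-w - s - I * mid ap am)) * b2

end RelToda

/-! ### The Fourier transform of G_R, and the passage from `kerR` to `kerPlus`. -/

namespace RelToda

open Complex Set

variable {ap am : ℝ}

theorem exists_norm_GRight_le (hap : 0 < ap) (ham : 0 < am) {v : ℝ} (hv : v < mid ap am) (Y : ℝ) :
    ∃ K, 0 < K ∧ ∀ z : ℂ, -v ≤ z.im → z.im ≤ Y →
      ‖GRight ap am z‖ ≤ K * Real.exp (alpha ap am / 2 * (z.im * (|z.re| - z.re))) := by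
  obtain ⟨K, hK, h⟩ := exists_norm_G_le_upper hap ham hv Y
  refine ⟨K, hK, fun z h1 h2 => ?_⟩
  have h3 := h z h1 h2
  rw [norm_G_eq_GRight] at h3
  have h4 := mul_le_mul_of_nonneg_right h3
    (Real.exp_pos (-(alpha ap am / 2 * (z.im * z.re)))).le
  rw [mul_assoc, mul_assoc, ← Real.exp_add, ← Real.exp_add, add_neg_cancel, Real.exp_zero,
    mul_one] at h4
  refine h4.trans (le_of_eq ?_)
  ring_nf

theorem GLeft_eq_conj (ap am : ℝ) (z : ℂ) :
    GLeft ap am z = (starRingEnd ℂ) (GRight ap am (-(starRingEnd ℂ) z)) := by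
  rw [conj_GRight]; simp

/-- `G_R(t - ia/2)`. -/
noncomputable def rKer (ap am : ℝ) (t : ℝ) : ℂ := GRight ap am (t - I * mid ap am / 2)

theorem im_sub_half_mid (t : ℝ) : ((t : ℂ) - I * mid ap am / 2).im = -(mid ap am / 2) := by
  have : (t : ℂ) - I * mid ap am / 2 = t - I * ((mid ap am / 2 : ℝ) : ℂ) := by push_cast; ring
  rw [this]; simp [-ofReal_div]

theorem re_sub_half_mid (t : ℝ) : ((t : ℂ) - I * mid ap am / 2).re = t := by
  have : (t : ℂ) - I * mid ap am / 2 = t - I * ((mid ap am / 2 : ℝ) : ℂ) := by push_cast; ring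
  rw [this]; simp [-ofReal_div]

theorem continuous_rKer (hap : 0 < ap) (ham : 0 < am) : Continuous (rKer ap am) := by
  rw [continuous_iff_continuousAt]
  intro t
  have hm := mid_pos hap ham
  have h1 := (analyticAt_GRight hap ham (z := t - I * mid ap am / 2)
    (neg_notMem_lattice_of_lt_im hap ham (by rw [im_sub_half_mid]; linarith))).continuousAt
  exact ContinuousAt.comp (f := fun t : ℝ => (t : ℂ) - I * mid ap am / 2) h1 (by fun_prop)

theorem exists_norm_rKer_le (hap : 0 < ap) (ham : 0 < am) : ∃ K, 0 < K ∧ ∀ t : ℝ,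
    ‖rKer ap am t‖ ≤ K * Real.exp (-(alpha ap am * mid ap am / 4 * (|t| - t))) := by
  have hm := mid_pos hap ham
  obtain ⟨K, hK, h⟩ := exists_norm_GRight_le hap ham (v := mid ap am / 2) (by linarith) 0
  refine ⟨K, hK, fun t => ?_⟩
  have h1 := h (t - I * mid ap am / 2) (by rw [im_sub_half_mid])
    (by rw [im_sub_half_mid]; linarith)
  rw [im_sub_half_mid, re_sub_half_mid] at h1
  refine h1.trans (le_of_eq ?_)
  ring_nf

/-- On the right the only decay is the rate η of the exponential factor; on the left |t| - t = 2|t|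
supplies the rate a/2, of which η is lost. Hence the minimum. -/
theorem exp_neg_abs_sub_le (hα : 0 < alpha ap am) (η t : ℝ) :
    Real.exp (-(alpha ap am * mid ap am / 4 * (|t| - t))) *
      Real.exp (-(alpha ap am * (t * η))) ≤
      Real.exp (-(alpha ap am * min η (mid ap am / 2 - η) * |t|)) := by
  rw [← Real.exp_add]
  refine Real.exp_le_exp.2 ?_
  have h1 := min_le_left η (mid ap am / 2 - η)
  have h2 := min_le_right η (mid ap am / 2 - η)
  set μ := min η (mid ap am / 2 - η)
  have key : μ * |t| ≤ mid ap am / 4 * (|t| - t) + t * η := by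
    rcases le_total 0 t with h | h
    · rw [abs_of_nonneg h]; nlinarith
    · rw [abs_of_nonpos h]; nlinarith
  nlinarith [mul_le_mul_of_nonneg_left key hα.le]

theorem norm_exp_real (α : ℝ) (t : ℝ) (y : ℂ) :
    ‖exp (I * α * t * y)‖ = Real.exp (-(α * (t * y.im))) := by
  rw [Complex.norm_exp]
  congr 1
  have : I * (α : ℂ) * t * y = I * ((α * t : ℝ) * y) := by push_cast; ring
  rw [this]
  simp [-ofReal_mul]
  ring

/-- The Fourier transform of `G_R` along the line `Im z = -a/2`. -/
theorem integral_rKer (hap : 0 < ap) (ham : 0 < am) {y : ℂ} (hy : 0 < y.im)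
    (hy' : y.im < mid ap am / 2) :
    ∫ t : ℝ, rKer ap am t * exp (I * alpha ap am * t * y) =
      Real.sqrt (ap * am) * G ap am (y - I * mid ap am) * exp (-(I * alpha ap am * y ^ 2 / 4)) := by
  have hm := mid_pos hap ham
  have hα := alpha_pos hap ham
  obtain ⟨K, hK, hb⟩ := exists_norm_rKer_le hap ham
  have hKb : ∀ t, ‖rKer ap am t‖ ≤ K := fun t => (hb t).trans (by
    refine mul_le_of_le_one_right hK.le (Real.exp_le_one_iff.2 ?_)
    have : 0 ≤ |t| - t := sub_nonneg.2 (le_abs_self t)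
    rw [neg_nonpos]; positivity)
  set L : ℝ → ℝ → ℂ := fun S r => (starRingEnd ℂ) (rKer ap am (r + 2 * S)) with hL
  have hLim : Tendsto (fun S : ℝ => ∫ r : ℝ, rKer ap am r * L S r *
      exp (I * alpha ap am * r * y)) atTop
      (𝓝 (∫ t : ℝ, rKer ap am t * exp (I * alpha ap am * t * y))) := by
    refine tendsto_integral_filter_of_dominated_convergence
      (fun t => K * K * Real.exp (-(alpha ap am * min y.im (mid ap am / 2 - y.im) * |t|)))
      ?_ ?_ ((integrable_exp_neg_mul_abs (mul_pos hα
        (lt_min hy (by linarith)))).const_mul _) ?_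
    · refine Eventually.of_forall fun S => Continuous.aestronglyMeasurable ?_
      exact ((continuous_rKer hap ham).mul (continuous_conj.comp
        ((continuous_rKer hap ham).comp (by fun_prop)))).mul (by fun_prop)
    · refine Eventually.of_forall fun S => Eventually.of_forall fun t => ?_
      rw [norm_mul, norm_mul, norm_exp_real]
      have h1 : ‖L S t‖ ≤ K := by
        simp only [hL]; rw [RCLike.norm_conj]; exact hKb _
      calc _ ≤ (K * Real.exp (-(alpha ap am * mid ap am / 4 * (|t| - t)))) * K *
            Real.exp (-(alpha ap am * (t * y.im))) := by
            gcongr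
            exact hb t
        _ = K * K * (Real.exp (-(alpha ap am * mid ap am / 4 * (|t| - t))) *
            Real.exp (-(alpha ap am * (t * y.im)))) := by ring
        _ ≤ _ := mul_le_mul_of_nonneg_left (exp_neg_abs_sub_le hα y.im t) (by positivity)
    · refine Eventually.of_forall fun t => ?_
      have h1 : Tendsto (fun S : ℝ => L S t) atTop (𝓝 1) := by
        have h2 := (tendsto_GRight_add hap ham (z := t - I * mid ap am / 2)
          (by rw [im_sub_half_mid, abs_neg, abs_of_pos (by linarith)]; linarith)).comp
          (tendsto_id.const_mul_atTop (two_pos : (0 : ℝ) < 2))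
        have h3 := (continuous_conj.tendsto 1).comp h2
        rw [map_one] at h3
        refine h3.congr fun S => ?_
        simp only [hL, Function.comp, rKer, id]
        congr 2
        push_cast; ring
      simpa using (h1.const_mul (rKer ap am t)).mul_const (exp (I * alpha ap am * t * y))
  have hval : ∀ S : ℝ, ∫ r : ℝ, rKer ap am r * L S r * exp (I * alpha ap am * r * y) =
      Real.sqrt (ap * am) * ((starRingEnd ℂ) (GRight ap am (0 + ((2 * S : ℝ) : ℂ))) *
        GRight ap am (-y + ((2 * S : ℝ) : ℂ))) *
        (G ap am (y - I * mid ap am) * exp (-(I * alpha ap am * y ^ 2 / 4))) := by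
    intro S
    -- The real part of s drives the limit: after the translation z = r + S one gamma function is
    -- centred at r, the other at -(r + 2S), where G_L tends to 1. Taking w = y + s compensates the
    -- Gaussian of the factor that leaves.
    set s : ℂ := -S - I * mid ap am / 2 with hs
    have hsim : s.im = -(mid ap am / 2) := by
      rw [hs, ← ofReal_neg, im_sub_half_mid]
    have h1 := betaInt_eq hap ham (s := s) (w := y + s) (by rw [hsim]; linarith)
      (by rw [hsim]) (by
        rw [add_im, hsim, abs_lt]; constructor <;> linarith)
    have h2 : betaInt ap am s (y + s) = exp (I * alpha ap am * S * y) *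
        ∫ r : ℝ, rKer ap am r * L S r * exp (I * alpha ap am * r * y) := by
      rw [betaInt, ← integral_add_right_eq_self _ S, ← integral_const_mul]
      refine integral_congr_ae (Eventually.of_forall fun r => ?_)
      simp only
      have e1 : ((r + S : ℝ) : ℂ) + s = r - I * mid ap am / 2 := by rw [hs]; push_cast; ring
      have e2 : -((r + S : ℝ) : ℂ) + s = -((r + 2 * S : ℝ) : ℂ) - I * mid ap am / 2 := by
        rw [hs]; push_cast; ring
      have e3 : L S r = GLeft ap am (-((r + 2 * S : ℝ) : ℂ) - I * mid ap am / 2) := by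
        rw [GLeft_eq_conj]
        simp only [hL, rKer]
        congr 2
        simp [Complex.conj_ofNat]
        ring
      rw [e1, e2, e3, rKer, G_eq_GRight, G_eq_GLeft]
      set A := GRight ap am (r - I * mid ap am / 2)
      set B := GLeft ap am (-((r + 2 * S : ℝ) : ℂ) - I * mid ap am / 2)
      have e4 : ∀ a b c d e : ℂ, a + b + c = d + e → A * exp a * (B * exp b) * exp c =
          exp d * (A * B * exp e) := by
        intro a b c d e h
        calc _ = A * B * (exp a * exp b * exp c) := by ring
          _ = A * B * (exp d * exp e) := by rw [← exp_add, ← exp_add, h, exp_add]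
          _ = _ := by ring
      refine e4 _ _ _ _ _ ?_
      rw [hs]
      push_cast
      ring
    have h3 : G ap am (2 * s + I * mid ap am) * G ap am (-(y + s) - s - I * mid ap am) =
        exp (I * alpha ap am * S * y) * exp (-(I * alpha ap am * y ^ 2 / 4)) *
        ((starRingEnd ℂ) (GRight ap am (0 + ((2 * S : ℝ) : ℂ))) *
        GRight ap am (-y + ((2 * S : ℝ) : ℂ))) := by
      have e1 : 2 * s + I * mid ap am = -((2 * S : ℝ) : ℂ) := by rw [hs]; push_cast; ring
      have e2 : -(y + s) - s - I * mid ap am = -y + ((2 * S : ℝ) : ℂ) := by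
        rw [hs]; push_cast; ring
      have e3 : (starRingEnd ℂ) (GRight ap am (0 + ((2 * S : ℝ) : ℂ))) =
          GLeft ap am (-((2 * S : ℝ) : ℂ)) := by
        rw [conj_GRight, zero_add, conj_ofReal]
      rw [e1, e2, e3, G_eq_GLeft, G_eq_GRight, mul_mul_mul_comm, ← exp_add, ← exp_add, mul_comm]
      congr 2
      push_cast; ring
    have e5 : y + s - s - I * mid ap am = y - I * mid ap am := by ring
    rw [h2, e5] at h1
    refine mul_left_cancel₀ (exp_ne_zero (I * alpha ap am * S * y)) (h1.trans ?_)
    linear_combination (Real.sqrt (ap * am) * G ap am (y - I * mid ap am)) * h3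
  have hRlim : Tendsto (fun S : ℝ => Real.sqrt (ap * am) *
      ((starRingEnd ℂ) (GRight ap am (0 + ((2 * S : ℝ) : ℂ))) *
        GRight ap am (-y + ((2 * S : ℝ) : ℂ))) *
        (G ap am (y - I * mid ap am) * exp (-(I * alpha ap am * y ^ 2 / 4)))) atTop
      (𝓝 (Real.sqrt (ap * am) * ((starRingEnd ℂ) 1 * 1) *
        (G ap am (y - I * mid ap am) * exp (-(I * alpha ap am * y ^ 2 / 4))))) := by
    have h2S : Tendsto (fun S : ℝ => 2 * S) atTop atTop :=
      tendsto_id.const_mul_atTop (two_pos : (0 : ℝ) < 2)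
    have t1 := (tendsto_GRight_add hap ham (z := 0) (by simpa using hm)).comp h2S
    have t2 := (tendsto_GRight_add hap ham (z := -y) (by
      rw [neg_im, abs_neg, abs_of_pos hy]; linarith)).comp h2S
    exact (((continuous_conj.tendsto 1).comp t1).mul t2).const_mul _ |>.mul_const _
  have := tendsto_nhds_unique (hLim.congr hval) hRlim
  rw [this]
  simp only [map_one, mul_one]
  ring

open FourierTransform in
theorem fourier_scaled (α : ℝ) (K : ℝ → ℂ) (r : ℝ) :
    ∫ t : ℝ, K t * exp (I * α * t * r) = 𝓕 K (-(α / (2 * Real.pi)) * r) := by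
  rw [Real.fourier_real_eq_integral_exp_smul]
  refine integral_congr_ae (Eventually.of_forall fun t => ?_)
  simp only [smul_eq_mul]
  rw [mul_comm]
  congr 2
  have hpi : (Real.pi : ℂ) ≠ 0 := ofReal_ne_zero.2 Real.pi_ne_zero
  push_cast
  field_simp

open FourierTransform in
/-- Fourier inversion for the transform `∫ K(t) exp(iαtr) dt`. -/
theorem fourier_inversion_scaled {α : ℝ} (hα : 0 < α) {K : ℝ → ℂ} (hc : Continuous K)
    (hi : Integrable K) (hi' : Integrable fun r : ℝ => ∫ t : ℝ, K t * exp (I * α * t * r))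
    (v : ℝ) : ∫ r : ℝ, (∫ t : ℝ, K t * exp (I * α * t * r)) * exp (-(I * α * r * v)) =
      2 * Real.pi / α * K v := by
  have hpi := Real.pi_pos
  have hβ : -(α / (2 * Real.pi)) ≠ 0 := by
    rw [neg_ne_zero]; positivity
  simp only [fourier_scaled α] at hi' ⊢
  have hF : Integrable (𝓕 K) := (integrable_comp_mul_left_iff (𝓕 K) hβ).1 hi'
  have h1 := congrFun (hc.fourierInv_fourier_eq hi hF) v
  rw [Real.fourierInv_eq'] at h1
  have h2 := Measure.integral_comp_mul_left (fun w : ℝ => exp ((↑(2 * Real.pi * inner ℝ w v) * I)) •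
    𝓕 K w) (-(α / (2 * Real.pi)))
  rw [h1] at h2
  have h3 : |(-(α / (2 * Real.pi)))⁻¹| = 2 * Real.pi / α := by
    rw [inv_neg, abs_neg, inv_div, abs_of_pos (by positivity)]
  rw [h3, real_smul] at h2
  rw [show (2 * Real.pi / α : ℂ) = ((2 * Real.pi / α : ℝ) : ℂ) by push_cast; ring, ← h2]
  refine integral_congr_ae (Eventually.of_forall fun r => ?_)
  simp only [smul_eq_mul]
  rw [mul_comm]
  congr 2
  have hpi' : (Real.pi : ℂ) ≠ 0 := ofReal_ne_zero.2 Real.pi_ne_zero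
  simp
  field_simp

theorem integrable_rKer_mul_exp (hap : 0 < ap) (ham : 0 < am) {y : ℂ} (hy : 0 < y.im)
    (hy' : y.im < mid ap am / 2) :
    Integrable fun t : ℝ => rKer ap am t * exp (I * alpha ap am * t * y) := by
  have hα := alpha_pos hap ham
  obtain ⟨K, hK, hb⟩ := exists_norm_rKer_le hap ham
  refine integrable_of_exp_bound (C := K)
    (μ := alpha ap am * min y.im (mid ap am / 2 - y.im))
    (mul_pos hα (lt_min hy (by linarith))) ((continuous_rKer hap ham).mul
      (by fun_prop)).aestronglyMeasurable fun t => ?_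
  rw [norm_mul, norm_exp_real]
  calc _ ≤ (K * Real.exp (-(alpha ap am * mid ap am / 4 * (|t| - t)))) *
        Real.exp (-(alpha ap am * (t * y.im))) := by
        gcongr
        exact hb t
    _ = K * (Real.exp (-(alpha ap am * mid ap am / 4 * (|t| - t))) *
        Real.exp (-(alpha ap am * (t * y.im)))) := by ring
    _ ≤ _ := mul_le_mul_of_nonneg_left (exp_neg_abs_sub_le hα y.im t) (by positivity)

theorem exists_norm_rKer_mul_exp_le (hap : 0 < ap) (ham : 0 < am) {y : ℂ} (hy : 0 < y.im)
    (hy' : y.im < mid ap am / 2) :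
    ∃ C, ∀ t : ℝ, ‖rKer ap am t * exp (I * alpha ap am * t * y)‖ ≤ C := by
  have hα := alpha_pos hap ham
  obtain ⟨K, hK, hb⟩ := exists_norm_rKer_le hap ham
  refine ⟨K, fun t => ?_⟩
  rw [norm_mul, norm_exp_real]
  calc _ ≤ (K * Real.exp (-(alpha ap am * mid ap am / 4 * (|t| - t)))) *
        Real.exp (-(alpha ap am * (t * y.im))) := by
        gcongr
        exact hb t
    _ = K * (Real.exp (-(alpha ap am * mid ap am / 4 * (|t| - t))) *
        Real.exp (-(alpha ap am * (t * y.im)))) := by ring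
    _ ≤ K * 1 := by
        refine mul_le_mul_of_nonneg_left ((exp_neg_abs_sub_le hα y.im t).trans
          (Real.exp_le_one_iff.2 ?_)) hK.le
        have : 0 < min y.im (mid ap am / 2 - y.im) := lt_min hy (by linarith)
        rw [neg_nonpos]; positivity
    _ = K := mul_one K

/-- G decays at the rate α(a - ε)/2 on both sides with ε = Im y, while the Gaussian grows at the
rate αε/2 to the right. The net rate is positive exactly for ε < a/2. -/
theorem exists_norm_G_mul_exp_le (hap : 0 < ap) (ham : 0 < am) {y : ℂ} (hy : 0 < y.im)
    (hy' : y.im < mid ap am / 2) : ∃ C, ∀ r : ℝ,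
      ‖G ap am (y + r - I * mid ap am) * exp (-(I * alpha ap am * (y + r) ^ 2 / 4))‖ ≤
        C * Real.exp (-(alpha ap am / 2 * (mid ap am - 2 * y.im) * |r|)) := by
  have hα := alpha_pos hap ham
  have hm := mid_pos hap ham
  set ε := y.im with hε
  obtain ⟨K, hK, h⟩ := exists_norm_G_le_upper hap ham (v := mid ap am - ε) (by linarith) 0
  refine ⟨K * Real.exp (alpha ap am / 2 * (mid ap am * |y.re|)), fun r => ?_⟩
  have i1 : (y + r - I * mid ap am).im = -(mid ap am - ε) := by simp [hε]
  have r1 : (y + r - I * mid ap am).re = r + y.re := by simp; ring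
  have h1 := h (y + r - I * mid ap am) (by rw [i1]) (by rw [i1]; linarith)
  rw [i1, r1] at h1
  have h2 : ‖exp (-(I * alpha ap am * (y + r) ^ 2 / 4))‖ =
      Real.exp (alpha ap am / 2 * (ε * (r + y.re))) := by
    rw [Complex.norm_exp]
    congr 1
    have : -(I * alpha ap am * (y + r) ^ 2 / 4) =
        -(((alpha ap am / 4 : ℝ) : ℂ) * (I * ((y + r) * (y + r)))) := by push_cast; ring
    rw [this, neg_re, re_ofReal_mul]
    simp [hε]
    ring
  rw [norm_mul, h2]
  refine (mul_le_mul_of_nonneg_right h1 (Real.exp_pos _).le).trans ?_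
  rw [mul_assoc, mul_assoc, ← Real.exp_add, ← Real.exp_add]
  refine mul_le_mul_of_nonneg_left (Real.exp_le_exp.2 ?_) hK.le
  have h3 : |r| - |y.re| ≤ |r + y.re| := by
    have := abs_sub_abs_le_abs_sub r (-y.re)
    rwa [abs_neg, sub_neg_eq_add] at this
  have h4 := le_abs_self (r + y.re)
  have h5 : -(mid ap am - ε) * |r + y.re| + ε * (r + y.re) ≤
      mid ap am * |y.re| - (mid ap am - 2 * ε) * |r| := by
    have h6 := abs_nonneg y.re
    nlinarith [mul_le_mul_of_nonneg_left h3 (by linarith : 0 ≤ mid ap am - 2 * ε),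
      mul_le_mul_of_nonneg_left h4 hy.le]
  nlinarith [mul_le_mul_of_nonneg_left h5 (by positivity : 0 ≤ alpha ap am / 2)]

open FourierTransform Convolution in
/-- The Fourier representation of `F^T` in terms of `kerR` agrees with that in terms of
`kerPlus`. -/
theorem integral_kerR_eq_integral_kerPlus (hap : 0 < ap) (ham : 0 < am) (x y : ℝ) {ε : ℝ}
    (hε : 0 < ε) (hε' : ε < mid ap am / 2) :
    (Integrable fun r : ℝ => kerPlus ap am x y (r + I * ε)) ∧
    exp (I * alpha ap am * y ^ 2 / 4) * ∫ z : ℝ, kerR ap am x y z =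
      exp (I * alpha ap am * y ^ 2 / 8) * ∫ r : ℝ, kerPlus ap am x y (r + I * ε) := by
  have hα := alpha_pos hap ham
  have hm := mid_pos hap ham
  have hsq : (Real.sqrt (ap * am) : ℂ) ^ 2 = ap * am := by
    rw [← ofReal_pow, Real.sq_sqrt (by positivity)]; push_cast; ring
  have hap' : (ap : ℂ) ≠ 0 := ofReal_ne_zero.2 hap.ne'
  have ham' : (am : ℂ) ≠ 0 := ofReal_ne_zero.2 ham.ne'
  have hpi : (Real.pi : ℂ) ≠ 0 := ofReal_ne_zero.2 Real.pi_ne_zero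
  -- Y₁ and Y₂ are the frequencies whose transforms, by `integral_rKer`, are the two gamma factors
  -- of `kerPlus` at height ε.
  set Y₁ : ℂ := I * ε + y / 2 with hY₁
  set Y₂ : ℂ := I * ε - y / 2 with hY₂
  have him : ∀ Y : ℂ, Y = Y₁ ∨ Y = Y₂ → Y.im = ε := by
    rintro Y (rfl | rfl)
    · have : Y₁ = I * ε + ((y / 2 : ℝ) : ℂ) := by rw [hY₁]; push_cast; ring
      rw [this]; simp [-ofReal_div]
    · have : Y₂ = I * ε - ((y / 2 : ℝ) : ℂ) := by rw [hY₂]; push_cast; ring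
      rw [this]; simp [-ofReal_div]
  set K : ℂ → ℝ → ℂ := fun Y t => rKer ap am t * exp (I * alpha ap am * t * Y) with hK
  have hKc : ∀ Y, Continuous (K Y) := fun Y => (continuous_rKer hap ham).mul (by fun_prop)
  have hKi : ∀ Y, Y = Y₁ ∨ Y = Y₂ → Integrable (K Y) := fun Y hY =>
    integrable_rKer_mul_exp hap ham (by rw [him Y hY]; exact hε) (by rw [him Y hY]; exact hε')
  set T : ℂ → ℝ → ℂ := fun Y r => Real.sqrt (ap * am) *
    (G ap am (Y + r - I * mid ap am) * exp (-(I * alpha ap am * (Y + r) ^ 2 / 4))) with hT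
  have hKT : ∀ Y, Y = Y₁ ∨ Y = Y₂ → ∀ r : ℝ,
      ∫ t : ℝ, K Y t * exp (I * alpha ap am * t * r) = T Y r := by
    intro Y hY r
    have h1 := integral_rKer hap ham (y := Y + r) (by simp [him Y hY, hε])
      (by simp [him Y hY, hε'])
    rw [hT]
    simp only
    rw [← mul_assoc, ← h1]
    refine integral_congr_ae (Eventually.of_forall fun t => ?_)
    simp only [hK]
    rw [mul_assoc, ← exp_add]
    congr 2
    ring
  have hTc : ∀ Y, Y = Y₁ ∨ Y = Y₂ → Continuous (T Y) := by
    intro Y hY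
    have := continuous_G_line hap ham (c := 1) (s := Y - I * mid ap am) (by simp)
      (by simp [him Y hY, hε])
    have e : (fun r : ℝ => G ap am (Y + r - I * mid ap am)) =
        fun r : ℝ => G ap am (1 * r + (Y - I * mid ap am)) := by
      funext r; congr 1; ring
    refine continuous_const.mul (Continuous.mul ?_ (by fun_prop))
    rw [e]; exact this
  have hTi : Integrable fun r => T Y₁ r * T Y₂ r := by
    have b := fun Y (hY : Y = Y₁ ∨ Y = Y₂) => exists_norm_G_mul_exp_le hap ham (y := Y)
      (by rw [him Y hY]; exact hε) (by rw [him Y hY]; exact hε')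
    obtain ⟨C₁, h1⟩ := b Y₁ (Or.inl rfl)
    obtain ⟨C₂, h2⟩ := b Y₂ (Or.inr rfl)
    rw [him Y₁ (Or.inl rfl)] at h1
    rw [him Y₂ (Or.inr rfl)] at h2
    have hμ : 0 < alpha ap am / 2 * (mid ap am - 2 * ε) :=
      mul_pos (by positivity) (by linarith)
    have hb : ∀ r, ‖T Y₂ r‖ ≤ Real.sqrt (ap * am) * |C₂| := by
      intro r
      simp only [hT]
      rw [norm_mul, norm_real, Real.norm_of_nonneg (Real.sqrt_nonneg _)]
      refine mul_le_mul_of_nonneg_left ((h2 r).trans ?_) (Real.sqrt_nonneg _)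
      refine (mul_le_mul_of_nonneg_right (le_abs_self C₂) (Real.exp_pos _).le).trans ?_
      refine mul_le_of_le_one_right (abs_nonneg _) (Real.exp_le_one_iff.2 ?_)
      rw [neg_nonpos]; positivity
    refine Integrable.mul_bdd (c := Real.sqrt (ap * am) * |C₂|) ?_
      (hTc Y₂ (Or.inr rfl)).aestronglyMeasurable (Eventually.of_forall hb)
    refine integrable_of_exp_bound (C := Real.sqrt (ap * am) * C₁) hμ
      (hTc Y₁ (Or.inl rfl)).aestronglyMeasurable fun r => ?_
    simp only [hT]
    rw [norm_mul, norm_real, Real.norm_of_nonneg (Real.sqrt_nonneg _), mul_assoc √_]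
    exact mul_le_mul_of_nonneg_left (h1 r) (Real.sqrt_nonneg _)
  -- The transform of this convolution is T Y₁ · T Y₂. Inverting it at x expresses one integral
  -- through the other.
  set Cv : ℝ → ℂ := K Y₁ ⋆[ContinuousLinearMap.mul ℂ ℂ] K Y₂ with hCv
  have hCT : ∀ r : ℝ, ∫ t : ℝ, Cv t * exp (I * alpha ap am * t * r) = T Y₁ r * T Y₂ r := by
    intro r
    rw [fourier_scaled, hCv, Real.fourier_mul_convolution_eq (hKi Y₁ (Or.inl rfl))
      (hKi Y₂ (Or.inr rfl)), ← fourier_scaled, ← fourier_scaled, hKT Y₁ (Or.inl rfl),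
      hKT Y₂ (Or.inr rfl)]
  have hCc : Continuous Cv := by
    refine BddAbove.continuous_convolution_right_of_integrable _ ?_ (hKi Y₁ (Or.inl rfl)) (hKc Y₂)
    obtain ⟨C, hC⟩ := exists_norm_rKer_mul_exp_le hap ham (y := Y₂)
      (by rw [him Y₂ (Or.inr rfl)]; exact hε) (by rw [him Y₂ (Or.inr rfl)]; exact hε')
    exact ⟨C, by rintro _ ⟨t, rfl⟩; exact hC t⟩
  have hCi : Integrable Cv :=
    (hKi Y₁ (Or.inl rfl)).integrable_convolution _ (hKi Y₂ (Or.inr rfl))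
  have hinv := fourier_inversion_scaled hα hCc hCi (by simp only [hCT]; exact hTi) x
  simp only [hCT] at hinv
  -- Centring the convolution variable at x/2 makes the two arguments ± z + x/2; the frequencies
  -- combine to exp(iαzy) and a constant.
  have hCx : Cv x = exp (-(alpha ap am * ε * x)) * ∫ z : ℝ, kerR ap am x y z := by
    rw [hCv, convolution_def, ← integral_add_right_eq_self _ (x / 2), ← integral_const_mul]
    refine integral_congr_ae (Eventually.of_forall fun z => ?_)
    simp only [hK, ContinuousLinearMap.mul_apply', rKer, kerR]
    have e1 : ((z + x / 2 : ℝ) : ℂ) - I * mid ap am / 2 = z + x / 2 - I * mid ap am / 2 := by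
      push_cast; ring
    have e2 : ((x - (z + x / 2) : ℝ) : ℂ) - I * mid ap am / 2 =
        -z + x / 2 - I * mid ap am / 2 := by
      push_cast; ring
    rw [e1, e2, mul_mul_mul_comm, ← exp_add, mul_left_comm, ← exp_add]
    congr 2
    rw [hY₁, hY₂]
    push_cast
    linear_combination (alpha ap am * x * ε : ℂ) * I_sq
  have hker : ∀ r : ℝ, kerPlus ap am x y (r + I * ε) = exp (I * alpha ap am * y ^ 2 / 8) *
      exp (alpha ap am * ε * x) / (ap * am) *
      (T Y₁ r * T Y₂ r * exp (-(I * alpha ap am * r * x))) := by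
    intro r
    simp only [hT, kerPlus]
    have e1 : (r : ℂ) + I * ε + y / 2 - I * mid ap am = Y₁ + r - I * mid ap am := by
      rw [hY₁]; ring
    have e2 : (r : ℂ) + I * ε - y / 2 - I * mid ap am = Y₂ + r - I * mid ap am := by
      rw [hY₂]; ring
    rw [e1, e2]
    generalize G ap am (Y₁ + r - I * mid ap am) = g₁
    generalize G ap am (Y₂ + r - I * mid ap am) = g₂
    have e3 : exp (-(I * alpha ap am * ((r + I * ε) * x + (r + I * ε) ^ 2 / 2))) =
        exp (I * alpha ap am * y ^ 2 / 8) * exp (alpha ap am * ε * x) *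
        (exp (-(I * alpha ap am * (Y₁ + r) ^ 2 / 4)) *
          exp (-(I * alpha ap am * (Y₂ + r) ^ 2 / 4)) * exp (-(I * alpha ap am * r * x))) := by
      rw [← exp_add, ← exp_add, ← exp_add, ← exp_add]
      congr 1
      rw [hY₁, hY₂]
      linear_combination (-(alpha ap am * ε * x : ℂ)) * I_sq
    rw [e3, div_mul_eq_mul_div, eq_div_iff (mul_ne_zero hap' ham'), ← hsq]
    ring
  have hnorm : ∀ r : ℝ, ‖exp (-(I * alpha ap am * r * x))‖ = 1 := by
    intro r
    have : -(I * alpha ap am * r * x) = ((-(alpha ap am * r * x) : ℝ) : ℂ) * I := by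
      push_cast; ring
    rw [this, norm_exp_ofReal_mul_I]
  constructor
  · simp only [hker]
    refine Integrable.const_mul (Integrable.mul_bdd (c := 1) hTi ?_
      (Eventually.of_forall fun r => (hnorm r).le)) _
    exact Continuous.aestronglyMeasurable (by fun_prop)
  · simp only [hker]
    rw [integral_const_mul, hinv, hCx]
    have e1 : (2 * Real.pi / alpha ap am : ℂ) = ap * am := by
      rw [alpha]; push_cast; field_simp
    rw [e1]
    have e2 : exp (I * alpha ap am * y ^ 2 / 4) =
        exp (I * alpha ap am * y ^ 2 / 8) * exp (I * alpha ap am * y ^ 2 / 8) := by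
      rw [← exp_add]; congr 1; ring
    have e3 : exp (alpha ap am * ε * x : ℂ) * exp (-(alpha ap am * ε * x : ℂ)) = 1 := by
      rw [← exp_add]; simp
    rw [e2]
    generalize exp (I * alpha ap am * y ^ 2 / 8) = E
    generalize ∫ z : ℝ, kerR ap am x y z = Q
    field_simp
    linear_combination (-(E ^ 2 * Q)) * e3

end RelToda

/-! ### Pairing with an imaginary Gaussian, and the passage from `kerR` to `kerL`. -/

namespace RelToda

open Complex Set

variable {ap am : ℝ}

theorem norm_gaussian_factor_le_one {b : ℂ} (hb : 0 < b.re) (t : ℝ) :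
    ‖exp (-(t : ℂ) ^ 2 / (4 * b))‖ ≤ 1 := by
  rw [Complex.norm_exp, Real.exp_le_one_iff]
  have : -(t : ℂ) ^ 2 / (4 * b) = ((-(t ^ 2 / 4) : ℝ) : ℂ) * b⁻¹ := by
    push_cast; rw [div_eq_mul_inv, mul_inv]; ring
  rw [this, re_ofReal_mul, inv_re]
  have : 0 ≤ b.re / normSq b := div_nonneg hb.le (normSq_nonneg _)
  nlinarith [sq_nonneg t]

theorem sqrt_neg_I_mul {c : ℝ} (hc : 0 < c) :
    ((c : ℂ) * -I) ^ (1 / 2 : ℂ) = Real.sqrt c * exp (-(I * Real.pi / 4)) := by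
  have hc' : (c : ℂ) ≠ 0 := ofReal_ne_zero.2 hc.ne'
  rw [cpow_def_of_ne_zero (mul_ne_zero hc' (neg_ne_zero.2 I_ne_zero)),
    log_ofReal_mul hc (neg_ne_zero.2 I_ne_zero), log_neg_I, Real.sqrt_eq_rpow,
    Real.rpow_def_of_pos hc, ofReal_exp, ← exp_add]
  congr 1
  push_cast
  ring

/-- The Fourier transform of an imaginary Gaussian, in its weak form. -/
theorem integral_fourier_mul_gaussian {α : ℝ} (hα : 0 < α) {h : ℝ → ℂ} (hh : Integrable h)
    (hT : Integrable fun w : ℝ => ∫ z : ℝ, h z * exp (I * α * z * w)) (y : ℝ) :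
    ∫ w : ℝ, (∫ z : ℝ, h z * exp (I * α * z * w)) * exp (-(I * α * w ^ 2 / 2) + I * α * w * y) =
      Real.sqrt (2 * Real.pi / α) * exp (-(I * Real.pi / 4)) *
        ∫ z : ℝ, h z * exp (I * α * (z + y) ^ 2 / 2) := by
  have hpi := Real.pi_pos
  set T : ℝ → ℂ := fun w => ∫ z : ℝ, h z * exp (I * α * z * w) with hTdef
  -- A real part ε > 0 makes the Gaussian integrable, so Fubini applies and its transform is
  -- classical; integrability of h and of its transform then allows ε → 0 on both sides.
  set b : ℝ → ℂ := fun ε => ε + I * α / 2 with hb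
  have hbre : ∀ ε, (b ε).re = ε := by
    intro ε
    have : b ε = ε + ((α / 2 : ℝ) : ℂ) * I := by rw [hb]; push_cast; ring
    rw [this]; simp [-ofReal_div]
  have hunit : ∀ w : ℝ, ∀ c : ℝ, ‖exp (I * α * w * c)‖ = 1 := by
    intro w c
    have : I * (α : ℂ) * w * c = ((α * w * c : ℝ) : ℂ) * I := by push_cast; ring
    rw [this, norm_exp_ofReal_mul_I]
  have hgn : ∀ ε w : ℝ, ‖exp (-(b ε) * w ^ 2)‖ = Real.exp (-ε * w ^ 2) := by
    intro ε w
    rw [Complex.norm_exp]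
    congr 1
    have : -(b ε) * (w : ℂ) ^ 2 = ((w ^ 2 : ℝ) : ℂ) * -(b ε) := by push_cast; ring
    rw [this, re_ofReal_mul, neg_re, hbre]; ring
  have key : ∀ ε : ℝ, 0 < ε → ∫ w : ℝ, T w * (exp (-(b ε) * w ^ 2) * exp (I * α * w * y)) =
      (Real.pi / b ε) ^ (1 / 2 : ℂ) *
        ∫ z : ℝ, h z * exp (-((α * (z + y) : ℝ) : ℂ) ^ 2 / (4 * b ε)) := by
    intro ε hε
    have hgi : Integrable fun w : ℝ => exp (-(b ε) * w ^ 2) * exp (I * α * w * y) := by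
      have h1 := integrable_cexp_quadratic (b := b ε) (by rw [hbre]; exact hε) (I * α * y) 0
      refine h1.congr (Eventually.of_forall fun w => ?_)
      simp only
      rw [← exp_add]; congr 1; ring
    have hprod : Integrable (Function.uncurry fun w z : ℝ =>
        (h z * exp (I * α * z * w)) * (exp (-(b ε) * w ^ 2) * exp (I * α * w * y)))
        (volume.prod volume) := by
      have h1 := hgi.mul_prod hh
      have h2 := h1.mul_bdd (c := 1) (g := fun p : ℝ × ℝ => exp (I * α * p.2 * p.1))
        (Continuous.aestronglyMeasurable (by fun_prop))
        (Eventually.of_forall fun p => (hunit p.2 p.1).le)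
      refine h2.congr (Eventually.of_forall fun p => ?_)
      simp only [Function.uncurry]
      ring
    calc _ = ∫ w : ℝ, ∫ z : ℝ, (h z * exp (I * α * z * w)) *
          (exp (-(b ε) * w ^ 2) * exp (I * α * w * y)) := by
          refine integral_congr_ae (Eventually.of_forall fun w => ?_)
          simp only [hTdef]
          rw [integral_mul_const]
      _ = ∫ z : ℝ, ∫ w : ℝ, (h z * exp (I * α * z * w)) *
          (exp (-(b ε) * w ^ 2) * exp (I * α * w * y)) := integral_integral_swap hprod
      _ = ∫ z : ℝ, (Real.pi / b ε) ^ (1 / 2 : ℂ) *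
          (h z * exp (-((α * (z + y) : ℝ) : ℂ) ^ 2 / (4 * b ε))) := by
          refine integral_congr_ae (Eventually.of_forall fun z => ?_)
          simp only
          have h1 := fourierIntegral_gaussian (b := b ε) (by rw [hbre]; exact hε)
            ((α * (z + y) : ℝ) : ℂ)
          have h2 : ∀ w : ℝ, (h z * exp (I * α * z * w)) *
              (exp (-(b ε) * w ^ 2) * exp (I * α * w * y)) =
              h z * (exp (I * ((α * (z + y) : ℝ) : ℂ) * w) * exp (-(b ε) * w ^ 2)) := by
            intro w
            have : exp (I * ((α * (z + y) : ℝ) : ℂ) * w) =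
                exp (I * α * z * w) * exp (I * α * w * y) := by
              rw [← exp_add]; congr 1; push_cast; ring
            rw [this]; ring
          simp only [h2]
          rw [integral_const_mul, h1]
          ring
      _ = _ := integral_const_mul _ _
  have hε0 : Tendsto (fun ε : ℝ => b ε) (𝓝[>] 0) (𝓝 (I * α / 2)) := by
    have : Continuous b := by rw [hb]; fun_prop
    exact (this.tendsto' 0 _ (by simp [hb])).mono_left nhdsWithin_le_nhds
  have hα' : (α : ℂ) ≠ 0 := ofReal_ne_zero.2 hα.ne'
  have hI2 : I * (α : ℂ) / 2 ≠ 0 := by simp [hα']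
  have hlim1 : Tendsto (fun ε : ℝ => ∫ w : ℝ, T w * (exp (-(b ε) * w ^ 2) *
      exp (I * α * w * y))) (𝓝[>] 0)
      (𝓝 (∫ w : ℝ, T w * exp (-(I * α * w ^ 2 / 2) + I * α * w * y))) := by
    refine tendsto_integral_filter_of_dominated_convergence (fun w => ‖T w‖) ?_ ?_ hT.norm ?_
    · refine Eventually.of_forall fun ε => hT.aestronglyMeasurable.mul ?_
      exact Continuous.aestronglyMeasurable (by fun_prop)
    · filter_upwards [self_mem_nhdsWithin] with ε hε
      refine Eventually.of_forall fun w => ?_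
      rw [norm_mul, norm_mul, hunit, mul_one, hgn]
      refine mul_le_of_le_one_right (norm_nonneg _) (Real.exp_le_one_iff.2 ?_)
      have : (0 : ℝ) < ε := hε
      nlinarith [sq_nonneg w]
    · refine Eventually.of_forall fun w => ?_
      have h1 := ((hε0.neg.mul_const ((w : ℂ) ^ 2)).cexp.mul_const
        (exp (I * α * w * y))).const_mul (T w)
      convert! h1 using 2
      rw [exp_add]
      congr 2
      ring_nf
  have hlim2 : Tendsto (fun ε : ℝ => (Real.pi / b ε) ^ (1 / 2 : ℂ) *
      ∫ z : ℝ, h z * exp (-((α * (z + y) : ℝ) : ℂ) ^ 2 / (4 * b ε))) (𝓝[>] 0)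
      (𝓝 ((Real.pi / (I * α / 2)) ^ (1 / 2 : ℂ) *
        ∫ z : ℝ, h z * exp (-((α * (z + y) : ℝ) : ℂ) ^ 2 / (4 * (I * α / 2))))) := by
    refine Tendsto.mul ?_ ?_
    · have e : (Real.pi : ℂ) / (I * α / 2) = ((2 * Real.pi / α : ℝ) : ℂ) * -I := by
        push_cast
        field_simp
        rw [I_sq, neg_neg]
      have hslit : (Real.pi : ℂ) / (I * α / 2) ∈ slitPlane := by
        rw [e, mem_slitPlane_iff]
        right
        have h2 : (2 * Real.pi / α) ≠ 0 := by positivity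
        simpa [-ofReal_div, -ofReal_mul] using h2
      exact (tendsto_const_nhds.div hε0 hI2).cpow tendsto_const_nhds hslit
    · refine tendsto_integral_filter_of_dominated_convergence (fun z => ‖h z‖) ?_ ?_ hh.norm ?_
      · refine Eventually.of_forall fun ε => hh.aestronglyMeasurable.mul ?_
        exact Continuous.aestronglyMeasurable (by fun_prop)
      · filter_upwards [self_mem_nhdsWithin] with ε hε
        refine Eventually.of_forall fun z => ?_
        rw [norm_mul]
        exact mul_le_of_le_one_right (norm_nonneg _)
          (norm_gaussian_factor_le_one (by rw [hbre]; exact hε) _)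
      · refine Eventually.of_forall fun z => ?_
        have h1 : Tendsto (fun ε => -((α * (z + y) : ℝ) : ℂ) ^ 2 / (4 * b ε)) (𝓝[>] 0)
            (𝓝 (-((α * (z + y) : ℝ) : ℂ) ^ 2 / (4 * (I * α / 2)))) :=
          tendsto_const_nhds.div (hε0.const_mul 4) (mul_ne_zero (by norm_num) hI2)
        exact h1.cexp.const_mul _
  have hfin := tendsto_nhds_unique (hlim1.congr' (by
    filter_upwards [self_mem_nhdsWithin] with ε hε
    exact key ε hε)) hlim2
  rw [hfin]
  have e : (Real.pi : ℂ) / (I * α / 2) = ((2 * Real.pi / α : ℝ) : ℂ) * -I := by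
    push_cast
    field_simp
    rw [I_sq, neg_neg]
  rw [e, sqrt_neg_I_mul (by positivity)]
  congr 1
  refine integral_congr_ae (Eventually.of_forall fun z => ?_)
  simp only
  congr 2
  push_cast
  field_simp
  rw [I_sq]; ring

/-- This relation absorbs the phase exp(-iπ/4) produced by the square root of the imaginary Gaussian
into the constants of G_R and G_L. -/
theorem alpha_mul_mid_sq (hap : 0 < ap) (ham : 0 < am) :
    alpha ap am * mid ap am ^ 2 / 4 = 3 * chi ap am + Real.pi / 4 := by
  rw [alpha, mid, chi]
  field_simp
  ring

/-- The Gaussians of the two G_R combine with exp(iαzy) to the square of z + y. This is the form in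
which the integral arises from the pairing with a Gaussian. -/
theorem kerR_eq (ap am x y z : ℝ) : kerR ap am x y z =
    exp (I * (2 * chi ap am + alpha ap am * (x / 2 - I * mid ap am / 2) ^ 2 / 2)) *
      (G ap am (z + (x / 2 - I * mid ap am / 2)) * G ap am (-z + (x / 2 - I * mid ap am / 2)) *
        exp (I * alpha ap am * (z + y) ^ 2 / 2)) * exp (-(I * alpha ap am * y ^ 2 / 2)) := by
  rw [kerR, GRight, GRight]
  have e1 : (z : ℂ) + x / 2 - I * mid ap am / 2 = z + (x / 2 - I * mid ap am / 2) := by ring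
  have e2 : -(z : ℂ) + x / 2 - I * mid ap am / 2 = -z + (x / 2 - I * mid ap am / 2) := by ring
  rw [e1, e2]
  set s : ℂ := x / 2 - I * mid ap am / 2
  have e3 : ∀ A B a b c d e f : ℂ, a + b + c = d + e + f → A * exp a * (B * exp b) * exp c =
      exp d * (A * B * exp e) * exp f := by
    intro A B a b c d e f h
    calc _ = A * B * (exp a * exp b * exp c) := by ring
      _ = A * B * (exp d * exp e * exp f) := by
        rw [← exp_add, ← exp_add, h, exp_add, exp_add]
      _ = _ := by ring
  exact e3 _ _ _ _ _ _ _ _ (by ring)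

theorem kerL_eq_conj (ap am x y z : ℝ) :
    kerL ap am x y z = (starRingEnd ℂ) (kerR ap am x y (-z)) := by
  rw [kerL, kerR, map_mul, map_mul, conj_GRight, conj_GRight, ← exp_conj]
  have e1 : -(starRingEnd ℂ) (((-z : ℝ) : ℂ) + x / 2 - I * mid ap am / 2) =
      z - x / 2 - I * mid ap am / 2 := by
    simp [Complex.conj_ofNat]; ring
  have e2 : -(starRingEnd ℂ) (-((-z : ℝ) : ℂ) + x / 2 - I * mid ap am / 2) =
      -z - x / 2 - I * mid ap am / 2 := by
    simp [Complex.conj_ofNat]; ring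
  rw [e1, e2]
  congr 2
  simp

theorem integral_kerL_eq_conj (ap am x y : ℝ) :
    ∫ z : ℝ, kerL ap am x y z = (starRingEnd ℂ) (∫ z : ℝ, kerR ap am x y z) := by
  rw [← integral_conj, ← integral_neg_eq_self]
  refine integral_congr_ae (Eventually.of_forall fun z => ?_)
  simp only [kerL_eq_conj, neg_neg]

theorem half_sub_im (x : ℝ) : ((x : ℂ) / 2 - I * mid ap am / 2).im = -(mid ap am / 2) := by
  rw [show (x : ℂ) / 2 = ((x / 2 : ℝ) : ℂ) by push_cast; ring, im_sub_half_mid]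

theorem integrable_kerR (hap : 0 < ap) (ham : 0 < am) (x y : ℝ) :
    Integrable (kerR ap am x y) := by
  have hm := mid_pos hap ham
  have h1 := integrable_betaKer hap ham (s := x / 2 - I * mid ap am / 2) (w := 0)
    (by rw [half_sub_im]; linarith) (by rw [half_sub_im]; simp [hm])
  simp only [mul_zero, exp_zero, mul_one] at h1
  have h2 := h1.mul_bdd (c := 1) (g := fun z : ℝ => exp (I * alpha ap am * (z + y) ^ 2 / 2))
    (Continuous.aestronglyMeasurable (by fun_prop)) (Eventually.of_forall fun z => by
      have : I * alpha ap am * ((z : ℂ) + y) ^ 2 / 2 =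
          ((alpha ap am * (z + y) ^ 2 / 2 : ℝ) : ℂ) * I := by push_cast; ring
      rw [this, norm_exp_ofReal_mul_I])
  refine ((h2.const_mul (exp (I * (2 * chi ap am + alpha ap am *
    (x / 2 - I * mid ap am / 2) ^ 2 / 2)))).mul_const
      (exp (-(I * alpha ap am * y ^ 2 / 2)))).congr (Eventually.of_forall fun z => ?_)
  exact (kerR_eq ap am x y z).symm

theorem integrable_kerL (hap : 0 < ap) (ham : 0 < am) (x y : ℝ) :
    Integrable (kerL ap am x y) := by
  have h := ((integrable_kerR hap ham x y).comp_neg).congr (Eventually.of_forall fun _ => rfl)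
  have h2 : Integrable fun z => (starRingEnd ℂ) (kerR ap am x y (-z)) := by
    refine h.mono (continuous_conj.comp_aestronglyMeasurable h.aestronglyMeasurable)
      (Eventually.of_forall fun z => ?_)
    rw [RCLike.norm_conj]
  exact h2.congr (Eventually.of_forall fun z => (kerL_eq_conj ap am x y z).symm)

/-- By `betaInt_eq` the transform is itself of the form G(±w + s'), with x replaced by -x, and such
a product decays exponentially. -/
theorem integrable_betaInt (hap : 0 < ap) (ham : 0 < am) (x : ℝ) :
    Integrable fun w : ℝ => betaInt ap am (x / 2 - I * mid ap am / 2) w := by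
  have hm := mid_pos hap ham
  set s : ℂ := x / 2 - I * mid ap am / 2 with hs
  have hsim : s.im = -(mid ap am / 2) := half_sub_im x
  have h1 := integrable_betaKer hap ham (s := -(x / 2 : ℝ) - I * mid ap am / 2) (w := 0)
    (by rw [← ofReal_neg, im_sub_half_mid]; linarith)
    (by rw [← ofReal_neg, im_sub_half_mid]; simp [hm])
  simp only [mul_zero, exp_zero, mul_one] at h1
  refine (h1.const_mul (Real.sqrt (ap * am) * G ap am (2 * s + I * mid ap am))).congr
    (Eventually.of_forall fun w => ?_)
  simp only
  rw [betaInt_eq hap ham (by rw [hsim]; linarith) (by rw [hsim])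
    (by rw [hsim]; simp [hm])]
  congr 3
  · rw [hs]; push_cast; ring
  · rw [hs]; push_cast; ring

/-- `integral_fourier_mul_gaussian` is applied to h(z) = G(±z + s) with s = (x - ia)/2. The
transform of h is a multiple of G(x) G(±w - (x + ia)/2), so the left side becomes the integral of
`kerL`; the right side is that of `kerR` by `kerR_eq`. -/
theorem integral_kerL_eq (hap : 0 < ap) (ham : 0 < am) (x y : ℝ) :
    GRight ap am x * ∫ z : ℝ, kerL ap am x y z =
      exp (I * alpha ap am * y ^ 2 / 2) * ∫ z : ℝ, kerR ap am x y z := by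
  have hm := mid_pos hap ham
  have hα := alpha_pos hap ham
  set s : ℂ := x / 2 - I * mid ap am / 2 with hs
  have hsim : s.im = -(mid ap am / 2) := half_sub_im x
  have h1 := integrable_betaKer hap ham (s := s) (w := 0)
    (by rw [hsim]; linarith) (by rw [hsim]; simp [hm])
  simp only [mul_zero, exp_zero, mul_one] at h1
  have h2 := integral_fourier_mul_gaussian hα h1 (integrable_betaInt hap ham x) y
  have hsq0 : (Real.sqrt (ap * am) : ℂ) ≠ 0 :=
    ofReal_ne_zero.2 (Real.sqrt_pos.2 (by positivity)).ne'
  have e1 : 2 * Real.pi / alpha ap am = ap * am := by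
    rw [alpha]; have := Real.pi_ne_zero; field_simp
  have e2 : 2 * s + I * mid ap am = x := by rw [hs]; ring
  set σ : ℂ := -(x / 2) - I * mid ap am / 2 with hσ
  have h3 : ∀ w : ℝ, (∫ z : ℝ, G ap am (z + s) * G ap am (-z + s) *
      exp (I * alpha ap am * z * w)) * exp (-(I * alpha ap am * w ^ 2 / 2) +
        I * alpha ap am * w * y) = Real.sqrt (ap * am) * G ap am x *
        exp (I * (2 * chi ap am + alpha ap am * σ ^ 2 / 2)) * kerL ap am x y w := by
    intro w
    have h4 := betaInt_eq hap ham (s := s) (w := w) (by rw [hsim]; linarith) (by rw [hsim])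
      (by rw [hsim]; simp [hm])
    rw [betaInt] at h4
    rw [h4, e2, kerL, GLeft, GLeft]
    have a1 : (w : ℂ) - s - I * mid ap am = w - x / 2 - I * mid ap am / 2 := by rw [hs]; ring
    have a2 : -(w : ℂ) - s - I * mid ap am = -w - x / 2 - I * mid ap am / 2 := by rw [hs]; ring
    rw [a1, a2]
    generalize G ap am ((w : ℂ) - x / 2 - I * mid ap am / 2) = A
    generalize G ap am (-(w : ℂ) - x / 2 - I * mid ap am / 2) = B
    have e3 : ∀ c a b d e f : ℂ, a = d + b + e + f → c * (A * B) * exp a =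
        c * exp d * (A * exp b * (B * exp e) * exp f) := by
      intro c a b d e f h
      rw [h, exp_add, exp_add, exp_add]; ring
    refine e3 _ _ _ _ _ _ ?_
    rw [hσ]; ring
  have h5 : ∫ z : ℝ, kerR ap am x y z = exp (I * (2 * chi ap am + alpha ap am * s ^ 2 / 2)) *
      (∫ z : ℝ, G ap am (z + s) * G ap am (-z + s) * exp (I * alpha ap am * (z + y) ^ 2 / 2)) *
      exp (-(I * alpha ap am * y ^ 2 / 2)) := by
    rw [← integral_const_mul, ← integral_mul_const]
    exact integral_congr_ae (Eventually.of_forall fun z => kerR_eq ap am x y z)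
  rw [integral_congr_ae (Eventually.of_forall h3), integral_const_mul, e1] at h2
  rw [h5]
  set Q := ∫ z : ℝ, G ap am (z + s) * G ap am (-z + s) * exp (I * alpha ap am * (z + y) ^ 2 / 2)
  set P := ∫ z : ℝ, kerL ap am x y z
  have h6 : G ap am x * exp (I * (2 * chi ap am + alpha ap am * σ ^ 2 / 2)) * P =
      exp (-(I * Real.pi / 4)) * Q := by
    refine mul_left_cancel₀ hsq0 ?_
    linear_combination h2
  have hconst : exp (I * (chi ap am + alpha ap am * x ^ 2 / 4)) =
      exp (I * (2 * chi ap am + alpha ap am * s ^ 2 / 2)) * exp (I * Real.pi / 4) *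
      exp (I * (2 * chi ap am + alpha ap am * σ ^ 2 / 2)) := by
    rw [← exp_add, ← exp_add]
    congr 1
    have h7 : (alpha ap am : ℂ) * mid ap am ^ 2 / 4 = 3 * chi ap am + Real.pi / 4 := by
      have := alpha_mul_mid_sq hap ham
      exact_mod_cast this
    rw [hs, hσ]
    linear_combination I * h7 - I * alpha ap am * mid ap am ^ 2 / 4 * I_sq
  have hpi4 : exp (I * Real.pi / 4) * exp (-(I * Real.pi / 4)) = 1 := by
    rw [← exp_add]; simp
  have hy2 : exp (I * alpha ap am * y ^ 2 / 2) * exp (-(I * alpha ap am * y ^ 2 / 2)) = 1 := by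
    rw [← exp_add]; simp
  rw [GRight, hconst]
  linear_combination (exp (I * (2 * chi ap am + alpha ap am * s ^ 2 / 2)) *
    exp (I * Real.pi / 4)) * h6 + exp (I * (2 * chi ap am + alpha ap am * s ^ 2 / 2)) * Q * hpi4 -
    exp (I * (2 * chi ap am + alpha ap am * s ^ 2 / 2)) * Q * hy2

end RelToda

/-! ### Bent contours and their independence of the parameters. -/

namespace RelToda

open Complex Set

variable {X X' B B' K K' X₀ B₀ K₀ : ℝ} {f f₁ f₂ : ℂ → ℂ}

/-- The integral of `f` along the contour that comes from `-∞ + iB`, goes down at `Re z = X` from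
`X + iB` to `X - iK`, and then proceeds to `∞ - iK`. -/
noncomputable def cInt (X B K : ℝ) (f : ℂ → ℂ) : ℂ :=
  (∫ r in Iic X, f (r + B * I)) - I * (∫ t in (-K)..B, f (X + t * I)) +
    ∫ r in Ioi X, f (r + (-K : ℝ) * I)

/-- Integrability along the contour of `cInt`. -/
structure CIntegrable (X B K : ℝ) (f : ℂ → ℂ) : Prop where
  left : IntegrableOn (fun r : ℝ => f (r + B * I)) (Iic X)
  vert : IntervalIntegrable (fun t : ℝ => f (X + t * I)) volume (-K) B
  right : IntegrableOn (fun r : ℝ => f (r + (-K : ℝ) * I)) (Ioi X)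

theorem CIntegrable.add (h₁ : CIntegrable X B K f₁) (h₂ : CIntegrable X B K f₂) :
    CIntegrable X B K (fun z => f₁ z + f₂ z) :=
  ⟨h₁.left.add h₂.left, h₁.vert.add h₂.vert, h₁.right.add h₂.right⟩

theorem CIntegrable.const_mul (c : ℂ) (h : CIntegrable X B K f) :
    CIntegrable X B K (fun z => c * f z) :=
  ⟨h.left.const_mul c, h.vert.const_mul c, h.right.const_mul c⟩

theorem cInt_add (h₁ : CIntegrable X B K f₁) (h₂ : CIntegrable X B K f₂) :
    cInt X B K (fun z => f₁ z + f₂ z) = cInt X B K f₁ + cInt X B K f₂ := by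
  rw [cInt, cInt, cInt, integral_add h₁.left h₂.left, integral_add h₁.right h₂.right,
    intervalIntegral.integral_add h₁.vert h₂.vert]
  ring

theorem cInt_const_mul (c : ℂ) (f : ℂ → ℂ) :
    cInt X B K (fun z => c * f z) = c * cInt X B K f := by
  rw [cInt, cInt, integral_const_mul, integral_const_mul, intervalIntegral.integral_const_mul]
  ring

/-- Each point of the contour lies above B₀ on the incoming branch, or to the right of X₀ on the
other two; no more is asked of the integrands. -/
theorem cInt_congr (hX : X₀ < X) (hB : B₀ < B)
    (h : ∀ z : ℂ, (B₀ < z.im ∨ X₀ < z.re) → f₁ z = f₂ z) :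
    cInt X B K f₁ = cInt X B K f₂ := by
  rw [cInt, cInt]
  congr 1
  · congr 1
    · refine setIntegral_congr_fun measurableSet_Iic fun r _ => h _ (Or.inl ?_)
      simpa using hB
    · congr 1
      refine intervalIntegral.integral_congr fun t _ => h _ (Or.inr ?_)
      simpa using hX
  · refine setIntegral_congr_fun measurableSet_Ioi fun r hr => h _ (Or.inr ?_)
    have : X < r := hr
    simp only [add_re, ofReal_re, re_ofReal_mul, I_re, mul_zero, add_zero]
    linarith

theorem cInt_shift (h : ℝ) (f : ℂ → ℂ) :
    cInt X B K (fun z => f (z + h * I)) = cInt X (B + h) (K - h) f := by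
  rw [cInt, cInt]
  congr 1
  · congr 1
    · congr 1; funext r; congr 1; push_cast; ring
    · congr 1
      have := intervalIntegral.integral_comp_add_right (fun t : ℝ => f (X + t * I)) h
        (a := -K) (b := B)
      rw [show -(K - h) = -K + h by ring, ← this]
      refine intervalIntegral.integral_congr fun t _ => ?_
      congr 1; push_cast; ring
  · congr 1; funext r; congr 1; push_cast; ring

/-- The degenerate choice K = -ε closes the vertical segment and gives back a horizontal line. -/
theorem cInt_line (X : ℝ) {ε : ℝ} (hf : Integrable fun r : ℝ => f (r + ε * I)) :
    cInt X ε (-ε) f = ∫ r : ℝ, f (r + ε * I) := by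
  rw [cInt, neg_neg, intervalIntegral.integral_same, mul_zero, sub_zero,
    intervalIntegral.integral_Iic_add_Ioi hf.integrableOn hf.integrableOn]

/-- Functions that may be integrated along the contours of `cInt`, independently of the contour. -/
structure ContourAdm (X₀ B₀ K₀ : ℝ) (f : ℂ → ℂ) : Prop where
  diff : ∀ z : ℂ, (B₀ < z.im ∨ X₀ < z.re) → DifferentiableAt ℂ f z
  left : ∀ B B' X : ℝ, B₀ < B → ∃ C μ : ℝ, 0 < μ ∧ ∀ r t : ℝ, r ≤ X → B ≤ t → t ≤ B' →
    ‖f (r + t * I)‖ ≤ C * Real.exp (μ * r)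
  right : ∀ K K' X : ℝ, K₀ < K → X₀ < X → ∃ C μ : ℝ, 0 < μ ∧ ∀ r t : ℝ, X ≤ r → -K' ≤ t →
    t ≤ -K → ‖f (r + t * I)‖ ≤ C * Real.exp (-(μ * r))

theorem ContourAdm.continuous_left (h : ContourAdm X₀ B₀ K₀ f) (hB : B₀ < B) :
    Continuous fun r : ℝ => f (r + B * I) := by
  rw [continuous_iff_continuousAt]
  intro r
  exact ContinuousAt.comp (f := fun r : ℝ => (r : ℂ) + B * I)
    (h.diff _ (Or.inl (by simpa using hB))).continuousAt (by fun_prop)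

theorem ContourAdm.continuous_vert (h : ContourAdm X₀ B₀ K₀ f) (hX : X₀ < X) :
    Continuous fun t : ℝ => f (X + t * I) := by
  rw [continuous_iff_continuousAt]
  intro r
  exact ContinuousAt.comp (f := fun t : ℝ => (X : ℂ) + t * I)
    (h.diff _ (Or.inr (by simpa using hX))).continuousAt (by fun_prop)

theorem ContourAdm.integrable_left (h : ContourAdm X₀ B₀ K₀ f) (hB : B₀ < B) (X : ℝ) :
    IntegrableOn (fun r : ℝ => f (r + B * I)) (Iic X) := by
  obtain ⟨C, μ, hμ, hb⟩ := h.left B B X hB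
  refine ((integrableOn_exp_mul_Iic' hμ X).const_mul C).mono'
    (h.continuous_left hB).aestronglyMeasurable ?_
  filter_upwards [ae_restrict_mem measurableSet_Iic] with r hr
  exact hb r B hr le_rfl le_rfl

theorem ContourAdm.integrable_right (h : ContourAdm X₀ B₀ K₀ f) (hX : X₀ < X) (hK : K₀ < K) :
    IntegrableOn (fun r : ℝ => f (r + (-K : ℝ) * I)) (Ioi X) := by
  obtain ⟨C, μ, hμ, hb⟩ := h.right K K X hK hX
  refine ((integrableOn_exp_neg_mul_Ioi hμ X).const_mul C).mono' ?_ ?_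
  · refine ContinuousOn.aestronglyMeasurable (fun r hr => ?_) measurableSet_Ioi
    have hr' : X < r := hr
    exact (ContinuousAt.comp (f := fun r : ℝ => (r : ℂ) + (-K : ℝ) * I)
      (h.diff _ (Or.inr (by
        simp only [add_re, ofReal_re, re_ofReal_mul, I_re, mul_zero, add_zero]
        linarith))).continuousAt (by fun_prop)).continuousWithinAt
  · filter_upwards [ae_restrict_mem measurableSet_Ioi] with r hr
    exact hb r (-K) (le_of_lt hr) le_rfl le_rfl

theorem ContourAdm.cIntegrable (h : ContourAdm X₀ B₀ K₀ f) (hX : X₀ < X) (hB : B₀ < B)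
    (hK : K₀ < K) : CIntegrable X B K f :=
  ⟨h.integrable_left hB X, (h.continuous_vert hX).intervalIntegrable _ _,
    h.integrable_right hX hK⟩

theorem ContourAdm.cInt_eq_left (h : ContourAdm X₀ B₀ K₀ f) (hX : X₀ < X) (hB : B₀ < B)
    (hBB : B ≤ B') : cInt X B K f = cInt X B' K f := by
  obtain ⟨C, μ, hμ, hb⟩ := h.left B B' X hB
  have h1 := integral_Iic_sub_integral_Iic (S := ∅) (φ := fun r => C * Real.exp (-(μ * r)))
    countable_empty hBB
    (fun z hz => (h.diff z (Or.inl (hB.trans_le hz.2.1))).continuousAt.continuousWithinAt)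
    (fun z _ hz2 _ => h.diff z (Or.inl (hB.trans hz2.1))) (tendsto_const_mul_exp_neg hμ C)
    (fun r t hr ht => by
      have := hb r t hr ht.1 ht.2
      simpa using this)
    (h.integrable_left hB X) (h.integrable_left (hB.trans_le hBB) X)
  have h2 := intervalIntegral.integral_add_adjacent_intervals (μ := volume)
    (f := fun t : ℝ => f (X + t * I)) (a := -K) (b := B) (c := B')
    ((h.continuous_vert hX).intervalIntegrable _ _) ((h.continuous_vert hX).intervalIntegrable _ _)
  rw [cInt, cInt, ← h2]
  linear_combination h1

theorem ContourAdm.cInt_eq_right (h : ContourAdm X₀ B₀ K₀ f) (hX : X₀ < X) (hK : K₀ < K)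
    (hKK : K ≤ K') : cInt X B K f = cInt X B K' f := by
  obtain ⟨C, μ, hμ, hb⟩ := h.right K K' X hK hX
  have h1 := integral_Ioi_sub_integral_Ioi (S := ∅) (φ := fun r => C * Real.exp (-(μ * r)))
    countable_empty (neg_le_neg hKK)
    (fun z hz => (h.diff z (Or.inr (hX.trans_le hz.1))).continuousAt.continuousWithinAt)
    (fun z hz _ _ => h.diff z (Or.inr (hX.trans hz))) (tendsto_const_mul_exp_neg hμ C)
    (fun r t hr ht => hb r t hr ht.1 ht.2)
    (h.integrable_right hX (hK.trans_le hKK)) (h.integrable_right hX hK)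
  have h2 := intervalIntegral.integral_add_adjacent_intervals (μ := volume)
    (f := fun t : ℝ => f (X + t * I)) (a := -K') (b := -K) (c := B)
    ((h.continuous_vert hX).intervalIntegrable _ _) ((h.continuous_vert hX).intervalIntegrable _ _)
  rw [cInt, cInt, ← h2]
  linear_combination -h1

theorem ContourAdm.cInt_eq_vert (h : ContourAdm X₀ B₀ K₀ f) (hX : X₀ < X) (hB : B₀ < B)
    (hK : K₀ < K) (hXX : X ≤ X') : cInt X B K f = cInt X' B K f := by
  have h1 := Complex.integral_boundary_rect_eq_zero_of_differentiableOn f (X + (-K : ℝ) * I)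
    (X' + B * I) (fun z hz => by
      refine (h.diff z (Or.inr ?_)).differentiableWithinAt
      have h2 := (mem_reProdIm.1 hz).1
      simp only [add_re, ofReal_re, re_ofReal_mul, I_re, mul_zero, add_zero] at h2
      rw [uIcc_of_le hXX] at h2
      linarith [h2.1])
  simp only [add_re, ofReal_re, re_ofReal_mul, I_re, mul_zero, add_zero, add_im, ofReal_im,
    im_ofReal_mul, I_im, mul_one, zero_add, smul_eq_mul] at h1
  have h2 : (∫ r in Iic X', f (r + B * I)) =
      (∫ r in Iic X, f (r + B * I)) + ∫ r in X..X', f (r + B * I) := by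
    rw [intervalIntegral.integral_of_le hXX, ← setIntegral_union (by
      rw [disjoint_left]; intro a h1 h2; exact absurd h2.1 (not_lt.2 h1)) measurableSet_Ioc
      (h.integrable_left hB X) ((h.integrable_left hB X').mono_set fun a ha => ha.2),
      Iic_union_Ioc_eq_Iic hXX]
  have h3 : (∫ r in Ioi X, f (r + (-K : ℝ) * I)) =
      (∫ r in X..X', f (r + (-K : ℝ) * I)) + ∫ r in Ioi X', f (r + (-K : ℝ) * I) := by
    rw [intervalIntegral.integral_of_le hXX, ← setIntegral_union (by
      rw [disjoint_left]; intro a h1 h2; exact absurd h1.2 (not_le.2 h2)) measurableSet_Ioi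
      ((h.integrable_right hX hK).mono_set fun a ha => ha.1)
      (h.integrable_right (hX.trans_le hXX) hK), Ioc_union_Ioi_eq_Ioi hXX]
  rw [cInt, cInt, h2, h3]
  linear_combination h1

/-- The contour integral does not depend on the contour. -/
theorem ContourAdm.cInt_eq (h : ContourAdm X₀ B₀ K₀ f) (hX : X₀ < X) (hB : B₀ < B) (hK : K₀ < K)
    (hX' : X₀ < X') (hB' : B₀ < B') (hK' : K₀ < K') : cInt X B K f = cInt X' B' K' f := by
  -- Contours are compared only in the increasing direction of all three parameters; two arbitrary
  -- ones are then both moved to their common maximum.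
  have key : ∀ {X B K X' B' K' : ℝ}, X₀ < X → B₀ < B → K₀ < K → X ≤ X' → B ≤ B' → K ≤ K' →
      cInt X B K f = cInt X' B' K' f := by
    intro X B K X' B' K' h1 h2 h3 h4 h5 h6
    rw [h.cInt_eq_vert h1 h2 h3 h4, h.cInt_eq_left (h1.trans_le h4) h2 h5,
      h.cInt_eq_right (h1.trans_le h4) h3 h6]
  rw [key hX hB hK (le_max_left X X') (le_max_left B B') (le_max_left K K'),
    ← key hX' hB' hK' (le_max_right X X') (le_max_right B B') (le_max_right K K')]

end RelToda

/-! ### Uniform bounds for the integrand on the bent contour. -/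

namespace RelToda

open Complex Set

variable {ap am m ρ β κ P X B B' K K' Y : ℝ}

/-- The analytic continuation of `kerPlus` in the parameters. -/
noncomputable def nKer (ap am : ℝ) (x y z : ℂ) : ℂ :=
  G ap am (z + y / 2 - I * mid ap am) * G ap am (z - y / 2 - I * mid ap am) *
    exp (-(I * alpha ap am * (z * x + z ^ 2 / 2)))

/-- A box of parameters `(x, y)` in which `nKer` is bounded uniformly. -/
def nBox (ap am m ρ β κ P : ℝ) : Set (ℂ × ℂ) :=
  {q | |q.1.re| < P ∧ -mid ap am + m < q.1.im ∧ q.1.im < mid ap am + 2 * κ ∧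
    |q.2.re| < 2 * ρ ∧ |q.2.im| < 2 * β}

theorem isOpen_nBox (ap am m ρ β κ P : ℝ) : IsOpen (nBox ap am m ρ β κ P) := by
  have o1 : IsOpen {q : ℂ × ℂ | |q.1.re| < P} := isOpen_lt (by fun_prop) continuous_const
  have o2 : IsOpen {q : ℂ × ℂ | -mid ap am + m < q.1.im} :=
    isOpen_lt continuous_const (by fun_prop)
  have o3 : IsOpen {q : ℂ × ℂ | q.1.im < mid ap am + 2 * κ} :=
    isOpen_lt (by fun_prop) continuous_const
  have o4 : IsOpen {q : ℂ × ℂ | |q.2.re| < 2 * ρ} := isOpen_lt (by fun_prop) continuous_const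
  have o5 : IsOpen {q : ℂ × ℂ | |q.2.im| < 2 * β} := isOpen_lt (by fun_prop) continuous_const
  exact o1.inter (o2.inter (o3.inter (o4.inter o5)))

/-- The contributions of y to the two gamma exponents cancel to leading order in r. What remains is
(t - a)|r| from the gamma functions, r Im x from the linear term and rt from the Gaussian. -/
theorem norm_nKer_le (hap : 0 < ap) (ham : 0 < am) {q : ℂ × ℂ} (hq : q ∈ nBox ap am m ρ β κ P)
    {C r t : ℝ} (hC : 0 ≤ C) (ht : |t| ≤ Y) (h : ∀ σ : ℝ, σ = 1 ∨ σ = -1 →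
      ‖G ap am (r + t * I + σ * (q.2 / 2) - I * mid ap am)‖ ≤ C * Real.exp (alpha ap am / 2 *
        ((t + σ * (q.2.im / 2) - mid ap am) * |r + σ * (q.2.re / 2)|))) :
    ‖nKer ap am q.1 q.2 (r + t * I)‖ ≤
      C * C * Real.exp (alpha ap am * ((Y + mid ap am + β) * ρ + Y * P)) *
        Real.exp (alpha ap am * ((t - mid ap am) * |r| + r * q.1.im + r * t)) := by
  have hα := alpha_pos hap ham
  have hm := mid_pos hap ham
  obtain ⟨h1, h2, h3, h4, h5⟩ := hq
  have hp := h 1 (Or.inl rfl)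
  have hn := h (-1) (Or.inr rfl)
  have hY : 0 ≤ Y := (abs_nonneg _).trans ht
  have hβ : 0 ≤ β := by linarith [abs_nonneg q.2.im]
  have ht' := abs_le.1 ht
  have h5' := abs_lt.1 h5
  have key : ∀ σ : ℝ, σ = 1 ∨ σ = -1 → (t + σ * (q.2.im / 2) - mid ap am) *
      |r + σ * (q.2.re / 2)| ≤ (t + σ * (q.2.im / 2) - mid ap am) * |r| +
        (Y + mid ap am + β) * ρ := by
    intro σ hσ
    refine (mul_abs_add_le (v := Y + mid ap am + β) ?_).trans ?_
    · rcases hσ with rfl | rfl <;> rw [abs_le] <;> constructor <;> linarith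
    · gcongr
      rcases hσ with rfl | rfl <;> simp only [one_mul, neg_mul, abs_neg, abs_div, abs_two] <;>
        linarith
  have k1 := key 1 (Or.inl rfl)
  have k2 := key (-1) (Or.inr rfl)
  have htx : t * q.1.re ≤ Y * P := (le_abs_self _).trans (by
    rw [abs_mul]; exact mul_le_mul ht h1.le (abs_nonneg _) hY)
  have hexp : ‖exp (-(I * alpha ap am * ((r + t * I) * q.1 + ((r : ℂ) + t * I) ^ 2 / 2)))‖ =
      Real.exp (alpha ap am * (r * q.1.im + t * q.1.re + r * t)) := by
    rw [norm_exp]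
    congr 1
    have : ((r : ℂ) + t * I) ^ 2 / 2 = ((r ^ 2 - t ^ 2) / 2 : ℝ) + (r * t : ℝ) * I := by
      push_cast
      linear_combination t ^ 2 / 2 * I_sq
    rw [this, show I * (alpha ap am : ℂ) * ((r + t * I) * q.1 + (((r ^ 2 - t ^ 2) / 2 : ℝ) +
      (r * t : ℝ) * I)) = I * ((alpha ap am : ℂ) * ((r + t * I) * q.1 +
      (((r ^ 2 - t ^ 2) / 2 : ℝ) + (r * t : ℝ) * I))) by ring]
    simp [-ofReal_div]
  rw [nKer, norm_mul, norm_mul, hexp]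
  have e1 : (r : ℂ) + t * I + q.2 / 2 - I * mid ap am =
    r + t * I + (1 : ℝ) * (q.2 / 2) - I * mid ap am := by push_cast; ring
  have e2 : (r : ℂ) + t * I - q.2 / 2 - I * mid ap am =
    r + t * I + (-1 : ℝ) * (q.2 / 2) - I * mid ap am := by push_cast; ring
  rw [e1, e2]
  refine (mul_le_mul_of_nonneg_right (mul_le_mul hp hn (norm_nonneg _) (by positivity))
    (Real.exp_pos _).le).trans ?_
  rw [mul_mul_mul_comm, mul_assoc, mul_assoc (C * C), ← Real.exp_add, ← Real.exp_add,
    ← Real.exp_add]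
  refine mul_le_mul_of_nonneg_left (Real.exp_le_exp.2 ?_) (by positivity)
  nlinarith

theorem exists_norm_nKer_le_up (hap : 0 < ap) (ham : 0 < am) (hB : β < B) :
    ∃ C, 0 < C ∧ ∀ q ∈ nBox ap am m ρ β κ P, ∀ r t : ℝ, B ≤ t → t ≤ B' →
      ‖nKer ap am q.1 q.2 (r + t * I)‖ ≤
        C * Real.exp (alpha ap am * ((t - mid ap am) * |r| + r * q.1.im + r * t)) := by
  obtain ⟨C, hC, h⟩ := exists_norm_G_le_upper hap ham
    (by linarith : mid ap am - (B - β) < mid ap am) (B' + β)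
  have hm := mid_pos hap ham
  refine ⟨C * C * Real.exp (alpha ap am * ((max |B| |B'| + mid ap am + β) * ρ +
    max |B| |B'| * P)), by positivity, fun q hq r t h1 h2 => ?_⟩
  refine norm_nKer_le hap ham hq hC.le (abs_le_max_abs_abs h1 h2) fun σ hσ => ?_
  have h5 := abs_lt.1 hq.2.2.2.2
  have e1 : ((r : ℂ) + t * I + σ * (q.2 / 2) - I * mid ap am).im =
    t + σ * (q.2.im / 2) - mid ap am := by simp
  have e2 : ((r : ℂ) + t * I + σ * (q.2 / 2) - I * mid ap am).re = r + σ * (q.2.re / 2) := by simp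
  rw [← e1, ← e2]
  refine h _ ?_ ?_ <;> rw [e1] <;> rcases hσ with rfl | rfl <;> linarith

theorem exists_norm_nKer_le_right (hap : 0 < ap) (ham : 0 < am) (hX : ρ < X) (Y : ℝ) :
    ∃ C, 0 < C ∧ ∀ q ∈ nBox ap am m ρ β κ P, ∀ r t : ℝ, X ≤ r → |t| ≤ Y →
      ‖nKer ap am q.1 q.2 (r + t * I)‖ ≤
        C * Real.exp (alpha ap am * ((t - mid ap am) * |r| + r * q.1.im + r * t)) := by
  obtain ⟨C, hC, h⟩ := exists_norm_G_le_right hap ham (sub_pos.2 hX) (Y + β + mid ap am)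
  have hm := mid_pos hap ham
  refine ⟨C * C * Real.exp (alpha ap am * ((Y + mid ap am + β) * ρ + Y * P)), by positivity,
    fun q hq r t h1 h2 => ?_⟩
  refine norm_nKer_le hap ham hq hC.le h2 fun σ hσ => ?_
  have h5 := abs_lt.1 hq.2.2.2.2
  have h4 := abs_lt.1 hq.2.2.2.1
  have h6 := abs_le.1 h2
  have e1 : ((r : ℂ) + t * I + σ * (q.2 / 2) - I * mid ap am).im =
    t + σ * (q.2.im / 2) - mid ap am := by simp
  have e2 : ((r : ℂ) + t * I + σ * (q.2 / 2) - I * mid ap am).re = r + σ * (q.2.re / 2) := by simp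
  rw [← e1, ← e2]
  refine h _ ?_ ?_
  · rw [e1, abs_le]
    rcases hσ with rfl | rfl <;> constructor <;> linarith
  · rw [e2]
    refine le_trans ?_ (le_abs_self _)
    rcases hσ with rfl | rfl <;> linarith

/-- For r < 0 the height t cancels and the exponent is αr(a + Im x): there is decay to the left
exactly when Im x > -a, and no change of height can improve it. -/
theorem exists_norm_nKer_le_left (hap : 0 < ap) (ham : 0 < am) (hB : β < B) (B' X : ℝ) :
    ∃ C, 0 < C ∧ ∀ q ∈ nBox ap am m ρ β κ P, ∀ r t : ℝ, r ≤ X → B ≤ t → t ≤ B' →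
      ‖nKer ap am q.1 q.2 (r + t * I)‖ ≤ C * Real.exp (alpha ap am * m * r) := by
  obtain ⟨C, hC, h⟩ := exists_norm_nKer_le_up (m := m) (ρ := ρ) (κ := κ) (P := P) (B' := B')
    hap ham hB
  have hα := alpha_pos hap ham
  have hm := mid_pos hap ham
  refine ⟨C * Real.exp (alpha ap am * (2 * (|B'| + mid ap am) * |X| +
    (2 * mid ap am + 2 * |κ| + |m|) * |X|)), by positivity, fun q hq r t hr h1 h2 => ?_⟩
  refine (h q hq r t h1 h2).trans ?_
  rw [mul_assoc, ← Real.exp_add]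
  refine mul_le_mul_of_nonneg_left (Real.exp_le_exp.2 ?_) hC.le
  rw [mul_assoc (alpha ap am), ← mul_add]
  refine mul_le_mul_of_nonneg_left ?_ hα.le
  obtain ⟨-, h4, h5, -, -⟩ := hq
  have hX := le_abs_self X
  have hX0 := abs_nonneg X
  have hB' := le_abs_self B'
  have hB0 := abs_nonneg B'
  have hκ := le_abs_self κ
  have hκ0 := abs_nonneg κ
  have hmm := neg_abs_le m
  have hm0 := abs_nonneg m
  have a1 : (t - mid ap am) * (|r| + r) ≤ (|B'| + mid ap am) * (2 * |X|) := by
    have b1 : 0 ≤ |r| + r := by linarith [neg_abs_le r]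
    have b2 : |r| + r ≤ 2 * |X| := by
      rcases le_total 0 r with h0 | h0
      · rw [abs_of_nonneg h0]; linarith
      · rw [abs_of_nonpos h0]; linarith
    exact mul_le_mul (by linarith) b2 b1 (by linarith)
  have a2 : (mid ap am + q.1.im - m) * r ≤ (2 * mid ap am + 2 * |κ| + |m|) * |X| :=
    (mul_le_mul_of_nonneg_left (hr.trans hX) (by linarith)).trans
      (mul_le_mul_of_nonneg_right (by linarith) hX0)
  linarith

/-- For r > 0 the exponent is αr(2t - a + Im x), so going down helps. Depth K > (Im x - a)/2 is
enough, which is why the contour is bent and arbitrarily large Im x can be reached. -/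
theorem exists_norm_nKer_le_down (hap : 0 < ap) (ham : 0 < am) (hX : ρ < X) (hX0 : 0 ≤ X) (K K' : ℝ) :
    ∃ C, 0 < C ∧ ∀ q ∈ nBox ap am m ρ β κ P, ∀ r t : ℝ, X ≤ r → -K' ≤ t → t ≤ -K →
      ‖nKer ap am q.1 q.2 (r + t * I)‖ ≤
        C * Real.exp (-(alpha ap am * (2 * (K - κ)) * r)) := by
  obtain ⟨C, hC, h⟩ := exists_norm_nKer_le_right (m := m) (β := β) (κ := κ) (P := P)
    hap ham hX (max |(-K')| |(-K)|)
  have hα := alpha_pos hap ham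
  refine ⟨C, hC, fun q hq r t hr h1 h2 => (h q hq r t hr (abs_le_max_abs_abs h1 h2)).trans ?_⟩
  refine mul_le_mul_of_nonneg_left (Real.exp_le_exp.2 ?_) hC.le
  rw [mul_assoc, ← mul_neg]
  refine mul_le_mul_of_nonneg_left ?_ hα.le
  obtain ⟨-, h4, h5, -, -⟩ := hq
  rw [abs_of_nonneg (hX0.trans hr)]
  have := mul_le_mul_of_nonneg_right (by linarith : 2 * t - mid ap am + q.1.im ≤ -(2 * (K - κ)))
    (hX0.trans hr)
  linarith

theorem exists_norm_nKer_le_vert (hap : 0 < ap) (ham : 0 < am) (hX : ρ < X) (Y : ℝ) :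
    ∃ C, 0 < C ∧ ∀ q ∈ nBox ap am m ρ β κ P, ∀ t : ℝ, |t| ≤ Y →
      ‖nKer ap am q.1 q.2 (X + t * I)‖ ≤ C := by
  obtain ⟨C, hC, h⟩ := exists_norm_nKer_le_right (m := m) (β := β) (κ := κ) (P := P)
    hap ham hX Y
  have hα := alpha_pos hap ham
  have hm := mid_pos hap ham
  refine ⟨C * Real.exp (alpha ap am * ((Y + mid ap am) * |X| + |X| * (mid ap am + |m| + 2 * |κ|) +
    |X| * Y)), by positivity, fun q hq t ht => (h q hq X t le_rfl ht).trans ?_⟩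
  refine mul_le_mul_of_nonneg_left (Real.exp_le_exp.2 (mul_le_mul_of_nonneg_left ?_ hα.le)) hC.le
  obtain ⟨-, h4, h5, -, -⟩ := hq
  have ht' := abs_le.1 ht
  have a0 : ∀ a b c : ℝ, |b| ≤ c → a * b ≤ |a| * c := fun a b c hb =>
    (le_abs_self _).trans (by rw [abs_mul]; exact mul_le_mul_of_nonneg_left hb (abs_nonneg _))
  have a1 := a0 X q.1.im (mid ap am + |m| + 2 * |κ|) (by
    rw [abs_le]
    constructor <;> linarith [neg_abs_le m, le_abs_self κ, abs_nonneg κ, abs_nonneg m])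
  have a2 := a0 X t Y ht
  have a3 : (t - mid ap am) * |X| ≤ (Y + mid ap am) * |X| :=
    mul_le_mul_of_nonneg_right (by linarith) (abs_nonneg _)
  linarith

/-- The poles in z lie on the half-lines going down from ± y/2, so they are avoided above |Im y|/2
and to the right of |Re y|/2. -/
theorem add_sub_notMem_lattice (hap : 0 < ap) (ham : 0 < am) {y z : ℂ}
    (h : |y.im| / 2 < z.im ∨ |y.re| / 2 < z.re) :
    -(z + y / 2 - I * mid ap am) ∉ lattice ap am ∧ -(z - y / 2 - I * mid ap am) ∉ lattice ap am := by
  rcases h with h | h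
  · have h1 := abs_le.1 (le_refl |y.im|)
    constructor <;> refine neg_notMem_lattice_of_lt_im hap ham ?_ <;> simp <;> linarith
  · have h1 := abs_le.1 (le_refl |y.re|)
    constructor <;> refine notMem_lattice_of_re_ne (ne_of_lt ?_) <;> simp <;> linarith

theorem differentiableAt_nKer (hap : 0 < ap) (ham : 0 < am) {x y z : ℂ}
    (h : |y.im| / 2 < z.im ∨ |y.re| / 2 < z.re) :
    DifferentiableAt ℂ (nKer ap am x y) z ∧
      DifferentiableAt ℂ (fun q : ℂ × ℂ => nKer ap am q.1 q.2 z) (x, y) := by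
  obtain ⟨h1, h2⟩ := add_sub_notMem_lattice hap ham h
  have g1 := (analyticAt_G hap ham h1).differentiableAt
  have g2 := (analyticAt_G hap ham h2).differentiableAt
  constructor
  · exact ((DifferentiableAt.comp (f := fun z => z + y / 2 - I * mid ap am) z g1 (by fun_prop)).mul
      (DifferentiableAt.comp (f := fun z => z - y / 2 - I * mid ap am) z g2 (by fun_prop))).mul
      (by fun_prop)
  · exact ((DifferentiableAt.comp (f := fun q : ℂ × ℂ => z + q.2 / 2 - I * mid ap am) (x, y) g1
      (by fun_prop)).mul
      (DifferentiableAt.comp (f := fun q : ℂ × ℂ => z - q.2 / 2 - I * mid ap am) (x, y) g2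
      (by fun_prop))).mul (by fun_prop)

theorem mem_nBox_of_lt {x y : ℂ} (hm : -mid ap am + m < x.im) (hρ : |y.re| / 2 < ρ)
    (hβ : |y.im| / 2 < β) (hκ : (x.im - mid ap am) / 2 < κ) :
    (x, y) ∈ nBox ap am m ρ β κ (|x.re| + 1) :=
  ⟨lt_add_one _, hm, by linarith, by linarith, by linarith⟩

theorem contourAdm_nKer (hap : 0 < ap) (ham : 0 < am) {x y : ℂ} (hx : -mid ap am < x.im) :
    ContourAdm (|y.re| / 2) (|y.im| / 2) ((x.im - mid ap am) / 2) (nKer ap am x y) := by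
  have hα := alpha_pos hap ham
  obtain ⟨m, hm1, hm2⟩ := exists_between (by linarith : 0 < x.im + mid ap am)
  refine ⟨fun z hz => (differentiableAt_nKer hap ham hz).1, fun B B' X hB => ?_,
    fun K K' X hK hX => ?_⟩
  · obtain ⟨β, h1, h2⟩ := exists_between hB
    obtain ⟨C, -, h⟩ := exists_norm_nKer_le_left (m := m) (ρ := |y.re| / 2 + 1)
      (κ := (x.im - mid ap am) / 2 + 1) (P := |x.re| + 1) hap ham h2 B' X
    exact ⟨C, alpha ap am * m, by positivity,
      h (x, y) (mem_nBox_of_lt (by linarith) (by linarith) h1 (by linarith))⟩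
  · obtain ⟨ρ, h1, h2⟩ := exists_between hX
    obtain ⟨κ, h3, h4⟩ := exists_between hK
    have := sub_pos.2 h4
    obtain ⟨C, -, h⟩ := exists_norm_nKer_le_down (m := m) (β := |y.im| / 2 + 1) (κ := κ)
      (P := |x.re| + 1) hap ham h2 (by linarith [abs_nonneg y.re]) K K'
    exact ⟨C, alpha ap am * (2 * (K - κ)), by positivity,
      h (x, y) (mem_nBox_of_lt (by linarith) h1 (by linarith) h3)⟩

/-- The contour integral of `nKer` is holomorphic in the parameters. -/
theorem differentiableAt_cInt_nKer (hap : 0 < ap) (ham : 0 < am) {p : ℂ × ℂ}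
    (hx : -mid ap am < p.1.im) (hX : |p.2.re| / 2 < X) (hB : |p.2.im| / 2 < B)
    (hK : (p.1.im - mid ap am) / 2 < K) :
    DifferentiableAt ℂ (fun q : ℂ × ℂ => cInt X B K (nKer ap am q.1 q.2)) p := by
  have hα := alpha_pos hap ham
  obtain ⟨m, hm1, hm2⟩ := exists_between (by linarith : 0 < p.1.im + mid ap am)
  obtain ⟨β, b1, b2⟩ := exists_between hB
  obtain ⟨ρ, r1, r2⟩ := exists_between hX
  obtain ⟨κ, k1, k2⟩ := exists_between hK
  have hκ := sub_pos.2 k2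
  set U := nBox ap am m ρ β κ (|p.1.re| + 1)
  have hpU : p ∈ U := mem_nBox_of_lt (by linarith) r1 b1 k1
  have hU : U ∈ 𝓝 p := (isOpen_nBox _ _ _ _ _ _ _).mem_nhds hpU
  have hadm : ∀ q ∈ U, ContourAdm (|q.2.re| / 2) (|q.2.im| / 2) ((q.1.im - mid ap am) / 2)
      (nKer ap am q.1 q.2) := fun q hq => contourAdm_nKer hap ham (by linarith [hq.2.1])
  have hc : ∀ q ∈ U, CIntegrable X B K (nKer ap am q.1 q.2) := fun q hq =>
    (hadm q hq).cIntegrable (by linarith [hq.2.2.2.1]) (by linarith [hq.2.2.2.2])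
      (by linarith [hq.2.2.1])
  have hd : ∀ z : ℂ, B ≤ z.im ∨ X ≤ z.re → ∀ q ∈ U,
      DifferentiableAt ℂ (fun q : ℂ × ℂ => nKer ap am q.1 q.2 z) q := fun z hz q hq =>
    (differentiableAt_nKer hap ham (hz.imp (fun h => by linarith [hq.2.2.2.2])
      (fun h => by linarith [hq.2.2.2.1]))).2
  unfold cInt
  refine (DifferentiableAt.sub ?_ (DifferentiableAt.const_mul ?_ I)).add ?_
  · obtain ⟨C, -, h⟩ := exists_norm_nKer_le_left (m := m) (ρ := ρ) (κ := κ) (P := |p.1.re| + 1)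
      hap ham b2 B X
    refine differentiableAt_integral_prod hU
      ((integrableOn_exp_mul_Iic' (by positivity : 0 < alpha ap am * m) X).const_mul C)
      (fun q hq => (hc q hq).left.aestronglyMeasurable)
      (Eventually.of_forall fun r => hd _ (Or.inl (by simp))) ?_
    filter_upwards [ae_restrict_mem measurableSet_Iic] with r hr q hq
    exact h q hq r B hr le_rfl le_rfl
  · simp only [intervalIntegral]
    obtain ⟨C, -, h⟩ := exists_norm_nKer_le_vert (m := m) (β := β) (κ := κ) (P := |p.1.re| + 1)
      hap ham r2 (max |(-K)| |B|)
    have hv : ∀ a b : ℝ, (∀ q ∈ U, IntegrableOn (fun t : ℝ => nKer ap am q.1 q.2 (X + t * I))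
        (Ioc a b)) → (∀ t ∈ Ioc a b, |t| ≤ max |(-K)| |B|) →
        DifferentiableAt ℂ (fun q : ℂ × ℂ => ∫ t in Ioc a b, nKer ap am q.1 q.2 (X + t * I)) p := by
      intro a b h1 h2
      refine differentiableAt_integral_prod hU (B := fun _ => C) (by simp)
        (fun q hq => (h1 q hq).aestronglyMeasurable)
        (Eventually.of_forall fun r => hd _ (Or.inr (by simp))) ?_
      filter_upwards [ae_restrict_mem measurableSet_Ioc] with t ht q hq
      exact h q hq t (h2 t ht)
    refine (hv _ _ (fun q hq => (hc q hq).vert.1) fun t ht => ?_).sub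
      (hv _ _ (fun q hq => (hc q hq).vert.2) fun t ht => ?_)
    · exact abs_le_max_abs_abs ht.1.le ht.2
    · rw [max_comm]; exact abs_le_max_abs_abs ht.1.le ht.2
  · obtain ⟨C, -, h⟩ := exists_norm_nKer_le_down (m := m) (β := β) (κ := κ) (P := |p.1.re| + 1)
      hap ham r2 (by linarith [abs_nonneg p.2.re]) K K
    refine differentiableAt_integral_prod hU
      ((integrableOn_exp_neg_mul_Ioi (by positivity : 0 < alpha ap am * (2 * (K - κ))) X).const_mul C)
      (fun q hq => (hc q hq).right.aestronglyMeasurable) ?_ ?_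
    · filter_upwards [ae_restrict_mem measurableSet_Ioi] with r hr
      refine hd _ (Or.inr ?_)
      simp only [add_re, ofReal_re, re_ofReal_mul, I_re, mul_zero, add_zero]
      exact le_of_lt hr
    · filter_upwards [ae_restrict_mem measurableSet_Ioi] with r hr q hq
      exact h q hq r (-K) (le_of_lt hr) le_rfl le_rfl

end RelToda

/-! ### The continuation to Im x > -a and its difference equations. -/

namespace RelToda

open Complex Set

variable {ap am X B K : ℝ}

/-- The analytic continuation of the eigenfunction in the half plane `Im x > -a`. -/
noncomputable def nVal (ap am : ℝ) (x y : ℂ) : ℂ :=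
  exp (I * alpha ap am * y ^ 2 / 8) *
    cInt (|y.re| + 1) (|y.im| + 1) (|x.im| + 1) (nKer ap am x y)

theorem nVal_eq (hap : 0 < ap) (ham : 0 < am) {x y : ℂ} (hx : -mid ap am < x.im)
    (hX : |y.re| / 2 < X) (hB : |y.im| / 2 < B) (hK : (x.im - mid ap am) / 2 < K) :
    nVal ap am x y = exp (I * alpha ap am * y ^ 2 / 8) * cInt X B K (nKer ap am x y) := by
  have hm := mid_pos hap ham
  rw [nVal, (contourAdm_nKer hap ham hx).cInt_eq _ _ _ hX hB hK]
  · linarith [abs_nonneg y.re]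
  · linarith [abs_nonneg y.im]
  · linarith [le_abs_self x.im, abs_nonneg x.im]

/-- The contour in the definition moves with x and y. Near a given point it can be frozen, because
the integral does not depend on it. -/
theorem differentiableAt_nVal (hap : 0 < ap) (ham : 0 < am) {p : ℂ × ℂ}
    (hx : -mid ap am < p.1.im) :
    DifferentiableAt ℂ (fun q : ℂ × ℂ => nVal ap am q.1 q.2) p := by
  have h0 := abs_nonneg p.2.re
  have h1 := abs_nonneg p.2.im
  have h2 := le_abs_self p.1.im
  have h3 := abs_nonneg p.1.im
  have hm := mid_pos hap ham
  have hd := differentiableAt_cInt_nKer hap ham hx (X := |p.2.re| + 1) (B := |p.2.im| + 1)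
    (K := |p.1.im| + 1) (by linarith) (by linarith) (by linarith)
  have hU := (isOpen_nBox ap am 0 (|p.2.re| + 1) (|p.2.im| + 1) (|p.1.im| + 1)
    (|p.1.re| + 1)).mem_nhds (x := p)
    (mem_nBox_of_lt (by linarith) (by linarith) (by linarith) (by linarith))
  have he : DifferentiableAt ℂ (fun q : ℂ × ℂ => exp (I * alpha ap am * q.2 ^ 2 / 8)) p := by
    fun_prop
  refine (he.mul hd).congr_of_eventuallyEq ?_
  filter_upwards [hU] with q hq
  exact nVal_eq hap ham (by linarith [hq.2.1]) (by linarith [hq.2.2.2.1])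
    (by linarith [hq.2.2.2.2]) (by linarith [hq.2.2.1])

theorem pi_div_par_mul_mid (hap : 0 < ap) (ham : 0 < am) (δ : Bool) :
    (Real.pi / par ap am δ : ℂ) * (I * mid ap am) =
      I * Real.pi / 2 + Real.pi / par ap am δ * (step ap am δ / 2) := by
  have h1 : (par ap am δ : ℂ) ≠ 0 := by exact_mod_cast (par_pos hap ham δ).ne'
  have h2 : (par ap am δ : ℂ) + par ap am (!δ) = 2 * mid ap am := by
    exact_mod_cast par_add_par ap am δ
  rw [step]
  field_simp
  linear_combination -h2

/-- In coordinates z - s/2 each term on the left has exactly one gamma function raised by a full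
step. After the difference equation one exponential of each cosh cancels between the two terms, and
the others combine to s_δ(y). -/
theorem nKer_y_shift (hap : 0 < ap) (ham : 0 < am) (δ : Bool) {x y z : ℂ}
    (h : |y.im| / 2 + par ap am (!δ) / 2 < z.im ∨ |y.re| / 2 < z.re) :
    exp (I * alpha ap am * (y + step ap am δ) ^ 2 / 8) * nKer ap am x (y + step ap am δ) z +
      -exp (I * alpha ap am * (y - step ap am δ) ^ 2 / 8) * nKer ap am x (y - step ap am δ) z =
    -2 * I * sd ap am δ y * ed ap am δ x * exp (I * alpha ap am * y ^ 2 / 8) *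
      nKer ap am x y (z + (-(par ap am (!δ) / 2) : ℝ) * I) := by
  set s := step ap am δ with hs
  have hz : z + (-(par ap am (!δ) / 2) : ℝ) * I = z - s / 2 := by
    rw [hs, step]; push_cast; ring
  obtain ⟨h1, h2⟩ := add_sub_notMem_lattice hap ham (y := y) (z := z - s / 2) (by
    refine h.imp (fun h => ?_) (fun h => ?_)
    · simp [hs, step_im]; linarith
    · simpa [hs, step_re] using h)
  have a1 := G_add_step hap ham δ h1
  have a2 := G_add_step hap ham δ h2
  have r1 := alpha_mul_step hap ham δ
  have r3 := pi_div_par_mul_mid hap ham δ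
  rw [← hs] at a1 a2 r1 r3
  rw [hz]
  simp only [nKer]
  rw [show z + (y + s) / 2 - I * mid ap am = z - s / 2 + y / 2 - I * mid ap am + s by ring,
    show z - (y + s) / 2 - I * mid ap am = z - s / 2 - y / 2 - I * mid ap am by ring,
    show z + (y - s) / 2 - I * mid ap am = z - s / 2 + y / 2 - I * mid ap am by ring,
    show z - (y - s) / 2 - I * mid ap am = z - s / 2 - y / 2 - I * mid ap am + s by ring, a1, a2]
  simp only [cd, sd, ed, cosh, sinh]
  set p : ℂ := Real.pi / par ap am δ with hp
  have hpm : ∀ u : ℂ, (Real.pi : ℂ) * u / par ap am δ = p * u := fun u => by rw [hp]; ring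
  have hr1 : I * (alpha ap am : ℂ) * s = -(2 * p) := by rw [r1, hp]; ring
  simp only [hpm]
  -- The factor i is written as exp(iπ/2) to merge it with the other exponentials; the separate name
  -- keeps the remaining occurrences of I out of that rewriting.
  obtain ⟨i', hi'⟩ : ∃ i' : ℂ, i' = I := ⟨I, rfl⟩
  have hI : exp (Real.pi / 2 * I) = i' := by rw [hi', exp_pi_div_two_mul_I]
  have e1 : exp (I * alpha ap am * (y + s) ^ 2 / 8) *
      exp (p * (z - s / 2 + y / 2 - I * mid ap am + s / 2)) =
      exp (I * alpha ap am * (y - s) ^ 2 / 8) *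
      exp (p * (z - s / 2 - y / 2 - I * mid ap am + s / 2)) := by
    rw [← exp_add, ← exp_add]
    congr 1
    linear_combination y / 2 * hr1
  have e2 : exp (I * alpha ap am * (y + s) ^ 2 / 8) *
      exp (-(p * (z - s / 2 + y / 2 - I * mid ap am + s / 2))) *
      exp (-(I * alpha ap am * (z * x + z ^ 2 / 2))) =
      i' * exp (-(p * y)) * exp (p * x) * exp (I * alpha ap am * y ^ 2 / 8) *
      exp (-(I * alpha ap am * ((z - s / 2) * x + (z - s / 2) ^ 2 / 2))) := by
    rw [← hI]
    simp only [← exp_add]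
    congr 1
    linear_combination (y / 4 + s / 4 - x / 2 - z / 2) * hr1 + r3
  have e3 : exp (I * alpha ap am * (y - s) ^ 2 / 8) *
      exp (-(p * (z - s / 2 - y / 2 - I * mid ap am + s / 2))) *
      exp (-(I * alpha ap am * (z * x + z ^ 2 / 2))) =
      i' * exp (p * y) * exp (p * x) * exp (I * alpha ap am * y ^ 2 / 8) *
      exp (-(I * alpha ap am * ((z - s / 2) * x + (z - s / 2) ^ 2 / 2))) := by
    rw [← hI]
    simp only [← exp_add]
    congr 1
    linear_combination (-y / 4 + s / 4 - x / 2 - z / 2) * hr1 + r3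
  rw [hi'] at e2 e3
  linear_combination (G ap am (z - s / 2 + y / 2 - I * mid ap am) *
    G ap am (z - s / 2 - y / 2 - I * mid ap am)) *
    (exp (-(I * alpha ap am * (z * x + z ^ 2 / 2))) * e1 + e2 - e3)

theorem nVal_y_shift (hap : 0 < ap) (ham : 0 < am) (δ : Bool) {x : ℂ} (y : ℂ)
    (hx : -mid ap am < x.im) :
    nVal ap am x (y + step ap am δ) - nVal ap am x (y - step ap am δ) =
      -2 * I * sd ap am δ y * ed ap am δ x * nVal ap am x y := by
  have hs := par_pos hap ham (!δ)
  have hm := mid_pos hap ham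
  set X := |y.re| + 1 with hX
  -- High enough to be admissible for y and for both shifted values, and still admissible for y
  -- after being lowered by half a step.
  set B := |y.im| + par ap am (!δ) + 1 with hB
  set K := |x.im| + 1 with hK
  have hX0 := abs_nonneg y.re
  have hB0 := abs_nonneg y.im
  have hK0 := abs_nonneg x.im
  have hK1 := le_abs_self x.im
  have hkK : (x.im - mid ap am) / 2 < K := by linarith
  have key : ∀ y' : ℂ, |y'.re| = |y.re| → |y'.im| ≤ |y.im| + par ap am (!δ) →
      nVal ap am x y' = exp (I * alpha ap am * y' ^ 2 / 8) * cInt X B K (nKer ap am x y') ∧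
      CIntegrable X B K (nKer ap am x y') := fun y' h1 h2 =>
    ⟨nVal_eq hap ham hx (by linarith) (by linarith) hkK,
      (contourAdm_nKer hap ham hx).cIntegrable (by linarith) (by linarith) hkK⟩
  obtain ⟨n1, c1⟩ := key (y + step ap am δ) (by simp [step_re]) (by
    rw [add_im, step_im]; exact (abs_add_le _ _).trans (by rw [abs_of_pos hs]))
  obtain ⟨n2, c2⟩ := key (y - step ap am δ) (by simp [step_re]) (by
    rw [sub_im, step_im]; exact (abs_sub _ _).trans (by rw [abs_of_pos hs]))
  have h3 := cInt_congr (X := X) (B := B) (K := K) (X₀ := |y.re| / 2)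
    (B₀ := |y.im| / 2 + par ap am (!δ) / 2) (by linarith) (by linarith)
    (fun z hz => nKer_y_shift hap ham δ (x := x) hz)
  rw [cInt_add (c1.const_mul _) (c2.const_mul _), cInt_const_mul, cInt_const_mul, cInt_const_mul,
    cInt_shift, ← sub_eq_add_neg] at h3
  rw [n1, n2, nVal_eq hap ham hx (y := y) (X := X) (B := B - par ap am (!δ) / 2)
    (K := K - -(par ap am (!δ) / 2)) (by linarith) (by linarith) (by linarith)]
  linear_combination h3

/-- Raising z by a full step raises both gamma functions and produces 4 cosh A cosh D = 2c_δ(y) - 2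
cosh(2πz/a_δ). The two exponentials of the last term are the shifts of x by ± one step. -/
theorem nKer_x_shift (hap : 0 < ap) (ham : 0 < am) (δ : Bool) {x y z : ℂ}
    (h : |y.im| / 2 < z.im ∨ |y.re| / 2 < z.re) :
    2 * cd ap am δ y * nKer ap am x y z + (-1 * nKer ap am (x + step ap am δ) y z +
      -1 * nKer ap am (x - step ap am δ) y z) =
    ed ap am δ (-(2 * x) + step ap am δ) *
      nKer ap am (x - step ap am δ) y (z + (par ap am (!δ) : ℝ) * I) := by
  set s := step ap am δ with hs
  have hz : z + (par ap am (!δ) : ℝ) * I = z + s := by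
    rw [hs, step]; ring
  obtain ⟨h1, h2⟩ := add_sub_notMem_lattice hap ham h
  have a1 := G_add_step hap ham δ h1
  have a2 := G_add_step hap ham δ h2
  have r1 := alpha_mul_step hap ham δ
  have r3 := pi_div_par_mul_mid hap ham δ
  rw [← hs] at a1 a2 r1 r3
  rw [hz]
  simp only [nKer]
  rw [show z + s + y / 2 - I * mid ap am = z + y / 2 - I * mid ap am + s by ring,
    show z + s - y / 2 - I * mid ap am = z - y / 2 - I * mid ap am + s by ring, a1, a2]
  simp only [cd, ed, cosh]
  set p : ℂ := Real.pi / par ap am δ with hp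
  have hpm : ∀ u : ℂ, (Real.pi : ℂ) * u / par ap am δ = p * u := fun u => by rw [hp]; ring
  have hr1 : I * (alpha ap am : ℂ) * s = -(2 * p) := by rw [r1, hp]; ring
  simp only [hpm]
  set A := z + y / 2 - I * mid ap am + s / 2 with hA
  set D := z - y / 2 - I * mid ap am + s / 2 with hD
  have q1 : exp (p * A) * exp (p * D) = -exp (2 * (p * z)) := by
    rw [← exp_add, ← neg_one_mul (exp _), ← exp_neg_pi_mul_I, ← exp_add]
    congr 1
    rw [hA, hD]
    linear_combination -2 * r3
  have q2 : exp (-(p * A)) * exp (-(p * D)) = -exp (-(2 * (p * z))) := by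
    rw [← exp_add, ← neg_one_mul (exp _), ← exp_pi_mul_I, ← exp_add]
    congr 1
    rw [hA, hD]
    linear_combination 2 * r3
  have q3 : exp (p * A) * exp (-(p * D)) = exp (p * y) := by
    rw [← exp_add]; congr 1; rw [hA, hD]; ring
  have q4 : exp (-(p * A)) * exp (p * D) = exp (-(p * y)) := by
    rw [← exp_add]; congr 1; rw [hA, hD]; ring
  have q5 : exp (-(I * alpha ap am * (z * (x + s) + z ^ 2 / 2))) =
      exp (-(I * alpha ap am * (z * x + z ^ 2 / 2))) * exp (2 * (p * z)) := by
    rw [← exp_add]; congr 1; linear_combination -z * hr1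
  have q6 : exp (-(I * alpha ap am * (z * (x - s) + z ^ 2 / 2))) =
      exp (-(I * alpha ap am * (z * x + z ^ 2 / 2))) * exp (-(2 * (p * z))) := by
    rw [← exp_add]; congr 1; linear_combination z * hr1
  have q7 : exp (p * (-(2 * x) + s)) *
      exp (-(I * alpha ap am * ((z + s) * (x - s) + (z + s) ^ 2 / 2))) =
      exp (-(I * alpha ap am * (z * x + z ^ 2 / 2))) := by
    rw [← exp_add]; congr 1; linear_combination (-x + s / 2) * hr1
  rw [q5, q6]
  linear_combination (G ap am (z + y / 2 - I * mid ap am) * G ap am (z - y / 2 - I * mid ap am)) *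
    (-((exp (p * A) + exp (-(p * A))) * (exp (p * D) + exp (-(p * D)))) * q7 -
      exp (-(I * alpha ap am * (z * x + z ^ 2 / 2))) * (q1 + q2 + q3 + q4))

theorem nVal_x_shift (hap : 0 < ap) (ham : 0 < am) (δ : Bool) {x : ℂ} (y : ℂ)
    (hx : -mid ap am < (x - step ap am δ).im) :
    nVal ap am (x + step ap am δ) y +
      (1 + ed ap am δ (-(2 * x) + step ap am δ)) * nVal ap am (x - step ap am δ) y =
      2 * cd ap am δ y * nVal ap am x y := by
  have hs := par_pos hap ham (!δ)
  have hm := mid_pos hap ham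
  set X := |y.re| + 1 with hX
  set B := |y.im| + 1 with hB
  -- Deep enough for x and both shifted values, and still for the lower one after the contour has
  -- been raised by a full step.
  set K := |x.im| + 2 * par ap am (!δ) + 1 with hK
  have hX0 := abs_nonneg y.re
  have hB0 := abs_nonneg y.im
  have hK1 := le_abs_self x.im
  have hK0 := abs_nonneg x.im
  rw [sub_im, step_im] at hx
  have key : ∀ x' : ℂ, x.im - par ap am (!δ) ≤ x'.im → x'.im ≤ x.im + par ap am (!δ) →
      nVal ap am x' y = exp (I * alpha ap am * y ^ 2 / 8) * cInt X B K (nKer ap am x' y) ∧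
      CIntegrable X B K (nKer ap am x' y) := fun x' h1 h2 =>
    ⟨nVal_eq hap ham (by linarith) (by linarith) (by linarith) (by linarith),
      (contourAdm_nKer hap ham (by linarith)).cIntegrable (by linarith) (by linarith)
        (by linarith)⟩
  obtain ⟨n0, c0⟩ := key x (by linarith) (by linarith)
  obtain ⟨n1, c1⟩ := key (x + step ap am δ) (by simp [step_im]; linarith) (by simp [step_im])
  obtain ⟨n2, c2⟩ := key (x - step ap am δ) (by simp [step_im]) (by simp [step_im]; linarith)
  have h3 := cInt_congr (X := X) (B := B) (K := K) (X₀ := |y.re| / 2) (B₀ := |y.im| / 2)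
    (by linarith) (by linarith) (fun z hz => nKer_x_shift hap ham δ (x := x) hz)
  rw [cInt_add (c0.const_mul _) ((c1.const_mul _).add (c2.const_mul _)),
    cInt_add (c1.const_mul _) (c2.const_mul _), cInt_const_mul, cInt_const_mul, cInt_const_mul,
    cInt_const_mul, cInt_shift] at h3
  have n3 := nVal_eq hap ham (x := x - step ap am δ) (y := y) (X := X) (B := B + par ap am (!δ))
    (K := K - par ap am (!δ)) (by simpa [step_im] using hx) (by linarith) (by linarith)
    (by simp [step_im]; linarith)
  rw [n0, n1, add_mul, one_mul]
  nth_rewrite 1 [n2]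
  rw [n3]
  linear_combination -exp (I * alpha ap am * y ^ 2 / 8) * h3

theorem nVal_ofReal (hap : 0 < ap) (ham : 0 < am) (x y : ℝ) {ε : ℝ} (hε : 0 < ε)
    (hε' : ε < mid ap am / 2) : nVal ap am x y = exp (I * alpha ap am * y ^ 2 / 8) *
      ∫ r : ℝ, kerPlus ap am x y (r + I * ε) := by
  have hm := mid_pos hap ham
  have hi := (integral_kerR_eq_integral_kerPlus hap ham x y hε hε').1
  have e : ∀ r : ℝ, kerPlus ap am x y (r + I * ε) = nKer ap am x y (r + ε * I) := fun r => by
    rw [mul_comm I]; rfl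
  simp only [e] at hi ⊢
  rw [nVal_eq hap ham (X := |y| + 1) (B := ε) (K := -ε) (by simpa using hm)
    (by simp; linarith [abs_nonneg y]) (by simpa using hε) (by simp; linarith)]
  rw [cInt_line _ hi]

theorem nVal_ofReal_eq_integral_kerR (hap : 0 < ap) (ham : 0 < am) (x y : ℝ) :
    nVal ap am x y = exp (I * alpha ap am * y ^ 2 / 4) * ∫ z : ℝ, kerR ap am x y z := by
  have hm := mid_pos hap ham
  rw [nVal_ofReal hap ham x y (ε := mid ap am / 4) (by linarith) (by linarith),
    (integral_kerR_eq_integral_kerPlus hap ham x y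
      (ε := mid ap am / 4) (by linarith) (by linarith)).2]

end RelToda

/-! ### Meromorphic continuation to all x, and the square-root-free eigenvalue equations. -/

namespace RelToda

open Complex Set ComplexConjugate

variable {ap am : ℝ}

theorem eqOn_of_eq_ofReal {f h : ℂ → ℂ} {U : Set ℂ} (hUo : IsOpen U) (hU : IsPreconnected U)
    (h0 : (0 : ℂ) ∈ U) (hf : ∀ z ∈ U, DifferentiableAt ℂ f z)
    (hh : ∀ z ∈ U, DifferentiableAt ℂ h z) (heq : ∀ r : ℝ, f r = h r) : EqOn f h U := by
  have hf' : AnalyticOnNhd ℂ f U :=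
    DifferentiableOn.analyticOnNhd (fun z hz => (hf z hz).differentiableWithinAt) hUo
  have hh' : AnalyticOnNhd ℂ h U :=
    DifferentiableOn.analyticOnNhd (fun z hz => (hh z hz).differentiableWithinAt) hUo
  refine hf'.eqOn_of_preconnected_of_frequently_eq hh' hU h0 ?_
  have ht : Tendsto (fun n : ℕ => (((1 : ℝ) / (n + 1) : ℝ) : ℂ)) atTop (𝓝[≠] 0) := by
    refine tendsto_nhdsWithin_iff.2 ⟨?_, Eventually.of_forall fun n => ?_⟩
    · exact (continuous_ofReal.tendsto' 0 0 ofReal_zero).comp tendsto_one_div_add_atTop_nhds_zero_nat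
    · simp only [mem_compl_iff, mem_singleton_iff, ofReal_eq_zero]
      positivity
  exact ht.frequently (Frequently.of_forall fun n => heq _)

theorem conj_sd (ap am : ℝ) (δ : Bool) (z : ℂ) :
    conj (sd ap am δ z) = sd ap am δ (conj z) := by
  rw [sd, sd, ← Complex.sinh_conj]; simp

theorem conj_ed (ap am : ℝ) (δ : Bool) (z : ℂ) :
    conj (ed ap am δ z) = ed ap am δ (conj z) := by
  rw [ed, ed, ← Complex.exp_conj]; simp

theorem conj_step (ap am : ℝ) (δ : Bool) : conj (step ap am δ) = -step ap am δ := by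
  simp [step]

/-- The complex conjugate `N*(x, y)` of `nVal`, with conjugate arguments. -/
noncomputable def nConj (ap am : ℝ) (x y : ℂ) : ℂ := conj (nVal ap am (conj x) (conj y))

theorem differentiableAt_nConj (hap : 0 < ap) (ham : 0 < am) {p : ℂ × ℂ}
    (hx : p.1.im < mid ap am) :
    DifferentiableAt ℂ (fun q : ℂ × ℂ => nConj ap am q.1 q.2) p := by
  have h := (differentiableAt_nVal hap ham (p := star p) (by
    change -mid ap am < -p.1.im; linarith)).star_star
  rw [star_star] at h
  exact h

theorem differentiableAt_left {f : ℂ → ℂ → ℂ} {x y : ℂ}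
    (h : DifferentiableAt ℂ (fun q : ℂ × ℂ => f q.1 q.2) (x, y)) :
    DifferentiableAt ℂ (fun x => f x y) x :=
  DifferentiableAt.comp (f := fun x : ℂ => (x, y)) x h (by fun_prop)

theorem differentiableAt_right {f : ℂ → ℂ → ℂ} {x y : ℂ}
    (h : DifferentiableAt ℂ (fun q : ℂ × ℂ => f q.1 q.2) (x, y)) :
    DifferentiableAt ℂ (fun y => f x y) y :=
  DifferentiableAt.comp (f := fun y : ℂ => (x, y)) y h (by fun_prop)

theorem nConj_ofReal (hap : 0 < ap) (ham : 0 < am) (x y : ℝ) : nConj ap am x y =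
    exp (-(I * alpha ap am * y ^ 2 / 4)) * ∫ z : ℝ, kerL ap am x y z := by
  rw [nConj, conj_ofReal, conj_ofReal, nVal_ofReal_eq_integral_kerR hap ham, map_mul,
    integral_kerL_eq_conj, ← exp_conj]
  congr 2
  simp [Complex.conj_ofNat]
  ring

/-- For real arguments this is `integral_kerL_eq`. It extends first to all y, with x real, and then
to the strip in x. -/
theorem nVal_eq_GRight_mul_nConj (hap : 0 < ap) (ham : 0 < am) {x : ℂ} (y : ℂ)
    (hx : |x.im| < mid ap am) : nVal ap am x y = GRight ap am x * nConj ap am x y := by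
  have hm := mid_pos hap ham
  have h1 : ∀ r : ℝ, ∀ y : ℂ, nVal ap am r y = GRight ap am r * nConj ap am r y := by
    intro r y
    refine eqOn_of_eq_ofReal (f := fun y => nVal ap am r y)
      (h := fun y => GRight ap am r * nConj ap am r y) isOpen_univ isPreconnected_univ (mem_univ _)
      (fun z _ => ?_) (fun z _ => ?_) (fun t => ?_) (mem_univ y)
    · exact differentiableAt_right (differentiableAt_nVal hap ham (by simpa using hm))
    · exact (differentiableAt_right (differentiableAt_nConj hap ham (by simpa using hm))).const_mul _
    · rw [nConj_ofReal hap ham, mul_left_comm, integral_kerL_eq hap ham,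
        nVal_ofReal_eq_integral_kerR hap ham, ← mul_assoc, ← exp_add]
      congr 2
      ring
  refine eqOn_of_eq_ofReal (f := fun x => nVal ap am x y)
      (h := fun x => GRight ap am x * nConj ap am x y) (isOpen_strip _) (isPreconnected_strip _) (by simpa using hm)
      (fun z hz => ?_) (fun z hz => ?_) (fun t => h1 t y) hx
  · exact differentiableAt_left (differentiableAt_nVal hap ham (abs_lt.1 hz).1)
  · exact (analyticAt_GRight hap ham (neg_notMem_lattice_of_lt_im hap ham
      (abs_lt.1 hz).1)).differentiableAt.mul
      (differentiableAt_left (differentiableAt_nConj hap ham (abs_lt.1 hz).2))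

/-- The meromorphic continuation in `x` of the eigenfunction. -/
noncomputable def nExt (ap am : ℝ) (x y : ℂ) : ℂ :=
  if -mid ap am < x.im then nVal ap am x y else GRight ap am x * nConj ap am x y

theorem nExt_of_lt {x y : ℂ} (hx : -mid ap am < x.im) : nExt ap am x y = nVal ap am x y :=
  if_pos hx

theorem nExt_of_gt (hap : 0 < ap) (ham : 0 < am) {x y : ℂ} (hx : x.im < mid ap am) :
    nExt ap am x y = GRight ap am x * nConj ap am x y := by
  rw [nExt]
  split_ifs with h
  · exact nVal_eq_GRight_mul_nConj hap ham y (abs_lt.2 ⟨h, hx⟩)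
  · rfl

/-- The half planes Im x > -a and Im x < a overlap, and on the lower one the only possible
singularities are those of G_R. -/
theorem differentiableAt_nExt (hap : 0 < ap) (ham : 0 < am) {p : ℂ × ℂ}
    (hp : -p.1 ∉ lattice ap am) :
    DifferentiableAt ℂ (fun q : ℂ × ℂ => nExt ap am q.1 q.2) p := by
  have hm := mid_pos hap ham
  rcases lt_or_ge (-mid ap am) p.1.im with h | h
  · refine (differentiableAt_nVal hap ham h).congr_of_eventuallyEq ?_
    have o : IsOpen {q : ℂ × ℂ | -mid ap am < q.1.im} := isOpen_lt continuous_const (by fun_prop)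
    filter_upwards [o.mem_nhds h] with q hq using nExt_of_lt hq
  · have h' : p.1.im < mid ap am := by linarith
    have hG := DifferentiableAt.comp (f := fun q : ℂ × ℂ => q.1) p
      (analyticAt_GRight hap ham hp).differentiableAt (by fun_prop)
    refine (hG.mul (differentiableAt_nConj hap ham h')).congr_of_eventuallyEq ?_
    have o : IsOpen {q : ℂ × ℂ | q.1.im < mid ap am} := isOpen_lt (by fun_prop) continuous_const
    filter_upwards [o.mem_nhds h'] with q hq using nExt_of_gt hap ham hq

/-- Near each point the continuation is an analytic function, possibly times G_R; analyticity and
meromorphy are both read off from this form. -/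
theorem nExt_eventuallyEq (hap : 0 < ap) (ham : 0 < am) (x y : ℂ) :
    ∃ f h : ℂ → ℂ, AnalyticAt ℂ f x ∧ (h = 1 ∨ h = GRight ap am) ∧
      (fun x => nExt ap am x y) =ᶠ[𝓝 x] fun x => h x * f x := by
  have hm := mid_pos hap ham
  rcases lt_or_ge (-mid ap am) x.im with h | h
  · have o : IsOpen {x : ℂ | -mid ap am < x.im} := isOpen_lt continuous_const (by fun_prop)
    refine ⟨fun x => nVal ap am x y, 1, DifferentiableOn.analyticAt (fun z hz =>
      (differentiableAt_left (y := y) (differentiableAt_nVal hap ham hz)).differentiableWithinAt)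
      (o.mem_nhds h), Or.inl rfl, ?_⟩
    filter_upwards [o.mem_nhds h] with q hq
    simp [nExt_of_lt hq]
  · have h' : x.im < mid ap am := by linarith
    have o : IsOpen {x : ℂ | x.im < mid ap am} := isOpen_lt (by fun_prop) continuous_const
    refine ⟨fun x => nConj ap am x y, GRight ap am, DifferentiableOn.analyticAt (fun z hz =>
      (differentiableAt_left (y := y) (differentiableAt_nConj hap ham hz)).differentiableWithinAt)
      (o.mem_nhds h'), Or.inr rfl, ?_⟩
    filter_upwards [o.mem_nhds h'] with q hq using nExt_of_gt hap ham hq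

theorem analyticAt_nExt (hap : 0 < ap) (ham : 0 < am) {x : ℂ} (y : ℂ) (hx : -x ∉ lattice ap am) :
    AnalyticAt ℂ (fun x => nExt ap am x y) x := by
  obtain ⟨f, h, hf, rfl | rfl, e⟩ := nExt_eventuallyEq hap ham x y
  · exact (analyticAt_const.mul hf).congr e.symm
  · exact ((analyticAt_GRight hap ham hx).mul hf).congr e.symm

theorem meromorphicAt_nExt (hap : 0 < ap) (ham : 0 < am) (x y : ℂ) :
    MeromorphicAt (fun x => nExt ap am x y) x := by
  obtain ⟨f, h, hf, rfl | rfl, e⟩ := nExt_eventuallyEq hap ham x y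
  · exact (analyticAt_const.mul hf).meromorphicAt.congr (e.symm.filter_mono nhdsWithin_le_nhds)
  · have hG : MeromorphicAt (GRight ap am) x := (meromorphicAt_G hap ham x).mul
      (AnalyticAt.meromorphicAt (by fun_prop))
    exact (hG.mul hf.meromorphicAt).congr (e.symm.filter_mono nhdsWithin_le_nhds)

theorem nExt_y_shift (hap : 0 < ap) (ham : 0 < am) (δ : Bool) (x y : ℂ) :
    nExt ap am x (y + step ap am δ) - nExt ap am x (y - step ap am δ) =
      -2 * I * sd ap am δ y * ed ap am δ x * nExt ap am x y := by
  have hm := mid_pos hap ham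
  rcases lt_or_ge (-mid ap am) x.im with h | h
  · simp only [nExt_of_lt h, nVal_y_shift hap ham δ y h]
  · have h' : x.im < mid ap am := by linarith
    have h1 := congrArg conj (nVal_y_shift hap ham δ (x := conj x) (conj y) (by
      rw [conj_im]; linarith))
    simp only [map_sub, map_mul, map_neg, conj_I, conj_sd, conj_ed, conj_conj,
      Complex.conj_ofNat] at h1
    simp only [nExt_of_gt hap ham h', nConj, map_add, map_sub, conj_step, sub_neg_eq_add,
      ← sub_eq_add_neg]
    linear_combination -GRight ap am x * h1

/-- Far enough up all three points lie in the half plane of `nVal` and the equation is known there.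
The domain of regularity is the complement of a countable set, hence connected. -/
theorem nExt_x_shift (hap : 0 < ap) (ham : 0 < am) (δ : Bool) {x : ℂ} (y : ℂ)
    (h0 : -x ∉ lattice ap am) (h1 : -(x + step ap am δ) ∉ lattice ap am)
    (h2 : -(x - step ap am δ) ∉ lattice ap am) :
    nExt ap am (x + step ap am δ) y +
      (1 + ed ap am δ (-(2 * x) + step ap am δ)) * nExt ap am (x - step ap am δ) y =
      2 * cd ap am δ y * nExt ap am x y := by
  set U : Set ℂ := {x | -x ∉ lattice ap am ∧ -(x + step ap am δ) ∉ lattice ap am ∧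
    -(x - step ap am δ) ∉ lattice ap am} with hU
  have hUc : IsPreconnected U := by
    have : U = ((fun x => -x) ⁻¹' lattice ap am ∪ ((fun x => -(x + step ap am δ)) ⁻¹' lattice ap am ∪
        (fun x => -(x - step ap am δ)) ⁻¹' lattice ap am))ᶜ := by
      rw [compl_union, compl_union]; rfl
    rw [this]
    refine isPreconnected_compl_of_countable (((lattice_countable ap am).preimage
      neg_injective).union (((lattice_countable ap am).preimage ?_).union
        ((lattice_countable ap am).preimage ?_)))
    · intro a b hab; simpa using hab
    · intro a b hab; simpa using hab
  have an := fun {x : ℂ} => analyticAt_nExt (x := x) hap ham y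
  have hed : ∀ x, AnalyticAt ℂ (fun x => ed ap am δ (-(2 * x) + step ap am δ)) x := fun x => by
    unfold ed; fun_prop
  have a1 : AnalyticOnNhd ℂ (fun x => nExt ap am (x + step ap am δ) y +
      (1 + ed ap am δ (-(2 * x) + step ap am δ)) * nExt ap am (x - step ap am δ) y) U := fun x hx =>
    (AnalyticAt.fun_comp_of_eq (f := fun x => x + step ap am δ) (an hx.2.1) (by fun_prop) rfl).add
      ((analyticAt_const.add (hed x)).mul (AnalyticAt.fun_comp_of_eq
        (f := fun x => x - step ap am δ) (an hx.2.2) (by fun_prop) rfl))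
  have a2 : AnalyticOnNhd ℂ (fun x => 2 * cd ap am δ y * nExt ap am x y) U := fun x hx =>
    analyticAt_const.mul (an hx.1)
  have hs := par_pos hap ham (!δ)
  have hm := mid_pos hap ham
  have o : IsOpen {x : ℂ | -mid ap am + par ap am (!δ) < x.im} :=
    isOpen_lt continuous_const (by fun_prop)
  have hp : step ap am δ ∈ {x : ℂ | -mid ap am + par ap am (!δ) < x.im} := by
    simp only [mem_ofPred_eq, step_im]; linarith
  have hb : ∀ x : ℂ, -mid ap am + par ap am (!δ) < x.im → -mid ap am < x.im ∧
      -mid ap am < (x + step ap am δ).im ∧ -mid ap am < (x - step ap am δ).im := fun x hx => by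
    rw [add_im, sub_im, step_im]
    exact ⟨by linarith, by linarith, by linarith⟩
  refine a1.eqOn_of_preconnected_of_eventuallyEq a2 hUc (z₀ := step ap am δ) ?_ ?_ ⟨h0, h1, h2⟩
  · obtain ⟨b0, b1, b2⟩ := hb _ hp
    exact ⟨neg_notMem_lattice_of_lt_im hap ham b0, neg_notMem_lattice_of_lt_im hap ham b1,
      neg_notMem_lattice_of_lt_im hap ham b2⟩
  · filter_upwards [o.mem_nhds hp] with x hx
    obtain ⟨b0, b1, b2⟩ := hb x hx
    rw [nExt_of_lt b0, nExt_of_lt b1, nExt_of_lt b2, nVal_x_shift hap ham δ y b2]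

/-- The lattice lies on the imaginary axis, which the map fixes pointwise; conjugation thus
exchanges the pole sets P and -P. -/
theorem neg_conj_mem_lattice {x : ℂ} : -conj x ∈ lattice ap am ↔ x ∈ lattice ap am := by
  have key : ∀ {x : ℂ}, x ∈ lattice ap am → -conj x = x := by
    rintro x ⟨k, l, rfl⟩
    simp
  constructor
  · intro h
    have := key h
    rw [map_neg, conj_conj, neg_neg] at this
    rwa [this]
  · intro h
    rwa [key h]

/-- The eigenvalue equations for the integral over `kerL`. -/
theorem exists_todaA_eigenfunction (hap : 0 < ap) (ham : 0 < am) : ∃ M : ℂ → ℂ → ℂ,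
    DifferentiableOn ℂ (fun p : ℂ × ℂ => M p.1 p.2) {p | p.1 ∉ lattice ap am} ∧
    (∀ y : ℂ, MeromorphicOn (fun x => M x y) Set.univ) ∧
    (∀ x y : ℝ, 0 < y → M x y = ∫ z : ℝ, kerL ap am x y z) ∧
    (∀ (δ : Bool) (x y : ℂ), x ∉ lattice ap am → x + step ap am δ ∉ lattice ap am →
      x - step ap am δ ∉ lattice ap am →
      todaA ap am δ 0 (fun x' => M x' y) x = 2 * cd ap am δ y * M x y) := by
  have hm := mid_pos hap ham
  -- The conjugate of the continuation, with conjugate arguments, is the integral of `kerL` up to a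
  -- Gaussian in y, which the prefactor removes. Conjugating the equation in x replaces the step by
  -- its negative.
  refine ⟨fun x y => exp (I * alpha ap am * y ^ 2 / 4) * conj (nExt ap am (conj x) (conj y)),
    fun p hp => ?_, fun y x _ => ?_, fun x y _ => ?_, fun δ x y h0 h1 h2 => ?_⟩
  · have h := (differentiableAt_nExt hap ham (p := star p) (by
      change -conj p.1 ∉ _; rwa [neg_conj_mem_lattice])).star_star
    rw [star_star] at h
    have he : DifferentiableAt ℂ (fun q : ℂ × ℂ => exp (I * alpha ap am * q.2 ^ 2 / 4)) p := by
      fun_prop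
    exact (he.mul h).differentiableWithinAt
  · refine (MeromorphicAt.const _ _).mul ?_
    obtain ⟨f, h, hf, hh, e⟩ := nExt_eventuallyEq hap ham (conj x) (conj y)
    have hf' : AnalyticAt ℂ (fun z => conj (f (conj z))) x := by
      rw [analyticAt_iff_eventually_differentiableAt] at hf ⊢
      filter_upwards [(continuous_conj.tendsto x).eventually hf] with z hz
      have := hz.conj_conj
      rw [conj_conj] at this
      exact this
    have hh' : MeromorphicAt (fun z => conj (h (conj z))) x := by
      rcases hh with rfl | rfl
      · simp [MeromorphicAt.const]
      · simp only [conj_GRight, conj_conj]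
        refine MeromorphicAt.mul ?_ (AnalyticAt.meromorphicAt (by fun_prop))
        exact (meromorphicAt_G hap ham (-x)).comp_analyticAt analyticAt_id.neg
    refine (hh'.mul hf'.meromorphicAt).congr (Filter.EventuallyEq.filter_mono ?_ nhdsWithin_le_nhds)
    filter_upwards [(continuous_conj.tendsto x).eventually e] with z hz
    rw [hz, map_mul]
    rfl
  · simp only [conj_ofReal]
    rw [nExt_of_lt (by simpa using hm)]
    have h := nConj_ofReal hap ham x y
    rw [nConj, conj_ofReal, conj_ofReal] at h
    rw [h, ← mul_assoc, ← exp_add]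
    simp
  · have e := congrArg conj (nExt_x_shift hap ham δ (x := conj x) (conj y)
      (by rwa [neg_conj_mem_lattice])
      (by rwa [← sub_neg_eq_add, ← conj_step, ← map_sub, neg_conj_mem_lattice])
      (by rwa [sub_eq_add_neg, ← conj_step, ← map_add, neg_conj_mem_lattice]))
    simp only [map_add, map_mul, map_one, conj_ed, conj_cd, conj_conj, map_neg, conj_step,
      Complex.conj_ofNat] at e
    simp only [todaA, map_add, map_sub, conj_step, sub_neg_eq_add, ofReal_zero, mul_zero, add_zero,
      ← sub_eq_add_neg] at e ⊢
    linear_combination exp (I * alpha ap am * y ^ 2 / 4) * e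

/-- The dual eigenvalue equations for the integral over `kerPlus`. -/
theorem exists_dualTodaA_eigenfunction (hap : 0 < ap) (ham : 0 < am) : ∃ N : ℂ → ℂ → ℂ,
    DifferentiableOn ℂ (fun p : ℂ × ℂ => N p.1 p.2) {p | -p.1 ∉ lattice ap am} ∧
    (∀ y : ℂ, MeromorphicOn (fun x => N x y) Set.univ) ∧
    (∀ x y ε : ℝ, 0 < y → 0 < ε → ε < mid ap am / 2 →
      N x y = Complex.exp (Complex.I * alpha ap am * y ^ 2 / 8) *
        ∫ r : ℝ, kerPlus ap am x y (r + Complex.I * ε)) ∧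
    (∀ (δ : Bool) (x y : ℂ), -x ∉ lattice ap am → sd ap am δ y ≠ 0 →
      dualTodaA ap am δ 0 (fun y' => N x y') y = ed ap am δ x * N x y) := by
  have hm := mid_pos hap ham
  refine ⟨nExt ap am, fun p hp => (differentiableAt_nExt hap ham hp).differentiableWithinAt,
    fun y x _ => meromorphicAt_nExt hap ham x y, fun x y ε _ h1 h2 => ?_, fun δ x y _ h => ?_⟩
  · rw [nExt_of_lt (by simpa using hm), nVal_ofReal hap ham x y h1 h2]
  · have h0 : ed ap am δ 0 = 1 := by simp [ed]
    rw [dualTodaA, nExt_y_shift hap ham, ofReal_zero, h0]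
    field_simp
    linear_combination -(ed ap am δ x * nExt ap am x y) * I_sq

end RelToda

/-! ### Square roots, conjugation symmetries and the value of the limit. -/

namespace RelToda

open Complex Set ComplexConjugate

variable {ap am : ℝ}

theorem tendsto_gR (hap : 0 < ap) (ham : 0 < am) :
    Tendsto (fun t : ℝ => gR ap am t) atTop (𝓝 0) := by
  have hm := mid_pos hap ham
  refine (tendsto_jInt_add hap ham (z := 0) (by simpa using hm)).congr fun t => ?_
  rw [zero_add, gR_eq_jInt hap ham (by simp; positivity)]

theorem conj_gR (t : ℝ) : conj (gR ap am t) = gR ap am t := by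
  simp [gR, conj_g, Complex.conj_ofNat]

theorem gL_neg (z : ℂ) : gL ap am (-z) = -gR ap am z := by
  rw [gL, gR, g_neg]; ring

theorem GRight_ofReal (hap : 0 < ap) (ham : 0 < am) (t : ℝ) :
    GRight ap am t = exp (I * gR ap am t) := by
  have hm := mid_pos hap ham
  rw [GRight_eq_exp hap ham (by simpa using hm), gR_eq_jInt hap ham (by simp; positivity)]

/-- `(G(± y + ia))^{1/2}`. -/
noncomputable def gammaRoot (ap am y : ℝ) : ℂ :=
  (G ap am (y + I * mid ap am) * G ap am (-y + I * mid ap am)) ^ (1 / 2 : ℂ)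

theorem G_mid_mul_G_mid_eq_ofReal (hap : 0 < ap) (ham : 0 < am) {y : ℝ} (hy : 0 < y) :
    G ap am (y + I * mid ap am) * G ap am (-y + I * mid ap am) =
      ((4 * Real.sinh (Real.pi * y / ap) * Real.sinh (Real.pi * y / am) : ℝ) : ℂ) := by
  rw [G_mid_mul_G_mid hap ham hy.ne']
  simp [sd, par]

theorem sinh_mul_sinh_pos (hap : 0 < ap) (ham : 0 < am) {y : ℝ} (hy : 0 < y) :
    0 < 4 * Real.sinh (Real.pi * y / ap) * Real.sinh (Real.pi * y / am) :=
  mul_pos (mul_pos (by norm_num) (Real.sinh_pos_iff.2 (by positivity)))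
    (Real.sinh_pos_iff.2 (by positivity))

theorem ofReal_cpow_half {a : ℝ} (ha : 0 ≤ a) : (a : ℂ) ^ (1 / 2 : ℂ) = Real.sqrt a := by
  rw [Real.sqrt_eq_rpow, ofReal_cpow ha]
  norm_num

theorem gammaRoot_eq (hap : 0 < ap) (ham : 0 < am) {y : ℝ} (hy : 0 < y) : gammaRoot ap am y =
    Real.sqrt (4 * Real.sinh (Real.pi * y / ap) * Real.sinh (Real.pi * y / am)) := by
  rw [gammaRoot, G_mid_mul_G_mid_eq_ofReal hap ham hy,
    ofReal_cpow_half (sinh_mul_sinh_pos hap ham hy).le]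

theorem conj_gammaRoot (hap : 0 < ap) (ham : 0 < am) {y : ℝ} (hy : 0 < y) :
    conj (gammaRoot ap am y) = gammaRoot ap am y := by
  rw [gammaRoot_eq hap ham hy, conj_ofReal]

theorem gammaRoot_div (hap : 0 < ap) (ham : 0 < am) {y : ℝ} (hy : 0 < y) :
    (G ap am (y + I * mid ap am) * G ap am (-y + I * mid ap am) / (ap * am)) ^ (1 / 2 : ℂ) =
      gammaRoot ap am y / Real.sqrt (ap * am) := by
  rw [gammaRoot_eq hap ham hy, G_mid_mul_G_mid_eq_ofReal hap ham hy, ← ofReal_mul, ← ofReal_div,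
    ofReal_cpow_half (div_nonneg (sinh_mul_sinh_pos hap ham hy).le (by positivity)),
    Real.sqrt_div (sinh_mul_sinh_pos hap ham hy).le, ofReal_div]

theorem prefR_eq (hap : 0 < ap) (ham : 0 < am) (η x : ℝ) {y : ℝ} (hy : 0 < y) :
    prefR ap am η x y =
      gammaRoot ap am y / Real.sqrt (ap * am) * exp (-(I / 2 * gR ap am (x - η))) := by
  rw [prefR, gammaRoot_div hap ham hy]

theorem prefL_eq_conj (hap : 0 < ap) (ham : 0 < am) (η x : ℝ) {y : ℝ} (hy : 0 < y) :
    prefL ap am η x y = conj (prefR ap am η x y) := by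
  rw [prefL, prefR_eq hap ham η x hy, gammaRoot_div hap ham hy, map_mul, map_div₀,
    conj_gammaRoot hap ham hy, conj_ofReal, ← exp_conj, ← neg_sub (x : ℂ) η, gL_neg, ← ofReal_sub]
  congr 2
  rw [map_neg, map_mul, map_div₀, conj_gR, conj_I, Complex.conj_ofNat]
  ring

/-- The square is 4 s₊ s₋, each sinh is half an exponential to leading order, and αa/2 = (π/2)(1/a₊
+ 1/a₋). -/
theorem tendsto_gammaRoot (hap : 0 < ap) (ham : 0 < am) :
    Tendsto (fun p : ℝ => gammaRoot ap am p * exp (-(alpha ap am * mid ap am * p / 2)))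
      atTop (𝓝 1) := by
  have key : ∀ a : ℝ, 0 < a → Tendsto (fun p : ℝ =>
      2 * Real.sinh (Real.pi * p / a) * Real.exp (-(Real.pi * p / a))) atTop (𝓝 1) := by
    intro a ha
    have h := (tendsto_const_mul_exp_neg (by positivity : 0 < 2 * Real.pi / a) 1).const_sub 1
    rw [sub_zero] at h
    refine h.congr fun p => ?_
    rw [Real.sinh_eq]
    have e1 : Real.exp (Real.pi * p / a) * Real.exp (-(Real.pi * p / a)) = 1 := by
      rw [← Real.exp_add]; simp
    have e2 : Real.exp (-(Real.pi * p / a)) * Real.exp (-(Real.pi * p / a)) =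
        Real.exp (-(2 * Real.pi / a * p)) := by rw [← Real.exp_add]; congr 1; ring
    linear_combination -e1 + e2
  have h := (((key ap hap).mul (key am ham)).sqrt).ofReal
  rw [mul_one, Real.sqrt_one] at h
  refine (by simpa using h : Tendsto _ _ (𝓝 (1 : ℂ))).congr' ?_
  filter_upwards [eventually_gt_atTop 0] with p hp
  rw [gammaRoot_eq hap ham hp]
  have e3 : (alpha ap am * mid ap am * p / 2 : ℂ) = ((alpha ap am * mid ap am * p / 2 : ℝ) : ℂ) := by
    push_cast; ring
  have e4 : Real.exp (-(alpha ap am * mid ap am * p / 2)) =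
      Real.sqrt (Real.exp (-(Real.pi * p / ap)) * Real.exp (-(Real.pi * p / am))) := by
    rw [← Real.exp_add, ← Real.exp_half]
    congr 1
    rw [alpha, mid]
    field_simp
    ring
  rw [e3, ← ofReal_neg, ← ofReal_exp, e4, ← ofReal_mul,
    ← Real.sqrt_mul (sinh_mul_sinh_pos hap ham hp).le]
  congr 2
  ring

theorem wSqrt_eq (γ x : ℝ) : wSqrt ap am γ x = gammaRoot ap am x *
    exp (-(I / 2 * (g ap am (x - γ) - g ap am (x + γ)))) := by
  rw [wSqrt, gammaRoot, show (-x - γ : ℂ) = -(x + γ) by ring, g_neg, ← sub_eq_add_neg]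

theorem conj_wSqrt (hap : 0 < ap) (ham : 0 < am) (γ : ℝ) {x : ℝ} (hx : 0 < x) :
    conj (wSqrt ap am γ x) = wSqrt ap am (-γ) x := by
  rw [wSqrt_eq, wSqrt_eq, map_mul, conj_gammaRoot hap ham hx, ← exp_conj]
  congr 2
  simp only [map_neg, map_mul, map_div₀, map_sub, map_add, conj_g, conj_ofReal, conj_I,
    Complex.conj_ofNat, ofReal_neg, sub_neg_eq_add, ← sub_eq_add_neg]
  ring

theorem conj_fourierIntegral (γ p q : ℝ) :
    conj (fourierIntegral ap am γ p q) = fourierIntegral ap am (-γ) p q := by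
  rw [fourierIntegral, fourierIntegral, ← integral_conj, ← integral_neg_eq_self]
  refine integral_congr_ae (Eventually.of_forall fun z => ?_)
  simp only [map_mul, conj_G, ← exp_conj, map_sub, map_add, map_div₀, map_neg, conj_ofReal, conj_I,
    Complex.conj_ofNat, ofReal_neg, neg_neg]
  have e : ∀ A B C D A' B' C' D' E E' : ℂ, A = B' → B = A' → C = D' → D = C' → E = E' →
      A * B * C * D * E = A' * B' * C' * D' * E' := by
    rintro _ _ _ _ _ _ _ _ _ _ rfl rfl rfl rfl rfl; ring
  refine e _ _ _ _ _ _ _ _ _ _ ?_ ?_ ?_ ?_ ?_ <;> congr 1 <;> ring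

/-- Conjugation reverses γ in every factor: in G, in the roots of w and in the Fourier integral. So
half of the Fourier representations need no limit of their own. -/
theorem hypF2_eq_conj (hap : 0 < ap) (ham : 0 < am) (γ : ℝ) {x y : ℝ} (hx : 0 < x) (hy : 0 < y) :
    hypF2 ap am γ x y = conj (hypF5 ap am γ x y) := by
  simp only [hypF2, hypF5, map_mul, map_div₀, conj_G, conj_ofReal, conj_wSqrt hap ham _ hx,
    conj_wSqrt hap ham _ hy, conj_fourierIntegral, neg_neg]

theorem hypF3_eq_conj (hap : 0 < ap) (ham : 0 < am) (γ : ℝ) {x y : ℝ} (hx : 0 < x) (hy : 0 < y) :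
    hypF3 ap am γ x y = conj (hypF4 ap am γ x y) := by
  simp only [hypF3, hypF4, map_mul, map_div₀, conj_G, conj_ofReal, conj_wSqrt hap ham _ hx,
    conj_wSqrt hap ham _ hy, conj_fourierIntegral, neg_neg, map_neg]

theorem kerMinus_eq_conj (x y ε r : ℝ) : kerMinus ap am x y (r + I * ε) =
    conj (kerPlus ap am x y ((-r : ℝ) + I * ε)) := by
  simp only [kerMinus, kerPlus, map_mul, conj_G, ← exp_conj, map_sub, map_add, map_div₀, map_neg,
    conj_ofReal, conj_I, Complex.conj_ofNat, ofReal_neg, map_pow]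
  rw [mul_comm (G ap am (-(-(r : ℂ) + -I * ε + y / 2 - -I * mid ap am)))]
  congr 1
  · congr 2 <;> ring
  · congr 1; ring

/-- The value of the limit of the hyperbolic eigenfunction. -/
noncomputable def todaVal (ap am η x y : ℝ) : ℂ :=
  prefR ap am η x y * exp (I * alpha ap am * y ^ 2 / 4) * ∫ z : ℝ, kerR ap am (x - η) y z

theorem todaVal_eq_kerL (hap : 0 < ap) (ham : 0 < am) (η x : ℝ) {y : ℝ} (hy : 0 < y) :
    todaVal ap am η x y = prefL ap am η x y * exp (-(I * alpha ap am * y ^ 2 / 4)) *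
      ∫ z : ℝ, kerL ap am (x - η) y z := by
  have h := integral_kerL_eq hap ham (x - η) y
  rw [GRight_ofReal hap ham] at h
  rw [todaVal, prefL_eq_conj hap ham η x hy, prefR_eq hap ham η x hy, map_mul, map_div₀,
    conj_gammaRoot hap ham hy, conj_ofReal, ← exp_conj, ← ofReal_sub, map_neg, map_mul, map_div₀,
    conj_gR, conj_I, Complex.conj_ofNat]
  set s := gR ap am ((x - η : ℝ) : ℂ)
  have e1 : exp (I * alpha ap am * y ^ 2 / 4) =
      exp (-(I * alpha ap am * y ^ 2 / 4)) * exp (I * alpha ap am * y ^ 2 / 2) := by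
    rw [← exp_add]; congr 1; ring
  have e2 : exp (-(-I / 2 * s)) = exp (-(I / 2 * s)) * exp (I * s) := by
    rw [← exp_add]; congr 1; ring
  rw [e1, e2]
  linear_combination -(gammaRoot ap am y / Real.sqrt (ap * am) * exp (-(I / 2 * s)) *
    exp (-(I * alpha ap am * y ^ 2 / 4))) * h

/-- The value is given by `kerR` and also by `kerL`, and these two expressions are conjugate to each
other. -/
theorem conj_todaVal (hap : 0 < ap) (ham : 0 < am) (η x : ℝ) {y : ℝ} (hy : 0 < y) :
    conj (todaVal ap am η x y) = todaVal ap am η x y := by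
  conv_rhs => rw [todaVal_eq_kerL hap ham η x hy]
  rw [todaVal, map_mul, map_mul, ← prefL_eq_conj hap ham η x hy, ← integral_kerL_eq_conj, ← exp_conj]
  congr 3
  simp [Complex.conj_ofNat]
  ring

theorem todaVal_eq_kerPlus (hap : 0 < ap) (ham : 0 < am) (η x y : ℝ) {ε : ℝ} (hε : 0 < ε)
    (hε' : ε < mid ap am / 2) : todaVal ap am η x y =
      prefR ap am η x y * exp (I * alpha ap am * y ^ 2 / 8) *
        ∫ r : ℝ, kerPlus ap am (x - η) y (r + I * ε) := by
  rw [todaVal, mul_assoc (prefR ap am η x y), mul_assoc (prefR ap am η x y),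
    (integral_kerR_eq_integral_kerPlus hap ham (x - η) y hε hε').2]

theorem todaVal_eq_kerMinus (hap : 0 < ap) (ham : 0 < am) (η x : ℝ) {y ε : ℝ} (hy : 0 < y)
    (hε : 0 < ε) (hε' : ε < mid ap am / 2) :
    Integrable (fun r : ℝ => kerMinus ap am (x - η) y (r + I * ε)) ∧ todaVal ap am η x y =
      prefL ap am η x y * exp (-(I * alpha ap am * y ^ 2 / 8)) *
        ∫ r : ℝ, kerMinus ap am (x - η) y (r + I * ε) := by
  have hi := (integral_kerR_eq_integral_kerPlus hap ham (x - η) y hε hε').1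
  simp only [kerMinus_eq_conj]
  refine ⟨(hi.comp_neg).mono (continuous_conj.comp_aestronglyMeasurable
    hi.comp_neg.aestronglyMeasurable) (Eventually.of_forall fun z => by rw [RCLike.norm_conj]), ?_⟩
  have h := congrArg conj (todaVal_eq_kerPlus hap ham η x y hε hε')
  rw [conj_todaVal hap ham η x hy, map_mul, map_mul, ← prefL_eq_conj hap ham η x hy, ← exp_conj,
    ← integral_conj, ← integral_neg_eq_self] at h
  rw [h]
  congr 3
  simp [Complex.conj_ofNat]
  ring

end RelToda

/-! ### The limit of the first and of the fifth representation. -/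

namespace RelToda

open Complex Set ComplexConjugate

variable {ap am : ℝ}

theorem conj_rKer (t : ℝ) : conj (rKer ap am t) = GLeft ap am (-t - I * mid ap am / 2) := by
  rw [rKer, conj_GRight]
  congr 1
  simp [Complex.conj_ofNat]
  ring

theorem tendsto_rKer (hap : 0 < ap) (ham : 0 < am) : Tendsto (rKer ap am) atTop (𝓝 1) := by
  have hm := mid_pos hap ham
  refine (tendsto_GRight_add hap ham (z := -(I * mid ap am / 2)) ?_).congr fun t => ?_
  · have : (-(I * mid ap am / 2) : ℂ).im = -(mid ap am / 2) := by
      have := im_sub_half_mid (ap := ap) (am := am) 0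
      rwa [ofReal_zero, zero_sub] at this
    rw [this, abs_neg, abs_of_pos (by linarith)]
    linarith
  · rw [rKer]; congr 1; ring

theorem exists_norm_rKer_le_const (hap : 0 < ap) (ham : 0 < am) :
    ∃ K, 0 < K ∧ ∀ t : ℝ, ‖rKer ap am t‖ ≤ K := by
  obtain ⟨K, hK, h⟩ := exists_norm_rKer_le hap ham
  refine ⟨K, hK, fun t => (h t).trans (mul_le_of_le_one_right hK.le (Real.exp_le_one_iff.2 ?_))⟩
  have := mul_nonneg (mul_nonneg (alpha_pos hap ham).le (mid_pos hap ham).le)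
    (sub_nonneg.2 (le_abs_self t))
  linarith

/-- The integral over `kerR`, with the two remaining factors of the hyperbolic integrand. -/
noncomputable def kerRInt (ap am u y c L : ℝ) : ℂ :=
  ∫ z : ℝ, kerR ap am u y z *
    (GLeft ap am (z + c - L - I * mid ap am / 2) * GLeft ap am (-z - c - L - I * mid ap am / 2))

/-- The two additional factors are conjugates of `rKer` at L ± (z + c): bounded uniformly and
tending to 1. The integrable function |kerR| dominates. -/
theorem tendsto_kerRInt (hap : 0 < ap) (ham : 0 < am) (u y c : ℝ) :
    Tendsto (kerRInt ap am u y c) atTop (𝓝 (∫ z : ℝ, kerR ap am u y z)) := by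
  obtain ⟨K, hK, h⟩ := exists_norm_rKer_le_const hap ham
  have hi := integrable_kerR hap ham u y
  have hc := continuous_rKer hap ham
  have e : ∀ L z : ℝ, kerR ap am u y z * (GLeft ap am (z + c - L - I * mid ap am / 2) *
      GLeft ap am (-z - c - L - I * mid ap am / 2)) =
      kerR ap am u y z * (conj (rKer ap am (L - (z + c))) * conj (rKer ap am (L + (z + c)))) := by
    intro L z
    rw [conj_rKer, conj_rKer]
    congr 3 <;> push_cast <;> ring
  unfold kerRInt
  simp only [e]
  refine tendsto_integral_filter_of_dominated_convergence (fun z => ‖kerR ap am u y z‖ * (K * K))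
    (Eventually.of_forall fun L => ?_) (Eventually.of_forall fun L => Eventually.of_forall fun z => ?_)
    (hi.norm.mul_const _) (Eventually.of_forall fun z => ?_)
  · refine hi.aestronglyMeasurable.mul (Continuous.aestronglyMeasurable ?_)
    exact (continuous_conj.comp (hc.comp (by fun_prop))).mul
      (continuous_conj.comp (hc.comp (by fun_prop)))
  · rw [norm_mul, norm_mul, RCLike.norm_conj, RCLike.norm_conj]
    exact mul_le_mul_of_nonneg_left (mul_le_mul (h _) (h _) (norm_nonneg _) hK.le) (norm_nonneg _)
  · have h1 : ∀ s : ℝ, Tendsto (fun L : ℝ => conj (rKer ap am (L + s))) atTop (𝓝 1) := by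
      intro s
      have := (continuous_conj.tendsto _).comp ((tendsto_rKer hap ham).comp
        (tendsto_atTop_add_const_right atTop s tendsto_id))
      rwa [map_one] at this
    have h2 := ((h1 (-(z + c))).mul (h1 (z + c))).const_mul (kerR ap am u y z)
    rw [mul_one, mul_one] at h2
    exact h2.congr fun L => by rw [← sub_eq_add_neg]

/-- With p = x + Λ and γ = η + Λ the difference p - γ is fixed and p + γ grows. The factors seeing p
- γ are written through G_R, those seeing p + γ through G_L, and the Gaussians combine to the
prefactor and the kernel. -/
theorem fourierIntegral_eq_kerRInt (γ p y : ℝ) : fourierIntegral ap am (-γ) p y =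
    exp (I * alpha ap am / 2 * (((p + γ) / 2 + I * mid ap am / 2) ^ 2 -
      ((p - γ) / 2 - I * mid ap am / 2) ^ 2)) * kerRInt ap am (p - γ) y 0 ((p + γ) / 2) := by
  rw [fourierIntegral, kerRInt, ← integral_const_mul]
  refine integral_congr_ae (Eventually.of_forall fun z => ?_)
  simp only [kerR]
  have e4 : ∀ A B C D a b c d e f g : ℂ, a + b + c + d + e = f + g →
      (A * exp a) * (B * exp b) * (C * exp c) * (D * exp d) * exp e =
        exp f * (A * C * exp g * (B * D)) := by
    intro A B C D a b c d e f g h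
    calc _ = A * B * C * D * (exp a * exp b * exp c * exp d * exp e) := by ring
      _ = A * B * C * D * (exp f * exp g) := by simp only [← exp_add, h]
      _ = _ := by ring
  rw [G_eq_GRight ap am (z + p / 2 - I * mid ap am / 2 + (-γ : ℝ) / 2),
    G_eq_GLeft ap am (z - p / 2 - I * mid ap am / 2 + (-γ : ℝ) / 2),
    G_eq_GRight ap am (-z + p / 2 - I * mid ap am / 2 + (-γ : ℝ) / 2),
    G_eq_GLeft ap am (-z - p / 2 - I * mid ap am / 2 + (-γ : ℝ) / 2)]
  rw [show (z : ℂ) + p / 2 - I * mid ap am / 2 + (-γ : ℝ) / 2 =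
      z + (p - γ : ℝ) / 2 - I * mid ap am / 2 by push_cast; ring,
    show (z : ℂ) - p / 2 - I * mid ap am / 2 + (-γ : ℝ) / 2 =
      z + (0 : ℝ) - ((p + γ) / 2 : ℝ) - I * mid ap am / 2 by push_cast; ring,
    show -(z : ℂ) + p / 2 - I * mid ap am / 2 + (-γ : ℝ) / 2 =
      -z + (p - γ : ℝ) / 2 - I * mid ap am / 2 by push_cast; ring,
    show -(z : ℂ) - p / 2 - I * mid ap am / 2 + (-γ : ℝ) / 2 =
      -z - (0 : ℝ) - ((p + γ) / 2 : ℝ) - I * mid ap am / 2 by push_cast; ring]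
  refine e4 _ _ _ _ _ _ _ _ _ _ _ ?_
  push_cast
  ring

/-- The denominator is moved up by reflection, and the translation z ↦ z + y/2 makes the same pair
of G_R appear as in `kerR`; the other pair only carries an additional shift by y. -/
theorem ratioIntegral_eq_kerRInt (hap : 0 < ap) (ham : 0 < am) (γ p y : ℝ) :
    ratioIntegral ap am γ p y = exp (I * alpha ap am / 2 * (y ^ 2 + ((p + γ) / 2 +
      I * mid ap am / 2) ^ 2 - ((p - γ) / 2 - I * mid ap am / 2) ^ 2)) *
      kerRInt ap am (p - γ) y y ((p + γ) / 2) := by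
  have hm := mid_pos hap ham
  rw [ratioIntegral, kerRInt, ← integral_const_mul, ← integral_add_right_eq_self _ (y / 2)]
  refine integral_congr_ae (Eventually.of_forall fun z => ?_)
  simp only [kerR]
  have hinv : ∀ w v : ℂ, v = -w → w.im = mid ap am / 2 → (G ap am w)⁻¹ = G ap am v := by
    intro w v hv h
    rw [hv]
    refine inv_eq_of_mul_eq_one_right (G_mul_neg hap ham
      (notMem_lattice_of_im_lt hap ham (by linarith)) (notMem_lattice_of_im_lt hap ham ?_))
    rw [neg_im]; linarith
  have e4 : ∀ A B C D a b c d f g : ℂ, a + b + c + d = f + g →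
      (A * exp a) * (B * exp b) * ((C * exp c) * (D * exp d)) =
        exp f * (A * D * exp g * (B * C)) := by
    intro A B C D a b c d f g h
    calc _ = A * B * C * D * (exp a * exp b * exp c * exp d) := by ring
      _ = A * B * C * D * (exp f * exp g) := by simp only [← exp_add, h]
      _ = _ := by ring
  rw [div_eq_mul_inv, mul_inv,
    hinv _ (-z - (y : ℝ) - ((p + γ) / 2 : ℝ) - I * mid ap am / 2) (by push_cast; ring)
      (by simp [-ofReal_div, -ofReal_add]),
    hinv _ (-z + (p - γ : ℝ) / 2 - I * mid ap am / 2) (by push_cast; ring)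
      (by simp [-ofReal_div, -ofReal_add]),
    show ((z + y / 2 : ℝ) : ℂ) + (p - y) / 2 - I * mid ap am / 2 - γ / 2 =
      z + (p - γ : ℝ) / 2 - I * mid ap am / 2 by push_cast; ring,
    show ((z + y / 2 : ℝ) : ℂ) - (p - y) / 2 - I * mid ap am / 2 - γ / 2 =
      z + y - ((p + γ) / 2 : ℝ) - I * mid ap am / 2 by push_cast; ring,
    G_eq_GRight ap am (z + (p - γ : ℝ) / 2 - I * mid ap am / 2),
    G_eq_GLeft ap am (z + y - ((p + γ) / 2 : ℝ) - I * mid ap am / 2),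
    G_eq_GRight ap am (-z + (p - γ : ℝ) / 2 - I * mid ap am / 2),
    G_eq_GLeft ap am (-z - y - ((p + γ) / 2 : ℝ) - I * mid ap am / 2)]
  refine e4 _ _ _ _ _ _ _ _ _ _ ?_
  push_cast
  ring

theorem wSqrt_eq_add (γ y : ℝ) : wSqrt ap am γ y = gammaRoot ap am y *
    exp (I / 2 * (g ap am (γ + y) + g ap am (γ - y))) := by
  rw [wSqrt_eq, show (y : ℂ) - γ = -(γ - y) by ring, g_neg, add_comm (y : ℂ)]
  congr 2
  ring

theorem wSqrt_neg_eq_add (γ y : ℝ) : wSqrt ap am (-γ) y = gammaRoot ap am y *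
    exp (-(I / 2 * (g ap am (γ + y) + g ap am (γ - y)))) := by
  rw [wSqrt_eq, ofReal_neg, show (y : ℂ) - -γ = γ + y by ring,
    show (y : ℂ) + -γ = -(γ - y) by ring, g_neg, sub_neg_eq_add]

/-- Once g is replaced by g_R, all terms whose argument grows with Λ tend to 0. The one growing
factor, the root at x + Λ, is compensated by exp(-αa(x + Λ)/2). -/
theorem tendsto_of_prefactor (hap : 0 < ap) (ham : 0 < am) (η x y : ℝ) (σ₁ σ₂ c J₀ : ℂ)
    {J F : ℝ → ℂ} (hJ : Tendsto J atTop (𝓝 J₀)) (hF : ∀ Λ : ℝ, F Λ =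
      gammaRoot ap am (x + Λ) * exp (-(alpha ap am * mid ap am * (x + Λ : ℝ) / 2)) *
      exp (I * (σ₁ * gR ap am (η + Λ : ℝ) + gR ap am (x + Λ + (η + Λ) : ℝ) / 2 +
        σ₂ * (gR ap am (η + Λ + y : ℝ) + gR ap am (η + Λ - y : ℝ)))) * (c * J Λ)) :
    Tendsto F atTop (𝓝 (c * J₀)) := by
  have hg := tendsto_gR hap ham
  have h1 : ∀ s : ℝ, Tendsto (fun Λ : ℝ => s + Λ) atTop atTop := fun s =>
    tendsto_atTop_add_const_left _ s tendsto_id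
  have h2 := (((hg.comp (h1 η)).const_mul σ₁).add
    ((hg.comp ((h1 x).atTop_add_atTop (h1 η))).div_const 2)).add
    (((hg.comp (tendsto_atTop_add_const_right _ y (h1 η))).add
      (hg.comp (tendsto_atTop_add_const_right _ (-y) (h1 η)))).const_mul σ₂)
  have h3 := (((tendsto_gammaRoot hap ham).comp (h1 x)).mul ((h2.const_mul I).cexp)).mul
    (hJ.const_mul c)
  simp only [mul_zero, zero_div, add_zero, exp_zero, one_mul] at h3
  refine h3.congr fun Λ => ?_
  rw [hF]
  rfl

theorem mul_exp_combine {A B S J a b c f a' b' c' d' : ℂ} (h : c + a + b + f = a' + b' + c' + d') :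
    exp c / S * (A * exp a * (B * exp b)) * (exp f * J) =
      A * exp a' * exp b' * (B / S * exp c' * exp d' * J) := by
  calc _ = A * B / S * J * (exp c * exp a * exp b * exp f) := by ring
    _ = A * B / S * J * (exp a' * exp b' * exp c' * exp d') := by simp only [← exp_add, h]
    _ = _ := by ring

theorem tendsto_hypF5 (hap : 0 < ap) (ham : 0 < am) (η x : ℝ) {y : ℝ} (hy : 0 < y) :
    Tendsto (fun Λ : ℝ => hypF5 ap am (η + Λ) (x + Λ) y) atTop (𝓝 (todaVal ap am η x y)) := by
  have hm := mid_pos hap ham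
  rw [todaVal, prefR_eq hap ham η x hy]
  have hJ := (tendsto_kerRInt hap ham (x - η) y 0).comp (Tendsto.atTop_div_const two_pos
    (tendsto_atTop_add_const_left atTop (x + η) (Tendsto.const_mul_atTop two_pos tendsto_id)))
  refine tendsto_of_prefactor hap ham η x y 1 (-1 / 2) _ _ hJ fun Λ => ?_
  rw [hypF5, wSqrt_eq, wSqrt_neg_eq_add, fourierIntegral_eq_kerRInt,
    G_eq_exp hap ham (by simpa using hm)]
  have e6 : kerRInt ap am (x + Λ - (η + Λ)) y 0 ((x + Λ + (η + Λ)) / 2) =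
      (kerRInt ap am (x - η) y 0 ∘ fun Λ => (x + η + 2 * id Λ) / 2) Λ := by
    simp only [Function.comp, id]; congr 1 <;> ring
  rw [e6]
  refine mul_exp_combine ?_
  have e7 : (((x + Λ : ℝ) : ℂ) - (η + Λ : ℝ)) = x - η := by push_cast; ring
  rw [e7]
  simp only [gR, ofReal_add, ofReal_sub]
  linear_combination (alpha ap am * mid ap am * (x + Λ) / 2 : ℂ) * I_sq

theorem tendsto_hypF (hap : 0 < ap) (ham : 0 < am) (η x : ℝ) {y : ℝ} (hy : 0 < y) :
    Tendsto (fun Λ : ℝ => hypF ap am (η + Λ) (x + Λ) y) atTop (𝓝 (todaVal ap am η x y)) := by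
  have hm := mid_pos hap ham
  rw [todaVal, prefR_eq hap ham η x hy]
  have hJ := (tendsto_kerRInt hap ham (x - η) y y).comp (Tendsto.atTop_div_const two_pos
    (tendsto_atTop_add_const_left atTop (x + η) (Tendsto.const_mul_atTop two_pos tendsto_id)))
  refine tendsto_of_prefactor hap ham η x y (-1) (1 / 2) _ _ hJ fun Λ => ?_
  rw [hypF, wSqrt_eq, wSqrt_eq_add, ratioIntegral_eq_kerRInt hap ham,
    G_eq_exp hap ham (by simpa using hm), g_neg]
  have e6 : kerRInt ap am (x + Λ - (η + Λ)) y y ((x + Λ + (η + Λ)) / 2) =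
      (kerRInt ap am (x - η) y y ∘ fun Λ => (x + η + 2 * id Λ) / 2) Λ := by
    simp only [Function.comp, id]; congr 1 <;> ring
  rw [e6]
  refine mul_exp_combine ?_
  have e7 : (((x + Λ : ℝ) : ℂ) - (η + Λ : ℝ)) = x - η := by push_cast; ring
  rw [e7]
  simp only [gR, ofReal_add, ofReal_sub]
  linear_combination (alpha ap am * mid ap am * (x + Λ) / 2 : ℂ) * I_sq

theorem todaF_eq (hap : 0 < ap) (ham : 0 < am) (η x : ℝ) {y : ℝ} (hy : 0 < y) :
    todaF ap am η x y = todaVal ap am η x y :=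
  (tendsto_hypF hap ham η x hy).limUnder_eq

end RelToda

/-! ### The limit of the fourth representation; all five representations. -/

namespace RelToda

open Complex Set ComplexConjugate

variable {ap am ε : ℝ}

/-- The integrand of the fourth representation after an affine change of variables. -/
noncomputable def shiftKer (ap am γ p y : ℝ) (T : ℂ) : ℂ :=
  G ap am (-T + (γ + y / 2 : ℝ)) * G ap am (-T + (γ - y / 2 : ℝ)) *
    G ap am (T + (y / 2 : ℝ) - I * mid ap am) * G ap am (T + (-(y / 2) : ℝ) - I * mid ap am) *
    exp (I * alpha ap am * (γ / 2 - T + I * mid ap am / 2) * p)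

theorem fourierIntegral_eq_shiftKer (γ p y : ℝ) : fourierIntegral ap am γ y p =
    ∫ t : ℝ, shiftKer ap am γ p y (t + (mid ap am / 2 : ℝ) * I) := by
  rw [fourierIntegral, ← integral_sub_left_eq_self _ _ (γ / 2)]
  refine integral_congr_ae (Eventually.of_forall fun t => ?_)
  simp only [shiftKer]
  have e : ∀ A B C D A' B' C' D' E E' : ℂ, A = A' → B = B' → C = C' → D = D' → E = E' →
      A * B * C * D * E = A' * B' * C' * D' * E' := by
    rintro _ _ _ _ _ _ _ _ _ _ rfl rfl rfl rfl rfl; rfl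
  refine e _ _ _ _ _ _ _ _ _ _ ?_ ?_ ?_ ?_ ?_ <;> congr 1 <;> push_cast <;> ring

theorem analyticAt_shiftKer (hap : 0 < ap) (ham : 0 < am) (γ p y : ℝ) {T : ℂ} (h0 : 0 < T.im)
    (h1 : T.im < mid ap am) : AnalyticAt ℂ (shiftKer ap am γ p y) T := by
  have a1 : ∀ s : ℝ, AnalyticAt ℂ (fun T => G ap am (-T + s)) T := fun s =>
    AnalyticAt.fun_comp_of_eq (f := fun T : ℂ => -T + s) (analyticAt_G hap ham
      (neg_notMem_lattice_of_lt_im hap ham (z := -T + s) (by simp; linarith))) (by fun_prop) rfl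
  have a2 : ∀ s : ℝ, AnalyticAt ℂ (fun T => G ap am (T + s - I * mid ap am)) T := fun s =>
    AnalyticAt.fun_comp_of_eq (f := fun T : ℂ => T + s - I * mid ap am) (analyticAt_G hap ham
      (neg_notMem_lattice_of_lt_im hap ham (z := T + s - I * mid ap am) (by simp; linarith)))
      (by fun_prop) rfl
  exact ((((a1 _).mul (a1 _)).mul (a2 _)).mul (a2 _)).mul (by fun_prop)

theorem exists_norm_shiftKer_le (hap : 0 < ap) (ham : 0 < am) (γ p y : ℝ) (hε : 0 < ε)
    (hε' : ε < mid ap am / 2) : ∃ C, ∀ r t : ℝ, t ∈ Icc ε (mid ap am / 2) →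
      ‖shiftKer ap am γ p y (r + t * I)‖ ≤ C * Real.exp (-(alpha ap am * mid ap am * |r|)) := by
  have hm := mid_pos hap ham
  have hα := alpha_pos hap ham
  obtain ⟨K, hK, h⟩ := exists_norm_G_le_upper hap ham (by linarith : mid ap am - ε < mid ap am) 0
  have key : ∀ (w : ℂ) (x r S : ℝ), w.im = x → w.re = r + S → |x| ≤ mid ap am →
      -(mid ap am - ε) ≤ x → x ≤ 0 → ‖G ap am w‖ ≤
        K * Real.exp (alpha ap am / 2 * (mid ap am * |S|)) *
          Real.exp (alpha ap am / 2 * (x * |r|)) := by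
    intro w x r S h1 h2 h3 h4 h5
    refine (h w (by rw [h1]; exact h4) (by rw [h1]; exact h5)).trans ?_
    rw [mul_assoc, ← Real.exp_add, ← mul_add, h1, h2]
    refine mul_le_mul_of_nonneg_left (Real.exp_le_exp.2
      (mul_le_mul_of_nonneg_left ?_ (by positivity))) hK.le
    linarith [mul_abs_add_le (r := r) (S := S) h3]
  set c : ℝ → ℝ := fun S => K * Real.exp (alpha ap am / 2 * (mid ap am * |S|)) with hc
  have hc0 : ∀ S, 0 ≤ c S := fun S => by positivity
  refine ⟨c (γ + y / 2) * c (γ - y / 2) * c (y / 2) * c (-(y / 2)) *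
    Real.exp (alpha ap am * (mid ap am * |p|)), fun r t ht => ?_⟩
  obtain ⟨t1, t2⟩ := ht
  have k1 : ∀ S : ℝ, ‖G ap am (-(r + t * I) + S)‖ ≤
      c S * Real.exp (alpha ap am / 2 * (-t * |r|)) := fun S => by
    have := key (-(r + t * I) + S) (-t) (-r) S (by simp) (by simp)
      (by rw [abs_le]; constructor <;> linarith) (by linarith) (by linarith)
    rwa [abs_neg] at this
  have k2 : ∀ S : ℝ, ‖G ap am ((r + t * I) + S - I * mid ap am)‖ ≤
      c S * Real.exp (alpha ap am / 2 * ((t - mid ap am) * |r|)) := fun S =>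
    key _ (t - mid ap am) r S (by simp) (by simp)
      (by rw [abs_le]; constructor <;> linarith) (by linarith) (by linarith)
  have k3 : ‖exp (I * alpha ap am * (γ / 2 - (r + t * I) + I * mid ap am / 2) * p)‖ ≤
      Real.exp (alpha ap am * (mid ap am * |p|)) := by
    rw [norm_exp_alpha]
    refine Real.exp_le_exp.2 ?_
    rw [← mul_neg]
    refine mul_le_mul_of_nonneg_left ?_ hα.le
    have e : ((γ : ℂ) / 2 - (r + t * I) + I * mid ap am / 2).im = -t + mid ap am / 2 := by
      rw [show (γ : ℂ) / 2 - (r + t * I) + I * mid ap am / 2 =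
        ((γ / 2 - r : ℝ) : ℂ) + ((-t + mid ap am / 2 : ℝ) : ℂ) * I by push_cast; ring]
      simp [-ofReal_div, -ofReal_add, -ofReal_sub]
    rw [e, ofReal_im, mul_zero, zero_add, ofReal_re]
    refine (neg_le_abs _).trans ?_
    rw [abs_mul]
    exact mul_le_mul_of_nonneg_right (by rw [abs_le]; constructor <;> linarith) (abs_nonneg _)
  have hp := fun S => (norm_nonneg _).trans (k1 S)
  have hp2 := fun S => (norm_nonneg _).trans (k2 S)
  rw [shiftKer, norm_mul, norm_mul, norm_mul, norm_mul]
  refine (mul_le_mul (mul_le_mul (mul_le_mul (mul_le_mul (k1 _) (k1 _) (norm_nonneg _) (hp _))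
    (k2 _) (norm_nonneg _) (mul_nonneg (hp _) (hp _))) (k2 _) (norm_nonneg _)
    (mul_nonneg (mul_nonneg (hp _) (hp _)) (hp2 _))) k3 (norm_nonneg _)
    (mul_nonneg (mul_nonneg (mul_nonneg (hp _) (hp _)) (hp2 _)) (hp2 _))).trans (le_of_eq ?_)
  have e : Real.exp (-(alpha ap am * mid ap am * |r|)) =
      Real.exp (alpha ap am / 2 * (-t * |r|)) * Real.exp (alpha ap am / 2 * (-t * |r|)) *
      (Real.exp (alpha ap am / 2 * ((t - mid ap am) * |r|)) *
        Real.exp (alpha ap am / 2 * ((t - mid ap am) * |r|))) := by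
    rw [← Real.exp_add, ← Real.exp_add, ← Real.exp_add]; congr 1; ring
  rw [e]
  ring

/-- The integral over `kerPlus`, with the two remaining factors of the hyperbolic integrand. -/
noncomputable def kerPlusInt (ap am u y ε γ : ℝ) : ℂ :=
  ∫ r : ℝ, kerPlus ap am u y (r + I * ε) * (GRight ap am (-(r + I * ε) + (y / 2 : ℝ) + γ) *
    GRight ap am (-(r + I * ε) + (-(y / 2) : ℝ) + γ))

theorem fourierIntegral_eq_kerPlusInt (hap : 0 < ap) (ham : 0 < am) (γ p y : ℝ) (hε : 0 < ε)
    (hε' : ε < mid ap am / 2) : fourierIntegral ap am γ y p =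
    exp (I * alpha ap am * γ * p / 2 - alpha ap am * mid ap am * p / 2 -
      I * (2 * chi ap am + alpha ap am * (γ ^ 2 / 2 + y ^ 2 / 8))) *
      kerPlusInt ap am (p - γ) y ε γ := by
  have hm := mid_pos hap ham
  obtain ⟨C, hC⟩ := exists_norm_shiftKer_le hap ham γ p y hε hε'
  -- The change of variables places the line at Im T = a/2, just where the limiting integrand
  -- `kerPlus` loses the decay used for domination. It is lowered to ε < a/2 before the limit is
  -- taken.
  rw [fourierIntegral_eq_shiftKer, ← integral_line_eq_of_exp_bound
    (mul_pos (alpha_pos hap ham) hm) countable_empty hε'.le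
    (fun z hz => (analyticAt_shiftKer hap ham γ p y (hε.trans_le hz.1)
      (by linarith [hz.2])).continuousAt.continuousWithinAt)
    (fun z hz _ => (analyticAt_shiftKer hap ham γ p y (hε.trans hz.1)
      (by linarith [hz.2])).differentiableAt) hC, kerPlusInt, ← integral_const_mul]
  refine integral_congr_ae (Eventually.of_forall fun r => ?_)
  simp only [shiftKer, kerPlus]
  rw [G_eq_GRight ap am (-(r + ε * I) + (γ + y / 2 : ℝ)),
    G_eq_GRight ap am (-(r + ε * I) + (γ - y / 2 : ℝ))]
  set T : ℂ := r + ε * I with hT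
  rw [mul_comm I (ε : ℂ), ← hT]
  rw [show -T + (γ + y / 2 : ℝ) = -T + (y / 2 : ℝ) + γ by push_cast; ring,
    show -T + (γ - y / 2 : ℝ) = -T + (-(y / 2) : ℝ) + γ by push_cast; ring,
    show T + (y / 2 : ℝ) - I * mid ap am = T + y / 2 - I * mid ap am by push_cast; ring,
    show T + (-(y / 2) : ℝ) - I * mid ap am = T - y / 2 - I * mid ap am by push_cast; ring]
  have e4 : ∀ A B C D a b e f g : ℂ, a + b + e = f + g →
      (A * exp a) * (B * exp b) * C * D * exp e = exp f * (C * D * exp g * (A * B)) := by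
    intro A B C D a b e f g h
    calc _ = A * B * C * D * (exp a * exp b * exp e) := by ring
      _ = A * B * C * D * (exp f * exp g) := by simp only [← exp_add, h]
      _ = _ := by ring
  refine e4 _ _ _ _ _ _ _ _ _ ?_
  push_cast
  linear_combination (alpha ap am * mid ap am * p / 2) * I_sq

/-- On the lowered line the two factors G_R are bounded uniformly in γ and tend to 1, so |kerPlus|
dominates up to a constant. -/
theorem tendsto_kerPlusInt (hap : 0 < ap) (ham : 0 < am) (u y : ℝ) (hε : 0 < ε)
    (hε' : ε < mid ap am / 2) : Tendsto (kerPlusInt ap am u y ε) atTop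
      (𝓝 (∫ r : ℝ, kerPlus ap am u y (r + I * ε))) := by
  have hm := mid_pos hap ham
  have hα := alpha_pos hap ham
  have hi := (integral_kerR_eq_integral_kerPlus hap ham u y hε hε').1
  obtain ⟨K, hK, h⟩ := exists_norm_GRight_le hap ham (by linarith : ε < mid ap am) 0
  have him : ∀ r S γ : ℝ, (-((r : ℂ) + I * ε) + S + γ).im = -ε := fun r S γ => by simp
  have hb : ∀ r S γ : ℝ, ‖GRight ap am (-((r : ℂ) + I * ε) + S + γ)‖ ≤ K := fun r S γ => by
    refine (h _ (him r S γ).ge (by rw [him]; linarith)).trans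
      (mul_le_of_le_one_right hK.le (Real.exp_le_one_iff.2 ?_))
    rw [him]
    have := mul_nonneg (mul_nonneg hα.le hε.le) (sub_nonneg.2
      (le_abs_self (-((r : ℂ) + I * ε) + S + γ).re))
    linarith
  have hc : ∀ S γ : ℝ, Continuous fun r : ℝ => GRight ap am (-((r : ℂ) + I * ε) + S + γ) := by
    intro S γ
    rw [continuous_iff_continuousAt]
    intro r
    exact ContinuousAt.comp (f := fun r : ℝ => -((r : ℂ) + I * ε) + S + γ)
      (analyticAt_GRight hap ham (neg_notMem_lattice_of_lt_im hap ham
        (by rw [him]; linarith))).continuousAt (by fun_prop)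
  refine tendsto_integral_filter_of_dominated_convergence
    (fun r => ‖kerPlus ap am u y (r + I * ε)‖ * (K * K))
    (Eventually.of_forall fun γ => hi.aestronglyMeasurable.mul
      ((hc _ γ).mul (hc _ γ)).aestronglyMeasurable)
    (Eventually.of_forall fun γ => Eventually.of_forall fun r => ?_)
    (hi.norm.mul_const _) (Eventually.of_forall fun r => ?_)
  · rw [norm_mul, norm_mul]
    exact mul_le_mul_of_nonneg_left (mul_le_mul (hb _ _ _) (hb _ _ _) (norm_nonneg _) hK.le)
      (norm_nonneg _)
  · have h1 : ∀ S : ℝ, Tendsto (fun γ : ℝ => GRight ap am (-((r : ℂ) + I * ε) + S + γ)) atTop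
        (𝓝 1) := fun S => tendsto_GRight_add hap ham (by
      have := him r S 0
      rw [ofReal_zero, add_zero] at this
      rw [this, abs_neg, abs_of_pos hε]
      linarith)
    have h2 := ((h1 (y / 2)).mul (h1 (-(y / 2)))).const_mul (kerPlus ap am u y (r + I * ε))
    rwa [mul_one, mul_one] at h2

theorem tendsto_hypF4 (hap : 0 < ap) (ham : 0 < am) (η x : ℝ) {y : ℝ} (hy : 0 < y) :
    Tendsto (fun Λ : ℝ => hypF4 ap am (η + Λ) (x + Λ) y) atTop (𝓝 (todaVal ap am η x y)) := by
  have hm := mid_pos hap ham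
  have hε : 0 < mid ap am / 4 := by linarith
  have hε' : mid ap am / 4 < mid ap am / 2 := by linarith
  rw [todaVal_eq_kerPlus hap ham η x y hε hε', prefR_eq hap ham η x hy]
  have hJ := (tendsto_kerPlusInt hap ham (x - η) y hε hε').comp
    (tendsto_atTop_add_const_left atTop η tendsto_id)
  refine tendsto_of_prefactor hap ham η x y (-1) (-1 / 2) _ _ hJ fun Λ => ?_
  rw [hypF4, wSqrt_eq, wSqrt_neg_eq_add, fourierIntegral_eq_kerPlusInt hap ham _ _ _ hε hε',
    G_eq_exp hap ham (by simpa using hm), g_neg]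
  have e6 : kerPlusInt ap am (x + Λ - (η + Λ)) y (mid ap am / 4) (η + Λ) =
      (kerPlusInt ap am (x - η) y (mid ap am / 4) ∘ fun Λ => η + id Λ) Λ := by
    simp only [Function.comp, id]; congr 1; ring
  rw [e6]
  refine mul_exp_combine ?_
  have e7 : (((x + Λ : ℝ) : ℂ) - (η + Λ : ℝ)) = x - η := by push_cast; ring
  rw [e7]
  simp only [gR, ofReal_add, ofReal_sub]
  ring

/-- The eigenfunction, in each of its five representations, converges. -/
theorem tendsto_todaF (hap : 0 < ap) (ham : 0 < am) (η x y : ℝ) (hy : 0 < y) :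
    Tendsto (fun Λ : ℝ => hypF ap am (η + Λ) (x + Λ) y) atTop (𝓝 (todaF ap am η x y)) ∧
    Tendsto (fun Λ : ℝ => hypF2 ap am (η + Λ) (x + Λ) y) atTop (𝓝 (todaF ap am η x y)) ∧
    Tendsto (fun Λ : ℝ => hypF3 ap am (η + Λ) (x + Λ) y) atTop (𝓝 (todaF ap am η x y)) ∧
    Tendsto (fun Λ : ℝ => hypF4 ap am (η + Λ) (x + Λ) y) atTop (𝓝 (todaF ap am η x y)) ∧
    Tendsto (fun Λ : ℝ => hypF5 ap am (η + Λ) (x + Λ) y) atTop (𝓝 (todaF ap am η x y)) := by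
  rw [todaF_eq hap ham η x hy]
  have h5 := tendsto_hypF5 hap ham η x hy
  have h4 := tendsto_hypF4 hap ham η x hy
  -- The limit is real, so the conjugate representations converge to the same value. The conjugation
  -- identities need x + Λ > 0, which holds for large Λ.
  have c5 := (continuous_conj.tendsto _).comp h5
  have c4 := (continuous_conj.tendsto _).comp h4
  rw [conj_todaVal hap ham η x hy] at c4 c5
  refine ⟨tendsto_hypF hap ham η x hy, c5.congr' ?_, c4.congr' ?_, h4, h5⟩ <;>
    filter_upwards [eventually_gt_atTop (-x)] with Λ hΛ
  · exact (hypF2_eq_conj hap ham _ (by linarith) hy).symm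
  · exact (hypF3_eq_conj hap ham _ (by linarith) hy).symm

/-- The four integral representations of the limit. -/
theorem todaF_representations (hap : 0 < ap) (ham : 0 < am) (η x y : ℝ) (hy : 0 < y) :
    (Integrable (kerR ap am (x - η) y) ∧
        todaF ap am η x y = prefR ap am η x y *
          Complex.exp (Complex.I * alpha ap am * y ^ 2 / 4) *
          ∫ z : ℝ, kerR ap am (x - η) y z) ∧
      (Integrable (kerL ap am (x - η) y) ∧
        todaF ap am η x y = prefL ap am η x y *
          Complex.exp (-(Complex.I * alpha ap am * y ^ 2 / 4)) *
          ∫ z : ℝ, kerL ap am (x - η) y z) ∧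
      (∀ ε : ℝ, 0 < ε → ε < mid ap am / 2 →
        (Integrable (fun r : ℝ => kerPlus ap am (x - η) y (r + Complex.I * ε)) ∧
          todaF ap am η x y = prefR ap am η x y *
            Complex.exp (Complex.I * alpha ap am * y ^ 2 / 8) *
            ∫ r : ℝ, kerPlus ap am (x - η) y (r + Complex.I * ε)) ∧
        (Integrable (fun r : ℝ => kerMinus ap am (x - η) y (r + Complex.I * ε)) ∧
          todaF ap am η x y = prefL ap am η x y *
            Complex.exp (-(Complex.I * alpha ap am * y ^ 2 / 8)) *
            ∫ r : ℝ, kerMinus ap am (x - η) y (r + Complex.I * ε))) := by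
  rw [todaF_eq hap ham η x hy]
  exact ⟨⟨integrable_kerR hap ham _ _, rfl⟩,
    ⟨integrable_kerL hap ham _ _, todaVal_eq_kerL hap ham η x hy⟩, fun ε hε hε' =>
    ⟨⟨(integral_kerR_eq_integral_kerPlus hap ham _ y hε hε').1,
      todaVal_eq_kerPlus hap ham η x y hε hε'⟩, todaVal_eq_kerMinus hap ham η x hy hε hε'⟩⟩

end RelToda

/-! ### The limits of the Hamiltonians. -/

namespace RelToda

open Complex Set ComplexConjugate

variable {ap am : ℝ}

theorem tendsto_exp_neg_pi_mul {a k : ℝ} (ha : 0 < a) (hk : 0 < k) (c : ℂ) :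
    Tendsto (fun Λ : ℝ => exp (-(2 * (Real.pi * (c + k * Λ) / a)))) atTop (𝓝 0) := by
  rw [tendsto_zero_iff_norm_tendsto_zero]
  refine (tendsto_const_mul_exp_neg (by positivity : 0 < 2 * Real.pi * k / a)
    (Real.exp (-(2 * Real.pi * c.re / a)))).congr fun Λ => ?_
  rw [norm_exp, ← Real.exp_add]
  congr 1
  have : -(2 * (Real.pi * (c + k * Λ) / a)) = ((2 * Real.pi / a : ℝ) : ℂ) * -(c + (k * Λ : ℝ)) := by
    push_cast; ring
  rw [this, re_ofReal_mul, neg_re, add_re, ofReal_re]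
  ring

theorem half_cpow_ne_zero : ((1 / 2 : ℂ)) ^ (1 / 2 : ℂ) ≠ 0 := fun h => by
  have := cpow_half_sq (1 / 2)
  rw [h] at this
  norm_num at this

theorem continuousAt_half_cpow : ContinuousAt (fun w : ℂ => (w / 2) ^ (1 / 2 : ℂ)) 1 :=
  ContinuousAt.cpow (by fun_prop) (by fun_prop) (by norm_num [slitPlane])

/-- The definition of the branch already displays the exponential exp(u/2) on the right half plane.
The slope k = 2 serves z + γ, in which both terms carry Λ, and k = 1 the dual case. -/
theorem tendsto_cdSqrt (hap : 0 < ap) (ham : 0 < am) (δ : Bool) {k : ℝ} (hk : 0 < k) (c : ℂ) :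
    Tendsto (fun Λ : ℝ => cdSqrt ap am δ (c + k * Λ) *
      exp (-(Real.pi * (c + k * Λ) / par ap am δ / 2))) atTop (𝓝 ((1 / 2) ^ (1 / 2 : ℂ))) := by
  have ha := par_pos hap ham δ
  have h1 := (tendsto_exp_neg_pi_mul ha hk c).const_add 1
  rw [add_zero] at h1
  refine (continuousAt_half_cpow.tendsto.comp h1).congr' ?_
  have h2 : Tendsto (fun Λ : ℝ => c.re + k * Λ) atTop atTop :=
    tendsto_atTop_add_const_left _ _ (Tendsto.const_mul_atTop hk tendsto_id)
  filter_upwards [h2.eventually_ge_atTop 0] with Λ hΛ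
  have hre : 0 ≤ (Real.pi * (c + k * Λ) / par ap am δ : ℂ).re := by
    have : (Real.pi * (c + k * Λ) / par ap am δ : ℂ) =
        ((Real.pi / par ap am δ : ℝ) : ℂ) * (c + (k * Λ : ℝ)) := by push_cast; ring
    rw [this, re_ofReal_mul, add_re, ofReal_re]
    positivity
  rw [cdSqrt, coshSqrt, if_pos hre, mul_right_comm, ← exp_add]
  simp

/-- The inequality has to be strict: on the imaginary axis the branch takes the limit from the
right, and beyond the branch points it is not even. -/
theorem cdSqrt_neg (hap : 0 < ap) (ham : 0 < am) (δ : Bool) {z : ℂ} (hz : z.re < 0) :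
    cdSqrt ap am δ z = cdSqrt ap am δ (-z) := by
  have ha := par_pos hap ham δ
  have e : (Real.pi * z / par ap am δ : ℂ) = ((Real.pi / par ap am δ : ℝ) : ℂ) * z := by
    push_cast; ring
  have hre : (Real.pi * z / par ap am δ : ℂ).re < 0 := by
    rw [e, re_ofReal_mul]
    exact mul_neg_of_pos_of_neg (by positivity) hz
  have e2 : (Real.pi * -z / par ap am δ : ℂ) = -(Real.pi * z / par ap am δ) := by ring
  rw [cdSqrt, cdSqrt, e2, coshSqrt, coshSqrt, if_neg (not_le.2 hre), if_pos (by rw [neg_re]; linarith)]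
  congr 3
  · ring
  · congr 2; ring

theorem tendsto_sdSqrt (hap : 0 < ap) (ham : 0 < am) (δ : Bool) {k : ℝ} (hk : 0 < k) (c : ℂ) :
    Tendsto (fun Λ : ℝ => sdSqrt ap am δ (c + k * Λ) *
      exp (-(Real.pi * (c + k * Λ) / par ap am δ / 2))) atTop (𝓝 ((1 / 2) ^ (1 / 2 : ℂ))) := by
  have h1 := (tendsto_exp_neg_pi_mul (par_pos hap ham δ) hk c).const_sub 1
  rw [sub_zero] at h1
  refine (continuousAt_half_cpow.tendsto.comp h1).congr fun Λ => ?_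
  rw [sdSqrt, sinhSqrt, mul_right_comm, ← exp_add]
  simp

theorem div_two_cpow_half (w : ℂ) :
    (w / 2) ^ (1 / 2 : ℂ) = (1 / 2) ^ (1 / 2 : ℂ) * w ^ (1 / 2 : ℂ) := by
  rcases eq_or_ne w 0 with rfl | hw
  · simp
  · have h2 : (1 / 2 : ℂ) = ((1 / 2 : ℝ) : ℂ) := by norm_num
    have h := log_ofReal_mul (by norm_num : (0 : ℝ) < 1 / 2) hw
    rw [cpow_def_of_ne_zero (by simpa using hw), cpow_def_of_ne_zero (by norm_num),
      cpow_def_of_ne_zero hw, ← exp_add, ← add_mul, div_eq_mul_one_div w, mul_comm w, h2, h,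
      ofReal_log (by norm_num)]

/-- Both branches switch formula at Re u = 0, so the identity holds everywhere, including the values
on the cuts. -/
theorem cdSqrt_eq_todaSqrt (hap : 0 < ap) (ham : 0 < am) (δ : Bool) (u : ℂ) :
    cdSqrt ap am δ u = (1 / 2) ^ (1 / 2 : ℂ) * todaSqrt ap am δ u *
      exp (Real.pi * u / par ap am δ / 2) := by
  have ha := par_pos hap ham δ
  have e : (Real.pi * u / par ap am δ : ℂ) = ((Real.pi / par ap am δ : ℝ) : ℂ) * u := by
    push_cast; ring
  have hre : 0 ≤ (Real.pi * u / par ap am δ : ℂ).re ↔ 0 ≤ u.re := by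
    rw [e, re_ofReal_mul]
    exact mul_nonneg_iff_of_pos_left (by positivity)
  have e1 : ed ap am δ (-(2 * u)) = exp (-(2 * (Real.pi * u / par ap am δ))) := by
    rw [ed]; congr 1; ring
  have e2 : ed ap am δ (2 * u) = exp (2 * (Real.pi * u / par ap am δ)) := by
    rw [ed]; congr 1; ring
  have e3 : ed ap am δ (-u) * exp (Real.pi * u / par ap am δ / 2) =
      exp (-(Real.pi * u / par ap am δ / 2)) := by
    rw [ed, ← exp_add]; congr 1; ring
  rw [cdSqrt, coshSqrt, todaSqrt]
  simp only [hre]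
  split_ifs
  · rw [div_two_cpow_half, e1]; ring
  · rw [div_two_cpow_half, e2]
    linear_combination -((1 / 2) ^ (1 / 2 : ℂ) *
      (1 + exp (2 * (Real.pi * u / par ap am δ))) ^ (1 / 2 : ℂ)) * e3

/-- In z - γ the parameter Λ cancels, so this root survives unchanged and becomes `todaSqrt`. The
three other roots are replaced by their leading exponentials, and all exponentials cancel exactly
for every Λ. -/
theorem tendsto_hypH_coeff (hap : 0 < ap) (ham : 0 < am) (δ : Bool) (η : ℝ) (x s : ℂ) :
    Tendsto (fun Λ : ℝ => cdSqrt ap am δ (x + Λ + s / 2 + (η + Λ : ℝ)) *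
      cdSqrt ap am δ (x + Λ + s / 2 - (η + Λ : ℝ)) /
        (sdSqrt ap am δ (x + Λ) * sdSqrt ap am δ (x + Λ + s))) atTop
      (𝓝 (todaSqrt ap am δ (x - η + s / 2))) := by
  have h1 := tendsto_cdSqrt hap ham δ two_pos (x + s / 2 + η)
  have h2 := tendsto_sdSqrt hap ham δ one_pos x
  have h3 := tendsto_sdSqrt hap ham δ one_pos (x + s)
  have h4 := ((h1.mul_const (cdSqrt ap am δ (x - η + s / 2) *
    exp (-(Real.pi * (x - η + s / 2) / par ap am δ / 2)))).div (h2.mul h3)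
    (mul_ne_zero half_cpow_ne_zero half_cpow_ne_zero))
  have e : (1 / 2 : ℂ) ^ (1 / 2 : ℂ) * (cdSqrt ap am δ (x - η + s / 2) *
      exp (-(Real.pi * (x - η + s / 2) / par ap am δ / 2))) /
      ((1 / 2) ^ (1 / 2 : ℂ) * (1 / 2) ^ (1 / 2 : ℂ)) = todaSqrt ap am δ (x - η + s / 2) := by
    rw [cdSqrt_eq_todaSqrt hap ham, mul_assoc _ (exp _), ← exp_add, add_neg_cancel, exp_zero]
    have := half_cpow_ne_zero
    field_simp
  rw [e] at h4
  refine h4.congr fun Λ => ?_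
  rw [Pi.div_apply]
  have e1 : x + s / 2 + η + (2 : ℝ) * Λ = x + Λ + s / 2 + (η + Λ : ℝ) := by push_cast; ring
  have e2 : x + (1 : ℝ) * (Λ : ℂ) = x + Λ := by push_cast; ring
  have e3 : x + s + (1 : ℝ) * (Λ : ℂ) = x + Λ + s := by push_cast; ring
  have e4 : x + Λ + s / 2 - (η + Λ : ℝ) = x - η + s / 2 := by push_cast; ring
  rw [e1, e2, e3, e4]
  have e5 : exp (-(Real.pi * (x + Λ + s / 2 + (η + Λ : ℝ)) / par ap am δ / 2)) *
      exp (-(Real.pi * (x - η + s / 2) / par ap am δ / 2)) =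
      exp (-(Real.pi * (x + Λ) / par ap am δ / 2)) *
      exp (-(Real.pi * (x + Λ + s) / par ap am δ / 2)) := by
    rw [← exp_add, ← exp_add]; congr 1; push_cast; ring
  rw [mul_mul_mul_comm, e5, mul_mul_mul_comm (sdSqrt ap am δ (x + Λ))]
  exact mul_div_mul_right _ _ (mul_ne_zero (exp_ne_zero _) (exp_ne_zero _))

/-- The Hamiltonians converge. -/
theorem tendsto_hypH (hap : 0 < ap) (ham : 0 < am) (δ : Bool) (η : ℝ) (ψ : ℂ → ℂ) (x : ℂ) :
    Tendsto (fun Λ : ℝ => hypH ap am δ (η + Λ) (fun z => ψ (z - Λ)) (x + Λ)) atTop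
      (𝓝 (todaH ap am δ η ψ x)) := by
  have h1 := (tendsto_hypH_coeff hap ham δ η x (step ap am δ)).mul_const (ψ (x + step ap am δ))
  have h2 := (tendsto_hypH_coeff hap ham δ η x (-step ap am δ)).mul_const (ψ (x - step ap am δ))
  simp only [neg_div, ← sub_eq_add_neg] at h2
  refine (h1.add h2).congr fun Λ => ?_
  rw [hypH, show x + Λ + step ap am δ - Λ = x + step ap am δ by ring,
    show x + Λ - step ap am δ - Λ = x - step ap am δ by ring]

/-- The arguments w ± (η + Λ) run off in opposite directions. As the root is even off the cuts, each
behaves like (1/2)^(1/2) times an exponential, and the exponentials multiply to e_δ(η + Λ). -/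
theorem tendsto_hypH_dual_coeff (hap : 0 < ap) (ham : 0 < am) (δ : Bool) (η : ℝ) (w : ℂ) :
    Tendsto (fun Λ : ℝ => ed ap am δ (-Λ) * (cdSqrt ap am δ (w + (η + Λ : ℝ)) *
      cdSqrt ap am δ (w - (η + Λ : ℝ)))) atTop (𝓝 (ed ap am δ η / 2)) := by
  have h := ((tendsto_cdSqrt hap ham δ one_pos (w + η)).mul
    (tendsto_cdSqrt hap ham δ one_pos (-w + η))).const_mul (ed ap am δ η)
  rw [← sq, cpow_half_sq, mul_one_div] at h
  refine h.congr' ?_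
  have h2 : Tendsto (fun Λ : ℝ => -w.re + η + Λ) atTop atTop :=
    tendsto_atTop_add_const_left _ _ tendsto_id
  filter_upwards [h2.eventually_gt_atTop 0] with Λ hΛ
  have e1 : w + η + (1 : ℝ) * (Λ : ℂ) = w + (η + Λ : ℝ) := by push_cast; ring
  have e2 : -w + η + (1 : ℝ) * (Λ : ℂ) = -(w - (η + Λ : ℝ)) := by push_cast; ring
  rw [e1, e2, ← cdSqrt_neg hap ham δ (by rw [sub_re, ofReal_re]; linarith)]
  have e3 : ed ap am δ η * (exp (-(Real.pi * (w + (η + Λ : ℝ)) / par ap am δ / 2)) *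
      exp (-(Real.pi * -(w - (η + Λ : ℝ)) / par ap am δ / 2))) = ed ap am δ (-Λ) := by
    rw [ed, ed, ← exp_add, ← exp_add]; congr 1; push_cast; ring
  rw [← e3]
  ring

/-- The renormalized dual Hamiltonians converge. -/
theorem tendsto_hypH_dual (hap : 0 < ap) (ham : 0 < am) (δ : Bool) (η : ℝ) (ψ : ℂ → ℂ) (y : ℂ) :
    Tendsto (fun Λ : ℝ => ed ap am δ (-Λ) * hypH ap am δ (η + Λ) ψ y) atTop
      (𝓝 (dualTodaH ap am δ η ψ y)) := by
  have h1 := (tendsto_hypH_dual_coeff hap ham δ η (y + step ap am δ / 2)).mul_const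
    ((sdSqrt ap am δ y * sdSqrt ap am δ (y + step ap am δ))⁻¹ * ψ (y + step ap am δ))
  have h2 := (tendsto_hypH_dual_coeff hap ham δ η (y - step ap am δ / 2)).mul_const
    ((sdSqrt ap am δ y * sdSqrt ap am δ (y - step ap am δ))⁻¹ * ψ (y - step ap am δ))
  have e : dualTodaH ap am δ η ψ y = ed ap am δ η / 2 *
      ((sdSqrt ap am δ y * sdSqrt ap am δ (y + step ap am δ))⁻¹ * ψ (y + step ap am δ)) +
      ed ap am δ η / 2 *
      ((sdSqrt ap am δ y * sdSqrt ap am δ (y - step ap am δ))⁻¹ * ψ (y - step ap am δ)) := by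
    rw [dualTodaH, mul_inv, mul_inv]; ring
  rw [e]
  refine (h1.add h2).congr fun Λ => ?_
  rw [hypH, div_eq_mul_inv, div_eq_mul_inv]
  ring

end RelToda

/-! ### The branch of G_R^(-1/2) on the cut plane. -/

namespace RelToda

open Complex Set ComplexConjugate

variable {ap am m : ℝ}

/-- The plane without the cuts `± i[m, ∞)`. -/
def cutSet (m : ℝ) : Set ℂ := {u | u.re = 0 → |u.im| < m}

theorem isOpen_cutSet (m : ℝ) : IsOpen (cutSet m) := by
  have : cutSet m = {u | u.re ≠ 0} ∪ {u | |u.im| < m} := by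
    ext u
    simp only [cutSet, mem_union, mem_ofPred_eq, ne_eq]
    tauto
  rw [this]
  exact (isOpen_ne_fun (by fun_prop) continuous_const).union (isOpen_strip m)

theorem starConvex_cutSet (hm : 0 < m) : StarConvex ℝ 0 (cutSet m) := by
  rw [starConvex_zero_iff]
  intro u hu a ha0 ha1 h
  rcases ha0.eq_or_lt with rfl | ha
  · simpa using hm
  · rw [real_smul, re_ofReal_mul] at h
    have h1 := hu ((mul_eq_zero.1 h).resolve_left ha.ne')
    rw [real_smul, im_ofReal_mul, abs_mul, abs_of_pos ha]
    exact (mul_le_of_le_one_left (abs_nonneg _) ha1).trans_lt h1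

theorem zero_mem_cutSet (hm : 0 < m) : (0 : ℂ) ∈ cutSet m := fun _ => by simpa using hm

theorem isPreconnected_cutSet (hm : 0 < m) : IsPreconnected (cutSet m) :=
  ((starConvex_cutSet hm).isPathConnected (zero_mem_cutSet hm)).isConnected.isPreconnected

theorem isSimplyConnected_cutSet (hm : 0 < m) : IsSimplyConnected (cutSet m) := by
  have := (starConvex_cutSet hm).contractibleSpace ⟨0, zero_mem_cutSet hm⟩
  exact SimplyConnectedSpace.ofContractible _

/-- From (v(z) - v(p))(v(z) + v(p)) = f(z) - f(p): a continuous nonvanishing square root of a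
holomorphic function is holomorphic. -/
theorem differentiableAt_of_sq {v f : ℂ → ℂ} {p : ℂ} (hv : ContinuousAt v p)
    (hf : DifferentiableAt ℂ f p) (h : ∀ᶠ z in 𝓝 p, v z ^ 2 = f z) (h0 : v p ≠ 0) :
    DifferentiableAt ℂ v p := by
  have h1 := hasDerivAt_iff_tendsto_slope.1 hf.hasDerivAt
  have h2 : Tendsto (fun z => v z + v p) (𝓝[≠] p) (𝓝 (v p + v p)) :=
    (hv.tendsto.mono_left nhdsWithin_le_nhds).add_const _
  have h3 : v p + v p ≠ 0 := by rw [← two_mul]; exact mul_ne_zero two_ne_zero h0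
  refine HasDerivAt.differentiableAt (hasDerivAt_iff_tendsto_slope.2 ((h1.div h2 h3).congr' ?_))
  filter_upwards [h2.eventually_ne h3, h.filter_mono nhdsWithin_le_nhds, self_mem_nhdsWithin]
    with z hz hz2 hz3
  have hzp : z - p ≠ 0 := sub_ne_zero.2 hz3
  rw [Pi.div_apply, slope_def_field, slope_def_field, ← hz2, ← h.self_of_nhds]
  field_simp
  ring

theorem notMem_lattice_of_mem_cutSet (hap : 0 < ap) (ham : 0 < am) {u : ℂ}
    (hu : u ∈ cutSet (mid ap am)) : u ∉ lattice ap am ∧ -u ∉ lattice ap am := by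
  by_cases h : u.re = 0
  · have h1 := abs_lt.1 (hu h)
    exact ⟨notMem_lattice_of_im_lt hap ham h1.2, neg_notMem_lattice_of_lt_im hap ham h1.1⟩
  · exact ⟨notMem_lattice_of_re_ne h, notMem_lattice_of_re_ne (by simpa using h)⟩

/-- The branch of `G_R^{-1/2}` on the cut plane. -/
theorem exists_GRight_root (hap : 0 < ap) (ham : 0 < am) : ∃ v : ℂ → ℂ,
    (∀ u ∈ cutSet (mid ap am), DifferentiableAt ℂ v u) ∧
    (∀ u ∈ cutSet (mid ap am), v u ^ 2 * GRight ap am u = 1) ∧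
    ∀ u : ℂ, |u.im| < mid ap am → v u = exp (-(I / 2 * jInt ap am u)) := by
  have hm := mid_pos hap ham
  have hne : ∀ u ∈ cutSet (mid ap am), GRight ap am u ≠ 0 := fun u hu => by
    obtain ⟨h1, h2⟩ := notMem_lattice_of_mem_cutSet hap ham hu
    exact left_ne_zero_of_mul_eq_one (GRight_mul_GLeft_neg hap ham h1 h2)
  have hd : ∀ u ∈ cutSet (mid ap am), DifferentiableAt ℂ (fun u => (GRight ap am u)⁻¹) u :=
    fun u hu => (analyticAt_GRight hap ham
      (notMem_lattice_of_mem_cutSet hap ham hu).2).differentiableAt.inv (hne u hu)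
  obtain ⟨v, hvc, hv⟩ := exists_continuousOn_pow_eq (isSimplyConnected_cutSet hm)
    (isOpen_cutSet _) (fun u hu => (hd u hu).continuousAt.continuousWithinAt)
    (fun ⟨u, hu, h⟩ => inv_ne_zero (hne u hu) h) two_ne_zero
  have hv0 : ∀ u ∈ cutSet (mid ap am), v u ≠ 0 := fun u hu h => by
    have := hv u
    rw [h] at this
    exact inv_ne_zero (hne u hu) (by simpa using this.symm)
  have hsub : {u : ℂ | |u.im| < mid ap am} ⊆ cutSet (mid ap am) := fun u hu _ => hu
  have hdv : ∀ u ∈ cutSet (mid ap am), DifferentiableAt ℂ v u := fun u hu =>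
    differentiableAt_of_sq (hvc.continuousAt ((isOpen_cutSet _).mem_nhds hu)) (hd u hu)
      (Eventually.of_forall hv) (hv0 u hu)
  have hsq : ∀ u ∈ cutSet (mid ap am), v u ^ 2 * GRight ap am u = 1 := fun u hu => by
    rw [hv]; exact inv_mul_cancel₀ (hne u hu)
  have hj : ContinuousOn (fun u => exp (-(I / 2 * jInt ap am u))) {u : ℂ | |u.im| < mid ap am} :=
    fun u hu => ((differentiableAt_jInt hap ham hu).continuousAt.const_mul _).neg.cexp
      |>.continuousWithinAt
  have hsq2 : EqOn (v ^ 2) ((fun u => exp (-(I / 2 * jInt ap am u))) ^ 2)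
      {u : ℂ | |u.im| < mid ap am} := fun u hu => by
    simp only [Pi.pow_apply]
    rw [hv, GRight_eq_exp hap ham hu, ← exp_neg, ← exp_nat_mul]
    congr 1
    push_cast
    ring
  -- A continuous root exists because the cut plane is star-shaped, hence simply connected, and G_R
  -- has neither zeros nor poles on it. Its sign is fixed by comparison with the explicit
  -- exponential on the strip, the root that tends to 1 on the right.
  rcases (isPreconnected_strip _).eq_or_eq_neg_of_sq_eq (hvc.mono hsub) hj hsq2
    (fun _ => exp_ne_zero _) with h | h
  · exact ⟨v, hdv, hsq, fun u hu => h hu⟩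
  · refine ⟨fun u => -v u, fun u hu => (hdv u hu).neg, fun u hu => ?_, fun u hu => ?_⟩
    · simp only [neg_sq]; exact hsq u hu
    · simp only [h hu, Pi.neg_apply, neg_neg]

theorem ed_mul_ed_neg (δ : Bool) (u : ℂ) : ed ap am δ u * ed ap am δ (-u) = 1 := by
  rw [ed, ed, ← exp_add, ← exp_zero]; congr 1; ring

theorem one_add_exp_mem_slitPlane {w : ℂ} (h : w.re < 0 ∨ |w.im| < Real.pi) :
    1 + exp w ∈ slitPlane := by
  by_cases h0 : (exp w).im = 0
  · refine Or.inl ?_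
    rw [add_re, one_re]
    rcases h with h | h
    · have h1 := (abs_le.1 (abs_re_le_norm (exp w))).1
      rw [norm_exp] at h1
      linarith [Real.exp_lt_one_iff.2 h]
    · rw [exp_im, mul_eq_zero, or_iff_right (Real.exp_pos _).ne'] at h0
      have h1 := abs_lt.1 h
      rw [Real.sin_eq_zero_iff_of_lt_of_lt h1.1 h1.2] at h0
      rw [exp_re, h0, Real.cos_zero, mul_one]
      positivity
  · refine Or.inr ?_
    rwa [add_im, one_im, zero_add]

theorem continuousAt_todaSqrt_right (hap : 0 < ap) (ham : 0 < am) (δ : Bool) {u : ℂ}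
    (h : 0 < u.re ∨ |u.im| < par ap am δ / 2) :
    ContinuousAt (fun u => (1 + ed ap am δ (-(2 * u))) ^ (1 / 2 : ℂ)) u ∧
      1 + ed ap am δ (-(2 * u)) ≠ 0 := by
  have ha := par_pos hap ham δ
  have hs : 1 + ed ap am δ (-(2 * u)) ∈ slitPlane := by
    rw [ed]
    have e : (Real.pi * -(2 * u) / par ap am δ : ℂ) = ((Real.pi / par ap am δ * 2 : ℝ) : ℂ) * -u := by
      push_cast; ring
    refine one_add_exp_mem_slitPlane ?_
    rw [e, re_ofReal_mul, im_ofReal_mul, neg_re, neg_im, abs_mul, abs_neg]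
    refine h.imp (fun h => mul_neg_of_pos_of_neg (by positivity) (by linarith)) fun h => ?_
    rw [abs_of_pos (by positivity)]
    calc _ < Real.pi / par ap am δ * 2 * (par ap am δ / 2) :=
          mul_lt_mul_of_pos_left h (by positivity)
      _ = Real.pi := by field_simp
  refine ⟨ContinuousAt.cpow ?_ continuousAt_const hs, slitPlane_ne_zero hs⟩
  unfold ed
  fun_prop

/-- Only the imaginary axis needs care. On the strip below the branch points both formulas are
continuous and nonzero, have the same square and agree at 0; so they agree on the whole strip. -/
theorem continuousAt_todaSqrt (hap : 0 < ap) (ham : 0 < am) (δ : Bool) {u : ℂ}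
    (hu : u ∈ cutSet (par ap am δ / 2)) : ContinuousAt (todaSqrt ap am δ) u := by
  have ha := par_pos hap ham δ
  set f₁ : ℂ → ℂ := fun u => (1 + ed ap am δ (-(2 * u))) ^ (1 / 2 : ℂ) with hf₁
  set f₂ : ℂ → ℂ := fun u => ed ap am δ (-u) * (1 + ed ap am δ (2 * u)) ^ (1 / 2 : ℂ) with hf₂
  have c₁ : ∀ u : ℂ, 0 < u.re ∨ |u.im| < par ap am δ / 2 → ContinuousAt f₁ u := fun u h =>
    (continuousAt_todaSqrt_right hap ham δ h).1
  have c₂ : ∀ u : ℂ, u.re < 0 ∨ |u.im| < par ap am δ / 2 → ContinuousAt f₂ u := fun u h => by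
    have e : f₂ = fun u => ed ap am δ (-u) * f₁ (-u) := by
      simp only [hf₁, hf₂, mul_neg, neg_neg]
    rw [e]
    refine ContinuousAt.mul (by unfold ed; fun_prop) ?_
    exact ContinuousAt.comp (f := fun u : ℂ => -u) (c₁ (-u) (by simpa using h)) (by fun_prop)
  rcases lt_trichotomy u.re 0 with h | h | h
  · refine (c₂ u (Or.inl h)).congr ?_
    filter_upwards [(isOpen_lt continuous_re continuous_const).mem_nhds h] with z hz
    rw [todaSqrt, if_neg (not_le.2 hz)]
  · have hS : EqOn f₂ f₁ {u : ℂ | |u.im| < par ap am δ / 2} := by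
      refine (isPreconnected_strip _).eq_of_sq_eq (fun u hu => (c₂ u (Or.inr hu)).continuousWithinAt)
        (fun u hu => (c₁ u (Or.inr hu)).continuousWithinAt) (fun u _ => ?_) (fun {u} hu h0 => ?_)
        (y := 0) (by simpa using ha) (by simp [hf₁, hf₂, ed])
      · simp only [Pi.pow_apply, hf₁, hf₂]
        rw [mul_pow, cpow_half_sq, cpow_half_sq]
        have h1 := ed_mul_ed_neg (ap := ap) (am := am) δ (2 * u)
        have h2 : ed ap am δ (-u) ^ 2 = ed ap am δ (-(2 * u)) := by
          rw [ed, ed, ← exp_nat_mul]; congr 1; push_cast; ring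
        rw [h2]
        linear_combination h1
      · have h1 := cpow_half_sq (1 + ed ap am δ (-(2 * u)))
        rw [show (1 + ed ap am δ (-(2 * u))) ^ (1 / 2 : ℂ) = 0 from h0] at h1
        exact (continuousAt_todaSqrt_right hap ham δ (Or.inr hu)).2 (by simpa using h1.symm)
    refine (c₁ u (Or.inr (hu h))).congr ?_
    filter_upwards [(isOpen_strip (par ap am δ / 2)).mem_nhds (hu h)] with z hz
    rw [todaSqrt]
    split_ifs
    · rfl
    · exact (hS hz).symm
  · refine (c₁ u (Or.inl h)).congr ?_
    filter_upwards [(isOpen_lt continuous_const continuous_re).mem_nhds h] with z hz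
    have hz' : 0 < z.re := hz
    rw [todaSqrt, if_pos hz'.le]

theorem step_div_two_im (δ : Bool) : (step ap am δ / 2).im = par ap am (!δ) / 2 := by
  rw [show step ap am δ / 2 = ((par ap am (!δ) / 2 : ℝ) : ℂ) * I by rw [step]; push_cast; ring]
  simp [-ofReal_div]

theorem step_div_two_re (δ : Bool) : (step ap am δ / 2).re = 0 := by
  rw [show step ap am δ / 2 = ((par ap am (!δ) / 2 : ℝ) : ℂ) * I by rw [step]; push_cast; ring]
  simp [-ofReal_div]

/-- Moving up and down by half a step lengthens the gap between the cuts from a_δ/2 to a, since a is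
the mean of the two parameters. -/
theorem mem_cutSet_half_iff (hap : 0 < ap) (ham : 0 < am) (δ : Bool) (w : ℂ) :
    w ∈ cutSet (par ap am δ / 2) ↔ w - step ap am δ / 2 ∈ cutSet (mid ap am) ∧
      w + step ap am δ / 2 ∈ cutSet (mid ap am) := by
  have h1 := par_add_par ap am δ
  have h2 := par_pos hap ham (!δ)
  simp only [cutSet, mem_ofPred_eq, sub_re, add_re, sub_im, add_im, step_div_two_im,
    step_div_two_re, sub_zero, add_zero, abs_lt]
  constructor
  · intro h
    constructor <;> intro h0 <;> obtain ⟨h3, h4⟩ := h h0 <;> constructor <;> linarith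
  · rintro ⟨h3, h4⟩ h0
    obtain ⟨h5, h6⟩ := h3 h0
    obtain ⟨h7, h8⟩ := h4 h0
    constructor <;> linarith

/-- The difference equation for the branch of `G_R^{-1/2}`. -/
theorem GRight_root_shift (hap : 0 < ap) (ham : 0 < am) {v : ℂ → ℂ}
    (hd : ∀ u ∈ cutSet (mid ap am), DifferentiableAt ℂ v u)
    (hsq : ∀ u ∈ cutSet (mid ap am), v u ^ 2 * GRight ap am u = 1)
    (hexp : ∀ u : ℂ, |u.im| < mid ap am → v u = exp (-(I / 2 * jInt ap am u))) (δ : Bool) {w : ℂ}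
    (hw : w ∈ cutSet (par ap am δ / 2)) :
    v (w - step ap am δ / 2) = todaSqrt ap am δ w * v (w + step ap am δ / 2) := by
  have ha := par_pos hap ham δ
  have ha' := par_pos hap ham (!δ)
  have hpp := par_add_par ap am δ
  have hiff := mem_cutSet_half_iff hap ham δ
  set s := step ap am δ with hs
  set W := cutSet (par ap am δ / 2) with hW
  have hv : ∀ σ : ℂ, ∀ w, w + σ ∈ cutSet (mid ap am) → ContinuousAt (fun w => v (w + σ)) w :=
    fun σ w h => ContinuousAt.comp (f := fun w => w + σ) (hd _ h).continuousAt (by fun_prop)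
  have hcl : ContinuousOn (fun w => v (w + -(s / 2))) W := fun w hw =>
    (hv _ w (by rw [← sub_eq_add_neg]; exact ((hiff w).1 hw).1)).continuousWithinAt
  have hcr : ContinuousOn (fun w => todaSqrt ap am δ w * v (w + s / 2)) W := fun w hw =>
    ((continuousAt_todaSqrt hap ham δ hw).mul (hv _ w ((hiff w).1 hw).2)).continuousWithinAt
  have hsqW : ∀ w ∈ W, v (w + -(s / 2)) ^ 2 = (todaSqrt ap am δ w * v (w + s / 2)) ^ 2 ∧
      todaSqrt ap am δ w * v (w + s / 2) ≠ 0 := by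
    intro w hw
    obtain ⟨h1, h2⟩ := (hiff w).1 hw
    have e1 := hsq _ h1
    have e2 := hsq _ h2
    have e3 := GRight_add_step hap ham δ (notMem_lattice_of_mem_cutSet hap ham h1).2
    rw [← hs, show w - s / 2 + s = w + s / 2 by ring,
      show -(2 * (w - s / 2)) - s = -(2 * w) by ring] at e3
    rw [e3] at e2
    have e4 : v (w - s / 2) ^ 2 = (todaSqrt ap am δ w * v (w + s / 2)) ^ 2 := by
      rw [mul_pow, todaSqrt_sq]
      refine mul_right_cancel₀ (right_ne_zero_of_mul_eq_one e1) ?_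
      linear_combination e1 - e2
    rw [← sub_eq_add_neg]
    refine ⟨e4, fun h0 => ?_⟩
    rw [h0, zero_pow two_ne_zero] at e4
    rw [e4, zero_mul] at e1
    exact zero_ne_one e1
  have hlim : ∀ σ : ℂ, σ.im = par ap am (!δ) / 2 ∨ σ.im = -(par ap am (!δ) / 2) →
      Tendsto (fun t : ℝ => v (t + σ)) atTop (𝓝 1) := by
    intro σ hσ
    have h0 : |σ.im| < mid ap am := by
      rcases hσ with h | h <;> rw [h, abs_lt] <;> constructor <;> linarith
    have h1 := ((tendsto_jInt_add hap ham h0).const_mul (-(I / 2))).cexp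
    rw [mul_zero, exp_zero] at h1
    refine h1.congr fun t => ?_
    rw [add_comm (t : ℂ), hexp _ (by simpa using h0), neg_mul]
  have hl := hlim (-(s / 2)) (Or.inr (by rw [neg_im, hs, step_div_two_im]))
  have hr := hlim (s / 2) (Or.inl (by rw [hs, step_div_two_im]))
  have ht : Tendsto (fun t : ℝ => todaSqrt ap am δ t) atTop (𝓝 1) := by
    have h1 := (tendsto_exp_neg_pi_mul ha one_pos 0).const_add 1
    rw [add_zero] at h1
    have h2 : Tendsto (fun w : ℂ => w ^ (1 / 2 : ℂ)) (𝓝 1) (𝓝 (1 ^ (1 / 2 : ℂ))) :=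
      (ContinuousAt.cpow (by fun_prop) (by fun_prop) (by norm_num [slitPlane]))
    rw [one_cpow] at h2
    refine (h2.comp h1).congr' ?_
    filter_upwards [eventually_ge_atTop 0] with t h0
    rw [todaSqrt, if_pos (by simpa using h0), ed]
    simp only [Function.comp]
    congr 3
    push_cast
    ring
  -- The squares agree by `GRight_add_step`, so the sides agree up to one global sign. Both tend to
  -- 1 along the positive axis; their sum tends to 2, which excludes the minus sign.
  have hsum := hl.add (ht.mul hr)
  obtain ⟨t, ht1, ht2⟩ := ((hsum.eventually_ne (by norm_num : (1 : ℂ) + 1 * 1 ≠ 0)).and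
    (eventually_gt_atTop 0)).exists
  have htW : (t : ℂ) ∈ W := fun h => absurd h (by simpa using ht2.ne')
  rcases (isPreconnected_cutSet (half_pos ha)).eq_or_eq_neg_of_sq_eq hcl hcr
    (fun w hw => (hsqW w hw).1) (fun {w} hw => (hsqW w hw).2) with h | h
  · rw [sub_eq_add_neg]; exact h hw
  · refine absurd ?_ ht1
    have := h htW
    simp only [Pi.neg_apply] at this
    rw [this, neg_add_cancel]

end RelToda

/-! ### The joint eigenfunction on the cut plane. -/

namespace RelToda

open Complex Set ComplexConjugate

variable {ap am : ℝ}

theorem differentiableAt_sdSqrt (hap : 0 < ap) (ham : 0 < am) (δ : Bool) {y : ℂ} (hy : 0 < y.re) :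
    DifferentiableAt ℂ (sdSqrt ap am δ) y := by
  have ha := par_pos hap ham δ
  have hre : 0 < (Real.pi * y / par ap am δ : ℂ).re := by
    rw [show (Real.pi * y / par ap am δ : ℂ) = ((Real.pi / par ap am δ : ℝ) : ℂ) * y by
      push_cast; ring, re_ofReal_mul]
    positivity
  have h : (1 - exp (-(2 * (Real.pi * y / par ap am δ)))) / 2 ∈ slitPlane := by
    refine Or.inl ?_
    have h1 := (abs_le.1 (abs_re_le_norm (exp (-(2 * (Real.pi * y / par ap am δ)))))).2
    rw [norm_exp] at h1
    have h2 : (-(2 * (Real.pi * y / par ap am δ) : ℂ)).re < 0 := by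
      rw [neg_re, ← ofReal_ofNat, re_ofReal_mul]; linarith
    have h3 := Real.exp_lt_one_iff.2 h2
    rw [div_ofNat_re, sub_re, one_re]
    linarith
  unfold sdSqrt sinhSqrt
  exact DifferentiableAt.mul (by fun_prop)
    (DifferentiableAt.cpow (by fun_prop) (differentiableAt_const _) h)

theorem sdSqrt_sq (δ : Bool) (y : ℂ) : sdSqrt ap am δ y ^ 2 = sd ap am δ y := sinhSqrt_sq _

theorem sdSqrt_ne_zero (hap : 0 < ap) (ham : 0 < am) (δ : Bool) {y : ℂ} (hy : 0 < y.re) :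
    sdSqrt ap am δ y ≠ 0 := fun h => by
  have h1 := sdSqrt_sq (ap := ap) (am := am) δ y
  rw [h, zero_pow two_ne_zero] at h1
  exact sd_ne_zero_of_re hap ham hy.ne' h1.symm

theorem sdSqrt_ofReal (hap : 0 < ap) (ham : 0 < am) (δ : Bool) {y : ℝ} (hy : 0 < y) :
    sdSqrt ap am δ y = Real.sqrt (Real.sinh (Real.pi * y / par ap am δ)) := by
  have ha := par_pos hap ham δ
  set r := Real.pi * y / par ap am δ with hr
  have hr0 : 0 < r := by positivity
  have h1 : 0 ≤ (1 - Real.exp (-(2 * r))) / 2 := by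
    have := Real.exp_lt_one_iff.2 (by linarith : -(2 * r) < 0)
    linarith
  have h2 : Real.sinh r = Real.exp r * ((1 - Real.exp (-(2 * r))) / 2) := by
    rw [Real.sinh_eq]
    have : Real.exp r * Real.exp (-(2 * r)) = Real.exp (-r) := by
      rw [← Real.exp_add]; congr 1; ring
    linear_combination this / 2
  rw [sdSqrt, sinhSqrt, h2, Real.sqrt_mul (Real.exp_pos _).le, ← Real.exp_half, ofReal_mul,
    ← ofReal_cpow_half h1, hr]
  push_cast
  rfl

theorem gammaRoot_eq_sdSqrt (hap : 0 < ap) (ham : 0 < am) {y : ℝ} (hy : 0 < y) :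
    gammaRoot ap am y = 2 * sdSqrt ap am true y * sdSqrt ap am false y := by
  have h4 : Real.sqrt 4 = 2 := by
    rw [show (4 : ℝ) = 2 ^ 2 by norm_num, Real.sqrt_sq (by norm_num)]
  have h1 := Real.sinh_nonneg_iff.2 (by positivity : 0 ≤ Real.pi * y / ap)
  rw [gammaRoot_eq hap ham hy, sdSqrt_ofReal hap ham _ hy, sdSqrt_ofReal hap ham _ hy,
    Real.sqrt_mul (by positivity), Real.sqrt_mul (by positivity), h4]
  push_cast
  rfl

/-- The step is half a period of exp(πy/a) for this root, so 1 - exp(-2u) is unchanged and exp(u/2)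
acquires ± i. The opposite signs turn the sum in `dualTodaH` into the difference in `nExt_y_shift`.
-/
theorem sdSqrt_not_add_step (hap : 0 < ap) (ham : 0 < am) (δ : Bool) (y : ℂ) :
    sdSqrt ap am (!δ) (y + step ap am δ) = I * sdSqrt ap am (!δ) y ∧
      sdSqrt ap am (!δ) (y - step ap am δ) = -I * sdSqrt ap am (!δ) y := by
  have ha : (par ap am (!δ) : ℂ) ≠ 0 := ofReal_ne_zero.2 (par_pos hap ham (!δ)).ne'
  have e1 : (Real.pi * (y + step ap am δ) / par ap am (!δ) : ℂ) =
      Real.pi * y / par ap am (!δ) + Real.pi * I := by rw [step]; field_simp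
  have e2 : (Real.pi * (y - step ap am δ) / par ap am (!δ) : ℂ) =
      Real.pi * y / par ap am (!δ) - Real.pi * I := by rw [step]; field_simp
  rw [sdSqrt, sdSqrt, sdSqrt, e1, e2]
  generalize (Real.pi * y / par ap am (!δ) : ℂ) = w
  have f1 : exp (-(2 * (w + Real.pi * I))) = exp (-(2 * w)) := by
    rw [show -(2 * (w + Real.pi * I)) = -(2 * w) - 2 * Real.pi * I by ring, exp_sub,
      exp_two_pi_mul_I, div_one]
  have f2 : exp (-(2 * (w - Real.pi * I))) = exp (-(2 * w)) := by
    rw [show -(2 * (w - Real.pi * I)) = -(2 * w) + 2 * Real.pi * I by ring, exp_add,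
      exp_two_pi_mul_I, mul_one]
  have f3 : exp ((w + Real.pi * I) / 2) = I * exp (w / 2) := by
    rw [show (w + Real.pi * I) / 2 = Real.pi / 2 * I + w / 2 by ring, exp_add,
      exp_pi_div_two_mul_I]
  have f4 : exp ((w - Real.pi * I) / 2) = -I * exp (w / 2) := by
    rw [show (w - Real.pi * I) / 2 = -Real.pi / 2 * I + w / 2 by ring, exp_add,
      exp_neg_pi_div_two_mul_I]
  simp only [sinhSqrt, f1, f2, f3, f4, mul_assoc, and_self]

theorem mem_cutPlane_iff {η : ℝ} {x : ℂ} : x ∈ cutPlane ap am η ↔ x - η ∈ cutSet (mid ap am) := by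
  simp [cutPlane, cutSet, sub_eq_zero]

theorem sdSqrt_true_mul_false (δ : Bool) (y : ℂ) :
    sdSqrt ap am true y * sdSqrt ap am false y = sdSqrt ap am δ y * sdSqrt ap am (!δ) y := by
  cases δ
  · exact mul_comm _ _
  · rfl

/-- The limit is a joint eigenfunction of the four Toda Hamiltonians. -/
theorem exists_joint_eigenfunction (hap : 0 < ap) (ham : 0 < am) (η : ℝ) : ∃ Φ : ℂ → ℂ → ℂ,
    DifferentiableOn ℂ (fun p : ℂ × ℂ => Φ p.1 p.2)
      {p | p.1 ∈ cutPlane ap am η ∧ 0 < p.2.re} ∧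
    (∀ x y : ℝ, 0 < y → Φ x y = todaF ap am η x y) ∧
    (∀ (δ : Bool) (x y : ℂ), x ∈ cutPlane ap am η → x + step ap am δ ∈ cutPlane ap am η →
      x - step ap am δ ∈ cutPlane ap am η → 0 < y.re →
      todaH ap am δ η (fun x' => Φ x' y) x = 2 * cd ap am δ y * Φ x y) ∧
    (∀ (δ : Bool) (x y : ℂ), x ∈ cutPlane ap am η → 0 < y.re →
      dualTodaH ap am δ η (fun y' => Φ x y') y = ed ap am δ x * Φ x y) := by
  have hm := mid_pos hap ham
  obtain ⟨v, hvd, hvsq, hvexp⟩ := exists_GRight_root hap ham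
  -- The real prefactor `prefR` continued holomorphically: the constant 2 is the root of the 4 in
  -- G(±y + ia) = 4 s₊(y) s₋(y), and v is the branch of G_R^(-1/2).
  refine ⟨fun x y => 2 / Real.sqrt (ap * am) * (sdSqrt ap am true y * sdSqrt ap am false y) *
    (v (x - η) * nExt ap am (x - η) y), fun p hp => ?_, fun x y hy => ?_,
    fun δ x y h0 h1 h2 _ => ?_, fun δ x y _ hy => ?_⟩
  · have hx := mem_cutPlane_iff.1 hp.1
    have d1 := fun δ => DifferentiableAt.comp (f := fun q : ℂ × ℂ => q.2) p
      (differentiableAt_sdSqrt hap ham δ hp.2) (by fun_prop)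
    have d2 := DifferentiableAt.comp (f := fun q : ℂ × ℂ => q.1 - η) p (hvd _ hx) (by fun_prop)
    have d3 := DifferentiableAt.comp (f := fun q : ℂ × ℂ => (q.1 - η, q.2)) p
      (differentiableAt_nExt hap ham (p := (p.1 - η, p.2))
        (notMem_lattice_of_mem_cutSet hap ham hx).2) (by fun_prop)
    exact ((((d1 true).mul (d1 false)).const_mul _).mul (d2.mul d3)).differentiableWithinAt
  · simp only
    rw [todaF_eq hap ham η x hy, todaVal, prefR_eq hap ham η x hy, gammaRoot_eq_sdSqrt hap ham hy,
      ← ofReal_sub, nExt_of_lt (by rw [ofReal_im]; linarith), nVal_ofReal_eq_integral_kerR hap ham,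
      hvexp _ (by rw [ofReal_im, abs_zero]; exact hm), gR_eq_jInt hap ham (by
        rw [ofReal_im, abs_zero]; positivity)]
    ring
  · rw [mem_cutPlane_iff] at h0 h1 h2
    rw [add_sub_right_comm] at h1
    rw [sub_right_comm] at h2
    simp only [todaH]
    rw [add_sub_right_comm, sub_right_comm x (step ap am δ)]
    set u := x - η
    set s := step ap am δ with hs
    -- k1 absorbs the Toda root of the upward term into v(u). For the downward term k2 leaves the
    -- root a second time, so its square 1 + e_δ(-2u + s) appears, as in `nExt_x_shift`.
    have k1 := GRight_root_shift hap ham hvd hvsq hvexp δ (w := u + s / 2)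
      ((mem_cutSet_half_iff hap ham δ _).2 ⟨by rwa [add_sub_cancel_right],
        by rwa [← hs, add_assoc, add_halves]⟩)
    have k2 := GRight_root_shift hap ham hvd hvsq hvexp δ (w := u - s / 2)
      ((mem_cutSet_half_iff hap ham δ _).2 ⟨by rwa [← hs, sub_sub, add_halves],
        by rwa [sub_add_cancel]⟩)
    rw [← hs, add_sub_cancel_right, add_assoc, add_halves] at k1
    rw [← hs, sub_add_cancel, sub_sub, add_halves] at k2
    have k3 := todaSqrt_sq ap am δ (u - s / 2)
    have k4 := nExt_x_shift hap ham δ y (notMem_lattice_of_mem_cutSet hap ham h0).2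
      (notMem_lattice_of_mem_cutSet hap ham h1).2 (notMem_lattice_of_mem_cutSet hap ham h2).2
    rw [← hs] at k4
    rw [show -(2 * (u - s / 2)) = -(2 * u) + s by ring] at k3
    rw [k2]
    set c := (2 : ℂ) / Real.sqrt (ap * am) * (sdSqrt ap am true y * sdSqrt ap am false y)
    linear_combination -(c * nExt ap am (u + s) y) * k1 + (c * v u * nExt ap am (u - s) y) * k3 +
      c * v u * k4
  · simp only [dualTodaH, sdSqrt_true_mul_false δ]
    obtain ⟨k1, k2⟩ := sdSqrt_not_add_step hap ham δ y
    have k3 := nExt_y_shift hap ham δ (x - η) y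
    have k4 := sdSqrt_sq (ap := ap) (am := am) δ y
    have k5 : ed ap am δ η * ed ap am δ (x - η) = ed ap am δ x := by
      rw [ed, ed, ed, ← exp_add]; congr 1; ring
    have n0 := sdSqrt_ne_zero hap ham δ hy
    have n1 := sdSqrt_ne_zero hap ham δ (y := y + step ap am δ) (by simpa [step_re] using hy)
    have n2 := sdSqrt_ne_zero hap ham δ (y := y - step ap am δ) (by simpa [step_re] using hy)
    rw [k1, k2, ← k5]
    rw [← k4] at k3
    generalize sdSqrt ap am δ (y + step ap am δ) = A at *
    generalize sdSqrt ap am δ (y - step ap am δ) = B at *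
    generalize sdSqrt ap am δ y = S at *
    generalize sdSqrt ap am (!δ) y = R at *
    set c := (2 : ℂ) / Real.sqrt (ap * am)
    -- The roots A and B at the shifted points cancel against those in the eigenfunction; only the
    -- factors ± i of the other root are left.
    have e : ∀ X Y : ℂ, A⁻¹ * (c * (A * (I * R)) * (v (x - η) * X)) +
        B⁻¹ * (c * (B * (-I * R)) * (v (x - η) * Y)) = c * R * v (x - η) * I * (X - Y) := by
      intro X Y
      field_simp
      ring
    rw [e, k3]
    field_simp
    linear_combination -c * R * v (x - η) * ed ap am δ η * ed ap am δ (x - η) *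
      nExt ap am (x - η) y * I_sq

end RelToda

theorem mainTheorem6 (ap am : ℝ) (hap : 0 < ap) (ham : 0 < am) :
    -- the Hamiltonians and the renormalized dual Hamiltonians converge
    (∀ (δ : Bool) (η : ℝ) (ψ : ℂ → ℂ) (x : ℂ),
      Tendsto (fun Λ : ℝ => hypH ap am δ (η + Λ) (fun z => ψ (z - Λ)) (x + Λ)) atTop
        (𝓝 (todaH ap am δ η ψ x))) ∧
    (∀ (δ : Bool) (η : ℝ) (ψ : ℂ → ℂ) (y : ℂ), 0 < y.re →
      Tendsto (fun Λ : ℝ => ed ap am δ (-Λ) * hypH ap am δ (η + Λ) ψ y) atTop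
        (𝓝 (dualTodaH ap am δ η ψ y))) ∧
    -- the eigenfunction, in each of its five representations, converges
    (∀ η x y : ℝ, 0 < y →
      Tendsto (fun Λ : ℝ => hypF ap am (η + Λ) (x + Λ) y) atTop (𝓝 (todaF ap am η x y)) ∧
      Tendsto (fun Λ : ℝ => hypF2 ap am (η + Λ) (x + Λ) y) atTop (𝓝 (todaF ap am η x y)) ∧
      Tendsto (fun Λ : ℝ => hypF3 ap am (η + Λ) (x + Λ) y) atTop (𝓝 (todaF ap am η x y)) ∧
      Tendsto (fun Λ : ℝ => hypF4 ap am (η + Λ) (x + Λ) y) atTop (𝓝 (todaF ap am η x y)) ∧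
      Tendsto (fun Λ : ℝ => hypF5 ap am (η + Λ) (x + Λ) y) atTop (𝓝 (todaF ap am η x y))) ∧
    -- the four integral representations of the limit
    (∀ η x y : ℝ, 0 < y →
      (Integrable (kerR ap am (x - η) y) ∧
        todaF ap am η x y = prefR ap am η x y *
          Complex.exp (Complex.I * alpha ap am * y ^ 2 / 4) *
          ∫ z : ℝ, kerR ap am (x - η) y z) ∧
      (Integrable (kerL ap am (x - η) y) ∧
        todaF ap am η x y = prefL ap am η x y *
          Complex.exp (-(Complex.I * alpha ap am * y ^ 2 / 4)) *
          ∫ z : ℝ, kerL ap am (x - η) y z) ∧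
      (∀ ε : ℝ, 0 < ε → ε < mid ap am / 2 →
        (Integrable (fun r : ℝ => kerPlus ap am (x - η) y (r + Complex.I * ε)) ∧
          todaF ap am η x y = prefR ap am η x y *
            Complex.exp (Complex.I * alpha ap am * y ^ 2 / 8) *
            ∫ r : ℝ, kerPlus ap am (x - η) y (r + Complex.I * ε)) ∧
        (Integrable (fun r : ℝ => kerMinus ap am (x - η) y (r + Complex.I * ε)) ∧
          todaF ap am η x y = prefL ap am η x y *
            Complex.exp (-(Complex.I * alpha ap am * y ^ 2 / 8)) *
            ∫ r : ℝ, kerMinus ap am (x - η) y (r + Complex.I * ε)))) ∧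
    -- the limit is a joint eigenfunction of the four Toda Hamiltonians
    (∀ η : ℝ, ∃ Φ : ℂ → ℂ → ℂ,
      DifferentiableOn ℂ (fun p : ℂ × ℂ => Φ p.1 p.2)
        {p | p.1 ∈ cutPlane ap am η ∧ 0 < p.2.re} ∧
      (∀ x y : ℝ, 0 < y → Φ x y = todaF ap am η x y) ∧
      (∀ (δ : Bool) (x y : ℂ), x ∈ cutPlane ap am η → x + step ap am δ ∈ cutPlane ap am η →
        x - step ap am δ ∈ cutPlane ap am η → 0 < y.re →
        todaH ap am δ η (fun x' => Φ x' y) x = 2 * cd ap am δ y * Φ x y) ∧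
      (∀ (δ : Bool) (x y : ℂ), x ∈ cutPlane ap am η → 0 < y.re →
        dualTodaH ap am δ η (fun y' => Φ x y') y = ed ap am δ x * Φ x y)) ∧
    -- the eigenvalue equations for the contour integral in the second representation
    (∃ M : ℂ → ℂ → ℂ,
      DifferentiableOn ℂ (fun p : ℂ × ℂ => M p.1 p.2) {p | p.1 ∉ lattice ap am} ∧
      (∀ y : ℂ, MeromorphicOn (fun x => M x y) Set.univ) ∧
      (∀ x y : ℝ, 0 < y → M x y = ∫ z : ℝ, kerL ap am x y z) ∧
      (∀ (δ : Bool) (x y : ℂ), x ∉ lattice ap am → x + step ap am δ ∉ lattice ap am →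
        x - step ap am δ ∉ lattice ap am →
        todaA ap am δ 0 (fun x' => M x' y) x = 2 * cd ap am δ y * M x y)) ∧
    -- the dual eigenvalue equations for the contour integral in the third representation
    (∃ N : ℂ → ℂ → ℂ,
      DifferentiableOn ℂ (fun p : ℂ × ℂ => N p.1 p.2) {p | -p.1 ∉ lattice ap am} ∧
      (∀ y : ℂ, MeromorphicOn (fun x => N x y) Set.univ) ∧
      (∀ x y ε : ℝ, 0 < y → 0 < ε → ε < mid ap am / 2 →
        N x y = Complex.exp (Complex.I * alpha ap am * y ^ 2 / 8) *
          ∫ r : ℝ, kerPlus ap am x y (r + Complex.I * ε)) ∧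
      (∀ (δ : Bool) (x y : ℂ), -x ∉ lattice ap am → sd ap am δ y ≠ 0 →
        dualTodaA ap am δ 0 (fun y' => N x y') y = ed ap am δ x * N x y)) :=
  ⟨tendsto_hypH hap ham, fun δ η ψ y _ => tendsto_hypH_dual hap ham δ η ψ y,
    tendsto_todaF hap ham, todaF_representations hap ham, exists_joint_eigenfunction hap ham,
    exists_todaA_eigenfunction hap ham, exists_dualTodaA_eigenfunction hap ham⟩
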